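/- Work over $\mathbb{C}$; a variety is an integral $\mathbb{C}$-scheme of finite type. For a coherent sheaf $\mathscr F$ on a scheme $X$ write $\mathscr F^{*}=\mathscr{H}om(\mathscr F,\mathscr O_X)$, $\mathscr F^{[\otimes m]}=(\mathscr F^{\otimes m})^{**}$, and $\Omega_X^{[1]}=(\Omega_X^1)^{**}$, where $\Omega^1_X$ is the sheaf of Kähler differentials over $\mathbb{C}$. We say that $X$ carries no non-zero pluri-form if $H^0(X,(\Omega_X^1)^{[\otimes m]})=0$ for all $m>0$. Let $p:X\to Z$ be a morphism of normal varieties over $\mathbb{C}$ which is equidimensional, i.e. $p$ is dominant and there is an integer $d$ such that all irreducible components of all non-empty fibers of $p$ have dimension $d$. Assume that general fibers of $p$ carry no non-zero pluri-form, i.e. there is a non-empty open subset $U\subseteq Z$ such that for every closed point $z\in U$ the scheme-theoretic fiber $X_z$ carries no non-zero pluri-form. Let $(p^*\Omega_Z^1)^{sat}$ be the saturation of the image of $p^*\Omega^1_Z$ in $\Omega_X^{[1]}$, i.e. the kernel of the map from $\Omega_X^{[1]}$ to the quotient of $\Omega_X^{[1]}/\mathrm{im}(p^*\Omega_Z^1)$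 by its torsion. Then for every $m>0$ there is an $H^0(X,\mathscr O_X)$-linear (in particular $\mathbb{C}$-linear) isomorphism $$H^0\big(X,(\Omega_X^1)^{[\otimes m]}\big)\;\cong\; H^0\big(X,((p^*\Omega_Z^1)^{sat})^{[\otimes m]}\big),$$ compatible with the natural maps of both sides to $H^0\big(X,(\Omega_X^{[1]})^{[\otimes m]}\big)$ induced by $\Omega_X^1\to\Omega_X^{[1]}$ and $(p^*\Omega_Z^1)^{sat}\hookrightarrow\Omega_X^{[1]}$. -/

import Mathlib

open CategoryTheory AlgebraicGeometry TopologicalSpace Opposite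

universe u

noncomputable section

namespace PluriForm

variable {X : Scheme.{u}}

/-- For a `k`-scheme `f : X ⟶ Spec k`, the structure maps `k → 𝒪_X(U)`. -/
def structureMap {k : CommRingCat.{u}} (f : X ⟶ Spec k) :
    (Functor.const _).obj k ⟶ X.presheaf where
  app U := (Scheme.ΓSpecIso k).inv ≫ f.appTop ≫ X.presheaf.map (homOfLE le_top).op
  naturality U V i := by
    simp [← Functor.map_comp]
    rfl

/-- The presheaf `U ↦ Ω¹_{𝒪_X(U)/k}`. -/
def preOmega {k : CommRingCat.{u}} (f : X ⟶ Spec k) : X.PresheafOfModules :=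
  PresheafOfModules.DifferentialsConstruction.relativeDifferentials' (structureMap f)

/-- The sheaf of `𝒪_X`-modules associated with a presheaf of `𝒪_X`-modules. -/
def sheafify : X.PresheafOfModules ⥤ X.Modules :=
  PresheafOfModules.sheafification (𝟙 X.ringCatSheaf.obj)

/-- The sheaf of Kähler differentials `Ω¹_X` of a `k`-scheme `f : X ⟶ Spec k`. -/
def Omega {k : CommRingCat.{u}} (f : X ⟶ Spec k) : X.Modules := sheafify.obj (preOmega f)

open MonoidalCategory

/-- Presheaves of `𝒪_X`-modules, with `𝒪_X` seen as a presheaf of commutative rings. -/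
abbrev Pre (X : Scheme.{u}) := PresheafOfModules.{u} (X.presheaf ⋙ forget₂ CommRingCat RingCat)

/-- The presheaf `U ↦ P(U)^{⊗ m}`, the tensor product being over `𝒪_X(U)`. -/
def tpow (P : Pre X) : ℕ → Pre X
  | 0 => 𝟙_ (Pre X)
  | m + 1 => P ⊗ tpow P m

/-- Functoriality of `tpow`. -/
def tpowMap {P Q : Pre X} (φ : P ⟶ Q) : ∀ m, tpow P m ⟶ tpow Q m
  | 0 => 𝟙 _
  | m + 1 => φ ⊗ₘ tpowMap φ m

/-- The tensor power `M^{⊗ m}` of an `𝒪_X`-module. -/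
def tensorPow (M : X.Modules) (m : ℕ) : X.Modules :=
  sheafify.obj (tpow ((Scheme.Modules.toPresheafOfModules X).obj M) m)

/-- The morphism `φ^{⊗ m} : M^{⊗ m} ⟶ N^{⊗ m}`. -/
def tensorPowMap {M N : X.Modules} (φ : M ⟶ N) (m : ℕ) : tensorPow M m ⟶ tensorPow N m :=
  sheafify.map (tpowMap (X := X) ((Scheme.Modules.toPresheafOfModules X).map φ) m)


section
variable {k : CommRingCat.{u}} (f : X ⟶ Spec k)

/-- The canonical morphism from a presheaf of modules to its associated sheaf. -/
def toSheafify (P : X.PresheafOfModules) :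
    P ⟶ (Scheme.Modules.toPresheafOfModules X).obj (sheafify.obj P) :=
  (PresheafOfModules.sheafificationAdjunction (𝟙 X.ringCatSheaf.obj)).unit.app P

/-- The universal derivation `d : 𝒪_X → Ω¹_X`. -/
def univD : PresheafOfModules.Derivation' (R := X.presheaf)
    ((Scheme.Modules.toPresheafOfModules X).obj (Omega f)) (structureMap f) :=
  (PresheafOfModules.DifferentialsConstruction.derivation' (structureMap f)).postcomp
    (toSheafify (preOmega f))

variable {Z : Scheme.{u}} (p : X ⟶ Z) (g : Z ⟶ Spec k)

/-- For a `k`-morphism `p : X ⟶ Z`, the derivation `𝒪_Z → p_* Ω¹_X`, `a ↦ d(p^♯ a)`. -/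
def pullD (hp : p ≫ g = f) : PresheafOfModules.Derivation' (R := Z.presheaf)
    ((Scheme.Modules.toPresheafOfModules Z).obj ((Scheme.Modules.pushforward p).obj (Omega f)))
      (structureMap g) where
  d {V} := ((univD f).d (X := op (p ⁻¹ᵁ V.unop))).comp (p.app V.unop).hom.toAddMonoidHom
  d_mul {V} a b := by
    have := (univD f).d_mul (X := op (p ⁻¹ᵁ V.unop)) (p.app V.unop a) (p.app V.unop b)
    rw [← map_mul] at this
    exact this
  d_map {V W} i a := by
    have := (univD f).d_map (X := op (p ⁻¹ᵁ V.unop)) (Y := op (p ⁻¹ᵁ W.unop))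
      ((Opens.map p.base).map i.unop).op (p.app V.unop a)
    refine Eq.trans ?_ this
    exact congrArg (univD f).d (ConcreteCategory.congr_hom (p.naturality i) a)
  d_app {V} a := by
    refine Eq.trans ?_ ((univD f).d_app (X := op (p ⁻¹ᵁ V.unop)) a)
    refine congrArg (univD f).d ?_
    subst hp
    have : (structureMap g).app V ≫ p.app V.unop = (structureMap (p ≫ g)).app (op (p ⁻¹ᵁ V.unop)) := by
      have h := p.naturality (homOfLE (le_top : V.unop ≤ ⊤)).op
      simp only [structureMap, Scheme.Hom.comp_appTop, Category.assoc]
      congr 2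
    exact ConcreteCategory.congr_hom this a

/-- The morphism `Ω¹_Z ⟶ p_* Ω¹_X`, `da ↦ d(p^♯ a)`. -/
def Omega.toPushforward (hp : p ≫ g = f) :
    Omega g ⟶ (Scheme.Modules.pushforward p).obj (Omega f) :=
  (PresheafOfModules.sheafificationAdjunction (𝟙 Z.ringCatSheaf.obj)).homEquiv _ _ |>.symm
    ((PresheafOfModules.DifferentialsConstruction.isUniversal' (structureMap g)).desc (pullD f p g hp))

/-- The pull-back of differentials `p^* Ω¹_Z ⟶ Ω¹_X`. -/
def Omega.pullbackMap (hp : p ≫ g = f) :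
    (Scheme.Modules.pullback p).obj (Omega g) ⟶ Omega f :=
  ((Scheme.Modules.pullbackPushforwardAdjunction p).homEquiv _ _).symm
    (Omega.toPushforward f p g hp)
end

/-- Sections over `U` of the dual sheaf `ℋom(M, 𝒪_X)`: the `𝒪_U`-linear maps `M|_U ⟶ 𝒪_U`, i.e. the
families of linear maps `M(V) → 𝒪_X(V)`, `V ⊆ U` open, that commute with restriction. -/
def dualSections (M : X.Modules) (U : X.Opens) :
    AddSubgroup (∀ V : {V : X.Opens // V ≤ U}, Γ(M, V.1) →ₗ[Γ(X, V.1)] Γ(X, V.1)) where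
  carrier := {φ | ∀ (V W : {V : X.Opens // V ≤ U}) (h : W.1 ≤ V.1) (s : Γ(M, V.1)),
    φ W (M.presheaf.map (homOfLE h).op s) = X.presheaf.map (homOfLE h).op (φ V s)}
  zero_mem' := by intro V W h s; simp
  add_mem' := by intro a b ha hb V W h s; simp [ha V W h s, hb V W h s]
  neg_mem' := by intro a ha V W h s; simp [ha V W h s]

/-- `𝒪_X(U)` acts on `ℋom(M, 𝒪_X)(U)` through the restrictions `𝒪_X(U) → 𝒪_X(V)`. -/
instance (M : X.Modules) (U : X.Opens) : Module Γ(X, U) (dualSections M U) where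
  smul a φ := ⟨fun V ↦ X.presheaf.map (homOfLE V.2).op a • φ.1 V, by
    intro V W h s
    simp only [LinearMap.smul_apply, smul_eq_mul, φ.2 V W h s, map_mul]
    congr 1
    rw [← ConcreteCategory.comp_apply, ← Functor.map_comp]; rfl⟩
  one_smul φ := by
    apply Subtype.ext; funext V; ext s
    change X.presheaf.map (homOfLE V.2).op 1 • φ.1 V s = φ.1 V s
    simp
  mul_smul a b φ := by
    apply Subtype.ext; funext V; ext s
    change X.presheaf.map (homOfLE V.2).op (a * b) • φ.1 V s =
      X.presheaf.map (homOfLE V.2).op a • X.presheaf.map (homOfLE V.2).op b • φ.1 V s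
    rw [map_mul, mul_smul]
  smul_zero a := by
    apply Subtype.ext; funext V; ext s
    change X.presheaf.map (homOfLE V.2).op a • (0 : Γ(X, V.1)) = 0
    simp
  zero_smul φ := by
    apply Subtype.ext; funext V; ext s
    change X.presheaf.map (homOfLE V.2).op 0 • φ.1 V s = 0
    simp
  smul_add a φ ψ := by
    apply Subtype.ext; funext V; ext s
    change X.presheaf.map (homOfLE V.2).op a • (φ.1 V s + ψ.1 V s) =
      X.presheaf.map (homOfLE V.2).op a • φ.1 V s + X.presheaf.map (homOfLE V.2).op a • ψ.1 V s
    rw [smul_add]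
  add_smul a b φ := by
    apply Subtype.ext; funext V; ext s
    change X.presheaf.map (homOfLE V.2).op (a + b) • φ.1 V s =
      X.presheaf.map (homOfLE V.2).op a • φ.1 V s + X.presheaf.map (homOfLE V.2).op b • φ.1 V s
    rw [map_add, add_smul]

/-- Restriction of sections of the dual sheaf. -/
def dualRes (M : X.Modules) {U U' : X.Opens} (h : U' ≤ U) :
    dualSections M U →+ dualSections M U' where
  toFun φ := ⟨fun V ↦ φ.1 ⟨V.1, V.2.trans h⟩, fun V W hWV s ↦ φ.2 ⟨V.1, V.2.trans h⟩ ⟨W.1, W.2.trans h⟩ hWV s⟩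
  map_zero' := rfl
  map_add' _ _ := rfl

/-- The presheaf of abelian groups underlying the dual sheaf. -/
def dualPresheaf (M : X.Modules) : TopCat.Presheaf Ab.{u} X where
  obj U := AddCommGrpCat.of (dualSections M U.unop)
  map i := AddCommGrpCat.ofHom (dualRes M i.unop.le)

instance (M : X.Modules) (U : (Opens X)ᵒᵖ) :
    Module (X.ringCatSheaf.obj.obj U) ((dualPresheaf M).obj U) :=
  inferInstanceAs (Module Γ(X, U.unop) (dualSections M U.unop))

lemma dualSections_glue (M : X.Modules) {ι : Type u} (U : ι → X.Opens)
    (sf : ∀ i, dualSections M (U i))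
    (hsf : ∀ i j, dualRes M (inf_le_left : U i ⊓ U j ≤ U i) (sf i) =
      dualRes M (inf_le_right : U i ⊓ U j ≤ U j) (sf j)) :
    ∃! φ : dualSections M (iSup U), ∀ i, dualRes M (le_iSup U i) φ = sf i := by
  have hsf' : ∀ (i j : ι) (V : X.Opens) (hi : V ≤ U i) (hj : V ≤ U j),
      (sf i).1 ⟨V, hi⟩ = (sf j).1 ⟨V, hj⟩ := by
    intro i j V hi hj
    exact congrFun (congrArg Subtype.val (hsf i j)) ⟨V, le_inf hi hj⟩
  have key : ∀ (V : {V : X.Opens // V ≤ iSup U}) (s : Γ(M, V.1)), ∃! t : Γ(X, V.1), ∀ i,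
      X.presheaf.map (homOfLE (inf_le_left : V.1 ⊓ U i ≤ V.1)).op t =
        (sf i).1 ⟨V.1 ⊓ U i, inf_le_right⟩
          (M.presheaf.map (homOfLE (inf_le_left : V.1 ⊓ U i ≤ V.1)).op s) := by
    intro V s
    refine TopCat.Sheaf.existsUnique_gluing' X.sheaf (fun i ↦ V.1 ⊓ U i) V.1
      (fun i ↦ homOfLE inf_le_left) ?_ _ ?_
    · rw [← inf_iSup_eq]; exact le_inf le_rfl V.2
    · intro i j
      have h1 := (sf i).2 ⟨V.1 ⊓ U i, inf_le_right⟩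
        ⟨(V.1 ⊓ U i) ⊓ (V.1 ⊓ U j), inf_le_left.trans inf_le_right⟩ inf_le_left
          (M.presheaf.map (homOfLE (inf_le_left : V.1 ⊓ U i ≤ V.1)).op s)
      have h2 := (sf j).2 ⟨V.1 ⊓ U j, inf_le_right⟩
        ⟨(V.1 ⊓ U i) ⊓ (V.1 ⊓ U j), inf_le_right.trans inf_le_right⟩ inf_le_right
          (M.presheaf.map (homOfLE (inf_le_left : V.1 ⊓ U j ≤ V.1)).op s)
      refine h1.symm.trans (Eq.trans ?_ h2)
      rw [hsf' i j _ _ (inf_le_right.trans inf_le_right), ← ConcreteCategory.comp_apply,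
        ← ConcreteCategory.comp_apply, ← Functor.map_comp, ← Functor.map_comp]
      rfl
  choose F hF hFu using key
  have hFr : ∀ (V : {V : X.Opens // V ≤ iSup U}) (s : Γ(M, V.1)) (W : X.Opens) (hW : W ≤ V.1) (i) (hi : W ≤ U i),
      X.presheaf.map (homOfLE hW).op (F V s) =
        (sf i).1 ⟨W, hi⟩ (M.presheaf.map (homOfLE hW).op s) := by
    intro V s W hW i hi
    have h1 := (sf i).2 ⟨V.1 ⊓ U i, inf_le_right⟩ ⟨W, hi⟩ (le_inf hW hi)
      (M.presheaf.map (homOfLE (inf_le_left : V.1 ⊓ U i ≤ V.1)).op s)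
    rw [← hF, ← ConcreteCategory.comp_apply, ← ConcreteCategory.comp_apply,
      ← Functor.map_comp, ← Functor.map_comp] at h1
    exact h1.symm
  let φ : dualSections M (iSup U) := ⟨fun V ↦
    { toFun := F V
      map_add' := fun s t ↦ ((hFu V _ _ fun i ↦ by
        simp only [map_add, hF])).symm
      map_smul' := fun a s ↦ ((hFu V _ _ fun i ↦ by
        simp only [Scheme.Modules.map_smul, map_smul, smul_eq_mul, map_mul, hF, RingHom.id_apply])).symm }, by
    intro V W h s
    refine (hFu W _ _ fun i ↦ ?_).symm
    have := hFr V s (W.1 ⊓ U i) (inf_le_left.trans h) i inf_le_right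
    rw [← ConcreteCategory.comp_apply, ← ConcreteCategory.comp_apply, ← Functor.map_comp, ← Functor.map_comp]
    exact this⟩
  refine ⟨φ, ?_, ?_⟩
  · intro i
    apply Subtype.ext; funext V; ext s
    have := hFr ⟨V.1, V.2.trans (le_iSup U i)⟩ s V.1 le_rfl i V.2
    have e : homOfLE (le_refl V.1) = 𝟙 _ := rfl
    rw [e] at this
    simp only [op_id, CategoryTheory.Functor.map_id] at this
    exact this
  · intro ψ hψ
    apply Subtype.ext; funext V; ext s
    refine hFu V s _ fun i ↦ ?_
    have h1 := ψ.2 V ⟨V.1 ⊓ U i, inf_le_left.trans V.2⟩ inf_le_left s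
    refine h1.symm.trans ?_
    have := congrFun (congrArg Subtype.val (hψ i)) ⟨V.1 ⊓ U i, inf_le_right⟩
    exact DFunLike.congr_fun this _

lemma dualPresheaf_isSheaf (M : X.Modules) : (dualPresheaf M).IsSheaf := by
  rw [TopCat.Presheaf.isSheaf_iff_isSheafUniqueGluing]
  intro ι U sf hsf
  exact dualSections_glue M U sf hsf

lemma dualRes_smul (M : X.Modules) {U U' : X.Opens} (h : U' ≤ U) (a : Γ(X, U))
    (φ : dualSections M U) :
    dualRes M h (a • φ) = X.presheaf.map (homOfLE h).op a • dualRes M h φ := by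
  apply Subtype.ext; funext W; ext s
  change X.presheaf.map (homOfLE (W.2.trans h)).op a • φ.1 ⟨W.1, W.2.trans h⟩ s =
    X.presheaf.map (homOfLE W.2).op (X.presheaf.map (homOfLE h).op a) •
      φ.1 ⟨W.1, W.2.trans h⟩ s
  rw [← ConcreteCategory.comp_apply, ← Functor.map_comp]; rfl

/-- The dual `M* = ℋom(M, 𝒪_X)` of an `𝒪_X`-module. -/
def dual (M : X.Modules) : X.Modules where
  val := PresheafOfModules.ofPresheaf (dualPresheaf M)
    fun _ _ i a φ ↦ dualRes_smul M i.unop.le a φ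
  isSheaf := dualPresheaf_isSheaf M

lemma dual_sections (M : X.Modules) (U : X.Opens) : (Γ(dual M, U) : Type u) = dualSections M U := rfl

/-- The transpose `N* ⟶ M*` of a morphism `M ⟶ N`. -/
def dualMap {M N : X.Modules} (α : M ⟶ N) : dual N ⟶ dual M where
  val := PresheafOfModules.homMk
    { app U := AddCommGrpCat.ofHom
        { toFun := fun φ : dualSections N U.unop ↦ (⟨fun V ↦
            { toFun := fun s ↦ φ.1 V (α.app V.1 s)
              map_add' := by simp
              map_smul' := by simp }, by
            intro V W h s
            refine Eq.trans ?_ (φ.2 V W h (α.app V.1 s))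
            exact congrArg (φ.1 W) (ConcreteCategory.congr_hom (α.mapPresheaf.naturality (homOfLE h).op) s)⟩ : dualSections M U.unop)
          map_zero' := rfl
          map_add' := fun _ _ ↦ rfl } }
    (fun _ _ _ ↦ rfl)

lemma res_self (U : X.Opens) (h : U ≤ U) (a : Γ(X, U)) : X.presheaf.map (homOfLE h).op a = a := by
  have e : homOfLE h = 𝟙 _ := rfl
  rw [e]; simp

/-- The section of `M**` given by evaluation at a section `s` of `M`. -/
def evalAt (M : X.Modules) {U : X.Opens} (s : Γ(M, U)) : dualSections (dual M) U :=
  ⟨fun V ↦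
    { toFun := fun φ : dualSections M V.1 ↦
        φ.1 ⟨V.1, le_rfl⟩ (M.presheaf.map (homOfLE V.2).op s)
      map_add' := fun _ _ ↦ rfl
      map_smul' := fun a φ ↦ congrArg
        (· * (φ : dualSections M V.1).1 ⟨V.1, le_rfl⟩ (M.presheaf.map (homOfLE V.2).op s))
        (res_self V.1 le_rfl a) }, by
    intro V W h φ
    refine Eq.trans ?_ ((φ : dualSections M V.1).2 ⟨V.1, le_rfl⟩ ⟨W.1, h⟩ h
      (M.presheaf.map (homOfLE V.2).op s))
    rw [← ConcreteCategory.comp_apply, ← Functor.map_comp]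
    rfl⟩

lemma evalAt_apply (M : X.Modules) {U : X.Opens} (s : Γ(M, U)) (V : {V : X.Opens // V ≤ U})
    (φ : dualSections M V.1) : (evalAt M s).1 V φ =
      φ.1 ⟨V.1, le_rfl⟩ (M.presheaf.map (homOfLE V.2).op s) := rfl

lemma evalAt_zero (M : X.Modules) (U : X.Opens) : evalAt M (0 : Γ(M, U)) = 0 := by
  apply Subtype.ext; funext V; apply LinearMap.ext; intro φ
  exact (congrArg ((φ : dualSections M V.1).1 ⟨V.1, le_rfl⟩) (map_zero _)).trans (map_zero _)

lemma evalAt_add (M : X.Modules) {U : X.Opens} (s t : Γ(M, U)) :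
    evalAt M (s + t) = evalAt M s + evalAt M t := by
  apply Subtype.ext; funext V; apply LinearMap.ext; intro φ
  exact (congrArg ((φ : dualSections M V.1).1 ⟨V.1, le_rfl⟩) (map_add _ s t)).trans (map_add _ _ _)

/-- The evaluation morphism `M ⟶ M**`. -/
def toDoubleDual (M : X.Modules) : M ⟶ dual (dual M) where
  val := PresheafOfModules.homMk
    { app U := AddCommGrpCat.ofHom
        { toFun := fun s : Γ(M, U.unop) ↦ evalAt M s
          map_zero' := evalAt_zero M U.unop
          map_add' := fun s t ↦ evalAt_add M s t }
      naturality U U' i := by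
        ext s
        apply Subtype.ext; funext V; apply LinearMap.ext; intro φ
        refine congrArg ((φ : dualSections M V.1).1 ⟨V.1, le_rfl⟩) ?_
        refine (ConcreteCategory.comp_apply (M.presheaf.map i) (M.presheaf.map (homOfLE V.2).op) s).symm.trans ?_
        rw [← Functor.map_comp]
        rfl }
    (fun U a s ↦ by
      apply Subtype.ext; funext V; apply LinearMap.ext; intro φ
      refine (congrArg ((φ : dualSections M V.1).1 ⟨V.1, le_rfl⟩)
        (M.map_smul (homOfLE V.2) a s)).trans ?_
      exact ((φ : dualSections M V.1).1 ⟨V.1, le_rfl⟩).map_smul _ _)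

section saturation

lemma res_res (M : X.Modules) {U V W : X.Opens} (h : V ≤ U) (h' : W ≤ V) (s : Γ(M, U)) :
    M.presheaf.map (homOfLE h').op (M.presheaf.map (homOfLE h).op s) =
      M.presheaf.map (homOfLE (h'.trans h)).op s := by
  rw [← ConcreteCategory.comp_apply, ← Functor.map_comp]; rfl

lemma res_app {M N : X.Modules} (φ : M ⟶ N) {U V : X.Opens} (h : V ≤ U) (s : Γ(M, U)) :
    φ.app V (M.presheaf.map (homOfLE h).op s) = N.presheaf.map (homOfLE h).op (φ.app U s) :=
  ConcreteCategory.congr_hom (φ.mapPresheaf.naturality (homOfLE h).op) s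

variable [IsIntegral X] {N E : X.Modules} (φ : N ⟶ E)

lemma res_ne_zero {U V : X.Opens} (h : V ≤ U) {x : X} (hx : x ∈ V) {a : Γ(X, U)} (ha : a ≠ 0) :
    X.presheaf.map (homOfLE h).op a ≠ 0 := by
  have : Nonempty V := ⟨⟨x, hx⟩⟩
  exact fun h0 ↦ ha (map_injective_of_isIntegral X (homOfLE h) (h0.trans (map_zero _).symm))

/-- Sections over `U` of the saturation in `E` of the image of `φ : N ⟶ E` on an integral scheme: the
sections of `E` whose class in `E / im φ` is torsion, i.e. those which, locally, become elements of
the image of `φ` after multiplication by a nonzero function. -/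
def satSections (U : X.Opens) : Submodule Γ(X, U) Γ(E, U) where
  carrier := {s | ∀ x ∈ U, ∃ (V : X.Opens) (_ : x ∈ V) (h : V ≤ U) (a : Γ(X, V)) (t : Γ(N, V)),
    a ≠ 0 ∧ a • E.presheaf.map (homOfLE h).op s = φ.app V t}
  zero_mem' := fun x hx ↦ ⟨U, hx, le_rfl, 1, 0, by
    have : Nonempty U := ⟨⟨x, hx⟩⟩
    exact one_ne_zero, by simp⟩
  add_mem' := by
    intro s s' hs hs' x hx
    obtain ⟨V, hxV, hV, a, t, ha, hat⟩ := hs x hx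
    obtain ⟨V', hxV', hV', a', t', ha', hat'⟩ := hs' x hx
    have hW : x ∈ V ⊓ V' := ⟨hxV, hxV'⟩
    have hl : V ⊓ V' ≤ V := inf_le_left
    have hr : V ⊓ V' ≤ V' := inf_le_right
    have : Nonempty (V ⊓ V' : X.Opens) := ⟨⟨x, hW⟩⟩
    refine ⟨V ⊓ V', hW, inf_le_left.trans hV,
      X.presheaf.map (homOfLE hl).op a * X.presheaf.map (homOfLE hr).op a',
      X.presheaf.map (homOfLE hr).op a' • N.presheaf.map (homOfLE hl).op t +
        X.presheaf.map (homOfLE hl).op a • N.presheaf.map (homOfLE hr).op t',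
      mul_ne_zero (res_ne_zero _ hW ha) (res_ne_zero _ hW ha'), ?_⟩
    rw [map_add, map_add, Scheme.Modules.Hom.app_smul, Scheme.Modules.Hom.app_smul, res_app,
      res_app, ← hat, ← hat', Scheme.Modules.map_smul, Scheme.Modules.map_smul, res_res, res_res,
      smul_add, mul_smul, mul_smul]
    congr 1
    rw [smul_comm]
  smul_mem' := by
    intro b s hs x hx
    obtain ⟨V, hxV, hV, a, t, ha, hat⟩ := hs x hx
    refine ⟨V, hxV, hV, a, X.presheaf.map (homOfLE hV).op b • t, ha, ?_⟩
    rw [Scheme.Modules.Hom.app_smul, ← hat, Scheme.Modules.map_smul, smul_comm]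

lemma satSections_res {U U' : X.Opens} (h : U' ≤ U) {s : Γ(E, U)} (hs : s ∈ satSections φ U) :
    E.presheaf.map (homOfLE h).op s ∈ satSections φ U' := by
  intro x hx
  obtain ⟨V, hxV, hV, a, t, ha, hat⟩ := hs x (h hx)
  have hW : x ∈ V ⊓ U' := ⟨hxV, hx⟩
  have hl : V ⊓ U' ≤ V := inf_le_left
  refine ⟨V ⊓ U', hW, inf_le_right, X.presheaf.map (homOfLE hl).op a,
    N.presheaf.map (homOfLE hl).op t, res_ne_zero _ hW ha, ?_⟩
  rw [res_app, ← hat, Scheme.Modules.map_smul, res_res, res_res]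

/-- The saturation of the image of `φ` as a family of submodules of `E`. -/
def satSubmodule : PresheafOfModules.Submodule E.val where
  obj U := satSections φ U.unop
  map i _ hs := satSections_res φ i.unop.le hs

lemma satSections_of_cover {ι : Type*} {U : X.Opens} (W : ι → X.Opens) (hW : ∀ i, W i ≤ U)
    (hU : U ≤ iSup W) {s : Γ(E, U)}
    (hs : ∀ i, E.presheaf.map (homOfLE (hW i)).op s ∈ satSections φ (W i)) :
    s ∈ satSections φ U := by
  intro x hx
  obtain ⟨i, hi⟩ := Opens.mem_iSup.mp (hU hx)
  obtain ⟨V, hxV, hV, a, t, ha, hat⟩ := hs i x hi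
  refine ⟨V, hxV, hV.trans (hW i), a, t, ha, ?_⟩
  rw [← hat, res_res]

lemma satSubmodule_isSheaf :
    TopCat.Presheaf.IsSheaf (X := X.carrier) (satSubmodule φ).toPresheafOfModules.presheaf := by
  rw [TopCat.Presheaf.isSheaf_iff_isSheafUniqueGluing]
  intro ι U sf hsf
  obtain ⟨s, hs, hu⟩ := E.isSheaf.isSheafUniqueGluing U (fun i ↦ (sf i).1)
    (fun i j ↦ congrArg Subtype.val (hsf i j))
  refine ⟨⟨s, satSections_of_cover φ U (le_iSup U) le_rfl fun i ↦ ?_⟩, fun i ↦ ?_, ?_⟩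
  · have := hs i
    exact this ▸ (sf i).2
  · exact Subtype.ext (hs i)
  · intro t ht
    exact Subtype.ext (hu t.1 fun i ↦ congrArg Subtype.val (ht i))

/-- The saturation in `E` of the image of `φ : N ⟶ E`: the kernel of
`E ⟶ (E / im φ) / torsion`. -/
def saturation : X.Modules where
  val := (satSubmodule φ).toPresheafOfModules
  isSheaf := satSubmodule_isSheaf φ

/-- The inclusion of the saturation of the image of `φ : N ⟶ E` into `E`. -/
def saturationι : saturation φ ⟶ E where
  val := (satSubmodule φ).ι

end saturation

section final
variable {k : CommRingCat.{u}}

/-- The reflexive tensor power `M^{[⊗ m]} = (M^{⊗ m})**`. -/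
def reflPow (M : X.Modules) (m : ℕ) : X.Modules := dual (dual (tensorPow M m))

/-- The morphism `φ^{[⊗ m]} : M^{[⊗ m]} ⟶ N^{[⊗ m]}` induced by `φ : M ⟶ N`. -/
def reflPowMap {M N : X.Modules} (φ : M ⟶ N) (m : ℕ) : reflPow M m ⟶ reflPow N m :=
  dualMap (dualMap (tensorPowMap φ m))

/-- The sheaf of reflexive differentials `Ω_X^{[1]} = (Ω¹_X)**`. -/
def reflOmega (f : X ⟶ Spec k) : X.Modules := dual (dual (Omega f))

/-- The canonical morphism `Ω¹_X ⟶ Ω_X^{[1]}`. -/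
def toReflOmega (f : X ⟶ Spec k) : Omega f ⟶ reflOmega f := toDoubleDual (Omega f)

/-- The saturation `(p^* Ω¹_Z)^{sat}` of the image of `p^* Ω¹_Z` in `Ω_X^{[1]}`. -/
def satPullback [IsIntegral X] {Z : Scheme.{u}} (f : X ⟶ Spec k) (p : X ⟶ Z) (g : Z ⟶ Spec k)
    (hp : p ≫ g = f) : X.Modules :=
  saturation (Omega.pullbackMap f p g hp ≫ toReflOmega f)

/-- The inclusion `(p^* Ω¹_Z)^{sat} ⟶ Ω_X^{[1]}`. -/
def satPullbackι [IsIntegral X] {Z : Scheme.{u}} (f : X ⟶ Spec k) (p : X ⟶ Z) (g : Z ⟶ Spec k)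
    (hp : p ≫ g = f) : satPullback f p g hp ⟶ reflOmega f :=
  saturationι (Omega.pullbackMap f p g hp ≫ toReflOmega f)

/-- A `k`-scheme carries no nonzero pluri-form if `H⁰(X, (Ω¹_X)^{[⊗ m]}) = 0` for all `m > 0`. -/
def NoPluriForms (f : X ⟶ Spec k) : Prop :=
  ∀ m : ℕ, 0 < m → ∀ s : Γ(reflPow (Omega f) m, ⊤), s = 0

/-- A scheme is normal if all its local rings are integrally closed domains. -/
def IsNormalScheme (X : Scheme.{u}) : Prop :=
  ∀ x : X, IsDomain (X.presheaf.stalk x) ∧ IsIntegrallyClosed (X.presheaf.stalk x)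

/-- A dominant morphism is equidimensional if all irreducible components of all its (nonempty)
fibers have one and the same dimension. -/
def IsEquidimensional {Z : Scheme.{u}} (p : X ⟶ Z) : Prop :=
  IsDominant p ∧ ∃ d : ℕ, ∀ z : Z, ∀ C ∈ irreducibleComponents (p.fiber z),
    topologicalKrullDim C = (d : WithBot ℕ∞)

/-- The fibers of `p` over the closed points of some nonempty open subset of `Z` (that is, the general
fibers of `p`) carry no nonzero pluri-form. -/
def GeneralFiberNoPluriForms {Z : Scheme.{u}} (f : X ⟶ Spec k) (p : X ⟶ Z) : Prop :=
  ∃ U : Z.Opens, (U : Set Z).Nonempty ∧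
    ∀ z ∈ U, IsClosed ({z} : Set Z) → NoPluriForms (p.fiberι z ≫ f)

end final

end PluriForm

end

/-! On an integral scheme a section of a reflexive tensor power is determined by its value at the
generic point. There a section of `(M^{⊗m})*` is an m-linear form Λ on the generic stalk of M. So
for M = Ω¹_X, with K the function field of X, a pluri-form is a linear functional σ on m-linear
forms on Ω_{K/ℂ}, that is on m-fold tensors of rational vector fields, such that σ(Λ) is regular
wherever Λ is (`Gen`, `regD_dualT_iff`). The saturation has the same description, with generic stalk
the span W of the differentials of functions on Z. Both sides embed in the reflexive power of
Ω_X^{[1]}, and the isomorphism is an equality of images (`exists_equiv_reflPow`): every σ has to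
factor through the restriction of forms to W, and the factor has to preserve regularity.

Factorization means that σ(ξ₁ ⊗ … ⊗ ξ_m) = 0 as soon as one ξ_i is vertical, i.e. kills the
functions of Z (`FiberVanishing.eq_zero_of_mem_verticalForms`). The proof is a descending induction
on the set of vertical slots. By linearity the other slots may be taken to extend derivations of the
function field L of Z; once they are fixed, σ becomes a multilinear form τ on relative vector
fields. Let O be the valuation ring of a codimension one point of X that dominates Z. It contains L,
and every derivation of L extends to a derivation of K that preserves O
(`exists_derivation_extension_of_isDiscreteValuationRing`). Two extensions differ by a vertical
field, so by induction the exchange of one for the other does not change the value of σ. Hence τ is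
regular at all horizontal codimension one points, and by normality cτ is a regular relative form
over an affine open subset Spec B of Z, for some nonzero c in B.

Such a form is zero because it vanishes on general fibers. For a finite type B-algebra A and a
general maximal ideal I of B, the kernel of a matrix over A commutes with reduction modulo I
(`Algebra.GenericallyPure.of_finiteType`). So multilinear forms on the differentials of a fiber lift
locally to relative forms on X, uniquely modulo I (`exists_lift_multilinear`). Applying the
functional to the lifts and restricting to the fiber yields a pluri-form on the fiber
(`IsLiftingFamily.exists_pluriForm`), which is zero by hypothesis. The values of cτ on regular
vector fields are therefore divisible by I for all general I, hence zero.

It remains to see that the functional induced on forms on W preserves regularity. By normality this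
is tested at discrete valuation rings O, and there the lattice spanned by the differentials of O has
a projection to its intersection with W (`exists_projection_of_lattice`). Forms on W extend along it
to forms on Ω without acquiring a pole at O (`isReg_of_factor`). -/

section

/-! ### Generic purity of modules over a finite type algebra -/

open scoped TensorProduct
set_option linter.unusedSectionVars false

/-- The multiplication map `I ⊗ C → C` is injective. -/
def Ideal.IsPureOn {B : Type u} [CommRing B] (I : Ideal B) (C : Type u) [AddCommGroup C] [Module B C] : Prop :=
  ∀ x : I ⊗[B] C, TensorProduct.lid B C (LinearMap.rTensor C I.subtype x) = 0 → x = 0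

namespace Ideal.IsPureOn

variable {B : Type u} [CommRing B] {I : Ideal B}
  {C C' C'' : Type u} [AddCommGroup C] [Module B C] [AddCommGroup C'] [Module B C']
  [AddCommGroup C''] [Module B C'']

lemma lid_natural (f : C →ₗ[B] C') (x : I ⊗[B] C) :
    TensorProduct.lid B C' (LinearMap.rTensor C' I.subtype (LinearMap.lTensor I f x)) =
      f (TensorProduct.lid B C (LinearMap.rTensor C I.subtype x)) := by
  induction x with
  | zero => simp
  | tmul a c => simp
  | add x y hx hy => simp only [map_add, hx, hy]

lemma of_equiv (h : I.IsPureOn C) (e : C ≃ₗ[B] C') : I.IsPureOn C' := by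
  intro x hx
  have h1 := lid_natural e.symm.toLinearMap x
  rw [hx, map_zero] at h1
  have h2 := congrArg (LinearMap.lTensor I e.toLinearMap) (h _ h1)
  rw [← LinearMap.comp_apply, ← LinearMap.lTensor_comp] at h2
  simpa using h2

lemma self : I.IsPureOn B := by
  intro x hx
  refine (TensorProduct.rid B I).injective ?_
  rw [map_zero]
  apply Subtype.ext
  refine Eq.trans ?_ hx
  induction x with
  | zero => simp
  | tmul a c => simp [mul_comm]
  | add x y hx hy =>
    simp only [map_add, Submodule.coe_add]
    have : ∀ x : I ⊗[B] B, ((TensorProduct.rid B I x : I) : B) =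
        TensorProduct.lid B B (LinearMap.rTensor B I.subtype x) := by
      intro x
      induction x with
      | zero => simp
      | tmul a c => simp [mul_comm]
      | add x y hx hy => simp only [map_add, Submodule.coe_add, hx, hy]
    rw [this, this]

lemma of_subsingleton [Subsingleton C] : I.IsPureOn C := fun _ _ ↦ Subsingleton.elim _ _

/-- Purity is the vanishing of Tor₁(B/I, C), so it passes to extensions: an element of the kernel
dies in `I ⊗ C''`, hence comes from `I ⊗ C'` by right exactness. -/
lemma of_exact (f : C' →ₗ[B] C) (g : C →ₗ[B] C'') (hf : Function.Injective f) (hg : Function.Surjective g)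
    (hfg : Function.Exact f g) (h' : I.IsPureOn C') (h'' : I.IsPureOn C'') : I.IsPureOn C := by
  intro x hx
  have h1 := h'' (LinearMap.lTensor I g x) (by rw [lid_natural, hx, map_zero])
  obtain ⟨y, rfl⟩ := (lTensor_exact I hfg hg x).mp h1
  rw [lid_natural] at hx
  rw [h' y (hf (hx.trans (map_zero f).symm)), map_zero]

/-- The kernel of `I ⊗ C → C` is killed by every a in I, since a • x is a ⊗ (image of x), and it is
killed by b; together they generate the unit ideal. -/
lemma of_smul_eq_zero [I.IsMaximal] {b : B} (hb : b ∉ I) (h : ∀ c : C, b • c = 0) : I.IsPureOn C := by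
  intro x hx
  have key : ∀ a ∈ I, a • x = 0 := by
    intro a ha
    have : ∀ x : I ⊗[B] C, a • x = (⟨a, ha⟩ : I) ⊗ₜ[B]
        TensorProduct.lid B C (LinearMap.rTensor C I.subtype x) := by
      intro x
      induction x with
      | zero => simp
      | tmul y c =>
        simp only [LinearMap.rTensor_tmul, Submodule.subtype_apply, TensorProduct.lid_tmul,
          TensorProduct.tmul_smul, TensorProduct.smul_tmul']
        congr 1
        apply Subtype.ext
        simp [mul_comm]
      | add x y hx hy => simp only [map_add, smul_add, hx, hy, TensorProduct.tmul_add]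
    rw [this, hx, TensorProduct.tmul_zero]
  have hbx : b • x = 0 := by
    clear hx key
    induction x with
    | zero => simp
    | tmul y c => rw [← TensorProduct.tmul_smul, h, TensorProduct.tmul_zero]
    | add x y hx hy => rw [smul_add, hx, hy, add_zero]
  obtain ⟨c, i, hi, e⟩ := (inferInstance : I.IsMaximal).exists_inv hb
  rw [← one_smul B x, ← e, add_smul, mul_smul, hbx, smul_zero, zero_add, key i hi]

/-- An element of `I ⊗ C` involves finitely many elements of C, so it comes from some `I ⊗ M n`, and
`M n` embeds in C. -/
lemma of_iUnion (M : ℕ → Submodule B C) (hM : Monotone M) (hU : ∀ c, ∃ n, c ∈ M n)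
    (h : ∀ n, I.IsPureOn (M n)) : I.IsPureOn C := by
  intro x hx
  have : ∃ n, ∃ y : I ⊗[B] (M n), LinearMap.lTensor I (M n).subtype y = x := by
    clear hx
    induction x with
    | zero => exact ⟨0, 0, map_zero _⟩
    | tmul a c =>
      obtain ⟨n, hn⟩ := hU c
      exact ⟨n, a ⊗ₜ ⟨c, hn⟩, by simp⟩
    | add x y hx hy =>
      obtain ⟨n, x, rfl⟩ := hx
      obtain ⟨n', y, rfl⟩ := hy
      refine ⟨max n n', LinearMap.lTensor I (Submodule.inclusion (hM (le_max_left n n'))) x +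
        LinearMap.lTensor I (Submodule.inclusion (hM (le_max_right n n'))) y, ?_⟩
      rw [map_add, ← LinearMap.comp_apply, ← LinearMap.comp_apply, ← LinearMap.lTensor_comp,
        ← LinearMap.lTensor_comp]
      rfl
  obtain ⟨n, y, rfl⟩ := this
  rw [lid_natural] at hx
  rw [h n y ((M n).injective_subtype (hx.trans (map_zero _).symm)), map_zero]

/-- If `I` is pure on a quotient `C` of `N`, the elements of the kernel in `I N` are in `I` times the kernel. -/
lemma mem_smul_ker (h : I.IsPureOn C) (π : C' →ₗ[B] C) (hπ : Function.Surjective π)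
    {n : C'} (hn : n ∈ LinearMap.ker π) (hnI : n ∈ I • (⊤ : Submodule B C')) : n ∈ I • LinearMap.ker π := by
  have : ∃ t : I ⊗[B] C', TensorProduct.lid B C' (LinearMap.rTensor C' I.subtype t) = n := by
    clear hn
    induction hnI using Submodule.smul_induction_on' with
    | smul r hr c _ => exact ⟨⟨r, hr⟩ ⊗ₜ c, by simp⟩
    | add x hx y hy h h' =>
      obtain ⟨t, rfl⟩ := h
      obtain ⟨t', rfl⟩ := h'
      exact ⟨t + t', by simp only [map_add]⟩
  obtain ⟨t, rfl⟩ := this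
  have h1 := h (LinearMap.lTensor I π t) (by rw [lid_natural]; exact hn)
  obtain ⟨y, rfl⟩ := (lTensor_exact I (LinearMap.exact_subtype_ker_map π) hπ t).mp h1
  rw [lid_natural]
  clear h1 hn hnI
  induction y with
  | zero => simp
  | tmul a c => simpa using Submodule.smul_mem_smul a.2 c.2
  | add x y hx hy => 
    simp only [map_add]
    exact Submodule.add_mem _ hx hy

end Ideal.IsPureOn

/-- `B`-algebras all of whose finite modules are pure for general maximal ideals of `B`. -/
def Algebra.GenericallyPure (B A : Type u) [CommRing B] [CommRing A] [Algebra B A] : Prop :=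
  ∀ (C : Type u) [AddCommGroup C] [Module A C] [Module B C] [IsScalarTower B A C] [Module.Finite A C],
    ∃ b : B, b ≠ 0 ∧ ∀ I : Ideal B, I.IsMaximal → b ∉ I → I.IsPureOn C

namespace Algebra.GenericallyPure
variable {B : Type u} [CommRing B] [IsDomain B]

/-- Dévissage: a finite module is an iterated extension of modules B/p. For p = 0 this is B itself,
which is pure for every I; for p ≠ 0 it is killed by some nonzero b in p, and ideals avoiding b
cause no trouble. -/
lemma self [IsNoetherianRing B] : Algebra.GenericallyPure B B := by
  intro C _ i1 i2 hT hfin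
  -- The definition supplies two B-module structures on C; the tower B → B → C forces them to agree.
  have : i1 = i2 := by
    refine Module.ext' _ _ fun r x ↦ ?_
    have := hT.smul_assoc r 1 x
    rw [smul_eq_mul, mul_one] at this
    refine this.trans (congrArg _ ?_)
    exact @one_smul B C _ i1.toMulAction x
  subst this
  induction hfin using IsNoetherianRing.induction_on_isQuotientEquivQuotientPrime with
  | subsingleton N => exact ⟨1, one_ne_zero, fun I _ _ ↦ .of_subsingleton⟩
  | quotient N p e =>
    by_cases hp : p.1 = ⊥
    · refine ⟨1, one_ne_zero, fun I _ _ ↦ ?_⟩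
      exact Ideal.IsPureOn.self.of_equiv (((Submodule.quotEquivOfEqBot _ hp).symm).trans e.symm)
    · obtain ⟨b, hb, hb0⟩ := Submodule.exists_mem_ne_zero_of_ne_bot hp
      refine ⟨b, hb0, fun I _ hbI ↦ ?_⟩
      refine Ideal.IsPureOn.of_equiv (C := B ⧸ p.1) (Ideal.IsPureOn.of_smul_eq_zero hbI fun c ↦ ?_) e.symm
      obtain ⟨c, rfl⟩ := Ideal.Quotient.mk_surjective c
      refine (Ideal.Quotient.eq_zero_iff_mem (a := b * c)).mpr ?_
      exact Ideal.mul_mem_right _ _ hb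
  | exact N₁ N₂ N₃ f g hf hg hfg h₁ h₃ =>
    obtain ⟨b, hb, h⟩ := h₁
    obtain ⟨b', hb', h'⟩ := h₃
    refine ⟨b * b', mul_ne_zero hb hb', fun I hI hbI ↦ ?_⟩
    exact .of_exact f g hf hg hfg (h I hI fun h ↦ hbI (I.mul_mem_right _ h)) 
      (h' I hI fun h ↦ hbI (I.mul_mem_left _ h))

lemma of_surjective {A A' : Type u} [CommRing A] [Algebra B A] [CommRing A'] [Algebra B A']
    (h : Algebra.GenericallyPure B A) (f : A →ₐ[B] A') (hf : Function.Surjective f) :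
    Algebra.GenericallyPure B A' := by
  intro C _ _ _ _ _
  let _ := Module.compHom C f.toRingHom
  have hs : ∀ (a : A) (c : C), a • c = f a • c := fun _ _ ↦ rfl
  have : IsScalarTower B A C := ⟨fun b a c ↦ by rw [hs, hs, map_smul, smul_assoc]⟩
  have : Module.Finite A C := by
    obtain ⟨s, hs'⟩ := (inferInstance : Module.Finite A' C)
    refine ⟨s, ?_⟩
    refine top_unique ?_
    intro x _
    have : x ∈ Submodule.span A' (s : Set C) := by rw [hs']; trivial
    induction this using Submodule.span_induction with
    | mem x h => exact Submodule.subset_span h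
    | zero => exact zero_mem _
    | add x y _ _ hx hy => exact add_mem (hx trivial) (hy trivial)
    | smul a x _ hx =>
      obtain ⟨a, rfl⟩ := hf a
      exact Submodule.smul_mem _ a (hx trivial)
  exact h C

/-- The submodules generated by the images of `M₀` under small powers of an endomorphism. -/
def powSum {A C : Type u} [CommRing A] [AddCommGroup C] [Module A C] (x : Module.End A C)
    (M₀ : Submodule A C) : ℕ → Submodule A C
  | 0 => ⊥
  | n + 1 => M₀ ⊔ (powSum x M₀ n).map x

section powSum
variable {A C : Type u} [CommRing A] [AddCommGroup C] [Module A C] (x : Module.End A C)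
    (M₀ : Submodule A C)

lemma powSum_mono : Monotone (powSum x M₀) := by
  refine monotone_nat_of_le_succ fun n ↦ ?_
  induction n with
  | zero => exact bot_le
  | succ n ih => exact sup_le_sup_left (Submodule.map_mono ih) _

lemma pow_mem_powSum (n : ℕ) {c : C} (hc : c ∈ M₀) : (x ^ n) c ∈ powSum x M₀ (n + 1) := by
  induction n with
  | zero => exact Submodule.mem_sup_left hc
  | succ n ih =>
    rw [pow_succ']
    exact Submodule.mem_sup_right (Submodule.mem_map_of_mem ih)

/-- The n-th graded piece of the filtration is generated by `x ^ n` applied to M₀, which presents it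
as a quotient of M₀. -/
lemma powSum_succ_le (n : ℕ) : powSum x M₀ (n + 1) ≤ powSum x M₀ n ⊔ M₀.map (x ^ n) := by
  induction n with
  | zero => simp [powSum, Module.End.one_eq_id]
  | succ n ih =>
    refine sup_le ?_ ((Submodule.map_mono ih).trans ?_)
    · exact (le_sup_left (a := M₀)).trans le_sup_left
    · rw [Submodule.map_sup, ← Submodule.map_comp, pow_succ']
      exact sup_le_sup_right le_sup_right _

/-- The kernel of the surjection from `M₀` onto a graded piece of `powSum`. -/
def powSumKer (n : ℕ) : Submodule A M₀ := (powSum x M₀ n).comap ((x ^ n) ∘ₗ M₀.subtype)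

/-- Makes the ascending chain condition in M₀ applicable: only finitely many different graded pieces
occur. -/
lemma powSumKer_mono : Monotone (powSumKer x M₀) := by
  refine monotone_nat_of_le_succ fun n c hc ↦ ?_
  change (x ^ (n + 1)) c ∈ powSum x M₀ (n + 1)
  rw [pow_succ']
  exact Submodule.mem_sup_right (Submodule.mem_map_of_mem hc)

variable [Algebra B A] [Module B C] [IsScalarTower B A C] {I : Ideal B}

/-- Each step of the filtration is an extension of the graded piece M₀ / `powSumKer` by the previous
step. -/
lemma isPureOn_powSum (h : ∀ n, I.IsPureOn (M₀ ⧸ powSumKer x M₀ n)) (n : ℕ) :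
    I.IsPureOn (powSum x M₀ n) := by
  induction n with
  | zero => 
    have : Subsingleton (powSum x M₀ 0) := inferInstanceAs (Subsingleton (⊥ : Submodule A C))
    exact .of_subsingleton
  | succ n ih =>
    let N := (powSum x M₀ n).submoduleOf (powSum x M₀ (n + 1))
    let φ : M₀ →ₗ[A] (powSum x M₀ (n + 1)) ⧸ N := N.mkQ ∘ₗ
      (((x ^ n) ∘ₗ M₀.subtype).codRestrict _ fun c ↦ pow_mem_powSum x M₀ n c.2)
    have hφ : Function.Surjective φ := by
      intro c
      obtain ⟨⟨c, hc⟩, rfl⟩ := N.mkQ_surjective c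
      obtain ⟨y, hy, _, ⟨z, hz, rfl⟩, rfl⟩ := Submodule.mem_sup.mp (powSum_succ_le x M₀ n hc)
      refine ⟨⟨z, hz⟩, ?_⟩
      rw [← sub_eq_zero, LinearMap.comp_apply, ← map_sub, Submodule.mkQ_apply, Submodule.Quotient.mk_eq_zero]
      change (x ^ n) z - (y + (x ^ n) z) ∈ powSum x M₀ n
      simpa using hy
    have hker : LinearMap.ker φ = powSumKer x M₀ n := by
      ext c
      rw [LinearMap.mem_ker, LinearMap.comp_apply, Submodule.mkQ_apply, Submodule.Quotient.mk_eq_zero]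
      rfl
    have e := (Submodule.quotEquivOfEq _ _ hker).symm.trans (φ.quotKerEquivOfSurjective hφ)
    refine Ideal.IsPureOn.of_exact ((Submodule.inclusion (powSum_mono x M₀ n.le_succ)).restrictScalars B)
      (N.mkQ.restrictScalars B) (Submodule.inclusion_injective (powSum_mono x M₀ n.le_succ)) N.mkQ_surjective ?_ ih
      ((h n).of_equiv (e.restrictScalars B))
    intro c
    refine (Submodule.Quotient.mk_eq_zero N).trans ⟨fun hc ↦ ⟨⟨c.1, hc⟩, rfl⟩, ?_⟩
    rintro ⟨c, rfl⟩
    exact c.2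

end powSum

open Polynomial in
-- A finite A[X]-module C is filtered by M₀ + X M₀ + … + X^(n-1) M₀, where M₀ is the A-span of a
-- finite set of generators. The graded pieces are quotients of M₀ by an ascending chain of kernels,
-- so up to isomorphism there are finitely many and the product of their bad elements b serves for
-- all of them. Purity then passes to the steps of the filtration and to their union.
lemma polynomial {A : Type u} [CommRing A] [IsNoetherianRing A] [Algebra B A]
    (h : Algebra.GenericallyPure B A) : Algebra.GenericallyPure B A[X] := by
  intro C _ _ _ _ _
  let _ : Module A C := Module.compHom C (Polynomial.C : A →+* A[X])
  have hs : ∀ (a : A) (c : C), a • c = (Polynomial.C a : A[X]) • c := fun _ _ ↦ rfl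
  have : IsScalarTower A A[X] C := ⟨fun b a c ↦ by rw [hs, Polynomial.smul_eq_C_mul, mul_smul]⟩
  have : IsScalarTower B A C := ⟨fun b a c ↦ by
    rw [hs, hs, ← smul_assoc, ← Polynomial.smul_C]⟩
  obtain ⟨s, hspan⟩ := (inferInstance : Module.Finite A[X] C)
  let x : Module.End A C :=
    { toFun := fun c ↦ (X : A[X]) • c
      map_add' := smul_add _
      map_smul' := fun a c ↦ smul_comm _ _ _ }
  let M₀ : Submodule A C := Submodule.span A (s : Set C)
  have : Module.Finite A M₀ := Module.Finite.iff_fg.mpr ⟨s, rfl⟩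
  obtain ⟨N, hN⟩ := monotone_stabilizes_iff_noetherian.mpr (inferInstance : IsNoetherian A M₀)
    ⟨powSumKer x M₀, powSumKer_mono x M₀⟩
  choose b hb0 hb using fun n : ℕ ↦ h (M₀ ⧸ powSumKer x M₀ n)
  refine ⟨∏ n ∈ Finset.range (N + 1), b n, Finset.prod_ne_zero_iff.mpr fun n _ ↦ hb0 n, fun I hI hbI ↦ ?_⟩
  have hb' : ∀ n ≤ N, b n ∉ I := fun n hn hbn ↦ hbI 
    (I.mem_of_dvd (Finset.dvd_prod_of_mem b (Finset.mem_range.mpr (by omega))) hbn)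
  have pure : ∀ n, I.IsPureOn (M₀ ⧸ powSumKer x M₀ n) := by
    intro n
    by_cases hn : n ≤ N
    · exact hb n I hI (hb' n hn)
    · exact (hb N I hI (hb' N le_rfl)).of_equiv
        ((Submodule.quotEquivOfEq _ _ (hN n (by omega))).restrictScalars B)
  refine Ideal.IsPureOn.of_iUnion (fun n ↦ (powSum x M₀ n).restrictScalars B)
    (fun _ _ h ↦ powSum_mono x M₀ h) (fun c ↦ ?_) (isPureOn_powSum x M₀ pure)
  have hXmem : ∀ n, ∀ c ∈ powSum x M₀ n, (X : A[X]) • c ∈ powSum x M₀ (n + 1) := fun n c hc ↦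
    Submodule.mem_sup_right (Submodule.mem_map_of_mem hc)
  have : c ∈ Submodule.span A[X] (s : Set C) := by rw [hspan]; trivial
  have hadd : ∀ c c', (∃ n, c ∈ powSum x M₀ n) → (∃ n, c' ∈ powSum x M₀ n) → ∃ n, c + c' ∈ powSum x M₀ n := by
    rintro c c' ⟨n, hn⟩ ⟨n', hn'⟩
    exact ⟨max n n', add_mem (powSum_mono x M₀ (le_max_left _ _) hn) (powSum_mono x M₀ (le_max_right _ _) hn')⟩
  induction this using Submodule.span_induction with
  | mem c hc => exact ⟨1, Submodule.mem_sup_left (Submodule.subset_span hc)⟩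
  | zero => exact ⟨0, zero_mem _⟩
  | add c c' _ _ h h' => exact hadd c c' h h'
  | smul a c _ h =>
    induction a using Polynomial.induction_on' with
    | add p q hp hq => rw [add_smul]; exact hadd _ _ hp hq
    | monomial n a =>
      rw [← Polynomial.C_mul_X_pow_eq_monomial, mul_smul]
      obtain ⟨k, hk⟩ := h
      refine ⟨k + n, (powSum x M₀ (k + n)).smul_mem a ?_⟩
      induction n with
      | zero => simpa using hk
      | succ n ih => rw [pow_succ', mul_smul]; exact hXmem _ _ ih

lemma mvPolynomial [IsNoetherianRing B] (n : ℕ) :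
    Algebra.GenericallyPure B (MvPolynomial (Fin n) B) := by
  induction n with
  | zero =>
    exact self.of_surjective (MvPolynomial.isEmptyAlgEquiv B (Fin 0)).symm.toAlgHom
      (MvPolynomial.isEmptyAlgEquiv B (Fin 0)).symm.surjective
  | succ n ih =>
    exact ih.polynomial.of_surjective (MvPolynomial.finSuccEquiv B n).symm.toAlgHom
      (MvPolynomial.finSuccEquiv B n).symm.surjective

theorem of_finiteType [IsNoetherianRing B] (A : Type u) [CommRing A] [Algebra B A] [Algebra.FiniteType B A] :
    Algebra.GenericallyPure B A := by
  obtain ⟨n, f, hf⟩ := Algebra.FiniteType.iff_quotient_mvPolynomial''.mp (inferInstance : Algebra.FiniteType B A)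
  exact (mvPolynomial n).of_surjective f hf

end Algebra.GenericallyPure

/-- The alternative is symmetric in a set and its complement, so that it survives the operations
that generate the constructible sets; unions use that nonempty open subsets of an irreducible space
meet. -/
lemma IsConstructible.exists_open_subset_or {X : Type*} [TopologicalSpace X] [IrreducibleSpace X] {s : Set X}
    (hs : Topology.IsConstructible s) : (∃ U : Set X, IsOpen U ∧ U.Nonempty ∧ U ⊆ s) ∨
      ∃ U : Set X, IsOpen U ∧ U.Nonempty ∧ U ⊆ sᶜ := by
  induction hs using Topology.IsConstructible.empty_union_induction with
  | open_retrocompact U hU _ =>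
    by_cases h : U.Nonempty
    · exact .inl ⟨U, hU, h, subset_rfl⟩
    · exact .inr ⟨Set.univ, isOpen_univ, Set.univ_nonempty, by
        rw [Set.not_nonempty_iff_eq_empty.mp h]; simp⟩
  | union s _ t _ h h' =>
    rcases h with ⟨U, hU, hne, h⟩ | ⟨U, hU, hne, h⟩
    · exact .inl ⟨U, hU, hne, h.trans Set.subset_union_left⟩
    rcases h' with ⟨U', hU', hne', h'⟩ | ⟨U', hU', hne', h'⟩
    · exact .inl ⟨U', hU', hne', h'.trans Set.subset_union_right⟩
    · refine .inr ⟨U ∩ U', hU.inter hU', nonempty_preirreducible_inter hU hU' hne hne', ?_⟩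
      rw [Set.compl_union]
      exact Set.inter_subset_inter h h'
  | compl s _ h => rw [compl_compl]; exact h.symm

/-- By Chevalley's theorem the image of Spec A in Spec B is constructible, and it contains the
generic point because B embeds in A; so it contains a basic open set D(b). -/
lemma Algebra.exists_map_ne_top {B A : Type u} [CommRing B] [IsDomain B] [IsNoetherianRing B] [CommRing A] [IsDomain A]
    [Algebra B A] [Algebra.FiniteType B A] [FaithfulSMul B A] :
    ∃ b : B, b ≠ 0 ∧ ∀ I : Ideal B, I.IsMaximal → b ∉ I → I.map (algebraMap B A) ≠ ⊤ := by
  have : Algebra.FinitePresentation B A := Algebra.FinitePresentation.of_finiteType.mp inferInstance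
  have hη : (⟨⊥, Ideal.isPrime_bot⟩ : PrimeSpectrum B) ∈ Set.range (PrimeSpectrum.comap (algebraMap B A)) :=
    ⟨⟨⊥, Ideal.isPrime_bot⟩, PrimeSpectrum.ext (Ideal.comap_bot_of_injective _ (FaithfulSMul.algebraMap_injective B A))⟩
  have hmem : ∀ U : Set (PrimeSpectrum B), IsOpen U → U.Nonempty → (⟨⊥, Ideal.isPrime_bot⟩ : PrimeSpectrum B) ∈ U := by
    rintro U hU ⟨x, hx⟩
    refine Specializes.mem_open ?_ hU hx
    rw [← PrimeSpectrum.le_iff_specializes]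
    exact bot_le (a := x.asIdeal)
  rcases IsConstructible.exists_open_subset_or (PrimeSpectrum.isConstructible_range_comap
    (f := algebraMap B A) (RingHom.finitePresentation_algebraMap.mpr this)) with ⟨U, hU, hne, h⟩ | ⟨U, hU, hne, h⟩
  · obtain ⟨_, ⟨_, ⟨b, rfl⟩, rfl⟩, hx, hb⟩ := PrimeSpectrum.isBasis_basic_opens.exists_subset_of_mem_open (hmem U hU hne) hU
    refine ⟨b, fun h0 ↦ hx (by simp [h0]), fun I hI hbI htop ↦ ?_⟩
    obtain ⟨Q, hQ⟩ := h (hb (show (⟨I, hI.isPrime⟩ : PrimeSpectrum B) ∈ _ from hbI))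
    have : I.map (algebraMap B A) ≤ Q.asIdeal := by
      rw [Ideal.map_le_iff_le_comap]
      exact (congrArg PrimeSpectrum.asIdeal hQ).ge
    exact Q.2.ne_top (top_unique (htop ▸ this))
  · exact absurd hη (h (hmem U hU hne))

end

/-! ### Lifting multilinear forms modulo general maximal ideals -/

section

open scoped TensorProduct
set_option linter.unusedSectionVars false

/-- A multilinear map takes values in a submodule if it does so on families of elements of spanning sets. -/
lemma MultilinearMap.mem_of_span {R A ι M N : Type*} [Finite ι] [CommRing R] [CommRing A] [Algebra A R] [AddCommGroup M]
    [Module R M] [Module A M] [IsScalarTower A R M] [AddCommGroup N] [Module R N] [Module A N] [IsScalarTower A R N]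
    (Λ : MultilinearMap R (fun _ : ι ↦ M) N)
    (s : Set M) (P : Submodule A N) (h : ∀ c : ι → M, (∀ i, c i ∈ s) → Λ c ∈ P) (c : ι → M)
    (hc : ∀ i, c i ∈ Submodule.span A s) : Λ c ∈ P := by
  classical
  have := Fintype.ofFinite ι
  -- Induction on the set F of slots whose entries are only known to lie in the span of s.
  have key : ∀ (F : Finset ι) (c : ι → M), (∀ i ∈ F, c i ∈ Submodule.span A s) → (∀ i ∉ F, c i ∈ s) → Λ c ∈ P := by
    intro F
    induction F using Finset.induction_on with
    | empty => exact fun c _ hc ↦ h c fun i ↦ hc i (by simp)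
    | insert i F hi ih =>
      intro c hc hc'
      have key : ∀ x ∈ Submodule.span A s, Λ (Function.update c i x) ∈ P := by
        intro x hx
        induction hx using Submodule.span_induction with
        | mem x hx =>
          refine ih _ (fun j hj ↦ ?_) (fun j hj ↦ ?_)
          · have : j ≠ i := fun e ↦ hi (e ▸ hj)
            rw [Function.update_of_ne this]
            exact hc j (Finset.mem_insert_of_mem hj)
          · by_cases hji : j = i
            · subst hji; simpa using hx
            · rw [Function.update_of_ne hji]
              exact hc' j (by simp [hji, hj])
        | zero => rw [MultilinearMap.map_update_zero]; exact zero_mem _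
        | add x y _ _ hx hy => rw [MultilinearMap.map_update_add]; exact add_mem hx hy
        | smul a x _ hx =>
          rw [← algebraMap_smul R a x, MultilinearMap.map_update_smul, algebraMap_smul]
          exact P.smul_mem a hx
      have := key (c i) (hc i (Finset.mem_insert_self _ _))
      rwa [Function.update_eq_self] at this
  exact key Finset.univ c (fun i _ ↦ hc i) (by simp)

lemma MultilinearMap.ext_of_span {R ι M N : Type*} [Finite ι] [CommRing R] [AddCommGroup M]
    [Module R M] [AddCommGroup N] [Module R N]
    {Λ Λ' : MultilinearMap R (fun _ : ι ↦ M) N}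
    (s : Set M) (hs : Submodule.span R s = ⊤) (h : ∀ c : ι → M, (∀ i, c i ∈ s) → Λ c = Λ' c) : Λ = Λ' := by
  ext c
  have := (Λ - Λ').mem_of_span s (⊥ : Submodule R N) (fun c hc ↦ by simp [h c hc]) c
    (fun i ↦ by rw [hs]; trivial)
  simpa [sub_eq_zero] using this

instance PiTensorProduct.finite_of_finite {R ι M : Type*} [Finite ι] [CommRing R] [AddCommGroup M]
    [Module R M] [Module.Finite R M] : Module.Finite R (PiTensorProduct R fun _ : ι ↦ M) := by
  classical
  obtain ⟨s, hs⟩ := (inferInstance : Module.Finite R M)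
  have : (Set.range fun c : ι → s ↦ PiTensorProduct.tprod R fun i ↦ (c i : M)).Finite := Set.finite_range _
  refine ⟨this.toFinset, top_unique ?_⟩
  rw [← PiTensorProduct.span_tprod_eq_top, Submodule.span_le]
  rintro _ ⟨c, rfl⟩
  refine MultilinearMap.mem_of_span (A := R) (PiTensorProduct.tprod R) (s : Set M) _ (fun c hc ↦ ?_) c
    (fun i ↦ by rw [hs]; trivial)
  refine Submodule.subset_span ?_
  rw [Set.Finite.coe_toFinset]
  exact ⟨fun i ↦ ⟨c i, hc i⟩, rfl⟩

section
variable {B A : Type u} [CommRing B] [CommRing A] [Algebra B A]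

lemma mem_smul_top_pi_iff {r : ℕ} (I : Ideal B) (x : Fin r → A) :
    x ∈ I • (⊤ : Submodule B (Fin r → A)) ↔ ∀ i, x i ∈ I.map (algebraMap B A) := by
  constructor
  · intro hx
    induction hx using Submodule.smul_induction_on' with
    | smul b hb y _ =>
      intro i
      rw [Pi.smul_apply, Algebra.smul_def]
      exact Ideal.mul_mem_right _ _ (Ideal.mem_map_of_mem _ hb)
    | add y _ z _ h h' => exact fun i ↦ add_mem (h i) (h' i)
  · intro h
    have : x = ∑ i, Pi.single i (x i) := (Finset.univ_sum_single x).symm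
    rw [this]
    refine Submodule.sum_mem _ fun i _ ↦ ?_
    have hi : x i ∈ I • (⊤ : Submodule B A) := by rw [Ideal.smul_top_eq_map]; exact h i
    generalize x i = z at hi
    induction hi using Submodule.smul_induction_on' with
    | smul b hb y _ => rw [Pi.single_smul]; exact Submodule.smul_mem_smul hb trivial
    | add y _ z _ h h' => rw [Pi.single_add]; exact add_mem h h'

/-- The form in which purity of the quotient C / N is applied: N ∩ IC = IN. -/
lemma Ideal.IsPureOn.mem_smul_of_mem {I : Ideal B} {C : Type u} [AddCommGroup C] [Module A C] [Module B C]
    [IsScalarTower B A C] {N : Submodule A C} (h : I.IsPureOn (C ⧸ N)) {n : C} (hn : n ∈ N)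
    (hnI : n ∈ I • (⊤ : Submodule B C)) : n ∈ I • N.restrictScalars B := by
  let π : C →ₗ[B] C ⧸ N := N.mkQ.restrictScalars B
  have hk : LinearMap.ker π = N.restrictScalars B := by
    ext x
    exact Submodule.Quotient.mk_eq_zero N
  have hπ : Function.Surjective π := fun y ↦ Submodule.mkQ_surjective N y
  rw [← hk]
  exact h.mem_smul_ker π hπ (by rw [hk]; exact hn) hnI

variable [IsDomain B] [IsNoetherianRing B] [Algebra.FiniteType B A]

/-- Together the two assertions say that the kernel of R commutes with reduction modulo I. The first
is purity of the cokernel of R, the second purity of its range, a quotient of N₁ by the kernel. -/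
lemma exists_lift_and_mem_smul_ker {N₁ N₂ : Type u} [AddCommGroup N₁] [AddCommGroup N₂] [Module A N₁] [Module A N₂]
    [Module B N₁] [Module B N₂] [IsScalarTower B A N₁] [IsScalarTower B A N₂] [Module.Finite A N₁]
    [Module.Finite A N₂] (R : N₁ →ₗ[A] N₂) :
    ∃ b : B, b ≠ 0 ∧ ∀ I : Ideal B, I.IsMaximal → b ∉ I →
      (∀ x, R x ∈ I • (⊤ : Submodule B N₂) → ∃ y, R y = 0 ∧ x - y ∈ I • (⊤ : Submodule B N₁)) ∧
      (∀ x, R x = 0 → x ∈ I • (⊤ : Submodule B N₁) → x ∈ I • LinearMap.ker (R.restrictScalars B)) := by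
  obtain ⟨b, hb0, hb⟩ := Algebra.GenericallyPure.of_finiteType (B := B) A (N₂ ⧸ LinearMap.range R)
  obtain ⟨b', hb0', hb'⟩ := Algebra.GenericallyPure.of_finiteType (B := B) A (LinearMap.range R)
  refine ⟨b * b', mul_ne_zero hb0 hb0', fun I hI hbI ↦ ?_⟩
  have p1 := hb I hI fun h ↦ hbI (I.mul_mem_right b' h)
  have p2 := hb' I hI fun h ↦ hbI (I.mul_mem_left b h)
  refine ⟨fun x hx ↦ ?_, fun x hx hxI ↦ ?_⟩
  · have h1 := p1.mem_smul_of_mem (LinearMap.mem_range_self R x) hx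
    have : (LinearMap.range R).restrictScalars B = (⊤ : Submodule B N₁).map (R.restrictScalars B) := by
      ext y
      simp
    rw [this, ← Submodule.map_smul''] at h1
    obtain ⟨z, hz, hzx⟩ := h1
    refine ⟨x - z, ?_, ?_⟩
    · rw [map_sub, sub_eq_zero]; exact hzx.symm
    · simpa using hz
  · have h1 := p2.mem_smul_ker
      (R.rangeRestrict.restrictScalars B) R.surjective_rangeRestrict (n := x) (by simpa [Subtype.ext_iff] using hx) hxI
    have : LinearMap.ker (R.rangeRestrict.restrictScalars B) = LinearMap.ker (R.restrictScalars B) := by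
      ext y
      simp [Subtype.ext_iff]
    rwa [this] at h1

/-- Generic lifting of homomorphisms modulo maximal ideals of the base. -/
theorem exists_lift_hom [IsNoetherianRing A] (T : Type u) [AddCommGroup T] [Module A T] [Module.Finite A T] :
    ∃ b : B, b ≠ 0 ∧ ∀ I : Ideal B, I.IsMaximal → b ∉ I →
      ∀ (S : Submonoid A) (A' : Type u) [CommRing A'] [Algebra A A'] [Algebra B A'] [IsScalarTower B A A'] [IsLocalization S A'],
      Function.Injective (algebraMap A A') →
      (∀ φ : T →ₗ[A] A' ⧸ I.map (algebraMap B A'), ∃ ψ : T →ₗ[A] A', ∀ t, Ideal.Quotient.mk _ (ψ t) = φ t) ∧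
      (∀ ψ : T →ₗ[A] A', (∀ t, ψ t ∈ I.map (algebraMap B A')) → ψ ∈ I • (⊤ : Submodule B (T →ₗ[A] A'))) := by
  obtain ⟨r, π, hπ⟩ := Module.Finite.exists_fin' A T
  obtain ⟨s, y, hy⟩ := Submodule.fg_iff_exists_fin_generating_family.mp
    (IsNoetherian.noetherian (LinearMap.ker π))
  -- A homomorphism from T is a tuple of values on the generators that satisfies the relations `y
  -- l`, so Hom(T, A) is the kernel of R.
  let R : (Fin r → A) →ₗ[A] (Fin s → A) :=
    LinearMap.pi fun l ↦ ∑ i, (y l i) • LinearMap.proj i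
  have hR : ∀ x l, R x l = ∑ i, y l i * x i := by
    intro x l
    simp [R, LinearMap.sum_apply]
  obtain ⟨b, hb0, hb⟩ := exists_lift_and_mem_smul_ker (B := B) R
  refine ⟨b, hb0, fun I hI hbI S A' _ _ _ _ _ hinj ↦ ?_⟩
  have hmap : I.map (algebraMap B A') = (I.map (algebraMap B A)).map (algebraMap A A') := by
    rw [Ideal.map_map, ← IsScalarTower.algebraMap_eq]
  have hsingle : ∀ x, π x = ∑ i, x i • π (Pi.single i 1) := by
    intro x
    conv_lhs => rw [← Finset.univ_sum_single x]
    rw [map_sum]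
    refine Finset.sum_congr rfl fun i _ ↦ ?_
    rw [← map_smul, ← Pi.single_smul, smul_eq_mul, mul_one]
  have hrel : ∀ l, π (y l) = 0 := fun l ↦ by
    have : y l ∈ LinearMap.ker π := by rw [← hy]; exact Submodule.subset_span ⟨l, rfl⟩
    exact this
  -- A solution x of the relations and a denominator c give the homomorphism to A' with values x i /
  -- c.
  have build : ∀ (c : S) (x : Fin r → A), R x = 0 → ∃ ψ : T →ₗ[A] A', ∀ i,
      algebraMap A A' c * ψ (π (Pi.single i 1)) = algebraMap A A' (x i) := by
    intro c x hx
    let ρ : (Fin r → A) →ₗ[A] A' := ∑ i, (LinearMap.toSpanSingleton A A' (IsLocalization.mk' A' (x i) c)) ∘ₗ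
      LinearMap.proj i
    have hρ : ∀ z, ρ z = ∑ i, z i • IsLocalization.mk' A' (x i) c := fun z ↦ by simp [ρ]
    have hker : LinearMap.ker π ≤ LinearMap.ker ρ := by
      rw [← hy, Submodule.span_le]
      rintro _ ⟨l, rfl⟩
      rw [SetLike.mem_coe, LinearMap.mem_ker, hρ]
      have : ∑ i, y l i • IsLocalization.mk' A' (x i) c = IsLocalization.mk' A' (R x l) c := by
        rw [IsLocalization.mk'_eq_mul_mk'_one (R x l), hR, map_sum, Finset.sum_mul]
        refine Finset.sum_congr rfl fun i _ ↦ ?_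
        rw [IsLocalization.mk'_eq_mul_mk'_one (x i), Algebra.smul_def, map_mul, mul_assoc]
      rw [this, hx, Pi.zero_apply, IsLocalization.mk'_zero]
    refine ⟨(LinearMap.ker π).liftQ ρ hker ∘ₗ (π.quotKerEquivOfSurjective hπ).symm.toLinearMap, fun i ↦ ?_⟩
    have : (π.quotKerEquivOfSurjective hπ).symm (π (Pi.single i 1)) = (LinearMap.ker π).mkQ (Pi.single i 1) := by
      rw [LinearEquiv.symm_apply_eq]; rfl
    rw [LinearMap.comp_apply, LinearEquiv.coe_coe, this, Submodule.mkQ_apply, Submodule.liftQ_apply, hρ]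
    rw [Finset.sum_eq_single i (fun j _ hj ↦ by simp [hj]) (by simp), Pi.single_eq_same, one_smul]
    exact IsLocalization.mk'_spec' A' (x i) c
  have ext : ∀ ψ ψ' : T →ₗ[A] A', (∀ i, ψ (π (Pi.single i 1)) = ψ' (π (Pi.single i 1))) → ψ = ψ' := by
    intro ψ ψ' h
    ext t
    obtain ⟨x, rfl⟩ := hπ t
    rw [hsingle, map_sum, map_sum]
    simp only [map_smul, h]
  constructor
  · intro φ
    -- The values of φ are lifted to A' and their denominators cleared by c; the resulting tuple a
    -- satisfies the relations only modulo I A'.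
    choose a' ha' using fun i ↦ Ideal.Quotient.mk_surjective (φ (π (Pi.single i 1)))
    obtain ⟨c, hc⟩ := IsLocalization.exist_integer_multiples_of_finite S a'
    choose a ha using hc
    have h1 : ∀ l, algebraMap A A' (R a l) ∈ (I.map (algebraMap B A)).map (algebraMap A A') := by
      intro l
      rw [← hmap, ← Ideal.Quotient.eq_zero_iff_mem]
      have : algebraMap A A' (R a l) = algebraMap A A' c * ∑ i, algebraMap A A' (y l i) * a' i := by
        rw [hR, map_sum, Finset.mul_sum]
        refine Finset.sum_congr rfl fun i _ ↦ ?_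
        rw [map_mul, ha, Algebra.smul_def]
        ring
      rw [this, map_mul, map_sum]
      have : ∑ i, Ideal.Quotient.mk (I.map (algebraMap B A')) (algebraMap A A' (y l i) * a' i) = φ (π (y l)) := by
        rw [hsingle, map_sum]
        refine Finset.sum_congr rfl fun i _ ↦ ?_
        rw [map_smul, ← ha', map_mul, Algebra.smul_def]
        rfl
      rw [this, hrel, map_zero, mul_zero]
    -- Membership in I A' descends to I A after multiplication by an element of S; d collects these
    -- factors over all relations, so that d • a can be corrected to an exact solution x.
    choose m hmS hm using fun l ↦ (IsLocalization.algebraMap_mem_map_algebraMap_iff S A' _ _).mp (h1 l)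
    let d : A := ∏ l, m l
    have hd : d ∈ S := Submonoid.prod_mem _ fun l _ ↦ hmS l
    obtain ⟨x, hx, hxa⟩ := (hb I hI hbI).1 (d • a) ((mem_smul_top_pi_iff I _).mpr fun l ↦ by
      rw [map_smul, Pi.smul_apply, smul_eq_mul]
      obtain ⟨q, hq⟩ := Finset.dvd_prod_of_mem m (Finset.mem_univ l)
      rw [show d = m l * q from hq, mul_right_comm]
      exact Ideal.mul_mem_right _ _ (hm l))
    obtain ⟨ψ, hψ⟩ := build (⟨d, hd⟩ * c) x hx
    have hmk : ∀ i, Ideal.Quotient.mk (I.map (algebraMap B A')) (ψ (π (Pi.single i 1))) = φ (π (Pi.single i 1)) := by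
      intro i
      rw [← ha', Ideal.Quotient.eq]
      have h2 := (mem_smul_top_pi_iff I _).mp hxa i
      have h3 := Ideal.mem_map_of_mem (algebraMap A A') h2
      rw [← hmap] at h3
      have hu := IsLocalization.map_units A' (⟨d, hd⟩ * c : S)
      have h4 : algebraMap A A' ((d • a - x) i) =
          - (algebraMap A A' ((⟨d, hd⟩ * c : S) : A) * (ψ (π (Pi.single i 1)) - a' i)) := by
        rw [mul_sub, hψ, Pi.sub_apply, Pi.smul_apply, map_sub, smul_eq_mul, map_mul, ha, Submonoid.coe_mul, map_mul,
          Algebra.smul_def]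
        ring
      rw [h4, neg_mem_iff] at h3
      exact (Ideal.unit_mul_mem_iff_mem _ hu).mp h3
    refine ⟨ψ, fun t ↦ ?_⟩
    obtain ⟨x, rfl⟩ := hπ t
    rw [hsingle, map_sum, map_sum, map_sum]
    refine Finset.sum_congr rfl fun i _ ↦ ?_
    rw [map_smul ψ, map_smul φ, ← hmk, Algebra.smul_def, map_mul, Algebra.smul_def]
    rfl
  · intro ψ hψ
    -- Up to a common denominator c the values of ψ form a tuple x with entries in I A. It solves
    -- the relations because A embeds in A', so it lies in I times the module of solutions.
    choose q hq using fun i ↦ (IsLocalization.mem_map_algebraMap_iff S A').mp (hmap ▸ hψ (π (Pi.single i 1)))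
    let c : S := ∏ i, (q i).2
    have hdvd : ∀ i, ∃ d : A, (c : A) = d * ((q i).2 : A) := by
      intro i
      obtain ⟨d, hd⟩ := Finset.dvd_prod_of_mem (fun i ↦ ((q i).2 : A)) (Finset.mem_univ i)
      exact ⟨d, by rw [mul_comm, ← hd]; simp [c]⟩
    choose d hd using hdvd
    let x : Fin r → A := fun i ↦ d i * (q i).1
    have hx : ∀ i, algebraMap A A' (x i) = algebraMap A A' c * ψ (π (Pi.single i 1)) := by
      intro i
      rw [map_mul, ← hq, hd i, map_mul]
      ring
    have hRx : R x = 0 := by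
      funext l
      apply hinj
      rw [hR, map_sum, Pi.zero_apply, map_zero]
      have : ∑ i, algebraMap A A' (y l i * x i) = algebraMap A A' c * ψ (π (y l)) := by
        rw [hsingle, map_sum, Finset.mul_sum]
        refine Finset.sum_congr rfl fun i _ ↦ ?_
        rw [map_mul, hx, map_smul, Algebra.smul_def]
        ring
      rw [this, hrel, map_zero, mul_zero]
    have h1 := (hb I hI hbI).2 x hRx ((mem_smul_top_pi_iff I _).mpr fun i ↦ Ideal.mul_mem_left _ _ (q i).1.2)
    have h2 : ∀ x ∈ I • LinearMap.ker (R.restrictScalars B), ∃ ψ ∈ I • (⊤ : Submodule B (T →ₗ[A] A')), ∀ i,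
        algebraMap A A' c * ψ (π (Pi.single i 1)) = algebraMap A A' (x i) := by
      intro x hx
      induction hx using Submodule.smul_induction_on' with
      | smul β hβ x hx =>
        obtain ⟨ψ, hψ⟩ := build c x hx
        refine ⟨β • ψ, Submodule.smul_mem_smul hβ trivial, fun i ↦ ?_⟩
        rw [LinearMap.smul_apply, mul_smul_comm, hψ, Pi.smul_apply, Algebra.smul_def, Algebra.smul_def,
          map_mul, ← IsScalarTower.algebraMap_apply]
      | add x _ x' _ h h' =>
        obtain ⟨ψ, hψ, e⟩ := h
        obtain ⟨ψ', hψ', e'⟩ := h'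
        refine ⟨ψ + ψ', add_mem hψ hψ', fun i ↦ ?_⟩
        rw [LinearMap.add_apply, mul_add, e, e', Pi.add_apply, map_add]
    obtain ⟨ψ', hψ', e⟩ := h2 x h1
    have : ψ = ψ' := ext _ _ fun i ↦ (IsLocalization.map_units A' c).mul_left_cancel (by rw [e, hx])
    rwa [this]

/-- Generic lifting of multilinear maps modulo maximal ideals of the base. -/
theorem exists_lift_multilinear [IsNoetherianRing A] (T : Type u) [AddCommGroup T] [Module A T] [Module.Finite A T] (j : ℕ) :
    ∃ b : B, b ≠ 0 ∧ ∀ I : Ideal B, I.IsMaximal → b ∉ I →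
      ∀ (S : Submonoid A) (A' : Type u) [CommRing A'] [Algebra A A'] [Algebra B A'] [IsScalarTower B A A'] [IsLocalization S A'],
      Function.Injective (algebraMap A A') →
      (∀ φ : MultilinearMap A (fun _ : Fin j ↦ T) (A' ⧸ I.map (algebraMap B A')), 
        ∃ ψ : MultilinearMap A (fun _ : Fin j ↦ T) A', ∀ t, Ideal.Quotient.mk _ (ψ t) = φ t) ∧
      (∀ ψ : MultilinearMap A (fun _ : Fin j ↦ T) A', (∀ t, ψ t ∈ I.map (algebraMap B A')) →
        ψ ∈ Submodule.span A {ψ : MultilinearMap A (fun _ : Fin j ↦ T) A' | ∃ b ∈ I, ∃ ψ', ψ = algebraMap B A b • ψ'}) := by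
  -- Multilinear maps on T are linear maps on its tensor power, which is again a finite module.
  obtain ⟨b, hb0, hb⟩ := exists_lift_hom (B := B) (A := A) (PiTensorProduct A fun _ : Fin j ↦ T)
  refine ⟨b, hb0, fun I hI hbI S A' _ _ _ _ _ hinj ↦ ⟨fun φ ↦ ?_, fun ψ hψ ↦ ?_⟩⟩
  · obtain ⟨ψ, hψ⟩ := (hb I hI hbI S A' hinj).1 (PiTensorProduct.lift φ)
    exact ⟨ψ.compMultilinearMap (PiTensorProduct.tprod A), fun t ↦ (hψ _).trans (PiTensorProduct.lift.tprod t)⟩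
  · have h1 := (hb I hI hbI S A' hinj).2 (PiTensorProduct.lift ψ) (fun t ↦ by
      have : t ∈ Submodule.span A (Set.range (PiTensorProduct.tprod A (s := fun _ : Fin j ↦ T))) := by
        rw [PiTensorProduct.span_tprod_eq_top]; trivial
      induction this using Submodule.span_induction with
      | mem x h => obtain ⟨t, rfl⟩ := h; rw [PiTensorProduct.lift.tprod]; exact hψ t
      | zero => rw [map_zero]; exact zero_mem _
      | add x y _ _ hx hy => rw [map_add]; exact add_mem hx hy
      | smul a x _ hx => rw [map_smul, Algebra.smul_def]; exact Ideal.mul_mem_left _ _ hx)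
    rw [← PiTensorProduct.lift.symm_apply_apply ψ]
    generalize PiTensorProduct.lift ψ = χ at h1
    induction h1 using Submodule.smul_induction_on' with
    | smul β hβ χ _ =>
      refine Submodule.subset_span ⟨β, hβ, PiTensorProduct.lift.symm χ, ?_⟩
      rw [← algebraMap_smul A, map_smul]
    | add x _ y _ hx hy => rw [map_add]; exact add_mem hx hy

/-- A nonzero function does not vanish identically on general fibers. Purity of A/(a) gives aA ∩ IA
= I·aA, so a ∈ IA would give a = ac with c ∈ IA; then c = 1, and the fiber over I would be empty. -/
lemma exists_notMem_map [IsDomain A] [FaithfulSMul B A] (a : A) (ha : a ≠ 0) :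
    ∃ b : B, b ≠ 0 ∧ ∀ I : Ideal B, I.IsMaximal → b ∉ I → a ∉ I.map (algebraMap B A) := by
  obtain ⟨b, hb0, hb⟩ := Algebra.GenericallyPure.of_finiteType (B := B) A (A ⧸ Ideal.span {a})
  obtain ⟨b', hb0', hb'⟩ := Algebra.exists_map_ne_top (B := B) (A := A)
  refine ⟨b * b', mul_ne_zero hb0 hb0', fun I hI hbI haI ↦ ?_⟩
  have p1 := hb I hI fun h ↦ hbI (I.mul_mem_right b' h)
  refine hb' I hI (fun h ↦ hbI (I.mul_mem_left b h)) ?_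
  have haI' : a ∈ I • (⊤ : Submodule B A) := by rw [Ideal.smul_top_eq_map]; exact haI
  have h1 := p1.mem_smul_of_mem (Ideal.mem_span_singleton_self a) haI'
  have h2 : ∀ x ∈ I • Submodule.restrictScalars B (Ideal.span {a}), ∃ c ∈ I.map (algebraMap B A), x = a * c := by
    intro x hx
    induction hx using Submodule.smul_induction_on' with
    | smul β hβ x hx =>
      obtain ⟨c, rfl⟩ := Ideal.mem_span_singleton'.mp hx
      refine ⟨algebraMap B A β * c, Ideal.mul_mem_right _ _ (Ideal.mem_map_of_mem _ hβ), ?_⟩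
      rw [Algebra.smul_def]; ring
    | add x _ y _ hx hy =>
      obtain ⟨c, hc, rfl⟩ := hx
      obtain ⟨c', hc', rfl⟩ := hy
      exact ⟨c + c', add_mem hc hc', by ring⟩
  obtain ⟨c, hc, e⟩ := h2 a h1
  rw [Ideal.eq_top_iff_one]
  have : c = 1 := mul_left_cancel₀ ha (by rw [mul_one, ← e])
  exact this ▸ hc

end

end

/-! ### Discrete valuation rings among the localizations of a normal domain -/

section

variable {k K : Type*} [Field k] [Field K] [Algebra k K]

/-- `O` is a localization of `A`, for subalgebras of a field. -/
structure Subalgebra.IsLocalizationOf (O A : Subalgebra k K) : Prop where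
  le : A ≤ O
  exists_mul_mem : ∀ y ∈ O, ∃ a ∈ A, a ≠ 0 ∧ a⁻¹ ∈ O ∧ a * y ∈ A

/-- Let y ∉ R with y𝔪 ⊆ R. If y𝔪 ⊆ 𝔪, then y is integral over R, as 𝔪 is a nonzero finitely
generated module, and y lies in R by normality. So yt is a unit for some t in 𝔪, and then 𝔪 = (t).
-/
lemma isDiscreteValuationRing_of_smul_mem {R K : Type*} [CommRing R] [IsDomain R] [IsLocalRing R] [IsNoetherianRing R]
    [IsIntegrallyClosed R] [Field K] [Algebra R K] [IsFractionRing R K] (y : K) (hy : ∀ r : R, algebraMap R K r ≠ y)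
    (h : ∀ r ∈ IsLocalRing.maximalIdeal R, ∃ s : R, algebraMap R K s = y * algebraMap R K r) :
    IsDiscreteValuationRing R := by
  have hinj := IsFractionRing.injective R K
  have hbot : IsLocalRing.maximalIdeal R ≠ ⊥ := by
    intro hbot
    obtain ⟨a, b, hb, e⟩ := IsFractionRing.div_surjective R y
    have hb0 : b ≠ 0 := nonZeroDivisors.ne_zero hb
    have hu : IsUnit b := by
      by_contra hnu
      have : b ∈ IsLocalRing.maximalIdeal R := (IsLocalRing.mem_maximalIdeal b).mpr hnu
      rw [hbot] at this
      exact hb0 this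
    obtain ⟨b, rfl⟩ := hu
    refine hy (a * ↑b⁻¹) ?_
    rw [← e, eq_div_iff ((map_ne_zero_iff _ hinj).mpr hb0), ← map_mul, mul_assoc]
    simp
  have hfield : ¬ IsField R := fun h ↦ hbot (IsLocalRing.isField_iff_maximalIdeal_eq.mp h)
  refine ((IsDiscreteValuationRing.TFAE R hfield).out 0 4 : _ ↔ _).mpr ?_
  by_cases hcase : ∀ r ∈ IsLocalRing.maximalIdeal R, ∃ s ∈ IsLocalRing.maximalIdeal R, algebraMap R K s = y * algebraMap R K r
  · exfalso
    have : IsIntegral R y := by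
      refine isIntegral_of_smul_mem_submodule (Submodule.map (Algebra.linearMap R K) (IsLocalRing.maximalIdeal R)) ?_
        ((IsNoetherian.noetherian _).map _) y ?_
      · intro h0
        refine hbot (eq_bot_iff.mpr fun r hr ↦ ?_)
        have : algebraMap R K r ∈ Submodule.map (Algebra.linearMap R K) (IsLocalRing.maximalIdeal R) := ⟨r, hr, rfl⟩
        rw [h0] at this
        exact hinj (this.trans (map_zero _).symm)
      · rintro _ ⟨r, hr, rfl⟩
        obtain ⟨s, hs, e⟩ := hcase r hr
        exact ⟨s, hs, e⟩
    obtain ⟨r, hr⟩ := IsIntegrallyClosed.isIntegral_iff.mp this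
    exact hy r hr
  · push Not at hcase
    obtain ⟨t, ht, h'⟩ := hcase
    obtain ⟨w, hw⟩ := h t ht
    have hwu : IsUnit w := by
      by_contra hnu
      exact h' w ((IsLocalRing.mem_maximalIdeal w).mpr hnu) hw
    refine ⟨t, le_antisymm (fun n hn ↦ ?_) ((Ideal.span_singleton_le_iff_mem _).mpr ht)⟩
    obtain ⟨s, hs⟩ := h n hn
    obtain ⟨w, rfl⟩ := hwu
    refine Ideal.mem_span_singleton'.mpr ⟨s * ↑w⁻¹, hinj ?_⟩
    have hw0 : algebraMap R K w ≠ 0 := (map_ne_zero_iff _ hinj).mpr w.ne_zero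
    have hy0 : y ≠ 0 := by rintro rfl; exact hw0 (by rw [hw, zero_mul])
    have e : algebraMap R K (↑w⁻¹) * algebraMap R K w = 1 := by rw [← map_mul]; simp
    refine mul_left_cancel₀ hy0 ?_
    rw [map_mul, map_mul, hs.symm]
    calc y * (algebraMap R K s * algebraMap R K (↑w⁻¹) * algebraMap R K t) =
        algebraMap R K s * (algebraMap R K (↑w⁻¹) * (y * algebraMap R K t)) := by ring
      _ = algebraMap R K s := by rw [← hw, e, mul_one]

/-- A normal noetherian domain is the intersection of the discrete valuation rings among its localizations. -/
theorem Subalgebra.exists_isDiscreteValuationRing (A : Subalgebra k K) [IsFractionRing A K] [IsNoetherianRing A]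
    [IsIntegrallyClosed A] (S : Submonoid K) (hSA : ∀ s ∈ S, s ∈ A) (x : K) (hx : ∀ s ∈ S, s * x ∉ A) :
    ∃ O : Subalgebra k K, O.IsLocalizationOf A ∧ IsDiscreteValuationRing O ∧ (∀ s ∈ S, s⁻¹ ∈ O) ∧ x ∉ O := by
  -- The ideal of denominators of x, up to elements of S; it is proper by `hx`.
  let J : Ideal A :=
    { carrier := {a | ∃ s ∈ S, s * (a * x) ∈ A}
      zero_mem' := ⟨1, S.one_mem, by simp⟩
      add_mem' := by
        rintro a b ⟨s, hs, h⟩ ⟨t, ht, h'⟩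
        refine ⟨s * t, S.mul_mem hs ht, ?_⟩
        have := A.add_mem (A.mul_mem (hSA t ht) h) (A.mul_mem (hSA s hs) h')
        convert this using 1
        push_cast
        ring
      smul_mem' := by
        rintro c a ⟨s, hs, h⟩
        refine ⟨s, hs, ?_⟩
        have := A.mul_mem c.2 h
        convert this using 1
        simp only [smul_eq_mul, MulMemClass.coe_mul]
        ring }
  have hJ : ∀ a : A, a ∈ J ↔ ∃ s ∈ S, s * (a * x) ∈ A := fun a ↦ Iff.rfl
  have hJS : ∀ (s : K) (hs : s ∈ S) (a : A), (⟨s, hSA s hs⟩ * a : A) ∈ J → a ∈ J := by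
    rintro s hs a ⟨t, ht, h⟩
    refine ⟨t * s, S.mul_mem ht hs, ?_⟩
    convert h using 1
    push_cast
    ring
  let colon : A → Ideal A := fun c ↦ Submodule.comap (LinearMap.toSpanSingleton A A c) J
  have hcolon : ∀ c a, a ∈ colon c ↔ a * c ∈ J := fun c a ↦ Iff.rfl
  -- A maximal member among the ideals (J : c) with c ∉ J is prime: it is an associated prime of A /
  -- J. It avoids S, because elements of S can be cancelled in J.
  obtain ⟨(P : Ideal A), ⟨c, hcJ, hc⟩, hmax⟩ := set_has_maximal_iff_noetherian.mpr (inferInstance : IsNoetherianRing A)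
    {I | ∃ c, c ∉ J ∧ colon c = I} ⟨colon 1, 1, fun ⟨s, hs, h⟩ ↦ hx s hs (by simpa using h), rfl⟩
  have hP : ∀ a, a ∈ P ↔ a * c ∈ J := fun a ↦ by rw [← hc, hcolon]
  have hprime : P.IsPrime := by
    refine ⟨fun h ↦ hcJ ?_, fun {y z} hyz ↦ ?_⟩
    · have : (1 : A) ∈ P := by rw [h]; trivial
      rwa [hP, one_mul] at this
    · by_contra! hcon
      have hz : z * c ∉ J := fun h ↦ hcon.2 ((hP z).mpr h)
      refine hmax (colon (z * c)) ⟨z * c, hz, rfl⟩ (lt_of_le_of_ne (fun a ha ↦ ?_) fun e ↦ ?_)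
      · rw [hcolon, mul_left_comm]
        exact J.mul_mem_left _ ((hP a).mp ha)
      · have : y ∈ colon (z * c) := by
          rw [hcolon, ← mul_assoc]
          exact (hP _).mp hyz
        rw [← e] at this
        exact hcon.1 this
  have hle : P.primeCompl ≤ nonZeroDivisors A := P.primeCompl_le_nonZeroDivisors
  let O := Localization.subalgebra.ofField K P.primeCompl hle
  have hO : ∀ y, y ∈ O ↔ ∃ a s : A, s ∉ P ∧ y = a * (s : K)⁻¹ := fun y ↦ by
    refine Iff.trans (Iff.rfl : y ∈ O ↔ ∃ (a s : A) (_ : s ∈ P.primeCompl), y = algebraMap A K a * (algebraMap A K s)⁻¹) ?_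
    exact exists_congr fun a ↦ exists_congr fun s ↦ exists_prop
  have hne : ∀ s : A, s ∉ P → (s : K) ≠ 0 := by
    intro s hs h0
    refine hs ?_
    have : s = 0 := Subtype.ext h0
    rw [this]
    exact P.zero_mem
  have hA : ∀ a : A, (a : K) ∈ O := fun a ↦ (hO _).mpr ⟨a, 1, fun h ↦ hprime.ne_top ((Ideal.eq_top_iff_one _).mpr h), by simp⟩
  have hinv : ∀ a : A, a ∉ P → (a : K)⁻¹ ∈ O := fun a ha ↦ (hO _).mpr ⟨1, a, ha, by simp⟩
  have hS : ∀ s ∈ S, s⁻¹ ∈ O := by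
    intro s hs
    refine hinv ⟨s, hSA s hs⟩ fun h ↦ hcJ (hJS s hs c ((hP _).mp h))
  have hy : (c : K) * x ∉ O := by
    intro h
    obtain ⟨a, s, hs, e⟩ := (hO _).mp h
    refine hs ((hP s).mpr ⟨1, S.one_mem, ?_⟩)
    have hs0 := hne s hs
    have : (1 : K) * (((s * c : A) : K) * x) = a := by
      rw [one_mul, MulMemClass.coe_mul, mul_assoc, e]
      field_simp
    rw [this]
    exact a.2
  have : IsLocalization.AtPrime O P := inferInstanceAs (IsLocalization P.primeCompl O)
  have : IsLocalRing O := IsLocalization.AtPrime.isLocalRing O P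
  have : IsNoetherianRing O := IsLocalization.isNoetherianRing P.primeCompl O inferInstance
  have : IsIntegrallyClosed O := isIntegrallyClosed_of_isLocalization O P.primeCompl hle
  -- The element c x is not in O, but it maps the maximal ideal of O into O, because Pc ⊆ J and
  -- elements of S are invertible in O.
  have hdvr : IsDiscreteValuationRing O := by
    refine isDiscreteValuationRing_of_smul_mem (K := K) ((c : K) * x) (fun r hr ↦ hy (hr ▸ r.2)) ?_
    rintro ⟨r, hrO⟩ hr
    obtain ⟨a, s, hs, e⟩ := (hO _).mp hrO
    have haP : a ∈ P := by
      by_contra ha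
      refine (IsLocalRing.mem_maximalIdeal _).mp hr (IsUnit.of_mul_eq_one ⟨s * (a : K)⁻¹, O.mul_mem (hA s) (hinv a ha)⟩ ?_)
      apply Subtype.ext
      have := hne a ha
      have := hne s hs
      simp only [MulMemClass.coe_mul, e, OneMemClass.coe_one]
      field_simp
    obtain ⟨t, ht, h⟩ := (hP a).mp haP
    have ht0 : t ≠ 0 := by
      rintro rfl
      exact hx 0 ht (by simp)
    have hmem : (c : K) * x * r ∈ O := by
      have := O.mul_mem (O.mul_mem (hA ⟨_, h⟩) (hS t ht)) (hinv s hs)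
      have e' : (c : K) * x * r = t * ((a * c : A) * x) * t⁻¹ * (s : K)⁻¹ := by
        rw [e, MulMemClass.coe_mul]
        field_simp
      rw [e']
      exact this
    exact ⟨⟨_, hmem⟩, rfl⟩
  refine ⟨O.restrictScalars k, ⟨fun a ha ↦ hA ⟨a, ha⟩, fun y hy ↦ ?_⟩, hdvr, hS, fun h ↦ hy (O.mul_mem (hA c) h)⟩
  obtain ⟨a, s, hs, e⟩ := (hO _).mp hy
  have hs0 := hne s hs
  refine ⟨s, s.2, hs0, hinv s hs, ?_⟩
  rw [e, mul_comm, mul_assoc, inv_mul_cancel₀ hs0, mul_one]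
  exact a.2

end

/-! ### Multilinear forms, lattices and regularity on a localization -/

section

set_option linter.unusedSectionVars false

namespace MultilinearMap
variable (K V ι : Type*) [Field K] [AddCommGroup V] [Module K V] [Fintype ι]

/-- The product of linear forms, as a multilinear form depending multilinearly on the linear forms. -/
noncomputable def prodForm :
    MultilinearMap K (fun _ : ι ↦ Module.Dual K V) (MultilinearMap K (fun _ : ι ↦ V) K) :=
  (LinearMap.applyₗ (MultilinearMap.mkPiAlgebra K ι K)).compMultilinearMap
    (compLinearMapMultilinear (R := K) (ι := ι) (M₁ := fun _ ↦ V) (M₁' := fun _ ↦ K) (M₂ := K))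

variable {K V ι}

lemma prodForm_apply (ξ : ι → Module.Dual K V) (v : ι → V) : prodForm K V ι ξ v = ∏ i, ξ i (v i) := rfl

variable {κ : Type*} [Fintype κ] [DecidableEq ι] (b : Module.Basis κ K V)

lemma eq_sum_prodForm [DecidableEq κ] (Λ : MultilinearMap K (fun _ : ι ↦ V) K) :
    Λ = ∑ c : ι → κ, Λ (fun i ↦ b (c i)) • prodForm K V ι (fun i ↦ b.coord (c i)) := by
  refine Module.Basis.ext_multilinear (fun _ ↦ b) fun c ↦ ?_
  simp only [sum_apply, smul_apply, prodForm_apply, Module.Basis.coord_apply, Module.Basis.repr_self, smul_eq_mul]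
  rw [Finset.sum_eq_single c]
  · simp
  · intro c' _ hc'
    obtain ⟨i, hi⟩ := Function.ne_iff.mp hc'
    rw [Finset.prod_eq_zero (Finset.mem_univ i) (by rw [Finsupp.single_eq_of_ne hi]), mul_zero]
  · simp

/-- In finite dimension, `prodForm` identifies the tensor power of the dual space with the space of
multilinear forms. Used to read a multilinear form on vector fields as a functional on forms. -/
lemma exists_pairing [FiniteDimensional K V] (τ : MultilinearMap K (fun _ : ι ↦ Module.Dual K V) K) :
    ∃ σ : Module.Dual K (MultilinearMap K (fun _ : ι ↦ V) K), ∀ ξ, σ (prodForm K V ι ξ) = τ ξ := by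
  classical
  let b := Module.finBasis K V
  refine ⟨{ toFun := fun Λ ↦ ∑ c : ι → _, Λ (fun i ↦ b (c i)) * τ (fun i ↦ b.coord (c i))
            map_add' := fun Λ Λ' ↦ by simp [add_mul, Finset.sum_add_distrib]
            map_smul' := fun a Λ ↦ by simp [Finset.mul_sum, mul_assoc] }, fun ξ ↦ ?_⟩
  have hξ : ξ = fun i ↦ ∑ l, ξ i (b l) • b.coord l := by
    funext i
    refine b.ext fun l ↦ ?_
    simp
  conv_rhs => rw [hξ, map_sum]
  refine Finset.sum_congr rfl fun c _ ↦ ?_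
  rw [map_smul_univ, prodForm_apply, smul_eq_mul]

end MultilinearMap

section lattice
variable {R K V : Type*} [CommRing R] [IsDomain R] [IsPrincipalIdealRing R] [Field K] [Algebra R K] [IsFractionRing R K]
  [AddCommGroup V] [Module K V] [Module R V] [IsScalarTower R K V]

/-- Over a principal ideal domain the torsion-free finite module M is free, and a basis of M is a
K-basis of V. -/
lemma exists_basis_of_lattice (M : Submodule R V) (hM : M.FG) (hspan : Submodule.span K (M : Set V) = ⊤) :
    ∃ (n : ℕ) (b : Module.Basis (Fin n) K V), (∀ i, b i ∈ M) ∧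
      ∀ v ∈ M, ∀ i, ∃ r : R, b.repr v i = algebraMap R K r := by
  have : Module.Finite R M := Module.Finite.iff_fg.mpr hM
  have hinj := IsFractionRing.injective R K
  have : FaithfulSMul R K := (faithfulSMul_iff_algebraMap_injective R K).mpr hinj
  have : Module.IsTorsionFree R V := Module.IsTorsionFree.trans_faithfulSMul R K V
  have : Module.IsTorsionFree R M := inferInstance
  have : Module.Free R M := inferInstance
  let bM := Module.finBasis R M
  have hli : LinearIndependent K fun i ↦ (bM i : V) := by
    rw [← LinearIndependent.iff_fractionRing R K]
    exact bM.linearIndependent.map' M.subtype (LinearMap.ker_eq_bot.mpr M.injective_subtype)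
  have hMle : (M : Set V) ⊆ Submodule.span K (Set.range fun i ↦ (bM i : V)) := by
    intro v hv
    have := bM.sum_repr ⟨v, hv⟩
    have := congrArg Subtype.val this
    simp only [AddSubmonoidClass.coe_finsetSum, SetLike.val_smul] at this
    rw [← this]
    refine Submodule.sum_mem _ fun i _ ↦ ?_
    rw [← algebraMap_smul K]
    exact Submodule.smul_mem _ _ (Submodule.subset_span ⟨i, rfl⟩)
  let b : Module.Basis _ K V := Module.Basis.mk hli (by
    rw [← hspan, Submodule.span_le]
    exact hMle)
  have hb : ∀ i, b i = bM i := fun i ↦ by simp [b]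
  refine ⟨_, b, fun i ↦ by rw [hb]; exact (bM i).2, fun v hv i ↦ ⟨bM.repr ⟨v, hv⟩ i, ?_⟩⟩
  have h1 := congrArg Subtype.val (bM.sum_repr ⟨v, hv⟩)
  simp only [AddSubmonoidClass.coe_finsetSum, SetLike.val_smul] at h1
  conv_lhs => rw [← h1]
  simp only [← algebraMap_smul K (bM.repr _ _), ← hb, map_sum, map_smul, Module.Basis.repr_self, Finsupp.coe_finsetSum,
    Finset.sum_apply, Finsupp.smul_apply, smul_eq_mul]
  rw [Finset.sum_eq_single i (fun l _ hl ↦ by rw [Finsupp.single_eq_of_ne hl.symm, mul_zero]) (by simp)]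
  simp

/-- A lattice has a projection to its intersection with a subspace. -/
lemma exists_projection_of_lattice (M : Submodule R V) (hM : M.FG) (hspan : Submodule.span K (M : Set V) = ⊤)
    (W : Submodule K V) :
    ∃ π : V →ₗ[K] V, (∀ v, π v ∈ W) ∧ (∀ w ∈ W, π w = w) ∧ ∀ v ∈ M, π v ∈ M := by
  let q : V →ₗ[K] V ⧸ W := W.mkQ
  let qR : V →ₗ[R] V ⧸ W := q.restrictScalars R
  -- The image of M in V / W is again a lattice, hence free. Lifting a basis of it to M gives a
  -- splitting s of q that maps this image into M, and id - s q is the projection.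
  obtain ⟨n, b, hb, hrepr⟩ := exists_basis_of_lattice (K := K) (M.map qR) (hM.map qR) (by
    refine top_unique ?_
    have : (⊤ : Submodule K (V ⧸ W)) = (Submodule.span K (M : Set V)).map q := by
      rw [hspan, Submodule.map_top, LinearMap.range_eq_top.mpr W.mkQ_surjective]
    rw [this, Submodule.map_span]
    exact Submodule.span_mono fun _ h ↦ h)
  choose m hm hmb using hb
  let s : V ⧸ W →ₗ[K] V := b.constr K m
  have hs : ∀ v, q (s v) = v := by
    intro v
    have : q ∘ₗ s = LinearMap.id := b.ext fun i ↦ by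
      simp only [LinearMap.comp_apply, s, Module.Basis.constr_basis, LinearMap.id_apply]
      exact hmb i
    exact DFunLike.congr_fun this v
  refine ⟨LinearMap.id - s ∘ₗ q, fun v ↦ ?_, fun w hw ↦ ?_, fun v hv ↦ ?_⟩
  · rw [← Submodule.Quotient.mk_eq_zero W]
    change q (v - s (q v)) = 0
    rw [map_sub, hs, sub_self]
  · have : q w = 0 := (Submodule.Quotient.mk_eq_zero W).mpr hw
    simp [this]
  · refine M.sub_mem hv ?_
    rw [LinearMap.comp_apply, Module.Basis.constr_apply_fintype]
    refine Submodule.sum_mem _ fun i _ ↦ ?_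
    obtain ⟨r, hr⟩ := hrepr (q v) ⟨v, hv, rfl⟩ i
    rw [Module.Basis.equivFun_apply, hr, algebraMap_smul]
    exact M.smul_mem r (hm i)

end lattice

section regular
variable {k K V : Type*} [Field k] [Field K] [Algebra k K] [AddCommGroup V] [Module K V] [Module k V]
  [IsScalarTower k K V] (δ : Derivation k K V)

lemma derivation_mem_span_of_adjoin (s : Set K) {a : K} (ha : a ∈ Algebra.adjoin k s) :
    δ a ∈ Submodule.span (Algebra.adjoin k s) (δ '' s) := by
  induction ha using Algebra.adjoin_induction with
  | mem x hx => exact Submodule.subset_span ⟨x, hx, rfl⟩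
  | algebraMap r => rw [δ.map_algebraMap]; exact zero_mem _
  | add x y _ _ hx hy => rw [map_add]; exact add_mem hx hy
  | mul x y hx hy h h' =>
    rw [δ.leibniz]
    exact add_mem (Submodule.smul_mem _ (⟨x, hx⟩ : Algebra.adjoin k s) h')
      (Submodule.smul_mem _ (⟨y, hy⟩ : Algebra.adjoin k s) h)

/-- Quotient rule: a δ(y) = δ(ay) - y δ(a) with ay and a in A and a invertible in O, so the
generators of A suffice for O. -/
lemma derivation_mem_span_of_isLocalizationOf {A O : Subalgebra k K} (h : O.IsLocalizationOf A) (s : Set K)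
    (hs : Algebra.adjoin k s = A) {y : K} (hy : y ∈ O) : δ y ∈ Submodule.span O (δ '' s) := by
  have key : ∀ a ∈ A, δ a ∈ Submodule.span O (δ '' s) := by
    intro a ha
    rw [← hs] at ha
    have h1 := derivation_mem_span_of_adjoin δ s ha
    refine Submodule.span_induction (p := fun v _ ↦ v ∈ Submodule.span O (δ '' s)) ?_ ?_ ?_ ?_ h1
    · exact fun x hx ↦ Submodule.subset_span hx
    · exact zero_mem _
    · exact fun x y _ _ hx hy ↦ add_mem hx hy
    · exact fun c x _ hx ↦ Submodule.smul_mem _ (⟨c, h.le (hs ▸ c.2)⟩ : O) hx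
  obtain ⟨a, ha, ha0, hinv, hay⟩ := h.exists_mul_mem y hy
  have h1 := key _ hay
  rw [δ.leibniz] at h1
  have h2 : y • δ a ∈ Submodule.span O (δ '' s) := Submodule.smul_mem _ (⟨y, hy⟩ : O) (key a ha)
  have h3 := Submodule.smul_mem _ (⟨_, hinv⟩ : O) (sub_mem h1 h2)
  rw [add_sub_cancel_right] at h3
  have : (⟨_, hinv⟩ : O) • a • δ y = δ y := by
    change a⁻¹ • a • δ y = δ y
    rw [smul_smul, inv_mul_cancel₀ ha0, one_smul]
  rwa [this] at h3

/-- A multilinear form takes values in `A` on the differentials of elements of `A`. -/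
def IsRegularOn {ι : Type*} (A : Subalgebra k K) (Λ : MultilinearMap K (fun _ : ι ↦ V) K) : Prop :=
  ∀ a : ι → K, (∀ i, a i ∈ A) → Λ (fun i ↦ δ (a i)) ∈ A

variable {δ} {ι : Type*} [Fintype ι] {A O : Subalgebra k K}

/-- The differentials of the generators of A span those of O over O, so finitely many values decide
regularity on O when s is finite. -/
lemma isRegularOn_of_generators (s : Set K) (h : O.IsLocalizationOf A) (hs : Algebra.adjoin k s = A)
    {Λ : MultilinearMap K (fun _ : ι ↦ V) K} (hΛ : ∀ a : ι → K, (∀ i, a i ∈ s) → Λ (fun i ↦ δ (a i)) ∈ O) :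
    IsRegularOn δ O Λ := by
  intro a ha
  have := MultilinearMap.mem_of_span (A := O) Λ (δ '' s) (Subalgebra.toSubmodule (⊥ : Subalgebra O K)) (fun c hc ↦ ?_)
    (fun i ↦ δ (a i)) fun i ↦ derivation_mem_span_of_isLocalizationOf δ h s hs (ha i)
  · obtain ⟨x, hx⟩ := Algebra.mem_bot.mp this
    rw [← hx]
    exact x.2
  · choose x hx hxc using hc
    obtain rfl : (fun i ↦ δ (x i)) = c := funext hxc
    exact Algebra.mem_bot.mpr ⟨⟨_, hΛ x hx⟩, rfl⟩

lemma Subalgebra.IsLocalizationOf.refl (A : Subalgebra k K) : A.IsLocalizationOf A :=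
  ⟨le_rfl, fun y hy ↦ ⟨1, A.one_mem, one_ne_zero, by rw [inv_one]; exact A.one_mem, by rwa [one_mul]⟩⟩

/-- Finitely many elements of a localization have a common denominator. -/
lemma Subalgebra.IsLocalizationOf.exists_mul_mem_of_finite (h : O.IsLocalizationOf A) {t : Set K} (ht : t.Finite)
    (htO : t ⊆ O) : ∃ a ∈ A, a ≠ 0 ∧ a⁻¹ ∈ O ∧ ∀ y ∈ t, a * y ∈ A := by
  induction t, ht using Set.Finite.induction_on with
  | empty => exact ⟨1, A.one_mem, one_ne_zero, by rw [inv_one]; exact O.one_mem, by simp⟩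
  | insert _ _ ih =>
    rename_i y t _ _
    obtain ⟨a, ha, ha0, hainv, hat⟩ := ih fun z hz ↦ htO (Set.mem_insert_of_mem _ hz)
    obtain ⟨b, hb, hb0, hbinv, hby⟩ := h.exists_mul_mem y (htO (Set.mem_insert _ _))
    refine ⟨a * b, A.mul_mem ha hb, mul_ne_zero ha0 hb0, by rw [mul_inv]; exact O.mul_mem hainv hbinv, ?_⟩
    rintro z (rfl | hz)
    · rw [mul_assoc]; exact A.mul_mem ha hby
    · rw [mul_right_comm]; exact A.mul_mem (hat z hz) hb

lemma isRegularOn_smul_of_generators (a : K) (s : Set K) (hs : Algebra.adjoin k s = A)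
    {Λ : MultilinearMap K (fun _ : ι ↦ V) K}
    (hat : ∀ c : ι → K, (∀ i, c i ∈ s) → a * Λ (fun i ↦ δ (c i)) ∈ A) : IsRegularOn δ A (a • Λ) :=
  isRegularOn_of_generators (O := A) (A := A) s (Subalgebra.IsLocalizationOf.refl A) hs hat

/-- The finitely many values of Λ on differentials of generators have a common denominator that is a
unit of O. -/
lemma IsRegularOn.exists_smul (hA : A.FG) (h : O.IsLocalizationOf A)
    {Λ : MultilinearMap K (fun _ : ι ↦ V) K} (hΛ : IsRegularOn δ O Λ) :
    ∃ a ∈ A, a ≠ 0 ∧ a⁻¹ ∈ O ∧ IsRegularOn δ A (a • Λ) := by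
  classical
  obtain ⟨s, hs⟩ := hA
  have hsA : (s : Set K) ⊆ A := by rw [← hs]; exact Algebra.subset_adjoin
  have hfin : (Set.range fun c : ι → (s : Set K) ↦ Λ fun i ↦ δ (c i)).Finite := Set.finite_range _
  obtain ⟨a, ha, ha0, hinv, hat⟩ := h.exists_mul_mem_of_finite hfin (by
    rintro _ ⟨c, rfl⟩
    exact hΛ (fun i ↦ (c i : K)) fun i ↦ h.le (hsA (c i).2))
  have hreg := isRegularOn_smul_of_generators (δ := δ) (Λ := Λ) a (s : Set K) hs fun c hc ↦
    hat _ (Set.mem_range_self (fun i ↦ (⟨c i, hc i⟩ : (s : Set K))))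
  exact ⟨a, ha, ha0, hinv, hreg⟩

/-- A form that is regular on O is a unit of O times a form regular on A; so preservation of
regularity, known on an affine chart, is inherited by all its localizations. -/
lemma mem_of_isRegularOn_localization (hA : A.FG) (h : O.IsLocalizationOf A)
    (σ : Module.Dual K (MultilinearMap K (fun _ : ι ↦ V) K)) (hσ : ∀ Λ, IsRegularOn δ A Λ → σ Λ ∈ A)
    {Λ : MultilinearMap K (fun _ : ι ↦ V) K} (hΛ : IsRegularOn δ O Λ) : σ Λ ∈ O := by
  obtain ⟨a, ha, ha0, hinv, hreg⟩ := hΛ.exists_smul hA h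
  have h1 := O.mul_mem hinv (h.le (hσ _ hreg))
  rwa [map_smul, smul_eq_mul, inv_mul_cancel_left₀ ha0] at h1

lemma Subalgebra.isLocalizationOf_top (A : Subalgebra k K) [IsFractionRing A K] :
    (⊤ : Subalgebra k K).IsLocalizationOf A := by
  refine ⟨le_top, fun y _ ↦ ?_⟩
  obtain ⟨a, b, hb, rfl⟩ := IsFractionRing.div_surjective A y
  have hb0 : (b : K) ≠ 0 := fun h ↦ nonZeroDivisors.ne_zero hb (Subtype.ext h)
  refine ⟨b, b.2, hb0, trivial, ?_⟩
  change (b : K) * (a / b) ∈ A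
  rw [mul_div_cancel₀ _ hb0]
  exact a.2

/-- The lattice generated by the differentials of elements of `O`. -/
def diffLattice (δ : Derivation k K V) (O : Subalgebra k K) : Submodule O V := Submodule.span O (δ '' O)

lemma diffLattice_fg (δ : Derivation k K V) (hA : A.FG) (h : O.IsLocalizationOf A) : (diffLattice δ O).FG := by
  obtain ⟨s, hs⟩ := hA
  have hsA : (s : Set K) ⊆ A := by rw [← hs]; exact Algebra.subset_adjoin
  have : diffLattice δ O = Submodule.span O (δ '' s) := by
    refine le_antisymm (Submodule.span_le.mpr ?_) (Submodule.span_mono (Set.image_mono (hsA.trans h.le)))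
    rintro _ ⟨y, hy, rfl⟩
    exact derivation_mem_span_of_isLocalizationOf δ h s hs hy
  rw [this]
  exact Submodule.fg_span (s.finite_toSet.image _)

lemma span_diffLattice (δ : Derivation k K V) (hδ : Submodule.span K (Set.range δ) = ⊤) [IsFractionRing O K] :
    Submodule.span K (diffLattice δ O : Set V) = ⊤ := by
  refine top_unique ?_
  rw [← hδ, Submodule.span_le]
  rintro _ ⟨y, rfl⟩
  have := derivation_mem_span_of_isLocalizationOf δ (Subalgebra.isLocalizationOf_top O) (O : Set K)
    (Algebra.adjoin_eq O) (y := y) trivial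
  refine Submodule.span_induction (p := fun v _ ↦ v ∈ Submodule.span K (diffLattice δ O : Set V)) ?_ ?_ ?_ ?_ this
  · intro v hv
    exact Submodule.subset_span (Submodule.subset_span hv)
  · exact zero_mem _
  · intro v w _ _ hv hw
    exact add_mem hv hw
  · intro c v _ hv
    exact Submodule.smul_mem _ (c : K) hv

lemma isRegularOn_iff_lattice {Λ : MultilinearMap K (fun _ : ι ↦ V) K} :
    IsRegularOn δ O Λ ↔ ∀ v : ι → V, (∀ i, v i ∈ diffLattice δ O) → Λ v ∈ O := by
  refine ⟨fun h v hv ↦ ?_, fun h a ha ↦ h _ fun i ↦ Submodule.subset_span ⟨_, ha i, rfl⟩⟩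
  have := MultilinearMap.mem_of_span (A := O) Λ (δ '' O) (Subalgebra.toSubmodule (⊥ : Subalgebra O K)) (fun c hc ↦ ?_) v hv
  · obtain ⟨x, hx⟩ := Algebra.mem_bot.mp this
    rw [← hx]
    exact x.2
  · choose x hx hxc using hc
    obtain rfl : (fun i ↦ δ (x i)) = c := funext hxc
    exact Algebra.mem_bot.mpr ⟨⟨_, h x hx⟩, rfl⟩

/-- The pairing with a multilinear form that is regular at a discrete valuation ring is regular there. -/
lemma pairing_mem [FiniteDimensional K V] (hδ : Submodule.span K (Set.range δ) = ⊤) (hA : A.FG) [IsFractionRing O K]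
    [IsPrincipalIdealRing O] (h : O.IsLocalizationOf A)
    (σ : Module.Dual K (MultilinearMap K (fun _ : ι ↦ V) K))
    (hσ : ∀ ξ : ι → Module.Dual K V, (∀ i, ∀ a ∈ O, ξ i (δ a) ∈ O) → σ (MultilinearMap.prodForm K V ι ξ) ∈ O)
    {Λ : MultilinearMap K (fun _ : ι ↦ V) K} (hΛ : IsRegularOn δ O Λ) : σ Λ ∈ O := by
  classical
  obtain ⟨n, b, hb, hrepr⟩ := exists_basis_of_lattice (K := K) (diffLattice δ O) (diffLattice_fg δ hA h)
    (span_diffLattice δ hδ)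
  -- In a basis of the lattice of differentials the coefficients of Λ lie in O and the coordinate
  -- forms are regular on O.
  rw [MultilinearMap.eq_sum_prodForm b Λ, map_sum]
  refine O.sum_mem fun c _ ↦ ?_
  rw [map_smul, smul_eq_mul]
  refine O.mul_mem (isRegularOn_iff_lattice.mp hΛ _ fun i ↦ hb _) (hσ _ fun i a ha ↦ ?_)
  obtain ⟨r, hr⟩ := hrepr (δ a) (Submodule.subset_span ⟨a, ha, rfl⟩) (c i)
  rw [Module.Basis.coord_apply, hr]
  exact r.2

end regular

end

/-! ### Extension of derivations to discrete valuation rings -/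

section

set_option linter.unusedSectionVars false
open IsLocalRing

/-- The dual numbers over a ring. -/
def DualNum (K : Type*) [CommRing K] := TrivSqZeroExt K K

noncomputable instance (K : Type*) [CommRing K] : CommRing (DualNum K) := inferInstanceAs (CommRing (TrivSqZeroExt K K))

namespace DualNum
variable {K : Type*} [CommRing K]

/-- The value of a dual number. -/
noncomputable def val : DualNum K →+* K := (TrivSqZeroExt.fstHom K K K).toRingHom

/-- The derivative part of a dual number. -/
noncomputable def der : DualNum K →+ K := (TrivSqZeroExt.sndHom K K).toAddMonoidHom

/-- The dual number with given value and derivative. -/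
def mk (x y : K) : DualNum K := (x, y)

lemma val_mk (x y : K) : val (mk x y) = x := rfl
lemma der_mk (x y : K) : der (mk x y) = y := rfl

@[ext] lemma ext {x y : DualNum K} (h : val x = val y) (h' : der x = der y) : x = y := TrivSqZeroExt.ext h h'

lemma der_mul (x y : DualNum K) : der (x * y) = val x * der y + val y * der x := by
  refine (TrivSqZeroExt.snd_mul x y).trans ?_
  rw [op_smul_eq_smul]
  rfl

lemma der_one : der (1 : DualNum K) = 0 := rfl

lemma isNilpotent_ker_val : IsNilpotent (RingHom.ker (val (K := K))) := by
  refine ⟨2, ?_⟩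
  rw [pow_two, Ideal.zero_eq_bot, eq_bot_iff, Ideal.mul_le]
  intro x hx y hy
  have hx : val x = 0 := hx
  have hy : val y = 0 := hy
  rw [Ideal.mem_bot]
  ext
  · rw [map_mul, hx, zero_mul, map_zero]
  · rw [der_mul, hx, hy, zero_mul, zero_mul, add_zero, map_zero]

/-- The ring homomorphism to the dual numbers given by a derivation. -/
noncomputable def ofDerivation {k R : Type*} [CommRing k] [CommRing R] [Algebra k R] [Algebra R K] [Algebra k K]
    (D : Derivation k R K) : R →+* DualNum K where
  toFun r := mk (algebraMap R K r) (D r)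
  map_one' := by ext <;> simp [val_mk, der_mk, der_one]
  map_zero' := by ext <;> simp [val_mk, der_mk]
  map_add' a b := by ext <;> simp [val_mk, der_mk]
  map_mul' a b := by ext <;> simp [val_mk, der_mk, der_mul, Algebra.smul_def]

end DualNum

/-- Derivations extend along formally smooth algebras. -/
lemma exists_derivation_of_formallySmooth {k R K : Type*} [CommRing k] [CommRing R] [Algebra k R] [CommRing K] [Algebra k K]
    [Algebra R K] [IsScalarTower k R K] [Algebra.FormallySmooth R K] (φ : R →+* DualNum K)
    (hφ : ∀ r, DualNum.val (φ r) = algebraMap R K r) (hk : ∀ c : k, DualNum.der (φ (algebraMap k R c)) = 0) :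
    ∃ D : Derivation k K K, ∀ r, D (algebraMap R K r) = DualNum.der (φ r) := by
  let _ : Algebra R (DualNum K) := φ.toAlgebra
  let g : DualNum K →ₐ[R] K := { DualNum.val with commutes' := hφ }
  have hg : Function.Surjective g := fun x ↦ ⟨DualNum.mk x 0, rfl⟩
  have hn : IsNilpotent (RingHom.ker (g : DualNum K →+* K)) := DualNum.isNilpotent_ker_val
  -- The identity of K lifts through the square-zero extension K[ε] → K, compatibly with φ on R; the
  -- derivative part of the lift is the derivation.
  let l := Algebra.FormallySmooth.liftOfSurjective (AlgHom.id R K) g hg hn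
  have hl : ∀ x, DualNum.val (l x) = x := fun x ↦
    DFunLike.congr_fun (Algebra.FormallySmooth.comp_liftOfSurjective (AlgHom.id R K) g hg hn) x
  have hlr : ∀ r, l (algebraMap R K r) = φ r := fun r ↦ l.commutes r
  have hmul : ∀ x y, DualNum.der (l (x * y)) = x * DualNum.der (l y) + y * DualNum.der (l x) := by
    intro x y
    rw [map_mul, DualNum.der_mul, hl, hl]
  refine ⟨Derivation.mk' { toFun := fun x ↦ DualNum.der (l x)
                           map_add' := fun x y ↦ by rw [map_add, map_add]
                           map_smul' := fun c x ↦ ?_ } hmul, fun r ↦ ?_⟩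
  · rw [Algebra.smul_def, hmul, IsScalarTower.algebraMap_apply k R K, hlr, hk, mul_zero, add_zero, RingHom.id_apply,
      Algebra.smul_def, ← IsScalarTower.algebraMap_apply k R K]
  · change DualNum.der (l (algebraMap R K r)) = _
    rw [hlr]

section field
variable {k L K : Type*} [Field k] [Field L] [Field K] [Algebra k L] [Algebra L K] [Algebra k K] [IsScalarTower k L K]
  [CharZero L] [Algebra.EssFiniteType L K]

/-- A finitely generated field extension in characteristic zero is formally smooth. -/
lemma exists_derivation_extension (D₀ : Derivation k L K) : ∃ D : Derivation k K K, ∀ l, D (algebraMap L K l) = D₀ l := by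
  obtain ⟨D, hD⟩ := exists_derivation_of_formallySmooth (k := k) (DualNum.ofDerivation D₀) (fun r ↦ rfl)
    (fun c ↦ D₀.map_algebraMap c)
  exact ⟨D, hD⟩

/-- The derivation is first extended to the polynomial ring L[v] by zero on the variables, and then
along L[v] → L(v) → K: a localization followed by a field extension in characteristic zero, both
formally smooth. -/
lemma exists_derivation_extension_of_algebraicIndependent {ι : Type*} {v : ι → K} (hv : AlgebraicIndependent L v)
    (D₀ : Derivation k L K) :
    ∃ D : Derivation k K K, (∀ l, D (algebraMap L K l) = D₀ l) ∧ ∀ i, D (v i) = 0 := by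
  let P := MvPolynomial ι L
  let _ : Algebra P K := (MvPolynomial.aeval v).toAlgebra
  have hP : ∀ f : P, algebraMap P K f = MvPolynomial.aeval v f := fun _ ↦ rfl
  have : FaithfulSMul P K := (faithfulSMul_iff_algebraMap_injective P K).mpr hv
  have : IsScalarTower L P K := IsScalarTower.of_algebraMap_eq fun l ↦ by
    rw [hP, MvPolynomial.algebraMap_eq, MvPolynomial.aeval_C]
  have : IsScalarTower k P K := IsScalarTower.of_algebraMap_eq fun c ↦ by
    rw [IsScalarTower.algebraMap_apply k L P, ← IsScalarTower.algebraMap_apply L P K, ← IsScalarTower.algebraMap_apply k L K]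
  let _ := FractionRing.liftAlgebra P K
  have : IsScalarTower L (FractionRing P) K := IsScalarTower.of_algebraMap_eq fun l ↦ by
    rw [IsScalarTower.algebraMap_apply L P K, IsScalarTower.algebraMap_apply L P (FractionRing P),
      ← IsScalarTower.algebraMap_apply P (FractionRing P) K]
  have : Algebra.EssFiniteType (FractionRing P) K := Algebra.EssFiniteType.of_comp L _ _
  have : CharZero (FractionRing P) := charZero_of_injective_algebraMap (algebraMap L (FractionRing P)).injective
  have : Algebra.FormallySmooth P (FractionRing P) := .of_isLocalization (nonZeroDivisors P)
  have : Algebra.FormallySmooth P K := .comp P (FractionRing P) K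
  let φ : P →+* DualNum K := MvPolynomial.eval₂Hom (DualNum.ofDerivation D₀) (fun i ↦ DualNum.mk (v i) 0)
  have hφC : ∀ l, φ (MvPolynomial.C l) = DualNum.mk (algebraMap L K l) (D₀ l) := fun l ↦ MvPolynomial.eval₂Hom_C _ _ l
  have hφX : ∀ i, φ (MvPolynomial.X i) = DualNum.mk (v i) 0 := fun i ↦ MvPolynomial.eval₂Hom_X' _ _ i
  obtain ⟨D, hD⟩ := exists_derivation_of_formallySmooth (k := k) φ (fun f ↦ by
    have : (DualNum.val.comp φ : P →+* K) = algebraMap P K := by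
      apply MvPolynomial.ringHom_ext
      · intro l
        rw [RingHom.comp_apply, hφC, DualNum.val_mk, hP, MvPolynomial.aeval_C]
      · intro i
        rw [RingHom.comp_apply, hφX, DualNum.val_mk, hP, MvPolynomial.aeval_X]
    exact DFunLike.congr_fun this f) (fun c ↦ by
      rw [IsScalarTower.algebraMap_apply k L P, MvPolynomial.algebraMap_eq, hφC, DualNum.der_mk, D₀.map_algebraMap])
  refine ⟨D, fun l ↦ ?_, fun i ↦ ?_⟩
  · have := hD (MvPolynomial.C l)
    rwa [hP, MvPolynomial.aeval_C, hφC, DualNum.der_mk] at this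
  · have := hD (MvPolynomial.X i)
    rwa [hP, MvPolynomial.aeval_X, hφX, DualNum.der_mk] at this

/-- E is linear over R = L[x], and z is a root of a nonzero polynomial p over R, so p'(z) E(z) = 0.
-/
lemma derivation_eq_zero_of_isTranscendenceBasis {L κ : Type*} [Field L] [CharZero L] [Field κ] [Algebra L κ]
    {ι : Type*} {x : ι → κ} (hx : IsTranscendenceBasis L x) (E : Derivation L κ κ) (hE : ∀ i, E (x i) = 0) (z : κ) :
    E z = 0 := by
  have := hx.isAlgebraic
  have := charZero_of_injective_algebraMap (algebraMap L κ).injective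
  let R := Algebra.adjoin L (Set.range x)
  have hR : ∀ r : R, E r = 0 := fun r ↦ Derivation.eqOn_adjoin (D1 := E) (D2 := 0) (by
    rintro _ ⟨i, rfl⟩; exact hE i) r.2
  let E' : Derivation R κ κ := Derivation.mk'
    { toFun := E
      map_add' := map_add E
      map_smul' := fun r y ↦ by
        change E (r * y) = r * E y
        rw [E.leibniz, hR, smul_zero, add_zero, smul_eq_mul] } (fun a b ↦ E.leibniz a b)
  -- Induction on the degree makes a minimal polynomial unnecessary: if p'(z) = 0 with p' ≠ 0, then
  -- p' takes the place of p.
  have key : ∀ (n : ℕ) (p : Polynomial R), p.natDegree ≤ n → p ≠ 0 → Polynomial.aeval z p = 0 → E z = 0 := by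
    intro n
    induction n with
    | zero =>
      intro p hp hp0 hpz
      rw [Polynomial.eq_C_of_natDegree_le_zero hp, Polynomial.aeval_C] at hpz
      exfalso
      apply hp0
      rw [Polynomial.eq_C_of_natDegree_le_zero hp, FaithfulSMul.algebraMap_injective R κ (hpz.trans (map_zero _).symm),
        Polynomial.C_0]
    | succ n ih =>
      intro p hp hp0 hpz
      have h1 : Polynomial.aeval z (Polynomial.derivative p) • E z = 0 :=
        (E'.map_aeval p z).symm.trans (by rw [hpz, map_zero])
      rcases smul_eq_zero.mp h1 with h | h
      · by_cases hd : Polynomial.derivative p = 0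
        · have := Polynomial.derivative_eq_zero.mp hd
          exact ih p (by omega) hp0 hpz
        · refine ih _ ?_ hd h
          have := Polynomial.natDegree_derivative_le p
          omega
      · exact h
  obtain ⟨p, hp0, hp⟩ := Algebra.IsAlgebraic.isAlgebraic (R := R) z
  exact key _ p le_rfl hp0 hp

/-- A relation for u over L[t] can be divided by a power of the variable until its constant term is
nonzero. That term is divisible by u, so it is a polynomial in t whose residue vanishes, against the
independence of the residues. -/
lemma algebraicIndependent_option_of_residue {L O : Type*} [Field L] [CommRing O] [IsDomain O] [IsDiscreteValuationRing O]
    [Algebra L O] {ι : Type*} {t : ι → O} (ht : AlgebraicIndependent L fun i ↦ residue O (t i)) {u : O}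
    (hu : Irreducible u) : AlgebraicIndependent L fun o : Option ι ↦ o.elim u t := by
  let res : O →ₐ[L] ResidueField O := { residue O with commutes' := fun _ ↦ rfl }
  have htO : AlgebraicIndependent L t := AlgebraicIndependent.of_comp res ht
  rw [htO.option_iff_transcendental]
  intro ⟨p, hp0, hpu⟩
  obtain ⟨q, hq, hq0⟩ := Polynomial.exists_eq_pow_rootMultiplicity_mul_and_not_dvd p hp0 0
  rw [Polynomial.dvd_iff_isRoot, Polynomial.IsRoot.def] at hq0
  have hqu : Polynomial.aeval u q = 0 := by
    rw [hq, map_mul, map_pow] at hpu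
    refine (mul_eq_zero.mp hpu).resolve_left (pow_ne_zero _ ?_)
    simpa using hu.ne_zero
  have hdvd : u ∣ algebraMap _ O (q.eval 0) := by
    have := Polynomial.sub_dvd_eval_sub u 0 (q.map (algebraMap (Algebra.adjoin L (Set.range t)) O))
    rw [sub_zero, Polynomial.eval_map_algebraMap, hqu, zero_sub, dvd_neg] at this
    convert this using 1
    rw [← map_zero (algebraMap (Algebra.adjoin L (Set.range t)) O), Polynomial.eval_map_apply]
  obtain ⟨F, hF⟩ : ∃ F : MvPolynomial ι L, MvPolynomial.aeval t F = ((q.eval 0 : Algebra.adjoin L (Set.range t)) : O) := by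
    exact (Algebra.adjoin_range_eq_range_aeval L t).le (q.eval 0).2
  have h0 : res (MvPolynomial.aeval t F) = 0 := by
    rw [hF]
    refine (residue_eq_zero_iff _).mpr ?_
    rw [hu.maximalIdeal_eq]
    exact Ideal.mem_span_singleton.mpr hdvd
  have h1 : MvPolynomial.aeval (fun i ↦ residue O (t i)) F = 0 := by
    rw [← h0, ← AlgHom.comp_apply, MvPolynomial.comp_aeval]
    rfl
  have h2 : F = 0 := ht (h1.trans (map_zero _).symm)
  rw [h2, map_zero] at hF
  exact hq0 (Subtype.ext hF.symm)

/-- A derivation of a subfield of a discrete valuation ring extends to a derivation preserving the ring. -/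
theorem exists_derivation_extension_of_isDiscreteValuationRing (O : Subalgebra L K) [IsDiscreteValuationRing O]
    [IsFractionRing O K] (hfin : ∀ D : Derivation k K K, ∃ c ∈ O, c ≠ 0 ∧ ∀ y ∈ O, c * D y ∈ O)
    (D₀ : Derivation k L L) :
    ∃ D : Derivation k K K, (∀ l, D (algebraMap L K l) = algebraMap L K (D₀ l)) ∧ ∀ y ∈ O, D y ∈ O := by
  have : FaithfulSMul L (ResidueField O) := (faithfulSMul_iff_algebraMap_injective _ _).mpr (algebraMap L (ResidueField O)).injective
  -- Lifts t of a transcendence basis of the residue field and a uniformizer u are independent over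
  -- L, so some extension D of D₀ kills them all. This D preserves O.
  obtain ⟨s, hs⟩ := exists_isTranscendenceBasis L (ResidueField O)
  choose t ht using fun i : s ↦ residue_surjective (R := O) i.1
  have ht' : (fun i : s ↦ residue O (t i)) = Subtype.val := funext ht
  obtain ⟨u, hu⟩ := IsDiscreteValuationRing.exists_irreducible O
  have hu0 : (u : K) ≠ 0 := fun h ↦ hu.ne_zero (Subtype.ext h)
  have hind := (algebraicIndependent_option_of_residue (t := t) (ht' ▸ hs.1) hu).map' (f := O.val) Subtype.val_injective
  let D₁ : Derivation k L K :=
    Derivation.mk' ((Algebra.linearMap L K).restrictScalars k ∘ₗ D₀.toLinearMap) (fun a b ↦ by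
      simp [Algebra.smul_def])
  obtain ⟨D, hDL, hDv⟩ := exists_derivation_extension_of_algebraicIndependent hind D₁
  have hDL : ∀ l, D (algebraMap L K l) = algebraMap L K (D₀ l) := hDL
  have hDu : D u = 0 := hDv none
  have hDt : ∀ i, D (t i) = 0 := fun i ↦ hDv (some i)
  refine ⟨D, hDL, ?_⟩
  -- Lowers the order of the pole. Suppose E = u^(n+1) D maps O to itself. It kills u and maps L
  -- into (u), so it induces an L-derivation of the residue field. That derivation kills the
  -- transcendence basis, hence is zero, and all values of E are divisible by u.
  have step : ∀ n : ℕ, (∀ y ∈ O, (u : K) ^ (n + 1) * D y ∈ O) → ∀ y ∈ O, (u : K) ^ n * D y ∈ O := by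
    intro n hn
    let E : O → O := fun y ↦ ⟨_, hn y y.2⟩
    have hE : ∀ y : O, (E y : K) = (u : K) ^ (n + 1) * D y := fun _ ↦ rfl
    have hEadd : ∀ y z, E (y + z) = E y + E z := fun y z ↦ Subtype.ext (by
      rw [AddMemClass.coe_add, hE, hE, hE, AddMemClass.coe_add, map_add, mul_add])
    have hEmul : ∀ y z, E (y * z) = y * E z + z * E y := fun y z ↦ Subtype.ext (by
      rw [AddMemClass.coe_add, MulMemClass.coe_mul, MulMemClass.coe_mul, hE, hE, hE, MulMemClass.coe_mul, D.leibniz,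
        smul_eq_mul, smul_eq_mul]
      ring)
    have hEu : E u = 0 := Subtype.ext (by rw [hE, hDu, mul_zero]; rfl)
    have hEL : ∀ l, residue O (E (algebraMap L O l)) = 0 := by
      intro l
      rw [residue_eq_zero_iff, hu.maximalIdeal_eq, Ideal.mem_span_singleton]
      refine ⟨u ^ n * algebraMap L O (D₀ l), Subtype.ext ?_⟩
      rw [hE]
      change (u : K) ^ (n + 1) * D (algebraMap L K l) = u * (u ^ n * algebraMap L K (D₀ l))
      rw [hDL, pow_succ]
      ring
    have hEm : ∀ y, residue O y = 0 → residue O (E y) = 0 := by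
      intro y hy
      rw [residue_eq_zero_iff, hu.maximalIdeal_eq, Ideal.mem_span_singleton] at hy
      obtain ⟨z, rfl⟩ := hy
      rw [hEmul, hEu, mul_zero, add_zero, map_mul]
      have : residue O u = 0 := by
        rw [residue_eq_zero_iff, hu.maximalIdeal_eq]
        exact Ideal.mem_span_singleton_self u
      rw [this, zero_mul]
    have hsub : ∀ y z, residue O y = residue O z → residue O (E y) = residue O (E z) := by
      intro y z h
      have h1 := hEm (y - z) (by rw [map_sub, h, sub_self])
      have h2 : E y = E (y - z) + E z := by rw [← hEadd, sub_add_cancel]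
      rw [h2, map_add, h1, zero_add]
    let r : ResidueField O → O := Function.surjInv (residue_surjective (R := O))
    have hr : ∀ z, residue O (r z) = z := Function.surjInv_eq _
    have hadd : ∀ a b, residue O (E (r (a + b))) = residue O (E (r a)) + residue O (E (r b)) := by
      intro a b
      rw [← map_add, ← hEadd]
      exact hsub _ _ (by rw [hr, map_add, hr, hr])
    have hmul : ∀ a b, residue O (E (r (a * b))) = a * residue O (E (r b)) + b * residue O (E (r a)) := by
      intro a b
      have := hsub (r (a * b)) (r a * r b) (by rw [hr, map_mul, hr, hr])
      rw [this, hEmul, map_add, map_mul, map_mul, hr, hr]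
    let Ē : Derivation L (ResidueField O) (ResidueField O) := Derivation.mk'
      { toFun := fun z ↦ residue O (E (r z))
        map_add' := hadd
        map_smul' := fun l z ↦ by
          rw [Algebra.smul_def, hmul]
          have : residue O (E (r (algebraMap L (ResidueField O) l))) = 0 := by
            rw [← hEL l]
            exact hsub _ _ (by rw [hr]; rfl)
          rw [this, mul_zero, add_zero, RingHom.id_apply, Algebra.smul_def] } hmul
    intro y hy
    have hzero : Ē (residue O ⟨y, hy⟩) = 0 := derivation_eq_zero_of_isTranscendenceBasis hs Ē (fun i ↦ by
      change residue O (E (r i.1)) = 0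
      have : E (t i) = 0 := Subtype.ext (by rw [hE, hDt, mul_zero]; rfl)
      rw [hsub (r i.1) (t i) (by rw [hr, ht]), this, map_zero]) _
    have hz : residue O (E ⟨y, hy⟩) = 0 := by
      rw [← hzero]
      exact hsub _ _ (hr _).symm
    rw [residue_eq_zero_iff, hu.maximalIdeal_eq, Ideal.mem_span_singleton] at hz
    obtain ⟨z, hz⟩ := hz
    have h1 : (u : K) ^ (n + 1) * D y = u * z := congrArg Subtype.val hz
    have h2 : (u : K) ^ n * D y = z := mul_left_cancel₀ hu0 (by rw [← h1, pow_succ]; ring)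
    rw [h2]
    exact z.2
  have all : ∀ n : ℕ, (∀ y ∈ O, (u : K) ^ n * D y ∈ O) → ∀ y ∈ O, D y ∈ O := by
    intro n
    induction n with
    | zero => intro h y hy; simpa using h y hy
    | succ n ih => exact fun h ↦ ih (step n h)
  -- The descent starts from the bound c on the poles of D, which is a unit times a power of u.
  obtain ⟨c, hc, hc0, hcD⟩ := hfin D
  obtain ⟨n, w, hw⟩ := IsDiscreteValuationRing.eq_unit_mul_pow_irreducible (x := (⟨c, hc⟩ : O))
    (fun h ↦ hc0 (congrArg Subtype.val h)) hu
  refine all n fun y hy ↦ ?_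
  have h1 := O.mul_mem ((w⁻¹ : Oˣ) : O).2 (hcD y hy)
  have h2 : c = (w : O) * (u : K) ^ n := congrArg Subtype.val hw
  have h3 : (((w⁻¹ : Oˣ) : O) : K) * ((w : O) : K) = 1 := by
    rw [← MulMemClass.coe_mul, Units.inv_mul]; rfl
  rwa [h2, ← mul_assoc, ← mul_assoc, h3, one_mul] at h1

end field

end

/-! ### Extending forms on differentials of a domain to the fraction field -/

section

set_option linter.unusedSectionVars false
open KaehlerDifferential

section localization
variable {B A K : Type*} [CommRing B] [CommRing A] [IsDomain A] [Field K] [Algebra B A] [Algebra A K] [Algebra B K]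
  [IsScalarTower B A K] [IsFractionRing A K]

lemma KaehlerDifferential.exists_smul_eq_zero_of_map_eq_zero {t : Ω[A⁄B]} (ht : map B B A K t = 0) :
    ∃ s : A, s ≠ 0 ∧ s • t = 0 := by
  obtain ⟨c, hc⟩ := (IsLocalizedModule.eq_zero_iff (nonZeroDivisors A) (map B B A K)).mp ht
  exact ⟨c, nonZeroDivisors.coe_ne_zero c, hc⟩

lemma KaehlerDifferential.exists_basis_map [FiniteDimensional K Ω[K⁄B]] :
    ∃ (n : ℕ) (t : Fin n → Ω[A⁄B]) (b : Module.Basis (Fin n) K Ω[K⁄B]), ∀ i, b i = map B B A K (t i) := by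
  have hspan := span_range_map_derivation_of_isLocalization B A K (nonZeroDivisors A)
  obtain ⟨s, hs, hs', hli⟩ := exists_linearIndependent K (Set.range (map B B A K ∘ D B A))
  rw [hspan] at hs'
  let b₀ : Module.Basis s K Ω[K⁄B] := Module.Basis.mk hli (by rw [Subtype.range_coe, hs'])
  have : Finite s := Module.Finite.finite_basis b₀
  have := Fintype.ofFinite s
  choose a ha using fun i : s ↦ hs i.2
  let b := b₀.reindex (Fintype.equivFin s)
  refine ⟨_, fun i ↦ D B A (a ((Fintype.equivFin s).symm i)), b, fun i ↦ ?_⟩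
  rw [Module.Basis.reindex_apply, Module.Basis.mk_apply]
  exact (ha _).symm

/-- Multilinear maps on the differentials of a domain extend to its fraction field. -/
theorem KaehlerDifferential.exists_multilinear_extension [FiniteDimensional K Ω[K⁄B]] {ι : Type*} [Fintype ι]
    (ψ : MultilinearMap A (fun _ : ι ↦ Ω[A⁄B]) K) :
    ∃ Λ : MultilinearMap K (fun _ : ι ↦ Ω[K⁄B]) K, ∀ t, Λ (fun i ↦ map B B A K (t i)) = ψ t := by
  classical
  obtain ⟨n, t₀, b, hb⟩ := exists_basis_map (B := B) (A := A) (K := K)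
  let Λ : MultilinearMap K (fun _ : ι ↦ Ω[K⁄B]) K :=
    ∑ c : ι → Fin n, ψ (fun i ↦ t₀ (c i)) • MultilinearMap.prodForm K _ ι (fun i ↦ b.coord (c i))
  let ψ' : MultilinearMap A (fun _ : ι ↦ Ω[A⁄B]) K :=
    (Λ.restrictScalars A).compLinearMap (fun _ ↦ map B B A K)
  have hψ' : ∀ t, ψ' t = Λ (fun i ↦ map B B A K (t i)) := fun _ ↦ rfl
  have hΛ : ∀ c : ι → Fin n, Λ (fun i ↦ b (c i)) = ψ (fun i ↦ t₀ (c i)) := by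
    intro c
    simp only [Λ, sum_apply, smul_apply, MultilinearMap.prodForm_apply, Module.Basis.coord_apply, Module.Basis.repr_self, smul_eq_mul]
    rw [Finset.sum_eq_single c]
    · simp
    · intro c' _ hc'
      obtain ⟨i, hi⟩ := Function.ne_iff.mp hc'
      rw [Finset.prod_eq_zero (Finset.mem_univ i) (by rw [Finsupp.single_eq_of_ne hi]), mul_zero]
    · simp
  refine ⟨Λ, fun t ↦ ?_⟩
  -- The images of the `t₀ l` are a K-basis and the kernel of Ω_A → Ω_K is torsion, so every t has a
  -- nonzero multiple in the span of the `t₀ l`.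
  have key : ∀ t : Ω[A⁄B], ∃ s : A, s ≠ 0 ∧ s • t ∈ Submodule.span A (Set.range t₀) := by
    intro t
    obtain ⟨d, hd⟩ := IsLocalization.exist_integer_multiples_of_finset (nonZeroDivisors A)
      (Finset.univ.image fun l ↦ b.repr (map B B A K t) l)
    choose a ha using fun l ↦ hd _ (Finset.mem_image_of_mem (fun l ↦ b.repr (map B B A K t) l) (Finset.mem_univ l))
    obtain ⟨s, hs, hst⟩ := exists_smul_eq_zero_of_map_eq_zero (K := K) (t := d.1 • t - ∑ l, a l • t₀ l) (by
      rw [map_sub, map_smul, map_sum, sub_eq_zero]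
      conv_lhs => rw [← b.sum_repr (map B B A K t), Finset.smul_sum]
      refine Finset.sum_congr rfl fun l _ ↦ ?_
      rw [map_smul, hb, ← algebraMap_smul K (a l), ha, smul_assoc])
    refine ⟨s * d.1, mul_ne_zero hs (nonZeroDivisors.coe_ne_zero d), ?_⟩
    rw [smul_sub, sub_eq_zero] at hst
    rw [mul_smul, hst]
    exact Submodule.smul_mem _ _ (Submodule.sum_mem _ fun l _ ↦ Submodule.smul_mem _ _ (Submodule.subset_span ⟨l, rfl⟩))
  choose s hs0 hs using key
  -- The two forms agree on the `t₀ l`, hence on the multiples s • t; the product of the factors s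
  -- is cancelled in K.
  have h1 := (ψ' - ψ).mem_of_span (Set.range t₀) (⊥ : Submodule A K) (fun c hc ↦ by
    choose l hl using hc
    obtain rfl : (fun i ↦ t₀ (l i)) = c := funext hl
    rw [sub_apply, hψ', Submodule.mem_bot, ← hΛ, sub_eq_zero]
    congr 1
    funext i
    exact (hb _).symm) (fun i ↦ s (t i) • t i) (fun i ↦ hs (t i))
  rw [Submodule.mem_bot, MultilinearMap.map_smul_univ] at h1
  rw [Algebra.smul_def, mul_eq_zero, map_prod] at h1
  have h2 := h1.resolve_left (Finset.prod_ne_zero_iff.mpr fun i _ h ↦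
    hs0 (t i) (IsFractionRing.injective A K (h.trans (map_zero _).symm)))
  rw [sub_apply, hψ', sub_eq_zero] at h2
  exact h2

end localization

end

/-! ### Normal charts, horizontal points and vanishing of relative forms -/

section

set_option linter.unusedSectionVars false
open KaehlerDifferential

section dual
variable {k K V : Type*} [Field k] [Field K] [Algebra k K] [AddCommGroup V] [Module K V] [Module k V]
  [IsScalarTower k K V] (δ : Derivation k K V) {A O : Subalgebra k K}

/-- A linear form is a form in one variable and is regular on K; clearing its denominators bounds
its poles on A, and so on every localization O of A. -/
lemma exists_mul_dual_mem (hA : A.FG) [IsFractionRing A K] (h : O.IsLocalizationOf A) (ξ : Module.Dual K V) :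
    ∃ a ∈ A, a ≠ 0 ∧ ∀ y ∈ O, a * ξ (δ y) ∈ O := by
  let Λ : MultilinearMap K (fun _ : Unit ↦ V) K := LinearMap.compMultilinearMap ξ (MultilinearMap.ofSubsingleton K V V () LinearMap.id)
  have hΛ : ∀ v, Λ v = ξ (v ()) := fun _ ↦ rfl
  obtain ⟨a, ha, ha0, -, hreg⟩ := IsRegularOn.exists_smul (δ := δ) (Λ := Λ) hA A.isLocalizationOf_top (fun _ _ ↦ trivial)
  refine ⟨a, ha, ha0, fun y hy ↦ ?_⟩
  have hO := isRegularOn_of_generators (δ := δ) (Λ := a • Λ) (A : Set K) h (Algebra.adjoin_eq A) fun c hc ↦ h.le (hreg c hc)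
  exact hO (fun _ ↦ y) fun _ ↦ hy

lemma IsRegularOn.of_isLocalizationOf {ι : Type*} [Fintype ι] {δ : Derivation k K V} (h : O.IsLocalizationOf A)
    {Λ : MultilinearMap K (fun _ : ι ↦ V) K} (hΛ : IsRegularOn δ A Λ) : IsRegularOn δ O Λ :=
  isRegularOn_of_generators (A : Set K) h (Algebra.adjoin_eq A) fun c hc ↦ h.le (hΛ c hc)

lemma Subalgebra.IsLocalizationOf.isFractionRing [IsFractionRing A K] (h : O.IsLocalizationOf A) : IsFractionRing O K := by
  refine IsFractionRing.of_field O K fun z ↦ ?_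
  obtain ⟨a, b, hb, rfl⟩ := IsFractionRing.div_surjective A z
  exact ⟨⟨a, h.le a.2⟩, ⟨b, h.le b.2⟩, rfl⟩

end dual

section charts
variable {k : Type*} {B K : Type u} [Field k] [CommRing B] [Field K] [Algebra k B] [Algebra k K] [Algebra B K]
  [IsScalarTower k B K]

variable (k) in
/-- A finitely generated integrally closed algebra with the given fraction field. -/
structure IsNormalChart (A : Subalgebra B K) : Prop where
  fg : (A.restrictScalars k).FG
  integrallyClosed : IsIntegrallyClosed A
  isFractionRing : IsFractionRing A K

variable (k) in
/-- The local ring at a codimension one point that dominates the base. -/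
structure IsHorizontal (A : Subalgebra B K) (O : Subalgebra k K) : Prop where
  isLocalizationOf : O.IsLocalizationOf (A.restrictScalars k)
  dvr : IsDiscreteValuationRing O
  inv_mem : ∀ b : B, b ≠ 0 → (algebraMap B K b)⁻¹ ∈ O

variable (k B K) in
/-- The derivation to the relative differentials, over the ground field. -/
noncomputable abbrev relD : Derivation k K Ω[K⁄B] := (D B K).restrictScalars k

lemma span_relD : Submodule.span K (Set.range (relD k B K)) = ⊤ := span_range_derivation B K

namespace IsNormalChart
variable {A : Subalgebra B K} (hA : IsNormalChart k A)
include hA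

lemma finiteType : Algebra.FiniteType k (A.restrictScalars k) := (Subalgebra.fg_iff_finiteType _).mp hA.fg

lemma isNoetherianRing : IsNoetherianRing A := by
  have := hA.finiteType
  exact Algebra.FiniteType.isNoetherianRing k (A.restrictScalars k)

lemma essFiniteType : Algebra.EssFiniteType k K := by
  have := hA.finiteType
  have : IsFractionRing (A.restrictScalars k) K := hA.isFractionRing
  have : Algebra.EssFiniteType (A.restrictScalars k) K := .of_isLocalization _ (nonZeroDivisors (A.restrictScalars k))
  exact Algebra.EssFiniteType.comp k (A.restrictScalars k) K

lemma finiteType_base : Algebra.FiniteType B A := by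
  have h1 := hA.finiteType
  let _ : Algebra k A := inferInstanceAs (Algebra k (A.restrictScalars k))
  have : IsScalarTower k B A := IsScalarTower.of_algebraMap_eq fun c ↦ Subtype.ext (IsScalarTower.algebraMap_apply k B K c)
  have : Algebra.FiniteType k A := h1
  exact Algebra.FiniteType.of_restrictScalars_finiteType k B A

lemma finiteDimensional : FiniteDimensional K Ω[K⁄B] := by
  have := hA.essFiniteType
  have := Algebra.EssFiniteType.of_comp k B K
  infer_instance

end IsNormalChart

section regularity
variable {ι : Type*} [Fintype ι]

variable (k) in
/-- The multilinear forms that are regular on `A`, as a module over `A`. -/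
def regularForms (A : Subalgebra B K) (ι : Type*) [Fintype ι] : Submodule A (MultilinearMap K (fun _ : ι ↦ Ω[K⁄B]) K) where
  carrier := {Λ | IsRegularOn (relD k B K) (A.restrictScalars k) Λ}
  zero_mem' := fun _ _ ↦ Subalgebra.zero_mem _
  add_mem' := fun h h' a ha ↦ Subalgebra.add_mem _ (h a ha) (h' a ha)
  smul_mem' := fun c _ h a ha ↦ Subalgebra.mul_mem _ c.2 (h a ha)

/-- Evaluation on the differentials of finitely many generators embeds the regular forms in a free
module of finite rank over the noetherian ring A. -/
lemma regularForms_fg {A : Subalgebra B K} (hA : IsNormalChart k A) : (regularForms k A ι).FG := by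
  classical
  have := hA.isNoetherianRing
  obtain ⟨s, hs⟩ := hA.fg
  have hsA : (s : Set K) ⊆ A := by
    have : (s : Set K) ⊆ A.restrictScalars k := by rw [← hs]; exact Algebra.subset_adjoin
    exact this
  let F : regularForms k A ι →ₗ[A] ((ι → s) → A) :=
    { toFun := fun Λ c ↦ ⟨Λ.1 fun i ↦ relD k B K (c i), Λ.2 _ fun i ↦ hsA (c i).2⟩
      map_add' := fun _ _ ↦ rfl
      map_smul' := fun _ _ ↦ rfl }
  have hF : Function.Injective F := by
    intro Λ Λ' h
    have := hA.isFractionRing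
    refine Subtype.ext (MultilinearMap.ext_of_span (relD k B K '' s) ?_ fun c hc ↦ ?_)
    · refine top_unique ?_
      rw [← span_relD (k := k), Submodule.span_le]
      rintro _ ⟨y, rfl⟩
      have : IsFractionRing (A.restrictScalars k) K := hA.isFractionRing
      have := derivation_mem_span_of_isLocalizationOf (relD k B K) (Subalgebra.isLocalizationOf_top (A.restrictScalars k)) s hs
        (y := y) trivial
      refine Submodule.span_induction (p := fun v _ ↦ v ∈ Submodule.span K (relD k B K '' s)) ?_ ?_ ?_ ?_ this
      · exact fun v hv ↦ Submodule.subset_span hv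
      · exact zero_mem _
      · exact fun v w _ _ hv hw ↦ add_mem hv hw
      · exact fun c v _ hv ↦ Submodule.smul_mem _ (c : K) hv
    · choose x hx hxc using hc
      obtain rfl : (fun i ↦ relD k B K (x i)) = c := funext hxc
      exact congrArg Subtype.val (congrFun h fun i ↦ ⟨x i, hx i⟩)
  have : IsNoetherian A (regularForms k A ι) := isNoetherian_of_injective F hF
  exact Module.Finite.iff_fg.mp inferInstance

variable [IsDomain B] [FaithfulSMul B K]

/-- A functional that is regular at the horizontal codimension one points is regular up to a
denominator from the base. -/
lemma exists_mul_mem_of_isHorizontal {A : Subalgebra B K} (hA : IsNormalChart k A)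
    (σ : Module.Dual K (MultilinearMap K (fun _ : ι ↦ Ω[K⁄B]) K))
    (hσ : ∀ O, IsHorizontal k A O → ∀ Λ, IsRegularOn (relD k B K) O Λ → σ Λ ∈ O) :
    ∃ b : B, b ≠ 0 ∧ ∀ Λ ∈ regularForms k A ι, algebraMap B K b * σ Λ ∈ A := by
  have := hA.isNoetherianRing
  have := hA.integrallyClosed
  have := hA.isFractionRing
  have hinj := FaithfulSMul.algebraMap_injective B K
  -- With the nonzero elements of B inverted, only the discrete valuation rings that dominate the
  -- base remain; these are the horizontal ones, where σ is known to be regular.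
  let S : Submonoid K := (nonZeroDivisors B).map (algebraMap B K)
  have point : ∀ Λ ∈ regularForms k A ι, ∃ b : B, b ≠ 0 ∧ algebraMap B K b * σ Λ ∈ A := by
    intro Λ hΛ
    by_contra! hcon
    have : IsFractionRing (A.restrictScalars k) K := hA.isFractionRing
    have : IsNoetherianRing (A.restrictScalars k) := hA.isNoetherianRing
    have : IsIntegrallyClosed (A.restrictScalars k) := hA.integrallyClosed
    obtain ⟨O, hO, hdvr, hS, hx⟩ := Subalgebra.exists_isDiscreteValuationRing (A.restrictScalars k) S (by
      rintro _ ⟨b, hb, rfl⟩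
      exact A.algebraMap_mem b) (σ Λ) (by
      rintro _ ⟨b, hb, rfl⟩
      exact hcon b (nonZeroDivisors.ne_zero hb))
    exact hx (hσ O ⟨hO, hdvr, fun b hb ↦ hS _ ⟨b, mem_nonZeroDivisors_of_ne_zero hb, rfl⟩⟩ Λ
      (IsRegularOn.of_isLocalizationOf hO hΛ))
  -- The denominator obtained so far depends on Λ; finite generation of the regular forms makes it
  -- uniform.
  obtain ⟨t, ht⟩ := regularForms_fg (ι := ι) hA
  have htm : ∀ Λ ∈ t, Λ ∈ regularForms k A ι := fun Λ h ↦ ht ▸ Submodule.subset_span h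
  classical
  choose! b hb0 hb using fun Λ (h : Λ ∈ t) ↦ point Λ (htm Λ h)
  refine ⟨∏ Λ ∈ t, b Λ, Finset.prod_ne_zero_iff.mpr hb0, fun Λ hΛ ↦ ?_⟩
  rw [← ht] at hΛ
  refine Submodule.span_induction (p := fun Λ _ ↦ algebraMap B K (∏ Λ ∈ t, b Λ) * σ Λ ∈ A) ?_ ?_ ?_ ?_ hΛ
  · intro Λ h
    have h : Λ ∈ t := h
    rw [← Finset.mul_prod_erase t b h, mul_comm (b Λ), map_mul, mul_assoc]
    exact A.mul_mem (A.algebraMap_mem _) (hb Λ h)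
  · rw [map_zero, mul_zero]; exact A.zero_mem
  · intro Λ Λ' _ _ h h'
    rw [map_add, mul_add]
    exact A.add_mem h h'
  · intro c Λ _ h
    have : σ (c • Λ) = (c : K) * σ Λ := σ.map_smul (c : K) Λ
    rw [this, mul_left_comm]
    exact A.mul_mem c.2 h

end regularity

/-- The functionals on forms on the general fibers of a family of charts vanish modulo general
maximal ideals of the base. -/
def FiberVanishing (k : Type*) {B K : Type u} [Field k] [CommRing B] [Field K] [Algebra k B] [Algebra k K] [Algebra B K]
    [IsScalarTower k B K] {κ : Type*} (A : κ → Subalgebra B K) : Prop :=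
  ∀ (j : ℕ), 0 < j → ∀ σ : Module.Dual K (MultilinearMap K (fun _ : Fin j ↦ Ω[K⁄B]) K),
    (∀ i, ∀ Λ ∈ regularForms k (A i) (Fin j), σ Λ ∈ A i) →
    ∃ b : B, b ≠ 0 ∧ ∀ I : Ideal B, I.IsMaximal → b ∉ I → ∀ i, ∀ ξ : Fin j → Module.Dual K Ω[K⁄B],
      (∀ l, ∀ a ∈ A i, ξ l (relD k B K a) ∈ A i) →
        ∃ y ∈ I.map (algebraMap B (A i)), (y : K) = σ (MultilinearMap.prodForm K _ _ ξ)

lemma exists_isMaximal_notMem [IsDomain B] [Algebra.FiniteType k B] {b : B} (hb : b ≠ 0) :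
    ∃ I : Ideal B, I.IsMaximal ∧ b ∉ I := by
  have : IsJacobsonRing B := isJacobsonRing_of_finiteType (A := k)
  by_contra! h
  have h1 : b ∈ (⊥ : Ideal B).jacobson := Ideal.mem_sInf.mpr fun {I} hI ↦ h I hI.2
  rw [IsJacobsonRing.out inferInstance Ideal.isRadical_bot] at h1
  exact hb h1

variable [IsDomain B] [Algebra.FiniteType k B] [FaithfulSMul B K] {κ : Type*} [Finite κ] [Nonempty κ] {A : κ → Subalgebra B K}

/-- A multilinear form on relative vector fields that is regular at the horizontal codimension one
points vanishes. -/
theorem FiberVanishing.eq_zero (hF : FiberVanishing k A) (hA : ∀ i, IsNormalChart k (A i)) {ι : Type*} [Fintype ι] [Nonempty ι]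
    (τ : MultilinearMap K (fun _ : ι ↦ Module.Dual K Ω[K⁄B]) K)
    (hτ : ∀ i O, IsHorizontal k (A i) O → ∀ η : ι → Module.Dual K Ω[K⁄B], (∀ l, ∀ a ∈ O, η l (relD k B K a) ∈ O) → τ η ∈ O) :
    τ = 0 := by
  classical
  have := Fintype.ofFinite κ
  let i₀ : κ := Classical.arbitrary κ
  have := (hA i₀).finiteDimensional
  let e := Fintype.equivFin ι
  let τ' := τ.domDomCongr e
  have hτ' : ∀ η, τ' η = τ (fun l ↦ η (e l)) := fun _ ↦ rfl
  -- The functional on forms whose value on a product of vector fields is that of τ.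
  obtain ⟨σ, hσ⟩ := MultilinearMap.exists_pairing τ'
  have hreg : ∀ i O, IsHorizontal k (A i) O → ∀ Λ, IsRegularOn (relD k B K) O Λ → σ Λ ∈ O := by
    intro i O hO Λ hΛ
    have := hO.dvr
    have := (hA i).isFractionRing
    have : IsFractionRing ((A i).restrictScalars k) K := (hA i).isFractionRing
    have : IsFractionRing O K := hO.isLocalizationOf.isFractionRing
    exact pairing_mem span_relD (hA i).fg hO.isLocalizationOf σ (fun ξ hξ ↦ by
      rw [hσ, hτ']
      exact hτ i O hO _ fun l ↦ hξ _) hΛ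
  -- On each chart regularity at horizontal points gives regularity up to a denominator in B; the
  -- product c clears the denominators of all charts at once.
  choose b hb0 hb using fun i ↦ exists_mul_mem_of_isHorizontal (hA i) σ (hreg i)
  obtain ⟨c, hc⟩ : ∃ c, c = ∏ i, b i := ⟨_, rfl⟩
  have hc0 : c ≠ 0 := hc ▸ Finset.prod_ne_zero_iff.mpr fun i _ ↦ hb0 i
  have hinj := FaithfulSMul.algebraMap_injective B K
  have hcK : algebraMap B K c ≠ 0 := fun h ↦ hc0 (hinj (h.trans (map_zero _).symm))
  have hcσ : ∀ i, ∀ Λ ∈ regularForms k (A i) _, (algebraMap B K c • σ) Λ ∈ A i := by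
    intro i Λ hΛ
    rw [LinearMap.smul_apply, smul_eq_mul, hc, ← Finset.mul_prod_erase Finset.univ b (Finset.mem_univ i), mul_comm (b i), map_mul,
      mul_assoc]
    exact (A i).mul_mem ((A i).algebraMap_mem _) (hb i Λ hΛ)
  obtain ⟨b₁, hb₁, hF⟩ := hF _ Fintype.card_pos (algebraMap B K c • σ) hcσ
  have := (hA i₀).isNoetherianRing
  have := (hA i₀).isFractionRing
  have := (hA i₀).finiteType_base
  -- On regular vector fields the value of cτ is an element a of `A i₀` that lies in the extension
  -- of I for all general maximal ideals I of B. A nonzero element does not, and general maximal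
  -- ideals exist.
  have vanish : ∀ ξ : Fin (Fintype.card ι) → Module.Dual K Ω[K⁄B], (∀ l, ∀ a ∈ A i₀, ξ l (relD k B K a) ∈ A i₀) → τ' ξ = 0 := by
    intro ξ hξ
    by_contra h0
    have hreg : MultilinearMap.prodForm K _ _ ξ ∈ regularForms k (A i₀) (Fin (Fintype.card ι)) := fun a ha ↦ by
      rw [MultilinearMap.prodForm_apply]
      exact Subalgebra.prod_mem _ fun l _ ↦ hξ l _ (ha l)
    let a : A i₀ := ⟨_, hcσ i₀ _ hreg⟩
    have ha : a ≠ 0 := fun h ↦ by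
      have := congrArg Subtype.val h
      change algebraMap B K c * σ _ = 0 at this
      rw [hσ] at this
      exact (mul_ne_zero hcK h0) this
    have : FaithfulSMul B (A i₀) := (faithfulSMul_iff_algebraMap_injective _ _).mpr fun x y h ↦ hinj (congrArg Subtype.val h)
    have : IsNoetherianRing B := Algebra.FiniteType.isNoetherianRing k B
    obtain ⟨b₂, hb₂, hmem⟩ := exists_notMem_map (B := B) a ha
    obtain ⟨I, hI, hbI⟩ := exists_isMaximal_notMem (k := k) (mul_ne_zero hb₁ hb₂)
    obtain ⟨y, hy, hya⟩ := hF I hI (fun h ↦ hbI (I.mul_mem_right _ h)) i₀ ξ hξ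
    have : y = a := Subtype.ext hya
    exact hmem I hI (fun h ↦ hbI (I.mul_mem_left _ h)) (this ▸ hy)
  ext η
  have : IsFractionRing ((A i₀).restrictScalars k) K := (hA i₀).isFractionRing
  -- Arbitrary vector fields become regular on the chart after scaling each of them by a nonzero
  -- function.
  choose a ha ha0 haη using fun l ↦ exists_mul_dual_mem (relD k B K) (hA i₀).fg (Subalgebra.IsLocalizationOf.refl _) (η (e.symm l))
  have h1 := vanish (fun l ↦ a l • η (e.symm l)) haη
  rw [MultilinearMap.map_smul_univ, smul_eq_mul] at h1
  have h2 := (mul_eq_zero.mp h1).resolve_left (Finset.prod_ne_zero_iff.mpr fun l _ ↦ ha0 l)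
  have h3 : η = fun l ↦ η (e.symm (e l)) := funext fun l ↦ by rw [e.symm_apply_apply]
  exact (congrArg τ h3).trans h2

end charts

end

/-! ### Vanishing on products with a vertical factor -/

section

set_option linter.unusedSectionVars false
open KaehlerDifferential

/-- The slots are exchanged one at a time. Those in `I` do not change; exchanging a slot i outside
`I` changes f by its value on a family with `ξ' i - ξ i` in slot i, whose entries on `insert i I`
lie in P, and such values are zero. -/
lemma MultilinearMap.eq_of_sub_mem {K M N ι : Type*} [Field K] [AddCommGroup M] [Module K M] [AddCommGroup N] [Module K N]
    [Fintype ι] (f : MultilinearMap K (fun _ : ι ↦ M) N) (P : Submodule K M) (I : Finset ι)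
    (hf : ∀ I', I ⊂ I' → ∀ ξ : ι → M, (∀ i ∈ I', ξ i ∈ P) → f ξ = 0)
    {ξ ξ' : ι → M} (hI : ∀ i ∈ I, ξ i ∈ P) (hIξ : ∀ i ∈ I, ξ i = ξ' i) (hsub : ∀ i, ξ' i - ξ i ∈ P) : f ξ' = f ξ := by
  classical
  have key : ∀ s : Finset ι, f (s.piecewise ξ' ξ) = f ξ := by
    intro s
    induction s using Finset.induction_on with
    | empty => rw [Finset.piecewise_empty]
    | insert i s his ih =>
      have hupd : s.piecewise ξ' ξ = Function.update (s.piecewise ξ' ξ) i (ξ i) := by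
        rw [eq_comm, Function.update_eq_self_iff, Finset.piecewise_eq_of_notMem _ _ _ his]
      rw [Finset.piecewise_insert, ← ih]
      by_cases hi : i ∈ I
      · rw [← hIξ i hi, ← hupd]
      · rw [← sub_eq_zero]
        nth_rewrite 2 [hupd]
        rw [← f.map_update_sub]
        refine hf (insert i I) (Finset.ssubset_insert hi) _ fun l hl ↦ ?_
        rcases Finset.mem_insert.mp hl with rfl | hl
        · rw [Function.update_self]; exact hsub l
        · have : l ≠ i := fun h ↦ hi (h ▸ hl)
          rw [Function.update_of_ne this]
          by_cases hs : l ∈ s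
          · rw [Finset.piecewise_eq_of_mem _ _ _ hs, ← hIξ l hl]; exact hI l hl
          · rw [Finset.piecewise_eq_of_notMem _ _ _ hs]; exact hI l hl
  have := key Finset.univ
  rwa [Finset.piecewise_univ] at this

section
variable {k : Type*} {B K : Type u} [Field k] [CommRing B] [Field K] [Algebra k B] [Algebra k K] [Algebra B K]
  [IsScalarTower k B K]

variable (k B K) in
/-- The linear forms on differentials that vanish on differentials from the base. -/
def verticalForms : Submodule K (Module.Dual K Ω[K⁄k]) where
  carrier := {ξ | ∀ b : B, ξ (D k K (algebraMap B K b)) = 0}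
  zero_mem' := fun _ ↦ rfl
  add_mem' := fun {ξ ξ'} h h' b ↦ by rw [LinearMap.add_apply, h, h', add_zero]
  smul_mem' := fun c ξ h b ↦ by rw [LinearMap.smul_apply, h, smul_zero]

/-- A linear form on Ω_{K/k} that kills dB is a B-derivation of K, hence a linear form on Ω_{K/B}.
-/
lemma exists_eq_comp_of_mem_verticalForms {ξ : Module.Dual K Ω[K⁄k]} (hξ : ξ ∈ verticalForms k B K) :
    ∃ η : Module.Dual K Ω[K⁄B], ξ = η ∘ₗ map k B K K := by
  let E : Derivation B K K := Derivation.mk'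
    { toFun := fun x ↦ ξ (D k K x)
      map_add' := fun x y ↦ by rw [map_add, map_add]
      map_smul' := fun b x ↦ by
        rw [Algebra.smul_def, (D k K).leibniz, map_add, map_smul, map_smul, hξ, smul_zero, add_zero, RingHom.id_apply,
          smul_eq_mul, Algebra.smul_def] }
    (fun x y ↦ by
      change ξ (D k K (x * y)) = _
      rw [(D k K).leibniz, map_add, map_smul, map_smul]
      rfl)
  refine ⟨E.liftKaehlerDifferential, ?_⟩
  refine LinearMap.ext_on_range (v := D k K) (span_range_derivation k K) fun x ↦ ?_
  rw [LinearMap.comp_apply, map_D, Algebra.algebraMap_self, RingHom.id_apply, Derivation.liftKaehlerDifferential_comp_D]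
  rfl

lemma comp_mem_verticalForms (η : Module.Dual K Ω[K⁄B]) : η ∘ₗ map k B K K ∈ verticalForms k B K := by
  intro b
  rw [LinearMap.comp_apply, map_D, Algebra.algebraMap_self, RingHom.id_apply, Derivation.map_algebraMap, map_zero]

/-- By the quotient rule the fraction field L may replace B, which makes vertical forms the
differences of extensions of one derivation of L. -/
lemma mem_verticalForms_iff {L : Type*} [Field L] [Algebra B L] [Algebra L K] [IsScalarTower B L K] [IsFractionRing B L]
    {ξ : Module.Dual K Ω[K⁄k]} :
    ξ ∈ verticalForms k B K ↔ ∀ l, ξ (D k K (algebraMap L K l)) = 0 := by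
  refine ⟨fun h l ↦ ?_, fun h b ↦ by rw [IsScalarTower.algebraMap_apply B L K]; exact h _⟩
  obtain ⟨η, rfl⟩ := exists_eq_comp_of_mem_verticalForms h
  rw [LinearMap.comp_apply, map_D, Algebra.algebraMap_self, RingHom.id_apply]
  obtain ⟨a, s, rfl⟩ := IsLocalization.exists_mk'_eq (nonZeroDivisors B) l
  have hs : algebraMap B K s ≠ 0 := by
    rw [IsScalarTower.algebraMap_apply B L K]
    exact (map_ne_zero _).mpr (IsLocalization.map_units L s).ne_zero
  have h1 : algebraMap B K s • D B K (algebraMap L K (IsLocalization.mk' L a s)) = 0 := by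
    rw [algebraMap_smul, ← Derivation.map_smul, Algebra.smul_def, IsScalarTower.algebraMap_apply B L K, ← map_mul,
      IsLocalization.mk'_spec', ← IsScalarTower.algebraMap_apply B L K, Derivation.map_algebraMap]
  rw [(smul_eq_zero.mp h1).resolve_left hs, map_zero]

variable [IsDomain B] [FaithfulSMul B K] [Algebra.FiniteType k B] [CharZero k]

/-- The linear forms on differentials that induce derivations of the fraction field of the base are generators. -/
lemma span_extensions_eq_top {L : Type*} [Field L] [Algebra B L] [Algebra L K] [IsScalarTower B L K] [IsFractionRing B L]
    [Algebra k L] [IsScalarTower k B L] [IsScalarTower k L K] [Algebra.EssFiniteType k K] :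
    Submodule.span K {ξ : Module.Dual K Ω[K⁄k] | ∃ D₀ : Derivation k L L, ∀ l, ξ (D k K (algebraMap L K l)) = algebraMap L K (D₀ l)} = ⊤ := by
  refine top_unique fun ξ _ ↦ ?_
  have : Algebra.EssFiniteType B L := .of_isLocalization _ (nonZeroDivisors B)
  have : Algebra.EssFiniteType k L := .comp k B L
  have : Algebra.EssFiniteType L K := .of_comp k L K
  have : CharZero L := charZero_of_injective_algebraMap (algebraMap k L).injective
  let b := Module.finBasis L Ω[L⁄k]
  let D₀ : ∀ i, Derivation k L L := fun i ↦ (b.coord i).compDer (D k L)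
  -- The coordinate derivations of a basis of Ω_{L/k} are extended to K; their combination with the
  -- coefficients of ξ agrees with ξ on dL.
  have ext : ∀ i, ∃ ξ' : Module.Dual K Ω[K⁄k], ∀ l, ξ' (D k K (algebraMap L K l)) = algebraMap L K (D₀ i l) := by
    intro i
    let D₁ : Derivation k L K :=
      Derivation.mk' ((Algebra.linearMap L K).restrictScalars k ∘ₗ (D₀ i).toLinearMap) (fun a b ↦ by
        simp [Algebra.smul_def])
    obtain ⟨E, hE⟩ := exists_derivation_extension D₁
    refine ⟨E.liftKaehlerDifferential, fun l ↦ ?_⟩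
    rw [Derivation.liftKaehlerDifferential_comp_D]
    exact hE l
  choose ξ' hξ' using ext
  have hmem : ∀ i, ξ' i ∈ Submodule.span K {ξ : Module.Dual K Ω[K⁄k] | ∃ D₀ : Derivation k L L, ∀ l, ξ (D k K (algebraMap L K l)) = algebraMap L K (D₀ l)} :=
    fun i ↦ Submodule.subset_span ⟨D₀ i, hξ' i⟩
  have hsum : ∑ i, ξ (map k k L K (b i)) • ξ' i ∈ Submodule.span K {ξ : Module.Dual K Ω[K⁄k] | ∃ D₀ : Derivation k L L, ∀ l, ξ (D k K (algebraMap L K l)) = algebraMap L K (D₀ l)} :=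
    Submodule.sum_mem _ fun i _ ↦ Submodule.smul_mem _ _ (hmem i)
  -- The difference kills dL, so it extends the zero derivation.
  have hdiff : ξ - ∑ i, ξ (map k k L K (b i)) • ξ' i ∈ Submodule.span K {ξ : Module.Dual K Ω[K⁄k] | ∃ D₀ : Derivation k L L, ∀ l, ξ (D k K (algebraMap L K l)) = algebraMap L K (D₀ l)} := by
    refine Submodule.subset_span ⟨0, fun l ↦ ?_⟩
    have h1 : D k K (algebraMap L K l) = ∑ i, (b.repr (D k L l) i) • map k k L K (b i) := by
      rw [← map_D k k L K l]
      conv_lhs => rw [← b.sum_repr (D k L l)]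
      rw [map_sum]
      exact Finset.sum_congr rfl fun i _ ↦ map_smul _ _ _
    rw [LinearMap.sub_apply, LinearMap.sum_apply, Derivation.zero_apply, map_zero, sub_eq_zero]
    simp only [LinearMap.smul_apply, hξ', smul_eq_mul]
    rw [h1, map_sum]
    refine Finset.sum_congr rfl fun i _ ↦ ?_
    rw [← algebraMap_smul K (b.repr (D k L l) i), map_smul, smul_eq_mul, mul_comm]
    rfl
  have := add_mem hdiff hsum
  rwa [sub_add_cancel] at this

/-- A horizontal local ring contains the fraction field of the base. -/
def IsHorizontal.toSubalgebra {L : Type*} [Field L] [Algebra B L] [Algebra L K] [IsScalarTower B L K] [IsFractionRing B L]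
    {A : Subalgebra B K} {O : Subalgebra k K} (hO : IsHorizontal k A O) : Subalgebra L K :=
  { O with
    algebraMap_mem' := fun l ↦ by
      obtain ⟨a, s, hs, rfl⟩ := IsFractionRing.div_surjective B l
      rw [map_div₀, ← IsScalarTower.algebraMap_apply, ← IsScalarTower.algebraMap_apply, div_eq_mul_inv]
      exact O.mul_mem (hO.isLocalizationOf.le (A.algebraMap_mem a)) (hO.inv_mem s (nonZeroDivisors.ne_zero hs)) }

variable {κ : Type*} [Finite κ] [Nonempty κ] {A : κ → Subalgebra B K}

/-- A functional on forms that is regular on all charts vanishes on products with a vertical factor. -/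
theorem FiberVanishing.eq_zero_of_mem_verticalForms (hF : FiberVanishing k A) (hA : ∀ i, IsNormalChart k (A i)) {ι : Type*}
    [Fintype ι] (σ : Module.Dual K (MultilinearMap K (fun _ : ι ↦ Ω[K⁄k]) K))
    (hσ : ∀ i Λ, IsRegularOn (D k K) ((A i).restrictScalars k) Λ → σ Λ ∈ A i) (ξ : ι → Module.Dual K Ω[K⁄k]) (i₀ : ι)
    (hξ : ξ i₀ ∈ verticalForms k B K) : σ (MultilinearMap.prodForm K _ _ ξ) = 0 := by
  classical
  let L := FractionRing B
  let _ : Algebra L K := FractionRing.liftAlgebra B K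
  have : IsScalarTower k L K := IsScalarTower.of_algebraMap_eq fun c ↦ by
    rw [IsScalarTower.algebraMap_apply k B L, ← IsScalarTower.algebraMap_apply B L K, ← IsScalarTower.algebraMap_apply k B K]
  have := (hA (Classical.arbitrary κ)).essFiniteType
  have : Algebra.EssFiniteType L K := .of_comp k L K
  have : CharZero L := charZero_of_injective_algebraMap (algebraMap k L).injective
  let f := σ.compMultilinearMap (MultilinearMap.prodForm K Ω[K⁄k] ι)
  -- Strong induction on the number of slots outside the set I of vertical ones: families with more
  -- vertical slots come first.
  suffices ∀ (n : ℕ) (I : Finset ι), I.Nonempty → Fintype.card ι - I.card = n → ∀ ξ : ι → Module.Dual K Ω[K⁄k],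
      (∀ i ∈ I, ξ i ∈ verticalForms k B K) → f ξ = 0 from
    this _ {i₀} (Finset.singleton_nonempty _) rfl ξ fun i hi ↦ by rwa [Finset.mem_singleton.mp hi]
  intro n
  induction n using Nat.strong_induction_on with
  | _ n ih =>
  intro I hI hn ξ hξ
  have hf : ∀ I', I ⊂ I' → ∀ ξ : ι → _, (∀ i ∈ I', ξ i ∈ verticalForms k B K) → f ξ = 0 := by
    intro I' hI' ξ hξ
    have h1 := Finset.card_lt_card hI'
    have h2 := Finset.card_le_univ I'
    exact ih _ (by omega) I' (hI.mono hI'.subset) rfl ξ hξ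
  -- The case in which every slot outside I extends a derivation of L; the general case follows by
  -- linearity.
  have main : ∀ ξ : ι → Module.Dual K Ω[K⁄k], (∀ i ∈ I, ξ i ∈ verticalForms k B K) →
      (∀ i ∉ I, ∃ D₀ : Derivation k L L, ∀ l, ξ i (D k K (algebraMap L K l)) = algebraMap L K (D₀ l)) → f ξ = 0 := by
    intro ξ hξI hξE
    have : Nonempty {i // i ∈ I} := ⟨⟨hI.choose, hI.choose_spec⟩⟩
    let τ : MultilinearMap K (fun _ : {i // i ∈ I} ↦ Module.Dual K Ω[K⁄B]) K :=
      (f.domDomRestrict (· ∈ I) (fun a ↦ ξ a)).compLinearMap (fun _ ↦ (map k B K K).dualMap)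
    have hτ : ∀ η, τ η = f (fun j ↦ if h : j ∈ I then η ⟨j, h⟩ ∘ₗ map k B K K else ξ j) := fun _ ↦ rfl
    -- With the slots outside I fixed, f is a form τ on relative vector fields, to be tested at
    -- horizontal local rings O.
    have hτ0 : τ = 0 := by
      refine hF.eq_zero hA τ fun i O hO η hη ↦ ?_
      rw [hτ]
      have := hO.dvr
      have : IsFractionRing ((A i).restrictScalars k) K := (hA i).isFractionRing
      have hOK : IsFractionRing O K := hO.isLocalizationOf.isFractionRing
      have hE : ∀ j ∉ I, ∃ ξ' : Module.Dual K Ω[K⁄k], ξ' - ξ j ∈ verticalForms k B K ∧ ∀ y ∈ O, ξ' (D k K y) ∈ O := by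
        intro j hj
        obtain ⟨D₀, hD₀⟩ := hξE j hj
        let O' : Subalgebra L K := hO.toSubalgebra
        have : IsDiscreteValuationRing O' := hO.dvr
        have : IsFractionRing O' K := hOK
        obtain ⟨E, hEL, hEO⟩ := exists_derivation_extension_of_isDiscreteValuationRing (k := k) O' (fun E ↦ by
          obtain ⟨a, ha, ha0, haO⟩ := exists_mul_dual_mem E (hA i).fg hO.isLocalizationOf LinearMap.id
          exact ⟨a, hO.isLocalizationOf.le ha, ha0, haO⟩) D₀
        refine ⟨E.liftKaehlerDifferential, ?_, fun y hy ↦ ?_⟩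
        · rw [mem_verticalForms_iff (L := L)]
          intro l
          rw [LinearMap.sub_apply, Derivation.liftKaehlerDifferential_comp_D, hEL, hD₀, sub_self]
        · rw [Derivation.liftKaehlerDifferential_comp_D]
          exact hEO y hy
      choose! ξ' hξ'N hξ'O using hE
      -- Replacing each slot outside I by an extension of the same derivation of L that preserves O
      -- changes it by a vertical form, hence by `hf` not the value of f. After the exchange all
      -- slots preserve O.
      have h1 := f.eq_of_sub_mem (verticalForms k B K) I hf
        (ξ := fun j ↦ if h : j ∈ I then η ⟨j, h⟩ ∘ₗ map k B K K else ξ j)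
        (ξ' := fun j ↦ if h : j ∈ I then η ⟨j, h⟩ ∘ₗ map k B K K else ξ' j)
        (fun j hj ↦ by simp only [hj, dite_true]; exact comp_mem_verticalForms _)
        (fun j hj ↦ by simp only [hj, dite_true])
        (fun j ↦ by
          by_cases hj : j ∈ I
          · simp only [hj, dite_true, sub_self]; exact zero_mem _
          · simp only [hj, dite_false]; exact hξ'N j hj)
      rw [← h1]
      refine mem_of_isRegularOn_localization (δ := D k K) (hA i).fg hO.isLocalizationOf σ (hσ i) fun a ha ↦ ?_
      rw [MultilinearMap.prodForm_apply]
      refine O.prod_mem fun j _ ↦ ?_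
      by_cases hj : j ∈ I
      · simp only [hj, dite_true]
        rw [LinearMap.comp_apply, map_D]
        exact hη _ _ (ha j)
      · simp only [hj, dite_false]
        exact hξ'O j hj _ (ha j)
    choose! η hη using fun j (hj : j ∈ I) ↦ exists_eq_comp_of_mem_verticalForms (hξI j hj)
    have h2 : (fun j ↦ if h : j ∈ I then η j ∘ₗ map k B K K else ξ j) = ξ := by
      funext j
      split_ifs with h
      · exact (hη j h).symm
      · rfl
    have h3 := hτ (fun j ↦ η j)
    rw [hτ0] at h3
    rw [← h2]
    exact h3.symm
  -- As a form in the slots outside I, f is determined by its values on extensions of derivations of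
  -- L, which span.
  let g := f.domDomRestrict (· ∉ I) (fun a ↦ ξ a)
  have hg : g = 0 := by
    refine MultilinearMap.ext_of_span _ (span_extensions_eq_top (k := k) (B := B) (K := K) (L := L)) fun c hc ↦ ?_
    refine main (fun j ↦ if h : j ∉ I then c ⟨j, h⟩ else ξ j) (fun i hi ↦ ?_) (fun i hi ↦ ?_)
    · rw [dif_neg (not_not.mpr hi)]; exact hξ i hi
    · rw [dif_pos hi]; exact hc _
  have h2 : (fun j ↦ if h : j ∉ I then ξ j else ξ j) = ξ := by
    funext j
    split_ifs <;> rfl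
  have h3 : g (fun a ↦ ξ a) = f (fun j ↦ if h : j ∉ I then ξ j else ξ j) := rfl
  rw [hg] at h3
  rw [← h2]
  exact h3.symm

end

end

/-! ### Lifting forms from a fiber and reducing regular functionals -/

section

set_option linter.unusedSectionVars false
open KaehlerDifferential

lemma Derivation.mem_span_of_isLocalization {R R' M : Type*} [CommRing R] [CommRing R'] [Algebra R R'] (S : Submonoid R)
    [IsLocalization S R'] [AddCommGroup M] [Module R' M] (δ : Derivation ℤ R' M) (x : R') :
    δ x ∈ Submodule.span R' (Set.range fun c : R ↦ δ (algebraMap R R' c)) := by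
  obtain ⟨c, s, rfl⟩ := IsLocalization.exists_mk'_eq S x
  have h1 := congrArg δ (IsLocalization.mk'_spec' R' c s)
  rw [δ.leibniz, ← eq_sub_iff_add_eq] at h1
  have h2 : algebraMap R R' s • δ (IsLocalization.mk' R' c s) ∈ Submodule.span R' (Set.range fun c : R ↦ δ (algebraMap R R' c)) := by
    rw [h1]
    exact sub_mem (Submodule.subset_span ⟨c, rfl⟩) (Submodule.smul_mem _ _ (Submodule.subset_span ⟨s, rfl⟩))
  obtain ⟨v, hv⟩ := (IsLocalization.map_units R' s).exists_left_inv
  have h3 := Submodule.smul_mem _ v h2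
  rwa [smul_smul, hv, one_smul] at h3

/-- Compatibility of two multilinear forms on differentials extends to a localization. -/
lemma MultilinearMap.exists_of_isLocalization {R R' K L W₁ W₂ ι : Type*} [Finite ι] [CommRing R] [CommRing R'] [Algebra R R']
    (S : Submonoid R) [IsLocalization S R'] [CommRing K] [CommRing L] [AddCommGroup W₁] [Module K W₁] [AddCommGroup W₂]
    [Module L W₂] (φ : R' →+* K) (χ : R' →+* L) (δ₁ : Derivation ℤ K W₁) (δ₂ : Derivation ℤ L W₂)
    (Λ : MultilinearMap K (fun _ : ι ↦ W₁) K) (μ : MultilinearMap L (fun _ : ι ↦ W₂) L)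
    (h : ∀ c : ι → R, ∃ r : R', φ r = Λ (fun i ↦ δ₁ (φ (algebraMap R R' (c i)))) ∧
      χ r = μ (fun i ↦ δ₂ (χ (algebraMap R R' (c i))))) (c : ι → R') :
    ∃ r : R', φ r = Λ (fun i ↦ δ₁ (φ (c i))) ∧ χ r = μ (fun i ↦ δ₂ (χ (c i))) := by
  let _ := φ.toAlgebra
  let _ := χ.toAlgebra
  let _ := Module.compHom W₁ φ
  let _ := Module.compHom W₂ χ
  have : IsScalarTower R' K W₁ := IsScalarTower.of_algebraMap_smul fun _ _ ↦ rfl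
  have : IsScalarTower R' L W₂ := IsScalarTower.of_algebraMap_smul fun _ _ ↦ rfl
  -- The two derivations are combined into one and the two forms into Θ. Compatibility then says
  -- that Θ takes values in the image of R' in K × L, and such a statement extends from a spanning
  -- set.
  let δ : Derivation ℤ R' (W₁ × W₂) := Derivation.mk'
    (AddMonoidHom.toIntLinearMap (AddMonoidHom.mk' (fun x ↦ (δ₁ (φ x), δ₂ (χ x))) fun x y ↦ by simp))
    fun x y ↦ by
      refine Prod.ext ?_ ?_
      · exact (congrArg δ₁ (map_mul φ x y)).trans (δ₁.leibniz _ _)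
      · exact (congrArg δ₂ (map_mul χ x y)).trans (δ₂.leibniz _ _)
  let Θ : MultilinearMap R' (fun _ : ι ↦ W₁ × W₂) (K × L) :=
    ((Λ.restrictScalars R').compLinearMap fun _ ↦ LinearMap.fst R' W₁ W₂).prod
      ((μ.restrictScalars R').compLinearMap fun _ ↦ LinearMap.snd R' W₁ W₂)
  have hΘ : ∀ v, Θ v = (Λ fun i ↦ (v i).1, μ fun i ↦ (v i).2) := fun _ ↦ rfl
  have key := Θ.mem_of_span (A := R') (Set.range fun c : R ↦ δ (algebraMap R R' c))
    (LinearMap.range (LinearMap.prod (Algebra.linearMap R' K) (Algebra.linearMap R' L))) (fun v hv ↦ by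
      choose c hc using hv
      obtain rfl := funext hc
      obtain ⟨r, h1, h2⟩ := h c
      exact ⟨r, Prod.ext h1 h2⟩) (fun i ↦ δ (c i)) fun i ↦ δ.mem_span_of_isLocalization S (c i)
  obtain ⟨r, hr⟩ := key
  exact ⟨r, congrArg Prod.fst hr, congrArg Prod.snd hr⟩

section lift
variable {B A A' K L W : Type u} [CommRing B] [CommRing A] [IsDomain A] [CommRing A'] [Field K] [CommRing L]
  [Algebra B A] [Algebra A A'] [Algebra B A'] [IsScalarTower B A A'] [Algebra A K] [Algebra B K] [IsScalarTower B A K]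
  [Algebra A' K] [IsScalarTower A A' K] [IsFractionRing A K] [FiniteDimensional K Ω[K⁄B]]
  {I : Ideal B} {j : ℕ}

lemma span_map_D : Submodule.span K (Set.range fun a : A ↦ D B K (algebraMap A K a)) = ⊤ := by
  rw [← span_range_map_derivation_of_isLocalization B A K (nonZeroDivisors A)]
  congr 2
  funext a
  exact (map_D B B A K a).symm

/-- A multilinear form on the differentials of a fiber lifts to the total space. -/
lemma exists_compatible_form (hlift : ∀ φ : MultilinearMap A (fun _ : Fin j ↦ Ω[A⁄B]) (A' ⧸ I.map (algebraMap B A')),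
        ∃ ψ : MultilinearMap A (fun _ : Fin j ↦ Ω[A⁄B]) A', ∀ t, Ideal.Quotient.mk _ (ψ t) = φ t)
    [AddCommGroup W] [Module L W] (χ : A' →+* L) (hχ : Function.Surjective χ) (hker : RingHom.ker χ = I.map (algebraMap B A'))
    (δ : Derivation ℤ L W) (hδ : ∀ b, δ (χ (algebraMap B A' b)) = 0) (μ : MultilinearMap L (fun _ : Fin j ↦ W) L) :
    ∃ Λ : MultilinearMap K (fun _ : Fin j ↦ Ω[K⁄B]) K, ∀ c : Fin j → A, ∃ r : A',
      algebraMap A' K r = Λ (fun i ↦ D B K (algebraMap A K (c i))) ∧ χ r = μ (fun i ↦ δ (χ (algebraMap A A' (c i)))) := by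
  let χA : A →+* L := χ.comp (algebraMap A A')
  let _ := χA.toAlgebra
  let _ := (χ.comp (algebraMap B A')).toAlgebra
  let _ := Module.compHom W χA
  let _ := Module.compHom W (χ.comp (algebraMap B A'))
  have : IsScalarTower A L W := IsScalarTower.of_algebraMap_smul fun _ _ ↦ rfl
  have hBA : ∀ b : B, algebraMap B A' b = algebraMap A A' (algebraMap B A b) := IsScalarTower.algebraMap_apply B A A'
  have : IsScalarTower B A W := IsScalarTower.of_algebraMap_smul fun b w ↦
    congrArg (fun z ↦ χ z • w) (hBA b).symm
  -- The derivation δ ∘ χ kills the functions from B, so it factors through Ω[A⁄B].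
  let δA : Derivation B A W := Derivation.mk'
    { toFun := fun x ↦ δ (χA x)
      map_add' := fun x y ↦ by rw [map_add, map_add]
      map_smul' := fun b x ↦ by
        rw [Algebra.smul_def, map_mul, δ.leibniz]
        have h0 : δ (χA (algebraMap B A b)) = 0 := by
          have := hδ b
          rwa [hBA] at this
        rw [h0, smul_zero, add_zero]
        exact congrArg (fun z ↦ χ z • δ (χA x)) (hBA b).symm }
    fun x y ↦ (congrArg δ (map_mul χA x y)).trans (δ.leibniz _ _)
  let e : L ≃+* A' ⧸ I.map (algebraMap B A') :=
    ((Ideal.quotEquivOfEq hker.symm).trans (RingHom.quotientKerEquivOfSurjective hχ)).symm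
  have he : ∀ r : A', e (χ r) = Ideal.Quotient.mk _ r := fun r ↦ by
    rw [RingEquiv.symm_apply_eq]
    rfl
  let eA : L →ₗ[A] A' ⧸ I.map (algebraMap B A') :=
    { toFun := e
      map_add' := map_add e
      map_smul' := fun a x ↦ by
        obtain ⟨y, rfl⟩ := hχ x
        have : a • χ y = χ (a • y) := by rw [Algebra.smul_def, Algebra.smul_def, map_mul]; rfl
        rw [this, he, he]
        rfl }
  -- Through χ, the form μ becomes a form on Ω[A⁄B] with values in A' / I A'. It lifts to A' and
  -- then extends to the function field.
  obtain ⟨ψ, hψ⟩ := hlift (eA.compMultilinearMap ((μ.restrictScalars A).compLinearMap fun _ ↦ δA.liftKaehlerDifferential))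
  obtain ⟨Λ, hΛ⟩ := exists_multilinear_extension (K := K) ((Algebra.linearMap A' K).restrictScalars A |>.compMultilinearMap ψ)
  refine ⟨Λ, fun c ↦ ⟨ψ fun i ↦ D B A (c i), ?_, ?_⟩⟩
  · refine (hΛ fun i ↦ D B A (c i)).symm.trans ?_
    simp only [map_D]
  · refine e.injective ((he _).trans ((hψ _).trans ?_))
    refine congrArg e (congrArg μ (funext fun i ↦ ?_))
    exact δA.liftKaehlerDifferential_comp_D (c i)

/-- A form that vanishes on a fiber has vanishing image under a regular functional. -/
lemma exists_mem_map_of_forall_mem_map [FaithfulSMul A' K] (hpure : ∀ ψ : MultilinearMap A (fun _ : Fin j ↦ Ω[A⁄B]) A',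
      (∀ t, ψ t ∈ I.map (algebraMap B A')) →
        ψ ∈ Submodule.span A {ψ : MultilinearMap A (fun _ : Fin j ↦ Ω[A⁄B]) A' | ∃ b ∈ I, ∃ ψ', ψ = algebraMap B A b • ψ'})
    (σ : Module.Dual K (MultilinearMap K (fun _ : Fin j ↦ Ω[K⁄B]) K))
    (hσ : ∀ Λ : MultilinearMap K (fun _ : Fin j ↦ Ω[K⁄B]) K,
      (∀ c : Fin j → A, ∃ r : A', algebraMap A' K r = Λ (fun i ↦ D B K (algebraMap A K (c i)))) →
        ∃ r : A', algebraMap A' K r = σ Λ)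
    (Λ : MultilinearMap K (fun _ : Fin j ↦ Ω[K⁄B]) K)
    (hΛ : ∀ c : Fin j → A, ∃ r ∈ I.map (algebraMap B A'), algebraMap A' K r = Λ (fun i ↦ D B K (algebraMap A K (c i)))) :
    ∃ r ∈ I.map (algebraMap B A'), algebraMap A' K r = σ Λ := by
  have hinj := FaithfulSMul.algebraMap_injective A' K
  have : IsScalarTower B A' K := IsScalarTower.of_algebraMap_eq fun b ↦ by
    rw [IsScalarTower.algebraMap_apply B A A', ← IsScalarTower.algebraMap_apply A A' K, ← IsScalarTower.algebraMap_apply B A K]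
  let P : Submodule A K := (Submodule.restrictScalars A (I.map (algebraMap B A'))).map
    ((Algebra.linearMap A' K).restrictScalars A)
  let ΛA : MultilinearMap A (fun _ : Fin j ↦ Ω[A⁄B]) K := (Λ.restrictScalars A).compLinearMap fun _ ↦ map B B A K
  have hP : ∀ t, ΛA t ∈ P := fun t ↦ by
    refine ΛA.mem_of_span (A := A) (Set.range (D B A)) P (fun v hv ↦ ?_) t fun i ↦ by
      rw [span_range_derivation]; trivial
    choose c hc using hv
    obtain rfl := funext hc
    obtain ⟨r, hr, e⟩ := hΛ c
    refine ⟨r, hr, e.trans ?_⟩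
    refine congrArg Λ (funext fun i ↦ ?_)
    exact (map_D B B A K (c i)).symm
  -- As A' embeds in K, the chosen preimages are unique, and therefore multilinear in the arguments.
  choose ψ₀ hψ₀ e₀ using hP
  let ψ : MultilinearMap A (fun _ : Fin j ↦ Ω[A⁄B]) A' :=
    { toFun := ψ₀
      map_update_add' := fun {_} t i x y ↦ hinj (by
        rw [map_add]
        refine (e₀ _).trans (Eq.trans ?_ (congrArg₂ _ (e₀ _) (e₀ _)).symm)
        convert ΛA.map_update_add t i x y)
      map_update_smul' := fun {_} t i a x ↦ hinj (by
        refine (e₀ _).trans (Eq.trans ?_ (((Algebra.linearMap A' K).restrictScalars A).map_smul a _).symm)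
        refine Eq.trans ?_ (congrArg (a • ·) (e₀ _)).symm
        convert ΛA.map_update_smul t i a x) }
  have uniq : ∀ Λ₁ Λ₂ : MultilinearMap K (fun _ : Fin j ↦ Ω[K⁄B]) K,
      (∀ t : Fin j → Ω[A⁄B], Λ₁ (fun i ↦ map B B A K (t i)) = Λ₂ (fun i ↦ map B B A K (t i))) → Λ₁ = Λ₂ := by
    intro Λ₁ Λ₂ h
    refine MultilinearMap.ext_of_span _ (span_map_D (A := A)) fun v hv ↦ ?_
    choose c hc using hv
    obtain rfl := funext hc
    have := h fun i ↦ D B A (c i)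
    simpa only [map_D] using this
  -- On a generator b ψ' the extension to K is b Λ', where Λ' is regular; its value under σ is b
  -- σ(Λ'), which lies in I A'.
  have main : ∀ ψ ∈ Submodule.span A {ψ : MultilinearMap A (fun _ : Fin j ↦ Ω[A⁄B]) A' | ∃ b ∈ I, ∃ ψ', ψ = algebraMap B A b • ψ'},
      ∀ Λ : MultilinearMap K (fun _ : Fin j ↦ Ω[K⁄B]) K,
        (∀ t : Fin j → Ω[A⁄B], Λ (fun i ↦ map B B A K (t i)) = algebraMap A' K (ψ t)) → ∃ r ∈ I.map (algebraMap B A'), algebraMap A' K r = σ Λ := by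
    intro ψ hψ
    have ext : ∀ ψ : MultilinearMap A (fun _ : Fin j ↦ Ω[A⁄B]) A', ∃ Λ : MultilinearMap K (fun _ : Fin j ↦ Ω[K⁄B]) K,
        ∀ t : Fin j → Ω[A⁄B], Λ (fun i ↦ map B B A K (t i)) = algebraMap A' K (ψ t) := fun ψ ↦
      exists_multilinear_extension (K := K) ((Algebra.linearMap A' K).restrictScalars A |>.compMultilinearMap ψ)
    induction hψ using Submodule.span_induction with
    | mem ψ h =>
      obtain ⟨b, hb, ψ', rfl⟩ := h
      intro Λ hΛ
      obtain ⟨Λ', hΛ'⟩ := ext ψ'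
      obtain ⟨r, hr⟩ := hσ Λ' fun c ↦ ⟨ψ' fun i ↦ D B A (c i), by rw [← hΛ']; simp only [map_D]⟩
      have : Λ = algebraMap B K b • Λ' := uniq _ _ fun t ↦ by
        rw [hΛ, smul_apply, smul_apply, hΛ', Algebra.smul_def, map_mul, smul_eq_mul, ← IsScalarTower.algebraMap_apply A A' K,
          ← IsScalarTower.algebraMap_apply B A K]
      refine ⟨algebraMap B A' b * r, Ideal.mul_mem_right _ _ (Ideal.mem_map_of_mem _ hb), ?_⟩
      rw [this, map_smul, map_mul, hr, ← IsScalarTower.algebraMap_apply B A' K, smul_eq_mul]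
    | zero =>
      intro Λ hΛ
      have : Λ = 0 := uniq _ _ fun t ↦ by rw [hΛ]; simp
      exact ⟨0, zero_mem _, by rw [this, map_zero, map_zero]⟩
    | add ψ₁ ψ₂ _ _ h₁ h₂ =>
      intro Λ hΛ
      obtain ⟨Λ₁, hΛ₁⟩ := ext ψ₁
      obtain ⟨Λ₂, hΛ₂⟩ := ext ψ₂
      obtain ⟨r₁, hr₁, e₁⟩ := h₁ Λ₁ hΛ₁
      obtain ⟨r₂, hr₂, e₂⟩ := h₂ Λ₂ hΛ₂
      have : Λ = Λ₁ + Λ₂ := uniq _ _ fun t ↦ by rw [hΛ, add_apply, add_apply, hΛ₁, hΛ₂, map_add]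
      exact ⟨r₁ + r₂, add_mem hr₁ hr₂, by rw [this, map_add, map_add, e₁, e₂]⟩
    | smul a ψ' _ h =>
      intro Λ hΛ
      obtain ⟨Λ', hΛ'⟩ := ext ψ'
      obtain ⟨r, hr, e⟩ := h Λ' hΛ'
      have : Λ = algebraMap A K a • Λ' := uniq _ _ fun t ↦ by
        rw [hΛ, smul_apply, smul_apply, hΛ', Algebra.smul_def, map_mul, smul_eq_mul, ← IsScalarTower.algebraMap_apply A A' K]
      refine ⟨algebraMap A A' a * r, Ideal.mul_mem_left _ _ hr, ?_⟩
      rw [this, map_smul, map_mul, e, ← IsScalarTower.algebraMap_apply A A' K, smul_eq_mul]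
  exact main ψ (hpure ψ hψ₀) Λ fun t ↦ (e₀ t).symm

end lift

end

/-! ### Tensor powers of presheaves and duals of associated sheaves -/

noncomputable section

namespace PluriForm
open MonoidalCategory

variable {X : Scheme.{u}}

/-- The universal multilinear map to the tensor power. -/
def ptens (P : Pre X) (V : (Opens X)ᵒᵖ) : ∀ m : ℕ,
    MultilinearMap (X.presheaf.obj V) (fun _ : Fin m ↦ (P.obj V : Type u)) ((tpow P m).obj V : Type u)
  | 0 => MultilinearMap.constOfIsEmpty (X.presheaf.obj V) (fun _ : Fin 0 ↦ (P.obj V : Type u))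
      (show ((tpow P 0).obj V : Type u) from (1 : X.presheaf.obj V))
  | m + 1 => LinearMap.uncurryLeft (M := fun _ : Fin (m + 1) ↦ (P.obj V : Type u))
      { toFun := fun x ↦ (TensorProduct.mk (X.presheaf.obj V) (P.obj V : Type u)
          ((tpow P m).obj V : Type u) x).compMultilinearMap (ptens P V m)
        map_add' := fun x y ↦ by
          ext s
          exact TensorProduct.add_tmul x y _
        map_smul' := fun a x ↦ by
          ext s
          exact (TensorProduct.smul_tmul' a x _).symm }

lemma ptens_succ (P : Pre X) (V : (Opens X)ᵒᵖ) (m : ℕ) (s : Fin (m + 1) → (P.obj V : Type u)) :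
    ptens P V (m + 1) s =
      (s 0 ⊗ₜ[X.presheaf.obj V] ptens P V m (Fin.tail s) : TensorProduct (X.presheaf.obj V) (P.obj V : Type u)
          ((tpow P m).obj V : Type u)) := rfl

/-- The linear map on the tensor power given by a multilinear map. -/
def liftTens (P : Pre X) (V : (Opens X)ᵒᵖ) {N : Type u} [AddCommGroup N] [Module (X.presheaf.obj V) N] :
    ∀ m : ℕ, MultilinearMap (X.presheaf.obj V) (fun _ : Fin m ↦ (P.obj V : Type u)) N →ₗ[X.presheaf.obj V]
      (((tpow P m).obj V : Type u) →ₗ[X.presheaf.obj V] N)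
  | 0 => 
      { toFun := fun f ↦ (LinearMap.toSpanSingleton (X.presheaf.obj V) N (f Fin.elim0) :
          X.presheaf.obj V →ₗ[X.presheaf.obj V] N)
        map_add' := fun f g ↦ LinearMap.ext fun a ↦ smul_add (A := N) a _ _
        map_smul' := fun b f ↦ LinearMap.ext fun a ↦ smul_comm (α := N) a b _ }
  | m + 1 =>
      { toFun := fun f ↦ (TensorProduct.lift (R := X.presheaf.obj V) (M := (P.obj V : Type u))
          (N := ((tpow P m).obj V : Type u)) ((liftTens P V m) ∘ₗ f.curryLeft) :
           TensorProduct (X.presheaf.obj V) (P.obj V : Type u) ((tpow P m).obj V : Type u) →ₗ[X.presheaf.obj V] N)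
        map_add' := fun f g ↦ by 
          apply TensorProduct.ext'
          intro x y
          have : (f + g).curryLeft x = f.curryLeft x + g.curryLeft x := rfl
          simp only [TensorProduct.lift.tmul, LinearMap.comp_apply, LinearMap.add_apply, this, map_add]
          rfl
        map_smul' := fun a f ↦ by
          apply TensorProduct.ext'
          intro x y
          have : (a • f).curryLeft x = a • f.curryLeft x := rfl
          simp only [TensorProduct.lift.tmul, LinearMap.comp_apply, LinearMap.smul_apply, this, map_smul,
            RingHom.id_apply]
          rfl }

lemma liftTens_ptens (P : Pre X) (V : (Opens X)ᵒᵖ) {N : Type u} [AddCommGroup N] [Module (X.presheaf.obj V) N]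
    (m : ℕ) (f : MultilinearMap (X.presheaf.obj V) (fun _ : Fin m ↦ (P.obj V : Type u)) N)
    (s : Fin m → (P.obj V : Type u)) : liftTens P V m f (ptens P V m s) = f s := by
  induction m with
  | zero => 
    refine (one_smul (X.presheaf.obj V) (f Fin.elim0)).trans ?_
    congr 1; exact Subsingleton.elim _ _
  | succ m ih => 
    refine (ih (f.curryLeft (s 0)) (Fin.tail s)).trans ?_
    simp

lemma tpow_hom_ext (P : Pre X) (V : (Opens X)ᵒᵖ) {N : Type u} [AddCommGroup N] [Module (X.presheaf.obj V) N]
    (m : ℕ) (f g : ((tpow P m).obj V : Type u) →ₗ[X.presheaf.obj V] N)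
    (h : ∀ s, f (ptens P V m s) = g (ptens P V m s)) : f = g := by
  induction m generalizing N with
  | zero => 
    exact LinearMap.ext_ring (R := X.presheaf.obj V) (h Fin.elim0)
  | succ m ih => 
    refine TensorProduct.ext (R := X.presheaf.obj V) (M := (P.obj V : Type u)) (N := ((tpow P m).obj V : Type u)) ?_
    ext1 x
    refine ih _ _ fun s ↦ ?_
    have := h (Fin.cons x s)
    simpa [ptens_succ] using! this

lemma ptens_map (P : Pre X) {V W : (Opens X)ᵒᵖ} (i : V ⟶ W) (m : ℕ) (s : Fin m → (P.obj V : Type u)) :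
    (tpow P m).presheaf.map i (ptens P V m s) = ptens P W m (fun j ↦ P.presheaf.map i (s j)) := by
  induction m with
  | zero => exact map_one (X.presheaf.map i).hom
  | succ m ih =>
    refine Eq.trans ?_ (congrArg (fun z ↦ ((P.presheaf.map i (s 0)) ⊗ₜ[X.presheaf.obj W] z :
      TensorProduct (X.presheaf.obj W) (P.obj W : Type u) ((tpow P m).obj W : Type u))) (ih (Fin.tail s)))
    rfl

lemma tpowMap_ptens {P Q : Pre X} (φ : P ⟶ Q) (V : (Opens X)ᵒᵖ) (m : ℕ) (s : Fin m → (P.obj V : Type u)) :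
    (tpowMap φ m).app V (ptens P V m s) = ptens Q V m (fun j ↦ φ.app V (s j)) := by
  induction m with
  | zero => rfl
  | succ m ih =>
    refine Eq.trans ?_ (congrArg (fun z ↦ ((φ.app V (s 0)) ⊗ₜ[X.presheaf.obj V] z :
      TensorProduct (X.presheaf.obj V) (Q.obj V : Type u) ((tpow Q m).obj V : Type u))) (ih (Fin.tail s)))
    rfl


/-- The canonical map from sections of a presheaf to sections of its associated sheaf. -/
def shf (P : Pre X) (U : X.Opens) :
    (P.obj (op U) : Type u) →ₗ[Γ(X, U)] Γ(sheafify.obj P, U) :=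
  ((toSheafify P).app (op U)).hom

lemma shf_res (P : Pre X) {U V : X.Opens} (h : V ≤ U) (t : (P.obj (op U) : Type u)) :
    shf P V (P.presheaf.map (homOfLE h).op t) =
      (sheafify.obj P).presheaf.map (homOfLE h).op (shf P U t) :=
  ConcreteCategory.congr_hom
    (((PresheafOfModules.toPresheaf _).map (toSheafify P)).naturality (homOfLE h).op) t

lemma shf_locally_surjective (P : Pre X) {U : X.Opens}
    (s : Γ(sheafify.obj P, U)) {x : X} (hx : x ∈ U) :
    ∃ (V : X.Opens) (h : V ≤ U) (_ : x ∈ V) (t : (P.obj (op V) : Type u)),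
     shf P V t = (sheafify.obj P).presheaf.map (homOfLE h).op s := by
  obtain ⟨V, i, ⟨t, ht⟩, hxV⟩ := Presheaf.imageSieve_mem (Opens.grothendieckTopology X)
    (CategoryTheory.toSheafify (Opens.grothendieckTopology X) P.presheaf) s x hx
  exact ⟨V, i.le, hxV, t, ht⟩

lemma shf_locally_injective (P : Pre X) {U : X.Opens}
    (s t : (P.obj (op U) : Type u)) (h : shf P U s = shf P U t) {x : X} (hx : x ∈ U) :
    ∃ (V : X.Opens) (h : V ≤ U), x ∈ V ∧
      P.presheaf.map (homOfLE h).op s = P.presheaf.map (homOfLE h).op t := by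
  obtain ⟨V, i, hi, hxV⟩ := Presheaf.equalizerSieve_mem (Opens.grothendieckTopology X)
    (CategoryTheory.toSheafify (Opens.grothendieckTopology X) P.presheaf) s t h x hx
  exact ⟨V, i.le, hxV, hi⟩

lemma O_ext {U : X.Opens} {a b : Γ(X, U)} (h : ∀ x ∈ U, ∃ (V : X.Opens) (hV : V ≤ U), x ∈ V ∧
    X.presheaf.map (homOfLE hV).op a = X.presheaf.map (homOfLE hV).op b) : a = b := by
  choose V hV hxV e using h
  refine TopCat.Sheaf.eq_of_locally_eq' X.sheaf (fun x : U ↦ V x.1 x.2) U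
    (fun x ↦ homOfLE (hV x.1 x.2)) (fun x hx ↦ Opens.mem_iSup.mpr ⟨⟨x, hx⟩, hxV x hx⟩) a b
    fun x ↦ e x.1 x.2

lemma O_res_res {U V W : X.Opens} (h : V ≤ U) (h' : W ≤ V) (s : Γ(X, U)) :
    X.presheaf.map (homOfLE h').op (X.presheaf.map (homOfLE h).op s) =
      X.presheaf.map (homOfLE (h'.trans h)).op s := by
  rw [← ConcreteCategory.comp_apply, ← Functor.map_comp]; rfl

lemma dualSections_sheafify_ext (P : Pre X) {U : X.Opens}
    (φ ψ : dualSections (sheafify.obj P) U)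
    (h : ∀ (V : {V : X.Opens // V ≤ U}) (t : (P.obj (op V.1) : Type u)), φ.1 V (shf P V.1 t) = ψ.1 V (shf P V.1 t)) :
    φ = ψ := by
  apply Subtype.ext; funext V; ext s
  refine O_ext fun x hx ↦ ?_
  obtain ⟨W, hW, hxW, t, ht⟩ := shf_locally_surjective P s hx
  refine ⟨W, hW, hxW, ?_⟩
  rw [← φ.2 V ⟨W, hW.trans V.2⟩ hW s, ← ψ.2 V ⟨W, hW.trans V.2⟩ hW s, ← ht]
  exact h ⟨W, hW.trans V.2⟩ t

/-- The universal property of sheafification on sections over U: a linear map to the sheaf 𝒪_X is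
determined by its values on the presheaf and may be prescribed there. -/
lemma exists_dualSections_sheafify (P : Pre X) (U : X.Opens)
    (φ : ∀ V : {V : X.Opens // V ≤ U}, (P.obj (op V.1) : Type u) →ₗ[Γ(X, V.1)] Γ(X, V.1))
    (hφ : ∀ (V W : {V : X.Opens // V ≤ U}) (h : W.1 ≤ V.1) (s : (P.obj (op V.1) : Type u)),
      φ W (P.presheaf.map (homOfLE h).op s) = X.presheaf.map (homOfLE h).op (φ V s)) :
    ∃ ψ : dualSections (sheafify.obj P) U, ∀ (V : {V : X.Opens // V ≤ U}) (t : (P.obj (op V.1) : Type u)),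
      ψ.1 V (shf P V.1 t) = φ V t := by
  have uniq : ∀ (V : {V : X.Opens // V ≤ U}) (t t' : (P.obj (op V.1) : Type u)), shf P V.1 t = shf P V.1 t' →
      φ V t = φ V t' := by
    intro V t t' h
    refine O_ext fun x hx ↦ ?_
    obtain ⟨W, hW, hxW, e⟩ := shf_locally_injective P t t' h hx
    refine ⟨W, hW, hxW, ?_⟩
    rw [← hφ V ⟨W, hW.trans V.2⟩ hW, ← hφ V ⟨W, hW.trans V.2⟩ hW, e]
  -- The value at s is glued from all pairs (W, t) of an open set and a local lift of s, and it is
  -- characterized by its restrictions to them. As no cover is chosen, linearity and compatibility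
  -- follow from uniqueness.
  have key : ∀ (V : {V : X.Opens // V ≤ U}) (s : Γ(sheafify.obj P, V.1)), ∃! r : Γ(X, V.1),
      ∀ (W : X.Opens) (hW : W ≤ V.1) (t : (P.obj (op W) : Type u)),
        shf P W t = (sheafify.obj P).presheaf.map (homOfLE hW).op s →
        X.presheaf.map (homOfLE hW).op r = φ ⟨W, hW.trans V.2⟩ t := by
    intro V s
    obtain ⟨r, hr, hu⟩ := TopCat.Sheaf.existsUnique_gluing' X.sheaf
      (fun i : {i : (W : X.Opens) × (P.obj (op W) : Type u) // ∃ hW : i.1 ≤ V.1,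
        shf P i.1 i.2 = (sheafify.obj P).presheaf.map (homOfLE hW).op s} ↦ i.1.1) V.1
      (fun i ↦ homOfLE i.2.1) (fun x hx ↦ by
        obtain ⟨W, hW, hxW, t, ht⟩ := shf_locally_surjective P s hx
        exact Opens.mem_iSup.mpr ⟨⟨⟨W, t⟩, hW, ht⟩, hxW⟩)
      (fun i ↦ φ ⟨i.1.1, i.2.1.trans V.2⟩ i.1.2) (fun i j ↦ by
        obtain ⟨⟨W, t⟩, hW, ht⟩ := i
        obtain ⟨⟨W', t'⟩, hW', ht'⟩ := j
        have h1 := hφ ⟨W, hW.trans V.2⟩ ⟨W ⊓ W', inf_le_left.trans (hW.trans V.2)⟩ inf_le_left t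
        have h2 := hφ ⟨W', hW'.trans V.2⟩ ⟨W ⊓ W', inf_le_left.trans (hW.trans V.2)⟩ inf_le_right t'
        refine h1.symm.trans (Eq.trans (uniq _ _ _ ?_) h2)
        dsimp only at ht ht' ⊢
        rw [shf_res, shf_res, ht, ht', res_res, res_res])
    refine ⟨r, fun W hW t ht ↦ hr ⟨⟨W, t⟩, hW, ht⟩, fun r' hr' ↦ hu r' fun i ↦ hr' _ i.2.1 _ i.2.2⟩
  choose F hF hFu using key
  refine ⟨⟨fun V ↦
    { toFun := F V
      map_add' := fun s s' ↦ ?_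
      map_smul' := fun a s ↦ ?_ }, ?_⟩, ?_⟩
  · refine O_ext fun x hx ↦ ?_
    obtain ⟨W, hW, hxW, t, ht⟩ := shf_locally_surjective P s hx
    obtain ⟨W', hW', hxW', t', ht'⟩ := shf_locally_surjective P s' hx
    have hl : W ⊓ W' ≤ W := inf_le_left
    have hr : W ⊓ W' ≤ W' := inf_le_right
    have e1 : shf P (W ⊓ W') (P.presheaf.map (homOfLE hl).op t) = (sheafify.obj P).presheaf.map (homOfLE (hl.trans hW)).op s := by
      rw [shf_res, ht, res_res]
    have e2 : shf P (W ⊓ W') (P.presheaf.map (homOfLE hr).op t') = (sheafify.obj P).presheaf.map (homOfLE (hl.trans hW)).op s' := by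
      rw [shf_res, ht', res_res]
    refine ⟨W ⊓ W', hl.trans hW, ⟨hxW, hxW'⟩, ?_⟩
    rw [map_add, hF V s _ _ _ e1, hF V s' _ _ _ e2, hF V (s + s') _ _ _ ((map_add _ _ _).trans 
      ((congrArg₂ _ e1 e2).trans (map_add _ _ _).symm))]
    exact LinearMap.map_add _ _ _
  · refine O_ext fun x hx ↦ ?_
    obtain ⟨W, hW, hxW, t, ht⟩ := shf_locally_surjective P s hx
    refine ⟨W, hW, hxW, ?_⟩
    have e : shf P W (X.presheaf.map (homOfLE hW).op a • t) = (sheafify.obj P).presheaf.map (homOfLE hW).op (a • s) := by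
      rw [map_smul, ht, Scheme.Modules.map_smul]
    rw [hF V _ _ _ _ e, map_smul, smul_eq_mul, RingHom.id_apply, smul_eq_mul, map_mul, hF V _ _ _ _ ht]
  · intro V W h s
    refine (hFu W _ _ fun W' hW' t ht ↦ ?_).symm
    rw [O_res_res]
    refine hF V s W' (hW'.trans h) t ?_
    rw [ht, res_res]
  · intro V t
    have := hF V (shf P V.1 t) V.1 le_rfl t (by rw [← shf_res]; congr 1; exact (ConcreteCategory.congr_hom (P.presheaf.map_id (op V.1)) t).symm)
    rwa [res_self] at this

end PluriForm

end

/-! ### Sections of the dual of a tensor power as families of multilinear maps -/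

noncomputable section

namespace PluriForm
open MonoidalCategory

variable {X : Scheme.{u}}

lemma sheafify_map_shf {P Q : Pre X} (φ : P ⟶ Q) (U : X.Opens) (t : (P.obj (op U) : Type u)) :
    (sheafify.map φ).app U (shf P U t) = shf Q U (φ.app (op U) t) := by
  have := (PresheafOfModules.sheafificationAdjunction (𝟙 X.ringCatSheaf.obj)).unit.naturality φ
  exact (ConcreteCategory.congr_hom (congrArg (fun ψ ↦ PresheafOfModules.Hom.app ψ (op U)) this) t).symm

/-- The presheaf of modules underlying an `𝒪_X`-module. -/
abbrev under (M : X.Modules) : Pre X := (Scheme.Modules.toPresheafOfModules X).obj M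

/-- The multilinear maps given by a section of the dual of a tensor power. -/
def evT {M : X.Modules} {m : ℕ} {U : X.Opens} (φ : dualSections (tensorPow M m) U)
    (V : {V : X.Opens // V ≤ U}) :
    MultilinearMap Γ(X, V.1) (fun _ : Fin m ↦ (Γ(M, V.1) : Type u)) Γ(X, V.1) :=
  (φ.1 V ∘ₗ shf (tpow (under M) m) V.1).compMultilinearMap (ptens (under M) (op V.1) m)

/-- The section of the tensor power given by sections of `M`. -/
def pureT {M : X.Modules} {m : ℕ} {U : X.Opens} (s : Fin m → Γ(M, U)) : Γ(tensorPow M m, U) :=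
  shf (tpow (under M) m) U (ptens (under M) (op U) m s)

lemma evT_apply {M : X.Modules} {m : ℕ} {U : X.Opens} (φ : dualSections (tensorPow M m) U)
    (V : {V : X.Opens // V ≤ U}) (s : Fin m → Γ(M, V.1)) : evT φ V s = φ.1 V (pureT s) := rfl

lemma pureT_res {M : X.Modules} {m : ℕ} {U V : X.Opens} (h : V ≤ U) (s : Fin m → Γ(M, U)) :
    (tensorPow M m).presheaf.map (homOfLE h).op (pureT s) =
      pureT (fun i ↦ M.presheaf.map (homOfLE h).op (s i)) := by
  refine (shf_res (tpow (under M) m) h _).symm.trans ?_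
  exact congrArg _ (ptens_map (under M) (homOfLE h).op m s)

lemma evT_res {M : X.Modules} {m : ℕ} {U : X.Opens} (φ : dualSections (tensorPow M m) U)
    (V W : {V : X.Opens // V ≤ U}) (h : W.1 ≤ V.1) (s : Fin m → Γ(M, V.1)) :
    evT φ W (fun i ↦ M.presheaf.map (homOfLE h).op (s i)) = X.presheaf.map (homOfLE h).op (evT φ V s) := by
  rw [evT_apply, evT_apply, ← φ.2 V W h, pureT_res]

lemma evT_ext {M : X.Modules} {m : ℕ} {U : X.Opens} {φ ψ : dualSections (tensorPow M m) U}
    (h : ∀ V s, evT φ V s = evT ψ V s) : φ = ψ := by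
  refine dualSections_sheafify_ext _ _ _ fun V t ↦ ?_
  have := tpow_hom_ext (under M) (op V.1) m (φ.1 V ∘ₗ shf (tpow (under M) m) V.1)
    (ψ.1 V ∘ₗ shf (tpow (under M) m) V.1) (h V)
  exact DFunLike.congr_fun this t

lemma exists_evT {M : X.Modules} {m : ℕ} {U : X.Opens}
    (f : ∀ V : {V : X.Opens // V ≤ U},
      MultilinearMap Γ(X, V.1) (fun _ : Fin m ↦ (Γ(M, V.1) : Type u)) Γ(X, V.1))
    (hf : ∀ (V W : {V : X.Opens // V ≤ U}) (h : W.1 ≤ V.1) (s : Fin m → Γ(M, V.1)),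
      f W (fun i ↦ M.presheaf.map (homOfLE h).op (s i)) = X.presheaf.map (homOfLE h).op (f V s)) :
    ∃ φ : dualSections (tensorPow M m) U, ∀ V s, evT φ V s = f V s := by
  obtain ⟨φ, hφ⟩ := exists_dualSections_sheafify (tpow (under M) m) U
    (fun V ↦ liftTens (under M) (op V.1) m (f V)) (fun V W h ↦ by
      let i : op V.1 ⟶ op W.1 := (homOfLE h).op
      -- With `Γ(X, W)` as a `Γ(X, V)`-module, restriction before and after evaluation become linear
      -- maps on the same tensor power, which are compared on pure tensors.
      let _ := Module.compHom (Γ(X, W.1) : Type u) (X.presheaf.map i).hom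
      let l1 : ((tpow (under M) m).obj (op V.1) : Type u) →ₗ[Γ(X, V.1)] Γ(X, W.1) :=
        { toFun := fun t ↦ liftTens (under M) (op W.1) m (f W) ((tpow (under M) m).presheaf.map i t)
          map_add' := fun a b ↦ (congrArg _ (map_add (ConcreteCategory.hom
            ((tpow (under M) m).presheaf.map i)) a b)).trans (LinearMap.map_add _ _ _)
          map_smul' := fun a b ↦ by
            refine (congrArg _ ((tpow (under M) m).map_smul i a b)).trans ?_
            exact LinearMap.map_smul _ _ _ }
      let l2 : ((tpow (under M) m).obj (op V.1) : Type u) →ₗ[Γ(X, V.1)] Γ(X, W.1) :=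
        { toFun := fun t ↦ X.presheaf.map i (liftTens (under M) (op V.1) m (f V) t)
          map_add' := fun a b ↦ by rw [map_add, map_add]
          map_smul' := fun a b ↦ by
            rw [map_smul, smul_eq_mul, map_mul]; rfl }
      have : l1 = l2 := by
        refine tpow_hom_ext (under M) (op V.1) m _ _ fun s ↦ ?_
        refine (congrArg _ (ptens_map (under M) i m s)).trans ?_
        refine (liftTens_ptens (under M) (op W.1) m _ _).trans ?_
        refine (hf V W h s).trans ?_
        exact congrArg _ (liftTens_ptens (under M) (op V.1) m _ _).symm
      exact fun s ↦ DFunLike.congr_fun this s)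
  refine ⟨φ, fun V s ↦ (hφ V _).trans ?_⟩
  exact liftTens_ptens (under M) (op V.1) m _ _

lemma tensorPowMap_pureT {M N : X.Modules} (α : M ⟶ N) {m : ℕ} {U : X.Opens} (s : Fin m → Γ(M, U)) :
    (tensorPowMap α m).app U (pureT s) = pureT (fun i ↦ α.app U (s i)) :=
  (sheafify_map_shf (X := X) (tpowMap (X := X) ((Scheme.Modules.toPresheafOfModules X).map α) m) U _).trans
    (congrArg _ (tpowMap_ptens (X := X) ((Scheme.Modules.toPresheafOfModules X).map α) (op U) m s))

end PluriForm

end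

/-! ### Generic stalks and regularity of forms -/

noncomputable section

namespace PluriForm

variable {X : Scheme.{u}}

lemma genericPoint_mem [IsIntegral X] {U : X.Opens} {x : X} (hx : x ∈ U) : genericPoint X ∈ U :=
  ((genericPoint_spec X).mem_open_set_iff U.isOpen).mpr (by simpa using ⟨x, hx⟩)

lemma exists_opens_le {ι : Type*} [Finite ι] (U : ι → X.Opens) {x : X} (hx : ∀ i, x ∈ U i) :
    ∃ V : X.Opens, x ∈ V ∧ ∀ i, V ≤ U i := by
  have := Fintype.ofFinite ι
  exact ⟨⟨⋂ i, (U i : Set X), isOpen_iInter_of_finite fun i ↦ (U i).isOpen⟩, 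
    Set.mem_iInter.mpr hx, fun i y hy ↦ Set.mem_iInter.mp hy i⟩

variable [IsIntegral X]

/-- The germ at the generic point. -/
abbrev gg (U : X.Opens) (hU : genericPoint X ∈ U) : Γ(X, U) →+* X.functionField :=
  (X.presheaf.germ U (genericPoint X) hU).hom

lemma gg_res {U V : X.Opens} (h : V ≤ U) (hV : genericPoint X ∈ V) (a : Γ(X, U)) :
    gg V hV (X.presheaf.map (homOfLE h).op a) = gg U (h hV) a :=
  X.presheaf.germ_res_apply (homOfLE h) _ hV a

lemma gg_injective {U : X.Opens} (hU : genericPoint X ∈ U) : Function.Injective (gg U hU) :=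
  germ_injective_of_isIntegral _ _ _

lemma subsingleton_of_genericPoint_notMem {U : X.Opens} (hU : genericPoint X ∉ U) :
    Subsingleton Γ(X, U) := by
  have : U = ⊥ := by
    ext x
    constructor
    · intro hx; exact absurd (genericPoint_mem hx) hU
    · intro hx; exact hx.elim
  subst this
  infer_instance

/-- A rational function is regular on an open set. -/
def IsReg (U : X.Opens) (hU : genericPoint X ∈ U) (x : X.functionField) : Prop :=
  x ∈ (gg U hU).range

lemma IsReg.mono {U V : X.Opens} (h : V ≤ U) (hV : genericPoint X ∈ V) {x : X.functionField}
    (hx : IsReg U (h hV) x) : IsReg V hV x := by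
  obtain ⟨a, rfl⟩ := hx
  exact ⟨_, gg_res h hV a⟩

lemma IsReg.of_locally {U : X.Opens} (hU : genericPoint X ∈ U) {x : X.functionField}
    (h : ∀ y ∈ U, ∃ (V : X.Opens) (_ : V ≤ U) (hV : genericPoint X ∈ V), y ∈ V ∧ IsReg V hV x) :
    IsReg U hU x := by
  choose V hV hη hy r using h
  choose a ha using r
  obtain ⟨b, hb, -⟩ := TopCat.Sheaf.existsUnique_gluing' X.sheaf (fun y : U ↦ V y.1 y.2) U
    (fun y ↦ homOfLE (hV y.1 y.2)) (fun y hyU ↦ Opens.mem_iSup.mpr ⟨⟨y, hyU⟩, hy y hyU⟩)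
    (fun y ↦ a y.1 y.2) (fun y z ↦ by
      refine gg_injective (U := V y.1 y.2 ⊓ V z.1 z.2) ⟨hη _ _, hη _ _⟩ ?_
      exact (gg_res (inf_le_left) ⟨hη _ _, hη _ _⟩ _).trans (((ha _ _).trans (ha _ _).symm).trans 
        (gg_res inf_le_right ⟨hη _ _, hη _ _⟩ _).symm))
  refine ⟨b, ?_⟩
  rw [← gg_res (hV _ hU) (hη _ hU) b, ← ha _ hU]
  exact congrArg _ (hb ⟨_, hU⟩)

/-- An identification of a vector space `W` over the function field with the generic stalk of `M`. -/
structure Gen (M : X.Modules) (W : Type u) [AddCommGroup W] [Module X.functionField W] where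
  γ : ∀ (U : X.Opens), genericPoint X ∈ U → Γ(M, U) → W
  map_add : ∀ (U : X.Opens) (hU : genericPoint X ∈ U) (s t : Γ(M, U)),
    γ U hU (s + t) = γ U hU s + γ U hU t
  map_smul : ∀ (U : X.Opens) (hU : genericPoint X ∈ U) (a : Γ(X, U)) (s : Γ(M, U)),
    γ U hU (a • s) = gg U hU a • γ U hU s
  map_res : ∀ (U V : X.Opens) (h : V ≤ U) (hV : genericPoint X ∈ V) (s : Γ(M, U)),
    γ V hV (M.presheaf.map (homOfLE h).op s) = γ U (h hV) s
  eq_res : ∀ (U : X.Opens) (hU : genericPoint X ∈ U) (s t : Γ(M, U)), γ U hU s = γ U hU t →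
    ∃ (V : X.Opens) (h : V ≤ U), genericPoint X ∈ V ∧
      M.presheaf.map (homOfLE h).op s = M.presheaf.map (homOfLE h).op t
  surj : ∀ w : W, ∃ (U : X.Opens) (hU : genericPoint X ∈ U) (s : Γ(M, U)), γ U hU s = w

namespace Gen
variable {M : X.Modules} {W : Type u} [AddCommGroup W] [Module X.functionField W] (G : Gen M W)

lemma exists_lift {ι : Type*} [Finite ι] (w : ι → W) {U : X.Opens} (hU : genericPoint X ∈ U) :
    ∃ (V : X.Opens) (_ : V ≤ U) (hV : genericPoint X ∈ V) (s : ι → Γ(M, V)), ∀ i, G.γ V hV (s i) = w i := by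
  choose V hV s hs using fun i ↦ G.surj (w i)
  obtain ⟨V', hV', h⟩ := exists_opens_le (fun i : Option ι ↦ i.elim U V) (x := genericPoint X)
    (by rintro (_ | i); exacts [hU, hV i])
  refine ⟨V', h none, hV', fun i ↦ M.presheaf.map (homOfLE (h (some i))).op (s i), fun i ↦ ?_⟩
  rw [← hs i]
  exact G.map_res _ _ (h (some i)) hV' (s i)

lemma exists_eq_res {ι : Type*} [Finite ι] {U V : X.Opens} (hU : genericPoint X ∈ U) (hV : genericPoint X ∈ V)
    (s : ι → Γ(M, U)) (t : ι → Γ(M, V)) (h : ∀ i, G.γ U hU (s i) = G.γ V hV (t i)) :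
    ∃ (W : X.Opens) (hWU : W ≤ U) (hWV : W ≤ V), genericPoint X ∈ W ∧ ∀ i,
      M.presheaf.map (homOfLE hWU).op (s i) = M.presheaf.map (homOfLE hWV).op (t i) := by
  have hl : U ⊓ V ≤ U := inf_le_left
  have hr : U ⊓ V ≤ V := inf_le_right
  have hη : genericPoint X ∈ U ⊓ V := ⟨hU, hV⟩
  choose W hW hηW e using fun i ↦ G.eq_res (U ⊓ V) hη (M.presheaf.map (homOfLE hl).op (s i))
    (M.presheaf.map (homOfLE hr).op (t i)) (by rw [G.map_res, G.map_res, h i])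
  obtain ⟨W', hW', h⟩ := exists_opens_le (fun i : Option ι ↦ i.elim (U ⊓ V) W) (x := genericPoint X)
    (by rintro (_ | i); exacts [hη, hηW i])
  refine ⟨W', (h none).trans hl, (h none).trans hr, hW', fun i ↦ ?_⟩
  have := congrArg (M.presheaf.map (homOfLE (h (some i))).op) (e i)
  exact (res_res M hl (h (some i) |>.trans (hW i)) (s i)).symm.trans ((res_res M (hW i) (h (some i)) _).symm.trans
    (this.trans (res_res M (hW i) (h (some i)) _)) |>.trans (res_res M hr (h (some i) |>.trans (hW i)) (t i)))

/-- A compatible family of multilinear maps induces a multilinear map on generic stalks. -/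
lemma exists_multilinear {m : ℕ} {U : X.Opens} (hU : genericPoint X ∈ U)
    (f : ∀ V : {V : X.Opens // V ≤ U},
      MultilinearMap Γ(X, V.1) (fun _ : Fin m ↦ (Γ(M, V.1) : Type u)) Γ(X, V.1))
    (hf : ∀ (V W : {V : X.Opens // V ≤ U}) (h : W.1 ≤ V.1) (s : Fin m → Γ(M, V.1)),
      f W (fun i ↦ M.presheaf.map (homOfLE h).op (s i)) = X.presheaf.map (homOfLE h).op (f V s)) :
    ∃ Λ : MultilinearMap X.functionField (fun _ : Fin m ↦ W) X.functionField,
      ∀ V hV s, Λ (fun i ↦ G.γ V.1 hV (s i)) = gg V.1 hV (f V s) := by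
  have wd : ∀ (V V' : {V : X.Opens // V ≤ U}) (hV : genericPoint X ∈ V.1) (hV' : genericPoint X ∈ V'.1)
      (s : Fin m → Γ(M, V.1)) (s' : Fin m → Γ(M, V'.1)), (∀ i, G.γ V.1 hV (s i) = G.γ V'.1 hV' (s' i)) →
      gg V.1 hV (f V s) = gg V'.1 hV' (f V' s') := by
    intro V V' hV hV' s s' h
    obtain ⟨Q, h1, h2, hQ, e⟩ := G.exists_eq_res hV hV' s s' h
    rw [← gg_res h1 hQ, ← gg_res h2 hQ, ← hf V ⟨Q, h1.trans V.2⟩ h1, ← hf V' ⟨Q, h1.trans V.2⟩ h2]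
    congr 2
    funext i
    exact e i
  choose V hVU hV s hs using fun w : Fin m → W ↦ G.exists_lift w hU
  have key : ∀ (w : Fin m → W) (V' : {V : X.Opens // V ≤ U}) (hV' : genericPoint X ∈ V'.1)
     (s' : Fin m → Γ(M, V'.1)), (∀ i, w i = G.γ V'.1 hV' (s' i)) → 
      gg (V w) (hV w) (f ⟨V w, hVU w⟩ (s w)) = gg V'.1 hV' (f V' s') := fun w V' hV' s' h ↦
    wd ⟨V w, hVU w⟩ V' (hV w) hV' (s w) s' fun i ↦ (hs w i).trans (h i)
  refine ⟨{ toFun := fun w ↦ gg (V w) (hV w) (f ⟨V w, hVU w⟩ (s w))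
            map_update_add' := ?_
            map_update_smul' := ?_ }, fun V' hV' s' ↦ key _ V' hV' s' fun i ↦ rfl⟩
  · intro _ w i x y
    -- Two extra indices make w, x and y lift to sections over one common open set.
    obtain ⟨V', hVU', hV', s', hs'⟩ := G.exists_lift (fun j : Fin m ⊕ Bool ↦ j.elim w (fun b ↦ if b then x else y)) hU
    have aux : ∀ (z : W) (t : Γ(M, V')), G.γ V' hV' t = z → ∀ j, Function.update w i z j = 
       G.γ V' hV' (Function.update (fun j ↦ s' (Sum.inl j)) i t j) := by
      intro z t ht j
      by_cases hj : j = i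
      · subst hj; simp [ht]
      · simp [hj, hs']
    rw [key _ ⟨V', hVU'⟩ hV' _ (aux (x + y) (s' (Sum.inr true) + s' (Sum.inr false)) 
         (by rw [G.map_add, hs', hs']; simp)),
        key _ ⟨V', hVU'⟩ hV' _ (aux x _ ((hs' (Sum.inr true)).trans (by simp))),
        key _ ⟨V', hVU'⟩ hV' _ (aux y _ ((hs' (Sum.inr false)).trans (by simp))),
        MultilinearMap.map_update_add, _root_.map_add]
  · intro _ w i c x
    obtain ⟨V₀, hV₀, a, rfl⟩ := X.presheaf.exists_germ_eq c
    obtain ⟨V', hVU', hV', s', hs'⟩ := G.exists_lift (fun j : Option (Fin m) ↦ j.elim x w)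
      (U := V₀ ⊓ U) ⟨hV₀, hU⟩
    have aux : ∀ (z : W) (t : Γ(M, V')), G.γ V' hV' t = z → ∀ j, Function.update w i z j = 
       G.γ V' hV' (Function.update (fun j ↦ s' (some j)) i t j) := by
      intro z t ht j
      by_cases hj : j = i
      · subst hj; simp [ht]
      · simp [hj, hs']
    have e : gg V' hV' (X.presheaf.map (homOfLE (hVU'.trans inf_le_left)).op a) = 
        X.presheaf.germ V₀ (genericPoint X) hV₀ a := gg_res _ hV' a
    rw [key _ ⟨V', hVU'.trans inf_le_right⟩ hV' _ (aux _ 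
         (X.presheaf.map (homOfLE (hVU'.trans inf_le_left)).op a • s' none) (by
          rw [G.map_smul, hs', e]; rfl)),
        key _ ⟨V', hVU'.trans inf_le_right⟩ hV' _ (aux x _ (hs' none)),
        MultilinearMap.map_update_smul, smul_eq_mul, _root_.map_mul, e]
    rfl


lemma exists_linear {U : X.Opens} (hU : genericPoint X ∈ U) (φ : dualSections M U) :
    ∃ ξ : Module.Dual X.functionField W, ∀ V hV s, ξ (G.γ V.1 hV s) = gg V.1 hV (φ.1 V s) := by
  obtain ⟨Λ, hΛ⟩ := G.exists_multilinear (m := 1) hU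
    (fun V ↦ MultilinearMap.ofSubsingleton _ _ _ (0 : Fin 1) (φ.1 V))
    (fun V W h s ↦ φ.2 V W h (s 0))
  exact ⟨(MultilinearMap.ofSubsingleton _ _ _ (0 : Fin 1)).symm Λ, fun V hV s ↦ hΛ V hV fun _ ↦ s⟩

lemma multilinear_ext {m : ℕ} {U : X.Opens} (hU : genericPoint X ∈ U)
    {Λ Λ' : MultilinearMap X.functionField (fun _ : Fin m ↦ W) X.functionField}
    (h : ∀ (V : X.Opens), V ≤ U → ∀ (hV : genericPoint X ∈ V) (s : Fin m → Γ(M, V)),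
      Λ (fun i ↦ G.γ V hV (s i)) = Λ' (fun i ↦ G.γ V hV (s i))) : Λ = Λ' := by
  ext w
  obtain ⟨V, hVU, hV, s, hs⟩ := G.exists_lift w hU
  obtain rfl : (fun i ↦ G.γ V hV (s i)) = w := funext hs
  exact h V hVU hV s

lemma linear_ext {U : X.Opens} (hU : genericPoint X ∈ U)
    {ξ ξ' : Module.Dual X.functionField W}
    (h : ∀ (V : X.Opens), V ≤ U → ∀ (hV : genericPoint X ∈ V) (s : Γ(M, V)),
      ξ (G.γ V hV s) = ξ' (G.γ V hV s)) : ξ = ξ' := by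
  ext w
  obtain ⟨V, hVU, hV, s, hs⟩ := G.exists_lift (fun _ : Unit ↦ w) hU
  obtain rfl := hs ()
  exact h V hVU hV _

/-- A multilinear form on the generic stalk takes regular values on sections over subsets of `U`. -/
def RegT {m : ℕ} (U : X.Opens)
    (Λ : MultilinearMap X.functionField (fun _ : Fin m ↦ W) X.functionField) : Prop :=
  ∀ (V : X.Opens) (_ : V ≤ U) (hV : genericPoint X ∈ V) (s : Fin m → Γ(M, V)),
    IsReg V hV (Λ (fun i ↦ G.γ V hV (s i)))

/-- A linear form on the generic stalk takes regular values on sections over subsets of `U`. -/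
def RegD (U : X.Opens) (ξ : Module.Dual X.functionField W) : Prop :=
  ∀ (V : X.Opens) (_ : V ≤ U) (hV : genericPoint X ∈ V) (s : Γ(M, V)), IsReg V hV (ξ (G.γ V hV s))

/-- Functions embed in the function field, so regular values of Λ have unique preimages;
multilinearity and compatibility with restriction are checked at the generic point. -/
lemma exists_of_regT {m : ℕ} {U : X.Opens}
    {Λ : MultilinearMap X.functionField (fun _ : Fin m ↦ W) X.functionField} (h : G.RegT U Λ) :
    ∃ φ : dualSections (tensorPow M m) U, ∀ V hV s,
      gg V.1 hV (evT φ V s) = Λ (fun i ↦ G.γ V.1 hV (s i)) := by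
  classical
  choose F hF using h
  have upd : ∀ (V : X.Opens) (hV : genericPoint X ∈ V) (s : Fin m → Γ(M, V)) (i : Fin m) (x : Γ(M, V)),
      (fun j ↦ G.γ V hV (Function.update s i x j)) =
        Function.update (fun j ↦ G.γ V hV (s j)) i (G.γ V hV x) := by
    intro V hV s i x
    funext j
    by_cases hj : j = i
    · subst hj; simp
    · simp [hj]
  -- Only the empty open set misses the generic point; the ring of sections there is zero, and the
  -- default value 0 is the only one.
  obtain ⟨φ, hφ⟩ := exists_evT (M := M) (m := m) (U := U) (fun V ↦
    if hV : genericPoint X ∈ V.1 then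
      { toFun := F V.1 V.2 hV
        map_update_add' := fun {inst} s i x y ↦ by
          obtain rfl : inst = instDecidableEqFin m := Subsingleton.elim _ _
          apply gg_injective hV
          rw [_root_.map_add, hF, hF, hF, upd, upd, upd, G.map_add, MultilinearMap.map_update_add]
        map_update_smul' := fun {inst} s i a x ↦ by
          obtain rfl : inst = instDecidableEqFin m := Subsingleton.elim _ _
          apply gg_injective hV
          rw [smul_eq_mul, _root_.map_mul, hF, hF, upd, upd, G.map_smul, MultilinearMap.map_update_smul,
            smul_eq_mul] }
    else 0) (fun V W h s ↦ by
      by_cases hW : genericPoint X ∈ W.1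
      · rw [dif_pos hW, dif_pos (h hW)]
        apply gg_injective hW
        refine (hF W.1 W.2 hW _).trans ?_
        refine Eq.trans ?_ (gg_res h hW _).symm
        refine Eq.trans ?_ (hF V.1 V.2 (h hW) _).symm
        congr 1
        funext i
        exact G.map_res _ _ h hW _
      · have := subsingleton_of_genericPoint_notMem hW
        exact Subsingleton.elim _ _)
  refine ⟨φ, fun V hV s ↦ ?_⟩
  rw [hφ, dif_pos hV]
  exact hF V.1 V.2 hV s

lemma exists_of_regD {U : X.Opens} {ξ : Module.Dual X.functionField W} (h : G.RegD U ξ) :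
    ∃ φ : dualSections M U, ∀ V hV s, gg V.1 hV (φ.1 V s) = ξ (G.γ V.1 hV s) := by
  classical
  choose F hF using h
  refine ⟨⟨fun V ↦ if hV : genericPoint X ∈ V.1 then
      { toFun := F V.1 V.2 hV
        map_add' := fun x y ↦ by
          apply gg_injective hV
          rw [_root_.map_add, hF, hF, hF, G.map_add, _root_.map_add]
        map_smul' := fun a x ↦ by
          apply gg_injective hV
          rw [smul_eq_mul, _root_.map_mul, hF, hF, G.map_smul, _root_.map_smul, smul_eq_mul]
          rfl }
    else 0, fun V W h s ↦ ?_⟩, fun V hV s ↦ ?_⟩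
  · by_cases hW : genericPoint X ∈ W.1
    · beta_reduce
      rw [dif_pos hW, dif_pos (h hW)]
      apply gg_injective hW
      refine (hF W.1 W.2 hW _).trans ?_
      refine Eq.trans ?_ (gg_res h hW _).symm
      refine Eq.trans ?_ (hF V.1 V.2 (h hW) _).symm
      rw [G.map_res]
    · have := subsingleton_of_genericPoint_notMem hW
      exact Subsingleton.elim _ _
  · simp only [dif_pos hV]
    exact hF V.1 V.2 hV s

/-- The multilinear form on the generic stalk given by a section of the dual of a tensor power. -/
def formT {m : ℕ} {U : X.Opens} (hU : genericPoint X ∈ U) (φ : dualSections (tensorPow M m) U) :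
    MultilinearMap X.functionField (fun _ : Fin m ↦ W) X.functionField :=
  (G.exists_multilinear hU (evT φ) (evT_res φ)).choose

lemma formT_apply {m : ℕ} {U : X.Opens} (hU : genericPoint X ∈ U) (φ : dualSections (tensorPow M m) U)
    (V : {V : X.Opens // V ≤ U}) (hV : genericPoint X ∈ V.1) (s : Fin m → Γ(M, V.1)) :
    G.formT hU φ (fun i ↦ G.γ V.1 hV (s i)) = gg V.1 hV (evT φ V s) :=
  (G.exists_multilinear hU (evT φ) (evT_res φ)).choose_spec V hV s

lemma regT_formT {m : ℕ} {U : X.Opens} (hU : genericPoint X ∈ U) (φ : dualSections (tensorPow M m) U) :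
    G.RegT U (G.formT hU φ) := fun V h hV s ↦ ⟨evT φ ⟨V, h⟩ s, (G.formT_apply hU φ ⟨V, h⟩ hV s).symm⟩

lemma formT_injective {m : ℕ} {U : X.Opens} (hU : genericPoint X ∈ U) {φ ψ : dualSections (tensorPow M m) U}
    (h : G.formT hU φ = G.formT hU ψ) : φ = ψ := by
  refine evT_ext fun V s ↦ ?_
  by_cases hV : genericPoint X ∈ V.1
  · apply gg_injective hV
    rw [← G.formT_apply hU φ V hV, ← G.formT_apply hU ψ V hV, h]
  · have := subsingleton_of_genericPoint_notMem hV
    exact Subsingleton.elim _ _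

lemma exists_formT_eq {m : ℕ} {U : X.Opens} (hU : genericPoint X ∈ U)
    {Λ : MultilinearMap X.functionField (fun _ : Fin m ↦ W) X.functionField} (h : G.RegT U Λ) :
    ∃ φ : dualSections (tensorPow M m) U, G.formT hU φ = Λ := by
  obtain ⟨φ, hφ⟩ := G.exists_of_regT h
  exact ⟨φ, G.multilinear_ext hU fun V h hV s ↦ (G.formT_apply hU φ ⟨V, h⟩ hV s).trans (hφ ⟨V, h⟩ hV s)⟩

/-- The linear form on the generic stalk given by a section of the dual. -/
def formD {U : X.Opens} (hU : genericPoint X ∈ U) (φ : dualSections M U) :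
    Module.Dual X.functionField W :=
  (G.exists_linear hU φ).choose

lemma formD_apply {U : X.Opens} (hU : genericPoint X ∈ U) (φ : dualSections M U)
    (V : {V : X.Opens // V ≤ U}) (hV : genericPoint X ∈ V.1) (s : Γ(M, V.1)) :
    G.formD hU φ (G.γ V.1 hV s) = gg V.1 hV (φ.1 V s) :=
  (G.exists_linear hU φ).choose_spec V hV s

lemma regD_formD {U : X.Opens} (hU : genericPoint X ∈ U) (φ : dualSections M U) :
    G.RegD U (G.formD hU φ) := fun V h hV s ↦ ⟨φ.1 ⟨V, h⟩ s, (G.formD_apply hU φ ⟨V, h⟩ hV s).symm⟩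

lemma formD_injective {U : X.Opens} (hU : genericPoint X ∈ U) {φ ψ : dualSections M U}
    (h : G.formD hU φ = G.formD hU ψ) : φ = ψ := by
  apply Subtype.ext; funext V; ext s
  by_cases hV : genericPoint X ∈ V.1
  · apply gg_injective hV
    rw [← G.formD_apply hU φ V hV, ← G.formD_apply hU ψ V hV, h]
  · have := subsingleton_of_genericPoint_notMem hV
    exact Subsingleton.elim _ _

lemma exists_formD_eq {U : X.Opens} (hU : genericPoint X ∈ U)
    {ξ : Module.Dual X.functionField W} (h : G.RegD U ξ) :
    ∃ φ : dualSections M U, G.formD hU φ = ξ := by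
  obtain ⟨φ, hφ⟩ := G.exists_of_regD h
  exact ⟨φ, G.linear_ext hU fun V h hV s ↦ (G.formD_apply hU φ ⟨V, h⟩ hV s).trans (hφ ⟨V, h⟩ hV s)⟩

/-- The generic stalk of the dual of a tensor power. -/
def dualT (m : ℕ) (hbd : ∀ Λ : MultilinearMap X.functionField (fun _ : Fin m ↦ W) X.functionField,
    ∃ U : X.Opens, genericPoint X ∈ U ∧ G.RegT U Λ) :
    Gen (dual (tensorPow M m)) (MultilinearMap X.functionField (fun _ : Fin m ↦ W) X.functionField) where
  γ U hU φ := G.formT hU φ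
  map_add U hU φ ψ := G.multilinear_ext hU fun V h hV s ↦ by
    rw [add_apply]
    refine (G.formT_apply hU _ ⟨V, h⟩ hV s).trans (Eq.trans ?_ (congrArg₂ _ (G.formT_apply hU φ ⟨V, h⟩ hV s)
      (G.formT_apply hU ψ ⟨V, h⟩ hV s)).symm)
    exact _root_.map_add (gg V hV) _ _
  map_smul U hU a φ := G.multilinear_ext hU fun V h hV s ↦ by
    rw [smul_apply]
    refine (G.formT_apply hU _ ⟨V, h⟩ hV s).trans (Eq.trans ?_ (congrArg _
      (G.formT_apply hU φ ⟨V, h⟩ hV s)).symm)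
    refine (_root_.map_mul (gg V hV) _ _).trans ?_
    rw [gg_res]
    rfl
  map_res U V h hV φ := G.multilinear_ext hV fun Q hQ hη s ↦
    (G.formT_apply hV _ ⟨Q, hQ⟩ hη s).trans (G.formT_apply (h hV) φ ⟨Q, hQ.trans h⟩ hη s).symm
  eq_res U hU φ ψ h := ⟨U, le_rfl, hU, by rw [G.formT_injective hU h]⟩
  surj Λ := by
    obtain ⟨U, hU, h⟩ := hbd Λ
    obtain ⟨φ, hφ⟩ := G.exists_formT_eq hU h
    exact ⟨U, hU, φ, hφ⟩

/-- The generic stalk of the dual. -/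
def dualD (hbd : ∀ ξ : Module.Dual X.functionField W,
    ∃ U : X.Opens, genericPoint X ∈ U ∧ G.RegD U ξ) :
    Gen (dual M) (Module.Dual X.functionField W) where
  γ U hU φ := G.formD hU φ
  map_add U hU φ ψ := G.linear_ext hU fun V h hV s ↦ by
    rw [LinearMap.add_apply]
    refine (G.formD_apply hU _ ⟨V, h⟩ hV s).trans (Eq.trans ?_ (congrArg₂ _ (G.formD_apply hU φ ⟨V, h⟩ hV s)
      (G.formD_apply hU ψ ⟨V, h⟩ hV s)).symm)
    exact _root_.map_add (gg V hV) _ _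
  map_smul U hU a φ := G.linear_ext hU fun V h hV s ↦ by
    rw [LinearMap.smul_apply]
    refine (G.formD_apply hU _ ⟨V, h⟩ hV s).trans (Eq.trans ?_ (congrArg _
      (G.formD_apply hU φ ⟨V, h⟩ hV s)).symm)
    refine (_root_.map_mul (gg V hV) _ _).trans ?_
    rw [gg_res]
    rfl
  map_res U V h hV φ := G.linear_ext hV fun Q hQ hη s ↦
    (G.formD_apply hV _ ⟨Q, hQ⟩ hη s).trans (G.formD_apply (h hV) φ ⟨Q, hQ.trans h⟩ hη s).symm
  eq_res U hU φ ψ h := ⟨U, le_rfl, hU, by rw [G.formD_injective hU h]⟩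
  surj ξ := by
    obtain ⟨U, hU, h⟩ := hbd ξ
    obtain ⟨φ, hφ⟩ := G.exists_formD_eq hU h
    exact ⟨U, hU, φ, hφ⟩

end Gen
end PluriForm

end

/-! ### The generic stalk of the sheaf of differentials -/

noncomputable section

set_option linter.unusedSectionVars false
namespace PluriForm

/-- The differential of a function. -/
def dX {X : Scheme.{u}} {k : Type u} [Field k] (f : X ⟶ Spec (CommRingCat.of k)) {U : X.Opens} (a : Γ(X, U)) :
    Γ(Omega f, U) := (univD f).d a

lemma dX_res {X : Scheme.{u}} {k : Type u} [Field k] (f : X ⟶ Spec (CommRingCat.of k)) {U V : X.Opens} (h : V ≤ U)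
    (a : Γ(X, U)) :
    dX f (X.presheaf.map (homOfLE h).op a) = (Omega f).presheaf.map (homOfLE h).op (dX f a) :=
  (univD f).d_map (homOfLE h).op a

variable {X : Scheme.{u}} [IsIntegral X] (W : Type u) [AddCommGroup W] [Module X.functionField W]

/-- Sections over U are functions on the proofs that U contains the generic point: a copy of W when
U is nonempty, and a single point when U is empty, as the sheaf condition requires. -/
instance constModule (U : (Opens X)ᵒᵖ) : Module (X.presheaf.obj U) (PLift (genericPoint X ∈ U.unop) → W) where
  smul a s := fun h ↦ gg U.unop h.down a • s h
  one_smul s := by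
    funext h
    change gg U.unop h.down 1 • s h = s h
    rw [map_one, one_smul]
  mul_smul a b s := by
    funext h
    change gg U.unop h.down (a * b) • s h = gg U.unop h.down a • gg U.unop h.down b • s h
    rw [map_mul, mul_smul]
  smul_zero a := by
    funext h
    exact smul_zero (gg U.unop h.down a)
  zero_smul s := by
    funext h
    change gg U.unop h.down 0 • s h = 0
    rw [map_zero, zero_smul]
  smul_add a s t := by
    funext h
    exact smul_add (gg U.unop h.down a) (s h) (t h)
  add_smul a b s := by
    funext h
    change gg U.unop h.down (a + b) • s h = gg U.unop h.down a • s h + gg U.unop h.down b • s h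
    rw [map_add, add_smul]

/-- The constant presheaf of abelian groups on an irreducible space. -/
def constPresheaf : TopCat.Presheaf Ab.{u} X where
  obj U := AddCommGrpCat.of (PLift (genericPoint X ∈ U.unop) → W)
  map i := AddCommGrpCat.ofHom
    { toFun := fun s h ↦ s ⟨i.unop.le h.down⟩
      map_zero' := rfl
      map_add' := fun _ _ ↦ rfl }

instance (U : (Opens X)ᵒᵖ) : Module (X.ringCatSheaf.obj.obj U) ((constPresheaf (X := X) W).obj U) :=
  constModule W U

lemma constPresheaf_isSheaf : (constPresheaf (X := X) W).IsSheaf := by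
  rw [TopCat.Presheaf.isSheaf_iff_isSheafUniqueGluing]
  intro ι U sf hsf
  have key : ∀ i j (hi : genericPoint X ∈ U i) (hj : genericPoint X ∈ U j),
      (sf i : PLift (genericPoint X ∈ U i) → W) ⟨hi⟩ = (sf j : PLift (genericPoint X ∈ U j) → W) ⟨hj⟩ :=
    fun i j hi hj ↦ congrFun (hsf i j : (fun h ↦ (sf i : PLift (genericPoint X ∈ U i) → W) _) = 
      fun h ↦ (sf j : PLift (genericPoint X ∈ U j) → W) _) ⟨⟨hi, hj⟩⟩
  refine ⟨(fun h ↦ (sf (Opens.mem_iSup.mp h.down).choose : PLift (genericPoint X ∈ _) → W)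
    ⟨(Opens.mem_iSup.mp h.down).choose_spec⟩ : PLift (genericPoint X ∈ iSup U) → W), fun i ↦ ?_, fun t ht ↦ ?_⟩
  · funext h
    exact key _ _ _ _
  · funext h
    exact congrFun (ht (Opens.mem_iSup.mp h.down).choose) ⟨(Opens.mem_iSup.mp h.down).choose_spec⟩

/-- The constant sheaf on an integral scheme given by a vector space over the function field. -/
def constMod : X.Modules where
  val := PresheafOfModules.ofPresheaf (constPresheaf (X := X) W) fun U V i a s ↦ by
    funext h
    exact (congrArg (fun z : X.functionField ↦ z • (s : PLift (genericPoint X ∈ U.unop) → W) ⟨i.unop.le h.down⟩)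
      (gg_res i.unop.le h.down a)).symm
  isSheaf := constPresheaf_isSheaf W

variable {W}
variable {k : Type u} [Field k] (f : X ⟶ Spec (CommRingCat.of k))

/-- The structure map of the function field. -/
def kToK : k →+* X.functionField := (gg ⊤ trivial).comp ((structureMap f).app (op ⊤)).hom

lemma gg_structureMap (U : X.Opens) (hU : genericPoint X ∈ U) (a : k) :
    gg U hU ((structureMap f).app (op U) a) = kToK f a := by
  have := ConcreteCategory.congr_hom ((structureMap f).naturality (homOfLE (le_top : U ≤ ⊤)).op) a
  refine (congrArg (gg U hU) this).trans ?_
  exact gg_res le_top hU _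

variable [Algebra k X.functionField] (hk : algebraMap k X.functionField = kToK f)
  [Module k W] [IsScalarTower k X.functionField W]

/-- The derivation of the structure sheaf with values in a constant sheaf. -/
def constD (δ : Derivation k X.functionField W) : PresheafOfModules.Derivation' (R := X.presheaf)
    (under (constMod W)) (structureMap f) where
  d {V} := (AddMonoidHom.mk' (fun a h ↦ δ (gg V.unop h.down a)) (fun a b ↦ by
    funext h
    simp only [Pi.add_apply, map_add]) : X.presheaf.obj V →+ (PLift (genericPoint X ∈ V.unop) → W))
  d_mul {V} a b := by
    funext h
    exact (congrArg δ (map_mul (gg V.unop h.down) a b)).trans (δ.leibniz _ _)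
  d_map {U V} i a := by
    funext h
    exact congrArg δ (gg_res i.unop.le h.down a)
  d_app {V} a := by
    funext h
    refine (congrArg δ (gg_structureMap f V.unop h.down a)).trans ?_
    rw [← hk]
    exact δ.map_algebraMap a


/-- The morphism from an associated sheaf given by a morphism of presheaves. -/
def ofShf {X : Scheme.{u}} {P : Pre X} {N : X.Modules} (ψ : P ⟶ under N) : sheafify.obj P ⟶ N :=
  ((PresheafOfModules.sheafificationAdjunction (𝟙 X.ringCatSheaf.obj)).homEquiv _ _).symm ψ

lemma ofShf_shf {X : Scheme.{u}} {P : Pre X} {N : X.Modules} (ψ : P ⟶ under N) {U : X.Opens}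
    (t : (P.obj (op U) : Type u)) : (ofShf ψ).app U (shf P U t) = ψ.app (op U) t := by
  have h1 := (PresheafOfModules.sheafificationAdjunction (𝟙 X.ringCatSheaf.obj)).homEquiv_unit
     (f := ofShf ψ)
  have h2 := ((PresheafOfModules.sheafificationAdjunction (𝟙 X.ringCatSheaf.obj)).homEquiv
    P N).apply_symm_apply ψ
  exact (ConcreteCategory.congr_hom (congrArg (fun ψ ↦ PresheafOfModules.Hom.app ψ (op U))
    (h1.symm.trans h2)) t)

/-- The morphism from the sheaf of differentials to a constant sheaf given by a derivation. -/
def omegaConst (δ : Derivation k X.functionField W) : Omega f ⟶ constMod W :=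
  ofShf (P := preOmega f)
    ((PresheafOfModules.DifferentialsConstruction.isUniversal' (structureMap f)).desc (constD f hk δ))

lemma omegaConst_dX (δ : Derivation k X.functionField W) {U : X.Opens} (hU : genericPoint X ∈ U) (a : Γ(X, U)) :
    ((omegaConst f hk δ).app U (dX f a) : PLift (genericPoint X ∈ U) → W) ⟨hU⟩ = δ (gg U hU a) := by
  refine (congrArg (fun z : PLift (genericPoint X ∈ U) → W ↦ z ⟨hU⟩) (ofShf_shf (P := preOmega f) (N := constMod W)
    ((PresheafOfModules.DifferentialsConstruction.isUniversal' (structureMap f)).desc (constD f hk δ))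
    ((PresheafOfModules.DifferentialsConstruction.derivation' (structureMap f)).d (X := op U) a))).trans ?_
  have := (PresheafOfModules.DifferentialsConstruction.isUniversal' (structureMap f)).fac (constD f hk δ)
  exact congrFun (PresheafOfModules.Derivation.congr_d this (X := op U) a) ⟨hU⟩


/-- The value at the generic point of a section of a constant sheaf. -/
def constVal {U : X.Opens} (hU : genericPoint X ∈ U) : Γ(constMod W, U) →+ W :=
  { toFun := fun s ↦ (s : PLift (genericPoint X ∈ U) → W) ⟨hU⟩
    map_zero' := rfl
    map_add' := fun _ _ ↦ rfl }

/-- A differential form at the generic point. -/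
def omegaVal (δ : Derivation k X.functionField W) {U : X.Opens} (hU : genericPoint X ∈ U) :
    Γ(Omega f, U) →+ W := (constVal hU).comp (((omegaConst f hk δ).app U).hom)

lemma omegaVal_smul (δ : Derivation k X.functionField W) {U : X.Opens} (hU : genericPoint X ∈ U)
    (a : Γ(X, U)) (s : Γ(Omega f, U)) : omegaVal f hk δ hU (a • s) = gg U hU a • omegaVal f hk δ hU s :=
  congrFun (Scheme.Modules.Hom.app_smul (omegaConst f hk δ) a s) ⟨hU⟩

lemma omegaVal_res (δ : Derivation k X.functionField W) {U V : X.Opens} (h : V ≤ U) (hV : genericPoint X ∈ V)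
    (s : Γ(Omega f, U)) : omegaVal f hk δ hV ((Omega f).presheaf.map (homOfLE h).op s) = omegaVal f hk δ (h hV) s :=
  congrFun (res_app (omegaConst f hk δ) h s) ⟨hV⟩

lemma omegaVal_dX (δ : Derivation k X.functionField W) {U : X.Opens} (hU : genericPoint X ∈ U) (a : Γ(X, U)) :
    omegaVal f hk δ hU (dX f a) = δ (gg U hU a) := omegaConst_dX f hk δ hU a

lemma exists_affine_le {X : Scheme.{u}} {U : X.Opens} {x : X} (hx : x ∈ U) : ∃ V : X.Opens, IsAffineOpen V ∧ V ≤ U ∧ x ∈ V := by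
  obtain ⟨_, ⟨A, hA, rfl⟩, hxA, hAU⟩ :=
    X.isBasis_affineOpens.exists_subset_of_mem_open hx U.isOpen
  exact ⟨A, hA, hAU, hxA⟩

lemma omega_locally_shf {X : Scheme.{u}} (f : X ⟶ Spec (CommRingCat.of k)) {U : X.Opens} (s : Γ(Omega f, U))
    {x : X} (hx : x ∈ U) :
    ∃ (V : X.Opens) (h : V ≤ U), IsAffineOpen V ∧ x ∈ V ∧ ∃ t, (Omega f).presheaf.map (homOfLE h).op s = 
      shf (preOmega f) V t := by
  obtain ⟨V, h, hxV, t, ht⟩ := shf_locally_surjective (preOmega f) s hx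
  obtain ⟨V', hV', h', hx'⟩ := exists_affine_le hxV
  exact ⟨V', h'.trans h, hV', hx', _, (res_res (Omega f) h h' s).symm.trans
    ((congrArg _ ht.symm).trans (shf_res (preOmega f) h' t).symm)⟩

/-- The structure map of the ring of sections over an open subset. -/
def kToO {X : Scheme.{u}} (f : X ⟶ Spec (CommRingCat.of k)) (U : X.Opens) : k →+* Γ(X, U) :=
  ((structureMap f).app (op U)).hom

lemma shf_mem_span {X : Scheme.{u}} (f : X ⟶ Spec (CommRingCat.of k)) {U : X.Opens} (t) : 
    (shf (preOmega f) U t : Γ(Omega f, U)) ∈ Submodule.span Γ(X, U) (Set.range (fun a : Γ(X, U) ↦ dX f a)) := by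
  let _ := (kToO f U).toAlgebra
  have : t ∈ Submodule.span Γ(X, U) (Set.range (KaehlerDifferential.D k Γ(X, U))) := by
    rw [KaehlerDifferential.span_range_derivation]; trivial
  refine Submodule.span_induction (p := fun t _ ↦ (shf (preOmega f) U t : Γ(Omega f, U)) ∈
    Submodule.span Γ(X, U) (Set.range (fun a : Γ(X, U) ↦ dX f a))) ?_ ?_ ?_ ?_ this
  · rintro _ ⟨a, rfl⟩
    exact Submodule.subset_span ⟨a, rfl⟩
  · exact (congrArg (· ∈ _) (LinearMap.map_zero (shf (preOmega f) U))).mpr (Submodule.zero_mem _)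
  · intro a b _ _ ha hb
    exact (congrArg (· ∈ _) (LinearMap.map_add (shf (preOmega f) U) a b)).mpr (Submodule.add_mem _ ha hb)
  · intro r a _ ha
    exact (congrArg (· ∈ _) (LinearMap.map_smul (shf (preOmega f) U) r a)).mpr (Submodule.smul_mem _ r ha)

/-- Identifies the generic value with the map on Kähler differentials of rings, to which the
compatibility of Ω with localization applies. -/
lemma omegaVal_shf {U : X.Opens} (hU : genericPoint X ∈ U) (t) :
    let _ := (kToO f U).toAlgebra
    let _ := (gg U hU).toAlgebra
    have : IsScalarTower k Γ(X, U) X.functionField := IsScalarTower.of_algebraMap_eq' (by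
      rw [hk]; ext a; exact (gg_structureMap f U hU a).symm)
    omegaVal f hk (KaehlerDifferential.D k X.functionField) hU (shf (preOmega f) U t) =
      KaehlerDifferential.map k k Γ(X, U) X.functionField t := by
  intro _ _ _
  let l : Ω[Γ(X, U)⁄k] →ₗ[Γ(X, U)] Ω[X.functionField⁄k] :=
    { toFun := fun t ↦ omegaVal f hk (KaehlerDifferential.D k X.functionField) hU (shf (preOmega f) U t)
      map_add' := fun a b ↦ by
        refine (congrArg _ (LinearMap.map_add (shf (preOmega f) U) a b)).trans ?_
        exact map_add _ _ _
      map_smul' := fun a b ↦ by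
        refine (congrArg _ (LinearMap.map_smul (shf (preOmega f) U) a b)).trans ?_
        refine (omegaVal_smul f hk _ hU a _).trans ?_
        exact algebraMap_smul _ _ _ }
  have : l = KaehlerDifferential.map k k Γ(X, U) X.functionField := by
    apply Derivation.liftKaehlerDifferential_unique
    ext a
    refine (omegaVal_dX f hk _ hU a).trans ?_
    exact (KaehlerDifferential.map_D k k Γ(X, U) X.functionField a).symm
  exact DFunLike.congr_fun this t

/-- On an affine open set V the section comes from a Kähler differential t with zero image in
Ω_{K/k}. As K is a localization of the functions on V, some nonzero a kills t, and the section
vanishes on D(a). -/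
lemma omegaVal_eq_zero {U : X.Opens} (hU : genericPoint X ∈ U) (s : Γ(Omega f, U))
    (hs : omegaVal f hk (KaehlerDifferential.D k X.functionField) hU s = 0) :
    ∃ (V : X.Opens) (h : V ≤ U), genericPoint X ∈ V ∧ (Omega f).presheaf.map (homOfLE h).op s = 0 := by
  obtain ⟨V, h, hVa, hV, t, ht⟩ := omega_locally_shf f s hU
  have h1 := omegaVal_res f hk (KaehlerDifferential.D k X.functionField) h hV s
  rw [hs, ht, omegaVal_shf] at h1
  have : Nonempty V := ⟨_, hV⟩
  let _ := (kToO f V).toAlgebra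
  have : IsScalarTower k Γ(X, V) X.functionField := IsScalarTower.of_algebraMap_eq' (by
      rw [hk]; ext a; exact (gg_structureMap f V hV a).symm)
  have := functionField_isFractionRing_of_isAffineOpen X V hVa
  obtain ⟨⟨a, ha⟩, hat⟩ := (IsLocalizedModule.eq_zero_iff (nonZeroDivisors Γ(X, V))
    (KaehlerDifferential.map k k Γ(X, V) X.functionField)).mp h1
  have hat' : a • shf (preOmega f) V t = 0 := by
    refine (LinearMap.map_smul (shf (preOmega f) V) a t).symm.trans ?_
    refine (congrArg _ hat).trans (map_zero _)
  refine ⟨X.basicOpen a, (X.basicOpen_le a).trans h, ?_, ?_⟩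
  · rw [X.mem_basicOpen a (genericPoint X) hV, isUnit_iff_ne_zero]
    intro h0
    exact nonZeroDivisors.ne_zero ha (gg_injective hV (h0.trans (map_zero _).symm))
  · have hu := X.toRingedSpace.isUnit_res_basicOpen a
    have e : X.presheaf.map (homOfLE (X.basicOpen_le a)).op a • (Omega f).presheaf.map (homOfLE ((X.basicOpen_le a).trans h)).op s = 0 := by
      rw [← res_res (Omega f) h (X.basicOpen_le a) s, ← Scheme.Modules.map_smul]
      refine (congrArg _ ?_).trans (map_zero _)
      exact (congrArg (a • ·) ht).trans hat'
    have hu' : IsUnit (X.presheaf.map (homOfLE (X.basicOpen_le a)).op a) := hu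
    exact (hu'.smul_eq_zero).mp e

/-- The generic stalk of the sheaf of differentials. -/
def genOmega : Gen (Omega f) Ω[X.functionField⁄k] where
  γ U hU s := omegaVal f hk (KaehlerDifferential.D k X.functionField) hU s
  map_add U hU s t := map_add _ _ _
  map_smul U hU a s := omegaVal_smul f hk _ hU a s
  map_res U V h hV s := omegaVal_res f hk _ h hV s
  eq_res U hU s t h := by
    obtain ⟨V, h, hV, e⟩ := omegaVal_eq_zero f hk hU (s - t) (by rw [map_sub, h, sub_self])
    refine ⟨V, h, hV, ?_⟩
    rwa [map_sub, sub_eq_zero] at e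
  surj w := by
    have : w ∈ Submodule.span X.functionField (Set.range (KaehlerDifferential.D k X.functionField)) := by
      rw [KaehlerDifferential.span_range_derivation]; trivial
    induction this using Submodule.span_induction with
    | mem w hw =>
      obtain ⟨x, rfl⟩ := hw
      obtain ⟨U, hU, a, rfl⟩ := X.presheaf.exists_germ_eq x
      exact ⟨U, hU, dX f a, omegaVal_dX f hk _ hU a⟩
    | zero => exact ⟨⊤, trivial, 0, map_zero _⟩
    | add w w' _ _ h h' =>
      obtain ⟨U, hU, s, rfl⟩ := h
      obtain ⟨U', hU', s', rfl⟩ := h'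
      have hη : genericPoint X ∈ U ⊓ U' := ⟨hU, hU'⟩
      have hl : U ⊓ U' ≤ U := inf_le_left
      have hr : U ⊓ U' ≤ U' := inf_le_right
      refine ⟨U ⊓ U', hη, (Omega f).presheaf.map (homOfLE hl).op s + 
        (Omega f).presheaf.map (homOfLE hr).op s', ?_⟩
      rw [map_add, omegaVal_res, omegaVal_res]
    | smul c w _ h =>
      obtain ⟨U, hU, s, rfl⟩ := h
      obtain ⟨U', hU', a, rfl⟩ := X.presheaf.exists_germ_eq c
      have hη : genericPoint X ∈ U ⊓ U' := ⟨hU, hU'⟩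
      have hl : U ⊓ U' ≤ U := inf_le_left
      have hr : U ⊓ U' ≤ U' := inf_le_right
      refine ⟨U ⊓ U', hη, X.presheaf.map (homOfLE hr).op a •
        (Omega f).presheaf.map (homOfLE hl).op s, ?_⟩
      rw [omegaVal_smul, omegaVal_res, gg_res]

end PluriForm

end

/-! ### Rings of regular functions inside the function field -/

noncomputable section

set_option linter.unusedSectionVars false
namespace PluriForm

variable {X : Scheme.{u}} [IsIntegral X]

/-- The algebra of rational functions that are regular on an open set. -/
def regAlg (R : Type*) [CommRing R] [Algebra R X.functionField] (U : X.Opens) (hU : genericPoint X ∈ U)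
    (h : ∀ r : R, IsReg U hU (algebraMap R X.functionField r)) : Subalgebra R X.functionField :=
  { (gg U hU).range with algebraMap_mem' := h }

section
variable {R : Type*} [CommRing R] [Algebra R X.functionField] {U : X.Opens} {hU : genericPoint X ∈ U}
    {h : ∀ r : R, IsReg U hU (algebraMap R X.functionField r)}

/-- Sections over `U` are the rational functions that are regular on `U`. -/
def regAlgEquiv : Γ(X, U) ≃+* regAlg R U hU h :=
  RingEquiv.ofBijective ((gg U hU).codRestrict (regAlg R U hU h) fun a ↦ ⟨a, rfl⟩)
    ⟨fun _ _ e ↦ gg_injective hU (congrArg Subtype.val e), fun ⟨_, a, ha⟩ ↦ ⟨a, Subtype.ext ha⟩⟩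

lemma isFractionRing_regAlg (hUa : IsAffineOpen U) : IsFractionRing (regAlg R U hU h) X.functionField := by
  have : Nonempty U := ⟨_, hU⟩
  have := functionField_isFractionRing_of_isAffineOpen X U hUa
  refine IsFractionRing.of_field _ _ fun z ↦ ?_
  obtain ⟨a, b, -, rfl⟩ := IsFractionRing.div_surjective Γ(X, U) z
  exact ⟨regAlgEquiv a, regAlgEquiv b, rfl⟩

/-- An element of K integral over the functions on U is integral over the stalk at every point of U,
so it belongs to all these stalks and is regular locally, hence on U. -/
lemma isIntegrallyClosed_regAlg (hX : IsNormalScheme X) (hUa : IsAffineOpen U) :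
    IsIntegrallyClosed (regAlg R U hU h) := by
  have := isFractionRing_regAlg (h := h) hUa
  rw [isIntegrallyClosed_iff X.functionField]
  intro x hx
  suffices IsReg U hU x from ⟨⟨x, this⟩, rfl⟩
  refine IsReg.of_locally hU fun y hy ↦ ?_
  have : Nonempty U := ⟨⟨y, hy⟩⟩
  have := (hX y).2
  have hx' : IsIntegral (X.presheaf.stalk y) x := by
    let φ : regAlg R U hU h →+* X.presheaf.stalk y := (X.presheaf.germ U y hy).hom.comp (regAlgEquiv (h := h)).symm.toRingHom
    obtain ⟨P, hP, hPx⟩ := hx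
    refine ⟨P.map φ, hP.map φ, ?_⟩
    rw [Polynomial.eval₂_map, ← hPx]
    congr 1
    ext a
    obtain ⟨a, rfl⟩ := (regAlgEquiv (h := h)).surjective a
    change algebraMap _ _ (X.presheaf.germ U y hy ((regAlgEquiv (h := h)).symm (regAlgEquiv a))) = _
    rw [RingEquiv.symm_apply_apply, Scheme.algebraMap_germ_eq_germToFunctionField]
    rfl
  obtain ⟨t, rfl⟩ := (isIntegrallyClosed_iff X.functionField).mp this hx'
  obtain ⟨V, hyV, a, rfl⟩ := X.presheaf.exists_germ_eq t
  have hV : genericPoint X ∈ V := genericPoint_mem hyV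
  have : Nonempty V := ⟨⟨y, hyV⟩⟩
  have hr : V ⊓ U ≤ V := inf_le_left
  refine ⟨V ⊓ U, inf_le_right, ⟨hV, hU⟩, ⟨hyV, hy⟩, IsReg.mono hr ⟨hV, hU⟩ ⟨a, ?_⟩⟩
  exact (Scheme.algebraMap_germ_eq_germToFunctionField X hyV a).symm

lemma mem_basicOpen_iff {U : X.Opens} (hU : genericPoint X ∈ U) (a : Γ(X, U)) : genericPoint X ∈ X.basicOpen a ↔ a ≠ 0 := by
  rw [X.mem_basicOpen a (genericPoint X) hU, isUnit_iff_ne_zero, not_iff_not]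
  exact ⟨fun h0 ↦ gg_injective hU (h0.trans (map_zero _).symm), fun h ↦ h ▸ map_zero _⟩

lemma exists_of_isReg_basicOpen (hUa : IsAffineOpen U) {a : Γ(X, U)} (ha : genericPoint X ∈ X.basicOpen a)
    {x : X.functionField} (hx : IsReg (X.basicOpen a) ha x) : ∃ n : ℕ, IsReg U hU (gg U hU a ^ n * x) := by
  obtain ⟨b, rfl⟩ := hx
  have := hUa.isLocalization_basicOpen a
  obtain ⟨c, ⟨_, n, rfl⟩, hc⟩ := IsLocalization.exists_mk'_eq (Submonoid.powers a) b
  refine ⟨n, c, ?_⟩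
  have h1 := IsLocalization.mk'_spec' Γ(X, X.basicOpen a) c (⟨a ^ n, n, rfl⟩ : Submonoid.powers a)
  rw [hc] at h1
  have h2 := congrArg (gg _ ha) h1
  rw [map_mul] at h2
  have e : ∀ z : Γ(X, U), gg _ ha (algebraMap Γ(X, U) Γ(X, X.basicOpen a) z) = gg U hU z :=
    fun z ↦ gg_res (X.basicOpen_le a) ha z
  rw [e, e, map_pow] at h2
  exact h2.symm

lemma isReg_inv_basicOpen {a : Γ(X, U)} (ha : genericPoint X ∈ X.basicOpen a) :
    IsReg (X.basicOpen a) ha (gg U hU a)⁻¹ := by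
  have hu : IsUnit (X.presheaf.map (homOfLE (X.basicOpen_le a)).op a) := X.toRingedSpace.isUnit_res_basicOpen a
  obtain ⟨b, hb⟩ := hu.exists_right_inv
  refine ⟨b, ?_⟩
  have := congrArg (gg _ ha) hb
  rw [map_mul, gg_res, map_one] at this
  exact eq_inv_of_mul_eq_one_right this

end

variable {k : Type u} [Field k] (f : X ⟶ Spec (CommRingCat.of k)) [Algebra k X.functionField]
  (hk : algebraMap k X.functionField = kToK f)

include hk in
lemma isReg_algebraMap (U : X.Opens) (hU : genericPoint X ∈ U) (c : k) : IsReg U hU (algebraMap k X.functionField c) :=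
  ⟨kToO f U c, (gg_structureMap f U hU c).trans (by rw [hk])⟩

/-- The algebra of rational functions that are regular on an open set, over the ground field. -/
abbrev regAlgK (U : X.Opens) (hU : genericPoint X ∈ U) : Subalgebra k X.functionField :=
  regAlg k U hU (isReg_algebraMap f hk U hU)

lemma regAlgK_basicOpen {U : X.Opens} (hU : genericPoint X ∈ U) (hUa : IsAffineOpen U) {a : Γ(X, U)}
    (ha : genericPoint X ∈ X.basicOpen a) : (regAlgK f hk (X.basicOpen a) ha).IsLocalizationOf (regAlgK f hk U hU) := by
  refine ⟨fun x hx ↦ IsReg.mono (X.basicOpen_le a) ha hx, fun y hy ↦ ?_⟩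
  obtain ⟨n, hn⟩ := exists_of_isReg_basicOpen (hU := hU) hUa ha hy
  have ha0 : gg U hU a ≠ 0 := fun h ↦ (mem_basicOpen_iff hU a).mp ha (gg_injective hU (h.trans (map_zero _).symm))
  refine ⟨gg U hU a ^ n, ⟨a ^ n, map_pow _ _ _⟩, pow_ne_zero _ ha0, ?_, hn⟩
  rw [← inv_pow]
  exact Subalgebra.pow_mem _ (isReg_inv_basicOpen ha) n

lemma kToO_finiteType {X : Scheme.{u}} (f : X ⟶ Spec (CommRingCat.of k)) [LocallyOfFiniteType f] {U : X.Opens} (hUa : IsAffineOpen U) : (kToO f U).FiniteType := by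
  have h1 := f.finiteType_appLE (isAffineOpen_top _) hUa (le_top : U ≤ f ⁻¹ᵁ ⊤)
  have h2 : (Scheme.ΓSpecIso (CommRingCat.of k)).inv.hom.FiniteType :=
    RingHom.FiniteType.of_surjective _ (Scheme.ΓSpecIso (CommRingCat.of k)).symm.commRingCatIsoToRingEquiv.surjective
  exact h1.comp h2

lemma regAlgK_fg [LocallyOfFiniteType f] {U : X.Opens} (hU : genericPoint X ∈ U) (hUa : IsAffineOpen U) :
    (regAlgK f hk U hU).FG := by
  rw [Subalgebra.fg_iff_finiteType]
  let _ := (kToO f U).toAlgebra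
  have : Algebra.FiniteType k Γ(X, U) := kToO_finiteType f hUa
  let e : Γ(X, U) →ₐ[k] regAlgK f hk U hU :=
    { (regAlgEquiv (h := isReg_algebraMap f hk U hU)).toRingHom with
      commutes' := fun c ↦ Subtype.ext ((gg_structureMap f U hU c).trans (by rw [← hk]; rfl)) }
  exact Algebra.FiniteType.of_surjective e (regAlgEquiv (h := isReg_algebraMap f hk U hU)).surjective

/-- Regularity on an affine open set can be tested on the differentials of functions. -/
lemma regT_iff {m : ℕ} {U : X.Opens} (hU : genericPoint X ∈ U) (hUa : IsAffineOpen U)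
    (Λ : MultilinearMap X.functionField (fun _ : Fin m ↦ Ω[X.functionField⁄k]) X.functionField) :
    (genOmega f hk).RegT U Λ ↔ IsRegularOn (KaehlerDifferential.D k X.functionField) (regAlgK f hk U hU) Λ := by
  constructor
  · intro h a ha
    choose b hb using ha
    have := h U le_rfl hU (fun i ↦ dX f (b i))
    have e : (fun i ↦ (genOmega f hk).γ U hU (dX f (b i))) = fun i ↦ KaehlerDifferential.D k X.functionField (a i) := by
      funext i
      rw [← hb i]
      exact omegaVal_dX f hk _ hU (b i)
    rw [e] at this
    exact this
  · intro h V hVU hV s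
    refine IsReg.of_locally hV fun y hy ↦ ?_
    -- Near y the sections come from Kähler differentials of rings of functions. On a basic open set
    -- of U around y their generic values lie in the span of the differentials of functions, where Λ
    -- is regular by localization.
    choose W hWV hWa hyW t ht using fun i ↦ omega_locally_shf f (s i) hy
    obtain ⟨W', hyW', hW'⟩ := exists_opens_le (fun i : Option (Fin m) ↦ i.elim V W) (x := y)
      (by rintro (_ | i); exacts [hy, hyW i])
    obtain ⟨a, haW, hya⟩ := hUa.exists_basicOpen_le ⟨y, hyW'⟩ (hVU hy)
    have hη := genericPoint_mem hya
    have hreg := h.of_isLocalizationOf (regAlgK_basicOpen f hk hU hUa hη)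
    refine ⟨X.basicOpen a, haW.trans (hW' none), hη, hya, ?_⟩
    have hmem := MultilinearMap.mem_of_span (A := regAlgK f hk (X.basicOpen a) hη) Λ
      (Set.range fun b : Γ(X, X.basicOpen a) ↦ KaehlerDifferential.D k X.functionField (gg _ hη b))
      (Subalgebra.toSubmodule (⊥ : Subalgebra (regAlgK f hk (X.basicOpen a) hη) X.functionField)) (fun c hc ↦ ?_)
      (fun i ↦ (genOmega f hk).γ V hV (s i)) fun i ↦ ?_
    · obtain ⟨z, hz⟩ := Algebra.mem_bot.mp hmem
      rw [← hz]
      exact z.2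
    · choose b hb using hc
      obtain rfl := funext hb
      exact Algebra.mem_bot.mpr ⟨⟨_, hreg _ fun i ↦ ⟨b i, rfl⟩⟩, rfl⟩
    · have hle : X.basicOpen a ≤ W i := haW.trans (hW' (some i))
      have h1 := omegaVal_res f hk (KaehlerDifferential.D k X.functionField) (hle.trans (hWV i)) hη (s i)
      have h2 : (Omega f).presheaf.map (homOfLE (hle.trans (hWV i))).op (s i) =
          shf (preOmega f) (X.basicOpen a) ((preOmega f).presheaf.map (homOfLE hle).op (t i)) :=
        (res_res (Omega f) (hWV i) hle (s i)).symm.trans ((congrArg _ (ht i)).trans (shf_res (preOmega f) hle (t i)).symm)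
      rw [h2] at h1
      change omegaVal f hk _ _ (s i) ∈ _
      rw [← h1]
      refine Submodule.span_induction (p := fun v _ ↦ omegaVal f hk (KaehlerDifferential.D k X.functionField) hη v ∈
        Submodule.span (regAlgK f hk (X.basicOpen a) hη)
          (Set.range fun b : Γ(X, X.basicOpen a) ↦ KaehlerDifferential.D k X.functionField (gg _ hη b))) ?_ ?_ ?_ ?_
        (shf_mem_span f ((preOmega f).presheaf.map (homOfLE hle).op (t i)))
      · rintro _ ⟨b, rfl⟩
        exact Submodule.subset_span ⟨b, (omegaVal_dX f hk _ hη b).symm⟩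
      · rw [map_zero]; exact zero_mem _
      · intro v w _ _ hv hw
        rw [map_add]; exact add_mem hv hw
      · intro r v _ hv
        rw [omegaVal_smul]
        exact Submodule.smul_mem _ (regAlgEquiv (h := isReg_algebraMap f hk _ hη) r) hv

/-- On an affine chart some nonzero function a clears the denominators of Λ, so Λ is regular on
D(a). This makes the forms on Ω_{K/k} the generic stalk of the dual of the tensor power. -/
lemma exists_regT [LocallyOfFiniteType f] {m : ℕ}
    (Λ : MultilinearMap X.functionField (fun _ : Fin m ↦ Ω[X.functionField⁄k]) X.functionField) :
    ∃ U : X.Opens, genericPoint X ∈ U ∧ (genOmega f hk).RegT U Λ := by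
  obtain ⟨U, hUa, -, hU⟩ := exists_affine_le (U := (⊤ : X.Opens)) (x := genericPoint X) trivial
  have := isFractionRing_regAlg (h := isReg_algebraMap f hk U hU) hUa
  obtain ⟨a, ⟨b, hb⟩, ha0, -, hreg⟩ := IsRegularOn.exists_smul (δ := KaehlerDifferential.D k X.functionField) (Λ := Λ)
    (regAlgK_fg f hk hU hUa) (Subalgebra.isLocalizationOf_top _) (fun _ _ ↦ trivial)
  have hη : genericPoint X ∈ X.basicOpen b := (mem_basicOpen_iff hU b).mpr fun h ↦ ha0 (by rw [← hb, h, map_zero])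
  refine ⟨X.basicOpen b, hη, (regT_iff f hk hη (hUa.basicOpen b) Λ).mpr fun c hc ↦ ?_⟩
  have h1 := hreg.of_isLocalizationOf (regAlgK_basicOpen f hk hU hUa hη) c hc
  have h2 : a⁻¹ ∈ regAlgK f hk (X.basicOpen b) hη := by rw [← hb]; exact isReg_inv_basicOpen hη
  have h3 := Subalgebra.mul_mem _ h2 h1
  rwa [smul_apply, smul_eq_mul, inv_mul_cancel_left₀ ha0] at h3

end PluriForm

end

/-! ### Reflexive tensor powers as functionals at the generic point -/

noncomputable section

set_option linter.unusedSectionVars false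
namespace PluriForm

variable {X : Scheme.{u}} [IsIntegral X]

namespace Gen
variable {M N : X.Modules} {W W' : Type u} [AddCommGroup W] [Module X.functionField W] [AddCommGroup W']
  [Module X.functionField W'] (G : Gen M W)

/-- Transport along an isomorphism of vector spaces. -/
def ofEquiv (e : W ≃ₗ[X.functionField] W') : Gen M W' where
  γ U hU s := e (G.γ U hU s)
  map_add U hU s t := by rw [G.map_add, _root_.map_add]
  map_smul U hU a s := by rw [G.map_smul, _root_.map_smul]
  map_res U V h hV s := by rw [G.map_res]
  eq_res U hU s t h := G.eq_res U hU s t (e.injective h)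
  surj w := by
    obtain ⟨U, hU, s, hs⟩ := G.surj (e.symm w)
    exact ⟨U, hU, s, by rw [hs, e.apply_symm_apply]⟩

variable [FiniteDimensional X.functionField W]
  (hbd : ∀ ξ : Module.Dual X.functionField W, ∃ U : X.Opens, genericPoint X ∈ U ∧ G.RegD U ξ)

/-- In finite dimension ζ is evaluation at a vector w; over an open set where w is the value of a
section, it takes regular values on sections of the dual. -/
lemma exists_regD_dualD (ζ : Module.Dual X.functionField (Module.Dual X.functionField W)) :
    ∃ U : X.Opens, genericPoint X ∈ U ∧ (G.dualD hbd).RegD U ζ := by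
  obtain ⟨w, rfl⟩ := (Module.evalEquiv X.functionField W).surjective ζ
  obtain ⟨U, hU, s, rfl⟩ := G.surj w
  refine ⟨U, hU, fun V hVU hV φ ↦ ⟨(φ : dualSections M V).1 ⟨V, le_rfl⟩ (M.presheaf.map (homOfLE hVU).op s), ?_⟩⟩
  rw [← G.formD_apply hV φ ⟨V, le_rfl⟩ hV, G.map_res]
  rfl

/-- The generic stalk of the double dual. -/
def bidual : Gen (dual (dual M)) W :=
  ((G.dualD hbd).dualD (G.exists_regD_dualD hbd)).ofEquiv (Module.evalEquiv X.functionField W).symm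

/-- Used in place of the construction of `bidual`, which passes through the inverse of
`Module.evalEquiv`. -/
lemma formD_bidual {U V : X.Opens} (h : V ≤ U) (hV : genericPoint X ∈ V) (s : Γ(dual (dual M), U)) (φ : dualSections M V) :
    G.formD hV φ ((G.bidual hbd).γ U (h hV) s) = gg V hV ((s : dualSections (dual M) U).1 ⟨V, h⟩ φ) := by
  have h1 := (G.dualD hbd).formD_apply (h hV) s ⟨V, h⟩ hV φ
  refine Eq.trans ?_ h1
  have h2 := (Module.evalEquiv X.functionField W).apply_symm_apply ((G.dualD hbd).formD (h hV) s)
  exact DFunLike.congr_fun h2 (G.formD hV φ)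

lemma bidual_toDoubleDual {U : X.Opens} (hU : genericPoint X ∈ U) (s : Γ(M, U)) :
    (G.bidual hbd).γ U hU ((toDoubleDual M).app U s) = G.γ U hU s := by
  refine (Module.evalEquiv X.functionField W).symm_apply_eq.mpr ?_
  refine (G.dualD hbd).linear_ext hU fun V hVU hV φ ↦ ?_
  refine ((G.dualD hbd).formD_apply hU _ ⟨V, hVU⟩ hV φ).trans ?_
  refine Eq.trans ?_ (congrArg (G.formD hV φ) (G.map_res U V hVU hV s))
  exact (G.formD_apply hV φ ⟨V, le_rfl⟩ hV _).symm

lemma bidual_injective {U : X.Opens} (hU : genericPoint X ∈ U) {s t : Γ(dual (dual M), U)}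
    (h : (G.bidual hbd).γ U hU s = (G.bidual hbd).γ U hU t) : s = t :=
  (G.dualD hbd).formD_injective hU ((Module.evalEquiv X.functionField W).symm.injective h)

/-- Multilinear forms that are regular on a module are regular on its double dual. -/
lemma RegT.bidual {m : ℕ} {U : X.Opens}
    {Λ : MultilinearMap X.functionField (fun _ : Fin m ↦ W) X.functionField} (hΛ : G.RegT U Λ) :
    (G.bidual hbd).RegT U Λ := by
  -- Slots are moved from M to its double dual one at a time; F is the set of those already moved.
  -- With the other slots fixed, Λ is a regular linear form on M, i.e. a section of the dual, and a
  -- section of the double dual takes a regular value on it.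
  have key : ∀ (F : Finset (Fin m)) (V : X.Opens) (_ : V ≤ U) (hV : genericPoint X ∈ V) (w : Fin m → W),
      (∀ i ∈ F, ∃ s, (G.bidual hbd).γ V hV s = w i) → (∀ i ∉ F, ∃ s, G.γ V hV s = w i) → IsReg V hV (Λ w) := by
    intro F
    induction F using Finset.induction_on with
    | empty =>
      intro V hVU hV w _ h
      choose s hs using fun i ↦ h i (Finset.notMem_empty i)
      obtain rfl := funext hs
      exact hΛ V hVU hV s
    | insert i F hi ih =>
      intro V hVU hV w h h'
      obtain ⟨s, hs⟩ := h i (Finset.mem_insert_self i F)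
      have hξ : G.RegD V (Λ.toLinearMap w i) := by
        intro V' hV'V hV' t
        refine ih V' (hV'V.trans hVU) hV' _ (fun l hl ↦ ?_) (fun l hl ↦ ?_)
        · have : l ≠ i := fun e ↦ hi (e ▸ hl)
          obtain ⟨s, hs⟩ := h l (Finset.mem_insert_of_mem hl)
          rw [Function.update_of_ne this]
          exact ⟨_, ((G.bidual hbd).map_res V V' hV'V hV' s).trans hs⟩
        · by_cases hli : l = i
          · subst hli
            rw [Function.update_self]
            exact ⟨t, rfl⟩
          · obtain ⟨s, hs⟩ := h' l (by simp [hli, hl])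
            rw [Function.update_of_ne hli]
            exact ⟨_, (G.map_res V V' hV'V hV' s).trans hs⟩
      obtain ⟨φ, hφ⟩ := G.exists_formD_eq hV hξ
      refine ⟨(s : dualSections (dual M) V).1 ⟨V, le_rfl⟩ φ, ?_⟩
      rw [← G.formD_bidual hbd le_rfl hV s φ, hφ, hs, MultilinearMap.toLinearMap_apply, Function.update_eq_self]
  intro V hVU hV s
  exact key Finset.univ V hVU hV _ (fun i _ ↦ ⟨s i, rfl⟩) fun i hi ↦ absurd (Finset.mem_univ i) hi

end Gen

section reflexive
variable {M N : X.Modules} {W W' : Type u} [AddCommGroup W] [Module X.functionField W] [AddCommGroup W']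
  [Module X.functionField W'] (G : Gen M W) (G' : Gen N W') {m : ℕ}
  (hbd : ∀ Λ : MultilinearMap X.functionField (fun _ : Fin m ↦ W) X.functionField,
    ∃ U : X.Opens, genericPoint X ∈ U ∧ G.RegT U Λ)
  (hbd' : ∀ Λ : MultilinearMap X.functionField (fun _ : Fin m ↦ W') X.functionField,
    ∃ U : X.Opens, genericPoint X ∈ U ∧ G'.RegT U Λ)

/-- Sections of the dual of the tensor power are exactly the regular forms. So sections of a
reflexive tensor power become functionals on forms that preserve regularity. -/
lemma regD_dualT_iff {U : X.Opens} (σ : Module.Dual X.functionField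
    (MultilinearMap X.functionField (fun _ : Fin m ↦ W) X.functionField)) :
    (G.dualT m hbd).RegD U σ ↔ ∀ (V : X.Opens) (_ : V ≤ U) (hV : genericPoint X ∈ V) (Λ), G.RegT V Λ → IsReg V hV (σ Λ) := by
  constructor
  · intro h V hVU hV Λ hΛ
    obtain ⟨φ, rfl⟩ := G.exists_formT_eq hV hΛ
    exact h V hVU hV φ
  · intro h V hVU hV φ
    exact h V hVU hV _ (G.regT_formT hV φ)

lemma formT_dualMap (α : M ⟶ N) (j : W →ₗ[X.functionField] W')
    (hj : ∀ U hU s, G'.γ U hU (α.app U s) = j (G.γ U hU s)) {U : X.Opens} (hU : genericPoint X ∈ U)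
    (ψ : dualSections (tensorPow N m) U) :
    G.formT hU ((dualMap (tensorPowMap α m)).app U ψ) = (G'.formT hU ψ).compLinearMap fun _ ↦ j := by
  refine G.multilinear_ext hU fun V hVU hV s ↦ ?_
  refine (G.formT_apply hU _ ⟨V, hVU⟩ hV s).trans ?_
  rw [MultilinearMap.compLinearMap_apply]
  have h1 : (fun i ↦ j (G.γ V hV (s i))) = fun i ↦ G'.γ V hV (α.app V (s i)) := funext fun i ↦ (hj V hV (s i)).symm
  rw [h1]
  refine Eq.trans ?_ (G'.formT_apply hU ψ ⟨V, hVU⟩ hV _).symm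
  exact congrArg (gg V hV) (congrArg (ψ.1 ⟨V, hVU⟩) (tensorPowMap_pureT α s))

/-- The effect of `reflPowMap` on functionals. -/
lemma formD_reflPowMap (α : M ⟶ N) (j : W →ₗ[X.functionField] W')
    (hj : ∀ U hU s, G'.γ U hU (α.app U s) = j (G.γ U hU s)) {U : X.Opens} (hU : genericPoint X ∈ U)
    (s : Γ(reflPow M m, U)) (Λ : MultilinearMap X.functionField (fun _ : Fin m ↦ W') X.functionField) :
    (G'.dualT m hbd').formD hU ((reflPowMap α m).app U s) Λ =
      (G.dualT m hbd).formD hU s (Λ.compLinearMap fun _ ↦ j) := by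
  obtain ⟨V, hVU, hV, ψ, hψ⟩ := (G'.dualT m hbd').exists_lift (fun _ : Unit ↦ Λ) hU
  obtain rfl := hψ ()
  refine ((G'.dualT m hbd').formD_apply hU _ ⟨V, hVU⟩ hV (ψ ())).trans ?_
  refine Eq.trans ?_ (congrArg _ (formT_dualMap G G' α j hj hV (ψ ())))
  exact ((G.dualT m hbd).formD_apply hU s ⟨V, hVU⟩ hV ((dualMap (tensorPowMap α m)).app V (ψ ()))).symm

/-- A morphism of modules as a linear map on sections. -/
def appLinear (α : M ⟶ N) (U : X.Opens) : Γ(M, U) →ₗ[Γ(X, U)] Γ(N, U) where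
  toFun := α.app U
  map_add' := map_add _
  map_smul' a s := Scheme.Modules.Hom.app_smul α a s

end reflexive

set_option maxHeartbeats 800000 in
/-- Comparison of reflexive tensor powers by functionals at the generic point. -/
theorem exists_equiv_reflPow {M N S : X.Modules} {V : Type u} [AddCommGroup V] [Module X.functionField V]
    (W : Submodule X.functionField V) (GM : Gen M V) (GN : Gen N V) (GS : Gen S W) (m : ℕ)
    (hM : ∀ Λ : MultilinearMap X.functionField (fun _ : Fin m ↦ V) X.functionField,
      ∃ U : X.Opens, genericPoint X ∈ U ∧ GM.RegT U Λ)
    (hN : ∀ Λ : MultilinearMap X.functionField (fun _ : Fin m ↦ V) X.functionField,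
      ∃ U : X.Opens, genericPoint X ∈ U ∧ GN.RegT U Λ)
    (hS : ∀ Λ : MultilinearMap X.functionField (fun _ : Fin m ↦ W) X.functionField,
      ∃ U : X.Opens, genericPoint X ∈ U ∧ GS.RegT U Λ)
    (α : M ⟶ N) (hα : ∀ U hU s, GN.γ U hU (α.app U s) = GM.γ U hU s)
    (ι : S ⟶ N) (hι : ∀ U hU s, GN.γ U hU (ι.app U s) = W.subtype (GS.γ U hU s))
    (hMS : ∀ U Λ, GM.RegT U Λ → GS.RegT (m := m) U (Λ.compLinearMap fun _ ↦ W.subtype))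
    (hσ : ∀ σ : Module.Dual X.functionField (MultilinearMap X.functionField (fun _ : Fin m ↦ V) X.functionField),
      (∀ (U : X.Opens) (hU : genericPoint X ∈ U) (Λ), GM.RegT U Λ → IsReg U hU (σ Λ)) →
      ∃ σ' : Module.Dual X.functionField (MultilinearMap X.functionField (fun _ : Fin m ↦ W) X.functionField),
        (∀ Λ, σ' (Λ.compLinearMap fun _ ↦ W.subtype) = σ Λ) ∧
        ∀ (U : X.Opens) (hU : genericPoint X ∈ U) (Λ), GS.RegT U Λ → IsReg U hU (σ' Λ)) :
    ∃ e : Γ(reflPow M m, ⊤) ≃ₗ[Γ(X, ⊤)] Γ(reflPow S m, ⊤),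
      ∀ s, (reflPowMap ι m).app ⊤ (e s) = (reflPowMap α m).app ⊤ s := by
  have hη : genericPoint X ∈ (⊤ : X.Opens) := trivial
  have hT : ∀ s Λ, (GN.dualT m hN).formD hη ((reflPowMap α m).app ⊤ s) Λ = (GM.dualT m hM).formD hη s Λ := fun s Λ ↦
    formD_reflPowMap GM GN hM hN α LinearMap.id hα hη s Λ
  have hL : ∀ s Λ, (GN.dualT m hN).formD hη ((reflPowMap ι m).app ⊤ s) Λ =
      (GS.dualT m hS).formD hη s (Λ.compLinearMap fun _ ↦ W.subtype) := fun s Λ ↦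
    formD_reflPowMap GS GN hS hN ι W.subtype hι hη s Λ
  -- Through π every form on W is the restriction of a form on V, so a functional on forms on W is
  -- determined by its composite with restriction.
  obtain ⟨π, hπ⟩ := W.subtype.exists_leftInverse_of_injective (LinearMap.ker_eq_bot.mpr W.injective_subtype)
  have hsurj : ∀ Λ : MultilinearMap X.functionField (fun _ : Fin m ↦ W) X.functionField,
      (Λ.compLinearMap fun _ ↦ π).compLinearMap (fun _ ↦ W.subtype) = Λ := fun Λ ↦ by
    ext w
    simp only [MultilinearMap.compLinearMap_apply]
    congr 1
    funext i
    exact DFunLike.congr_fun hπ (w i)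
  let T := appLinear (reflPowMap α m) ⊤
  let L := appLinear (reflPowMap ι m) ⊤
  have hTinj : Function.Injective T := fun s t h ↦ (GM.dualT m hM).formD_injective hη (LinearMap.ext fun Λ ↦ by
    rw [← hT, ← hT]
    exact congrArg (fun z ↦ (GN.dualT m hN).formD hη z Λ) h)
  have hLinj : Function.Injective L := fun s t h ↦ (GS.dualT m hS).formD_injective hη (LinearMap.ext fun Λ ↦ by
    rw [← hsurj Λ, ← hL, ← hL]
    exact congrArg (fun z ↦ (GN.dualT m hN).formD hη z _) h)
  -- T and L embed both sides in the sections of the reflexive power of N, where comparing images is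
  -- comparing functionals on forms on V.
  have hrange : LinearMap.range T = LinearMap.range L := by
    apply le_antisymm
    · rintro _ ⟨s, rfl⟩
      obtain ⟨σ', hσ', hreg⟩ := hσ ((GM.dualT m hM).formD hη s) fun U hU Λ hΛ ↦
        (regD_dualT_iff GM hM _).mp ((GM.dualT m hM).regD_formD hη s) U le_top hU Λ hΛ
      obtain ⟨s', hs'⟩ := (GS.dualT m hS).exists_formD_eq hη ((regD_dualT_iff GS hS σ').mpr fun U _ hU Λ hΛ ↦ hreg U hU Λ hΛ)
      refine ⟨s', (GN.dualT m hN).formD_injective hη (LinearMap.ext fun Λ ↦ ?_)⟩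
      refine (hL s' Λ).trans ?_
      rw [hs', hσ']
      exact (hT s Λ).symm
    -- Restriction of forms from V to W preserves regularity by `hMS`, so composition with it turns
    -- regular functionals into regular functionals.
    · rintro _ ⟨s', rfl⟩
      let σ : Module.Dual X.functionField (MultilinearMap X.functionField (fun _ : Fin m ↦ V) X.functionField) :=
        (GS.dualT m hS).formD hη s' ∘ₗ MultilinearMap.compLinearMapₗ (fun _ ↦ W.subtype)
      obtain ⟨s, hs⟩ := (GM.dualT m hM).exists_formD_eq hη (ξ := σ) ((regD_dualT_iff GM hM σ).mpr fun U _ hU Λ hΛ ↦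
        (regD_dualT_iff GS hS _).mp ((GS.dualT m hS).regD_formD hη s') U le_top hU _ (hMS U Λ hΛ))
      refine ⟨s, (GN.dualT m hN).formD_injective hη (LinearMap.ext fun Λ ↦ ?_)⟩
      refine (hT s Λ).trans ?_
      rw [hs]
      exact (hL s' Λ).symm
  let e := (LinearEquiv.ofInjective T hTinj).trans ((LinearEquiv.ofEq _ _ hrange).trans (LinearEquiv.ofInjective L hLinj).symm)
  refine ⟨e, fun s ↦ ?_⟩
  have h1 := (LinearEquiv.ofInjective L hLinj).apply_symm_apply
    (LinearEquiv.ofEq _ _ hrange (LinearEquiv.ofInjective T hTinj s))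
  exact congrArg Subtype.val h1

end PluriForm

end

/-! ### Pulled back differentials at the generic point -/

noncomputable section

set_option linter.unusedSectionVars false
namespace PluriForm

variable {X : Scheme.{u}} {k : Type u} [Field k]

lemma omega_hom_ext {Z : Scheme.{u}} (g : Z ⟶ Spec (CommRingCat.of k)) {N : Z.Modules} {α β : Omega g ⟶ N}
    (h : ∀ (U : Z.Opens) (b : Γ(Z, U)), α.app U (dX g b) = β.app U (dX g b)) : α = β := by
  refine ((PresheafOfModules.sheafificationAdjunction (𝟙 Z.ringCatSheaf.obj)).homEquiv (preOmega g) N).injective ?_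
  ext U t
  have key : ∀ s ∈ Submodule.span Γ(Z, U.unop) (Set.range fun b : Γ(Z, U.unop) ↦ dX g b), α.app U.unop s = β.app U.unop s := by
    intro s hs
    refine Submodule.span_induction (p := fun s _ ↦ α.app U.unop s = β.app U.unop s) ?_ ?_ ?_ ?_ hs
    · rintro _ ⟨b, rfl⟩
      exact h _ b
    · rw [map_zero, map_zero]
    · intro s t _ _ hs ht
      rw [map_add, map_add, hs, ht]
    · intro a s _ hs
      rw [Scheme.Modules.Hom.app_smul, Scheme.Modules.Hom.app_smul, hs]
  have h1 := (PresheafOfModules.sheafificationAdjunction (𝟙 Z.ringCatSheaf.obj)).homEquiv_unit (f := α)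
  have h2 := (PresheafOfModules.sheafificationAdjunction (𝟙 Z.ringCatSheaf.obj)).homEquiv_unit (f := β)
  rw [h1, h2]
  exact key _ (shf_mem_span g (U := U.unop) t)

section pullback
variable (f : X ⟶ Spec (CommRingCat.of k)) {Z : Scheme.{u}} (p : X ⟶ Z) (g : Z ⟶ Spec (CommRingCat.of k)) (hp : p ≫ g = f)

lemma toPushforward_dX {U : Z.Opens} (b : Γ(Z, U)) :
    (Omega.toPushforward f p g hp).app U (dX g b) = dX f (p.app U b) := by
  refine (ofShf_shf (P := preOmega g) (N := (Scheme.Modules.pushforward p).obj (Omega f))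
    ((PresheafOfModules.DifferentialsConstruction.isUniversal' (structureMap g)).desc (pullD f p g hp))
    ((PresheafOfModules.DifferentialsConstruction.derivation' (structureMap g)).d (X := op U) b)).trans ?_
  have := (PresheafOfModules.DifferentialsConstruction.isUniversal' (structureMap g)).fac (pullD f p g hp)
  exact PresheafOfModules.Derivation.congr_d this (X := op U) b

lemma unit_pullbackMap : (Scheme.Modules.pullbackPushforwardAdjunction p).unit.app (Omega g) ≫
    (Scheme.Modules.pushforward p).map (Omega.pullbackMap f p g hp) = Omega.toPushforward f p g hp := by
  have h := (Scheme.Modules.pullbackPushforwardAdjunction p).homEquiv_unit (f := Omega.pullbackMap f p g hp)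
  exact h.symm.trans (Equiv.apply_symm_apply _ _)

lemma exists_pullbackMap_eq {U : Z.Opens} (b : Γ(Z, U)) :
    ∃ n, (Omega.pullbackMap f p g hp).app (p ⁻¹ᵁ U) n = dX f (p.app U b) := by
  refine ⟨((Scheme.Modules.pullbackPushforwardAdjunction p).unit.app (Omega g)).app U (dX g b), ?_⟩
  have h1 := ConcreteCategory.congr_hom (congrArg (fun α ↦ Scheme.Modules.Hom.app α U) (unit_pullbackMap f p g hp)) (dX g b)
  exact h1.trans (toPushforward_dX f p g hp b)

end pullback

variable [IsIntegral X] (f : X ⟶ Spec (CommRingCat.of k)) [Algebra k X.functionField]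
  (hk : algebraMap k X.functionField = kToK f)

lemma omegaVal_comp {W W' : Type u} [AddCommGroup W] [Module X.functionField W] [Module k W] [IsScalarTower k X.functionField W]
    [AddCommGroup W'] [Module X.functionField W'] [Module k W'] [IsScalarTower k X.functionField W']
    (δ : Derivation k X.functionField W) (l : W →ₗ[X.functionField] W') {U : X.Opens} (hU : genericPoint X ∈ U)
    (s : Γ(Omega f, U)) : omegaVal f hk (l.compDer δ) hU s = l (omegaVal f hk δ hU s) := by
  obtain ⟨V, h, -, hV, t, ht⟩ := omega_locally_shf f s hU
  rw [← omegaVal_res f hk δ h hV s, ← omegaVal_res f hk (l.compDer δ) h hV s, ht]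
  refine Submodule.span_induction (p := fun v _ ↦ omegaVal f hk (l.compDer δ) hV v = l (omegaVal f hk δ hV v)) ?_ ?_ ?_ ?_
    (shf_mem_span f t)
  · rintro _ ⟨b, rfl⟩
    rw [omegaVal_dX, omegaVal_dX]
    rfl
  · rw [map_zero, map_zero, map_zero]
  · intro v w _ _ hv hw
    rw [map_add, map_add, hv, hw, map_add]
  · intro r v _ hv
    rw [omegaVal_smul, omegaVal_smul, hv, map_smul]

variable {Z : Scheme.{u}} (p : X ⟶ Z) (g : Z ⟶ Spec (CommRingCat.of k)) (hp : p ≫ g = f)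

/-- Functions on the base as rational functions. -/
def pB (U : Z.Opens) (hU : p (genericPoint X) ∈ U) : Γ(Z, U) →+* X.functionField := (gg (p ⁻¹ᵁ U) hU).comp (p.app U).hom

lemma pB_res {U V : Z.Opens} (h : V ≤ U) (hV : p (genericPoint X) ∈ V) (b : Γ(Z, U)) :
    pB p V hV (Z.presheaf.map (homOfLE h).op b) = pB p U (h hV) b := by
  have h1 := ConcreteCategory.congr_hom (p.naturality (homOfLE h).op) b
  refine (congrArg (gg (p ⁻¹ᵁ V) hV) h1).trans ?_
  exact gg_res (U := p ⁻¹ᵁ U) (V := p ⁻¹ᵁ V) (fun x hx ↦ h hx) hV _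

/-- The span of the differentials of functions on the base. -/
def baseSpan (k : Type u) [Field k] [Algebra k X.functionField] (U : Z.Opens) (hU : p (genericPoint X) ∈ U) :
    Submodule X.functionField Ω[X.functionField⁄k] :=
  Submodule.span X.functionField (Set.range fun b ↦ KaehlerDifferential.D k X.functionField (pB p U hU b))

lemma baseSpan_mono {U V : Z.Opens} (h : V ≤ U) (hV : p (genericPoint X) ∈ V) : baseSpan p k U (h hV) ≤ baseSpan p k V hV := by
  refine Submodule.span_le.mpr ?_
  rintro _ ⟨b, rfl⟩
  exact Submodule.subset_span ⟨_, congrArg _ (pB_res p h hV b)⟩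

lemma pB_ne_zero {U : Z.Opens} (hU : p (genericPoint X) ∈ U) {b : Γ(Z, U)} (hb : p (genericPoint X) ∈ Z.basicOpen b) :
    pB p U hU b ≠ 0 := by
  have hu : IsUnit (Z.presheaf.map (homOfLE (Z.basicOpen_le b)).op b) := Z.toRingedSpace.isUnit_res_basicOpen b
  rw [← pB_res p (Z.basicOpen_le b) hb]
  exact (hu.map (pB p _ hb)).ne_zero

/-- Quotient rule: with b = c / a^n one has a^n db = dc - b d(a^n). -/
lemma baseSpan_basicOpen {U : Z.Opens} (hUa : IsAffineOpen U) (hU : p (genericPoint X) ∈ U) {a : Γ(Z, U)}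
    (ha : p (genericPoint X) ∈ Z.basicOpen a) : baseSpan p k (Z.basicOpen a) ha ≤ baseSpan p k U hU := by
  refine Submodule.span_le.mpr ?_
  rintro _ ⟨b, rfl⟩
  have := hUa.isLocalization_basicOpen a
  obtain ⟨c, ⟨_, n, rfl⟩, hc⟩ := IsLocalization.exists_mk'_eq (Submonoid.powers a) b
  have h1 := IsLocalization.mk'_spec' Γ(Z, Z.basicOpen a) c (⟨a ^ n, n, rfl⟩ : Submonoid.powers a)
  rw [hc] at h1
  have h2 := congrArg (pB p _ ha) h1
  rw [map_mul] at h2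
  have e : ∀ z : Γ(Z, U), pB p _ ha (algebraMap Γ(Z, U) Γ(Z, Z.basicOpen a) z) = pB p U hU z :=
    fun z ↦ pB_res p (Z.basicOpen_le a) ha z
  rw [e, e] at h2
  have h0 : pB p U hU (a ^ n) ≠ 0 := by rw [map_pow]; exact pow_ne_zero _ (pB_ne_zero p hU ha)
  have h3 := congrArg (KaehlerDifferential.D k X.functionField) h2
  rw [Derivation.leibniz] at h3
  have h4 : pB p U hU (a ^ n) • KaehlerDifferential.D k X.functionField (pB p _ ha b) ∈ baseSpan p k U hU := by
    rw [← eq_sub_iff_add_eq] at h3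
    rw [h3]
    exact sub_mem (Submodule.subset_span ⟨c, rfl⟩) (Submodule.smul_mem _ _ (Submodule.subset_span ⟨_, rfl⟩))
  exact (Submodule.smul_mem_iff _ h0).mp h4

/-- V contains a basic open set of U around the image of the generic point; consequently the span
does not depend on the choice of an affine open subset of Z. -/
lemma baseSpan_le {U V : Z.Opens} (hUa : IsAffineOpen U) (hU : p (genericPoint X) ∈ U) (hV : p (genericPoint X) ∈ V) :
    baseSpan p k V hV ≤ baseSpan p k U hU := by
  obtain ⟨a, haV, ha⟩ := hUa.exists_basicOpen_le ⟨_, hV⟩ hU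
  exact (baseSpan_mono p haV ha).trans (baseSpan_basicOpen p hUa hU ha)

/-- Pulled back differentials lie in the span of the differentials of functions on the base. -/
lemma omegaVal_pullbackMap_mem {U : Z.Opens} (hUa : IsAffineOpen U) (hU : p (genericPoint X) ∈ U) {V : X.Opens}
    (hV : genericPoint X ∈ V) (n) :
    omegaVal f hk (KaehlerDifferential.D k X.functionField) hV ((Omega.pullbackMap f p g hp).app V n) ∈ baseSpan p k U hU := by
  let W := baseSpan p k U hU
  let δ : Derivation k X.functionField (Ω[X.functionField⁄k] ⧸ W) := W.mkQ.compDer (KaehlerDifferential.D k X.functionField)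
  -- The claim is that pulled back differentials die in the constant sheaf with value Ω_{K/k} / W.
  -- By adjunction this is tested on differentials of functions on Z.
  have hzero : Omega.pullbackMap f p g hp ≫ omegaConst f hk δ = 0 := by
    refine ((Scheme.Modules.pullbackPushforwardAdjunction p).homEquiv _ _).injective ?_
    rw [Adjunction.homEquiv_unit, Adjunction.homEquiv_unit, Functor.map_comp, ← Category.assoc, unit_pullbackMap]
    refine omega_hom_ext g fun Q b ↦ ?_
    have h1 : (Omega.toPushforward f p g hp ≫ (Scheme.Modules.pushforward p).map (omegaConst f hk δ)).app Q (dX g b) =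
        (omegaConst f hk δ).app (p ⁻¹ᵁ Q) (dX f (p.app Q b)) :=
      congrArg ((omegaConst f hk δ).app (p ⁻¹ᵁ Q)) (toPushforward_dX f p g hp b)
    refine h1.trans ?_
    rw [Functor.map_zero, Limits.comp_zero]
    funext h
    refine (omegaConst_dX f hk δ h.down (p.app Q b)).trans ?_
    exact (Submodule.Quotient.mk_eq_zero W).mpr (baseSpan_le p hUa hU h.down (Submodule.subset_span ⟨b, rfl⟩))
  rw [← Submodule.Quotient.mk_eq_zero W]
  change W.mkQ _ = 0
  rw [← omegaVal_comp]
  have h2 := ConcreteCategory.congr_hom (congrArg (fun α ↦ Scheme.Modules.Hom.app α V) hzero) n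
  exact congrArg (constVal hV) h2

end PluriForm

end

/-! ### The generic stalk of the saturation -/

noncomputable section

set_option linter.unusedSectionVars false
namespace PluriForm

variable {X : Scheme.{u}} [IsIntegral X] {k : Type u} [Field k]
  (f : X ⟶ Spec (CommRingCat.of k)) [LocallyOfFiniteType f] [Algebra k X.functionField]
  (hk : algebraMap k X.functionField = kToK f)

include hk in
lemma essFiniteType_functionField : Algebra.EssFiniteType k X.functionField := by
  obtain ⟨U, hUa, -, hU⟩ := exists_affine_le (U := (⊤ : X.Opens)) (x := genericPoint X) trivial
  have := isFractionRing_regAlg (h := isReg_algebraMap f hk U hU) hUa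
  have := (Subalgebra.fg_iff_finiteType _).mp (regAlgK_fg f hk hU hUa)
  have : Algebra.EssFiniteType (regAlgK f hk U hU) X.functionField := .of_isLocalization _ (nonZeroDivisors (regAlgK f hk U hU))
  exact Algebra.EssFiniteType.comp k (regAlgK f hk U hU) X.functionField

include hk in
lemma finiteDimensional_omega : FiniteDimensional X.functionField Ω[X.functionField⁄k] := by
  have := essFiniteType_functionField f hk
  infer_instance

lemma exists_regD (ξ : Module.Dual X.functionField Ω[X.functionField⁄k]) :
    ∃ U : X.Opens, genericPoint X ∈ U ∧ (genOmega f hk).RegD U ξ := by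
  obtain ⟨U, hU, h⟩ := exists_regT f hk (m := 1) (MultilinearMap.ofSubsingleton _ _ _ (0 : Fin 1) ξ)
  exact ⟨U, hU, fun V hVU hV s ↦ h V hVU hV fun _ ↦ s⟩

/-- The generic stalk of the sheaf of reflexive differentials. -/
def genRefl : Gen (reflOmega f) Ω[X.functionField⁄k] :=
  have := finiteDimensional_omega f hk
  (genOmega f hk).bidual (exists_regD f hk)

lemma genRefl_toReflOmega (U : X.Opens) (hU : genericPoint X ∈ U) (s : Γ(Omega f, U)) :
    (genRefl f hk).γ U hU ((toReflOmega f).app U s) = (genOmega f hk).γ U hU s :=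
  have := finiteDimensional_omega f hk
  (genOmega f hk).bidual_toDoubleDual (exists_regD f hk) hU s

lemma genRefl_injective {U : X.Opens} (hU : genericPoint X ∈ U) {s t : Γ(reflOmega f, U)}
    (h : (genRefl f hk).γ U hU s = (genRefl f hk).γ U hU t) : s = t :=
  have := finiteDimensional_omega f hk
  (genOmega f hk).bidual_injective (exists_regD f hk) hU h

lemma regT_genRefl {m : ℕ} {U : X.Opens}
    {Λ : MultilinearMap X.functionField (fun _ : Fin m ↦ Ω[X.functionField⁄k]) X.functionField}
    (hΛ : (genOmega f hk).RegT U Λ) : (genRefl f hk).RegT U Λ :=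
  have := finiteDimensional_omega f hk
  Gen.RegT.bidual (genOmega f hk) (exists_regD f hk) hΛ

variable {Z : Scheme.{u}} (p : X ⟶ Z) (g : Z ⟶ Spec (CommRingCat.of k)) (hp : p ≫ g = f)
  {Y : Z.Opens} (hYa : IsAffineOpen Y) (hY : p (genericPoint X) ∈ Y)

include hYa in
lemma mem_baseSpan_of_mem_satSections {U : X.Opens} (hU : genericPoint X ∈ U) {s : Γ(reflOmega f, U)}
    (hs : s ∈ satSections (Omega.pullbackMap f p g hp ≫ toReflOmega f) U) : (genRefl f hk).γ U hU s ∈ baseSpan p k Y hY := by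
  obtain ⟨V, hV, hVU, a, t, ha, hat⟩ := hs _ hU
  have h1 := congrArg ((genRefl f hk).γ V hV) hat
  rw [(genRefl f hk).map_smul, (genRefl f hk).map_res] at h1
  have h2 : (genRefl f hk).γ V hV ((Omega.pullbackMap f p g hp ≫ toReflOmega f).app V t) =
      (genOmega f hk).γ V hV ((Omega.pullbackMap f p g hp).app V t) := genRefl_toReflOmega f hk V hV _
  have ha0 : gg V hV a ≠ 0 := fun h ↦ ha (gg_injective hV (h.trans (map_zero _).symm))
  rw [← Submodule.smul_mem_iff _ ha0, h1, h2]
  exact omegaVal_pullbackMap_mem f hk p g hp hYa hY hV t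

lemma exists_mul_isReg {U : X.Opens} (hUa : IsAffineOpen U) (hU : genericPoint X ∈ U) (s : Finset X.functionField) :
    ∃ a : Γ(X, U), a ≠ 0 ∧ ∀ x ∈ s, IsReg U hU (gg U hU a * x) := by
  have : Nonempty U := ⟨_, hU⟩
  have := functionField_isFractionRing_of_isAffineOpen X U hUa
  obtain ⟨a, ha⟩ := IsLocalization.exist_integer_multiples_of_finset (nonZeroDivisors Γ(X, U)) s
  refine ⟨a, nonZeroDivisors.coe_ne_zero a, fun x hx ↦ ?_⟩
  obtain ⟨c, hc⟩ := ha x hx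
  exact ⟨c, hc⟩

/-- A section of the reflexive differentials lies in the saturation if it does so at the generic point. -/
lemma mem_satSections_of_mem_baseSpan {U : X.Opens} (hU : genericPoint X ∈ U) {s : Γ(reflOmega f, U)}
    (hs : (genRefl f hk).γ U hU s ∈ baseSpan p k Y hY) :
    s ∈ satSections (Omega.pullbackMap f p g hp ≫ toReflOmega f) U := by
  intro x hx
  -- The point p x need not lie in Y, but the span is the same for an affine neighbourhood Q of p x.
  obtain ⟨Q, hQa, -, hxQ⟩ := exists_affine_le (U := (⊤ : Z.Opens)) (x := p x) trivial
  have hxU : x ∈ U ⊓ p ⁻¹ᵁ Q := ⟨hx, hxQ⟩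
  obtain ⟨V, hVa, hVU, hxV⟩ := exists_affine_le hxU
  have hV : genericPoint X ∈ V := genericPoint_mem hxV
  have hVQ : V ≤ p ⁻¹ᵁ Q := hVU.trans inf_le_right
  have hVU : V ≤ U := hVU.trans inf_le_left
  have hQ : p (genericPoint X) ∈ Q := hVQ hV
  have hs' := baseSpan_le p hQa hQ hY hs
  suffices ∃ a : Γ(X, V), a ≠ 0 ∧ ∃ t, gg V hV a • (genRefl f hk).γ U hU s =
      (genOmega f hk).γ V hV ((Omega.pullbackMap f p g hp).app V t) by
    obtain ⟨a, ha, t, hat⟩ := this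
    refine ⟨V, hxV, hVU, a, t, ha, genRefl_injective f hk hV ?_⟩
    rw [(genRefl f hk).map_smul, (genRefl f hk).map_res, hat]
    exact (genRefl_toReflOmega f hk V hV _).symm
  -- The value of s is a combination of differentials db with rational coefficients; multiplication
  -- by their common denominator a on V makes it a pulled back differential.
  obtain ⟨c, hc⟩ := Finsupp.mem_span_range_iff_exists_finsupp.mp hs'
  classical
  obtain ⟨a, ha, hreg⟩ := exists_mul_isReg hVa hV (c.support.image c)
  refine ⟨a, ha, ?_⟩
  choose! r hr using fun b (hb : b ∈ c.support) ↦ hreg (c b) (Finset.mem_image_of_mem c hb)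
  choose n hn using fun b : Γ(Z, Q) ↦ exists_pullbackMap_eq f p g hp b
  refine ⟨∑ b ∈ c.support, r b • ((Scheme.Modules.pullback p).obj (Omega g)).presheaf.map (homOfLE hVQ).op (n b), ?_⟩
  rw [← hc, Finsupp.sum, Finset.smul_sum, map_sum]
  have hsum : ∀ (F : Finset Γ(Z, Q)) (w : Γ(Z, Q) → Γ(Omega f, V)), (genOmega f hk).γ V hV (∑ b ∈ F, w b) =
    ∑ b ∈ F, (genOmega f hk).γ V hV (w b) := fun F w ↦ map_sum (omegaVal f hk _ hV) w F
  rw [hsum]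
  refine Finset.sum_congr rfl fun b hb ↦ ?_
  rw [Scheme.Modules.Hom.app_smul, (genOmega f hk).map_smul, hr b hb, res_app, hn, (genOmega f hk).map_res, smul_smul]
  congr 1
  exact (omegaVal_dX f hk _ hQ (p.app Q b)).symm

lemma satPullbackι_mem {U : X.Opens} (s : Γ(satPullback f p g hp, U)) :
    (satPullbackι f p g hp).app U s ∈ satSections (Omega.pullbackMap f p g hp ≫ toReflOmega f) U :=
  (show satSections (Omega.pullbackMap f p g hp ≫ toReflOmega f) U from s).2

/-- The generic stalk of the saturation of the pulled back differentials. -/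
def genSat : Gen (satPullback f p g hp) (baseSpan p k Y hY) where
  γ U hU s := ⟨(genRefl f hk).γ U hU ((satPullbackι f p g hp).app U s),
    mem_baseSpan_of_mem_satSections f hk p g hp hYa hY hU (satPullbackι_mem f p g hp s)⟩
  map_add U hU s t := Subtype.ext ((congrArg _ (map_add _ s t)).trans ((genRefl f hk).map_add _ _ _ _))
  map_smul U hU a s := Subtype.ext ((congrArg _ (Scheme.Modules.Hom.app_smul _ a s)).trans ((genRefl f hk).map_smul _ _ _ _))
  map_res U V h hV s := Subtype.ext ((congrArg _ (res_app _ h s)).trans ((genRefl f hk).map_res _ _ _ _ _))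
  eq_res U hU s t h := ⟨U, le_rfl, hU, congrArg _ (Subtype.ext (genRefl_injective f hk hU (congrArg Subtype.val h)))⟩
  surj w := by
    obtain ⟨U, hU, s, hs⟩ := (genOmega f hk).surj w
    have h1 := (genRefl_toReflOmega f hk U hU s).trans hs
    exact ⟨U, hU, ⟨(toReflOmega f).app U s, mem_satSections_of_mem_baseSpan f hk p g hp hY hU (by rw [h1]; exact w.2)⟩,
      Subtype.ext h1⟩

lemma exists_genSat_eq {U : X.Opens} (hU : genericPoint X ∈ U) (t : Γ(Omega f, U)) (w : baseSpan p k Y hY)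
    (h : (genOmega f hk).γ U hU t = w) : ∃ s, (genSat f hk p g hp hYa hY).γ U hU s = w := by
  have h1 := (genRefl_toReflOmega f hk U hU t).trans h
  exact ⟨⟨(toReflOmega f).app U t, mem_satSections_of_mem_baseSpan f hk p g hp hY hU (by rw [h1]; exact w.2)⟩, Subtype.ext h1⟩

lemma regT_genSat {m : ℕ} {U : X.Opens}
    {Λ : MultilinearMap X.functionField (fun _ : Fin m ↦ Ω[X.functionField⁄k]) X.functionField}
    (hΛ : (genOmega f hk).RegT U Λ) :
    (genSat f hk p g hp hYa hY).RegT U (Λ.compLinearMap fun _ ↦ (baseSpan p k Y hY).subtype) := fun V hVU hV s ↦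
  regT_genRefl f hk hΛ V hVU hV fun i ↦ (satPullbackι f p g hp).app V (s i)

/-- Λ is extended to Ω along a linear projection; the extension is regular on some open set, and so
is its restriction. -/
lemma exists_regT_genSat {m : ℕ} (Λ : MultilinearMap X.functionField (fun _ : Fin m ↦ baseSpan p k Y hY) X.functionField) :
    ∃ U : X.Opens, genericPoint X ∈ U ∧ (genSat f hk p g hp hYa hY).RegT U Λ := by
  obtain ⟨π, hπ⟩ := (baseSpan p k Y hY).subtype.exists_leftInverse_of_injective
    (LinearMap.ker_eq_bot.mpr (Submodule.injective_subtype _))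
  obtain ⟨U, hU, h⟩ := exists_regT f hk (Λ.compLinearMap fun _ ↦ π)
  refine ⟨U, hU, ?_⟩
  have h1 := regT_genSat f hk p g hp hYa hY h
  have h2 : (Λ.compLinearMap fun _ ↦ π).compLinearMap (fun _ ↦ (baseSpan p k Y hY).subtype) = Λ := by
    ext w
    simp only [MultilinearMap.compLinearMap_apply]
    congr 1
    funext i
    exact DFunLike.congr_fun hπ (w i)
  rwa [h2] at h1

end PluriForm

end

/-! ### Factoring functionals through the saturation -/

noncomputable section

set_option linter.unusedSectionVars false

/-- A functional on multilinear forms that vanishes on products with a factor vanishing on `W` factors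
through the restriction to `W`. -/
lemma MultilinearMap.exists_factor {K V ι : Type*} [Field K] [AddCommGroup V] [Module K V] [FiniteDimensional K V] [Fintype ι]
    (W : Submodule K V) (σ : Module.Dual K (MultilinearMap K (fun _ : ι ↦ V) K))
    (hσ : ∀ (ξ : ι → Module.Dual K V) (i : ι), (∀ w ∈ W, ξ i w = 0) → σ (prodForm K V ι ξ) = 0) :
    ∃ σ' : Module.Dual K (MultilinearMap K (fun _ : ι ↦ W) K),
      (∀ Λ, σ' (Λ.compLinearMap fun _ ↦ W.subtype) = σ Λ) ∧
      ∀ (π : V →ₗ[K] W), (∀ w : W, π w = w) → ∀ Λ, σ' Λ = σ (Λ.compLinearMap fun _ ↦ π) := by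
  classical
  have key : ∀ (π : V →ₗ[K] W), (∀ w : W, π w = w) → ∀ Λ : MultilinearMap K (fun _ : ι ↦ V) K,
      σ (Λ.compLinearMap fun _ ↦ W.subtype ∘ₗ π) = σ Λ := by
    intro π hπ Λ
    have hprod : ∀ ξ : ι → Module.Dual K V, σ ((prodForm K V ι ξ).compLinearMap fun _ ↦ W.subtype ∘ₗ π) = σ (prodForm K V ι ξ) := by
      intro ξ
      let f := σ.compMultilinearMap (prodForm K V ι)
      have h1 : (prodForm K V ι ξ).compLinearMap (fun _ ↦ W.subtype ∘ₗ π) = prodForm K V ι (fun i ↦ ξ i ∘ₗ W.subtype ∘ₗ π) := rfl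
      rw [h1]
      -- The forms `ξ i` and `ξ i ∘ π` agree on W, so they differ by a form in the annihilator of W,
      -- and σ vanishes on products with such a factor.
      refine f.eq_of_sub_mem (Submodule.dualAnnihilator W) ∅ (fun I' hI' ξ hξ ↦ ?_) (by simp) (by simp) fun i ↦ ?_
      · obtain ⟨i, hi, -⟩ := Finset.exists_of_ssubset hI'
        exact hσ ξ i ((Submodule.mem_dualAnnihilator _).mp (hξ i hi))
      · rw [Submodule.mem_dualAnnihilator]
        intro w hw
        simp only [LinearMap.sub_apply, LinearMap.comp_apply, Submodule.subtype_apply]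
        rw [hπ ⟨w, hw⟩, sub_self]
    have hlin : σ ∘ₗ compLinearMapₗ (fun _ ↦ W.subtype ∘ₗ π) = σ := by
      ext Λ
      rw [eq_sum_prodForm (Module.finBasis K V) Λ, _root_.map_sum, _root_.map_sum]
      refine Finset.sum_congr rfl fun c _ ↦ ?_
      rw [_root_.map_smul, _root_.map_smul]
      exact congrArg _ (hprod _)
    exact DFunLike.congr_fun hlin Λ
  obtain ⟨π₀, hπ₀⟩ := W.subtype.exists_leftInverse_of_injective (LinearMap.ker_eq_bot.mpr W.injective_subtype)
  have hπ₀ : ∀ w : W, π₀ w = w := fun w ↦ DFunLike.congr_fun hπ₀ w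
  -- Every projection to W computes the same σ'; this leaves room for a projection adapted to each
  -- valuation ring.
  refine ⟨σ ∘ₗ compLinearMapₗ (fun _ ↦ π₀), fun Λ ↦ key π₀ hπ₀ Λ, fun π hπ Λ ↦ ?_⟩
  rw [← key π₀ hπ₀ (Λ.compLinearMap fun _ ↦ π)]
  change σ (Λ.compLinearMap fun _ ↦ π₀) = _
  congr 1
  ext v
  simp only [compLinearMap_apply, LinearMap.comp_apply, Submodule.subtype_apply, hπ]

namespace PluriForm

variable {X : Scheme.{u}} [IsIntegral X] {k : Type u} [Field k]
  (f : X ⟶ Spec (CommRingCat.of k)) [LocallyOfFiniteType f] [Algebra k X.functionField]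
  (hk : algebraMap k X.functionField = kToK f)

/-- An element of the lattice involves finitely many elements of O. They are regular on D(a) for a
common denominator a that is a unit of O, and there the element is the value of a section of Ω. -/
lemma exists_omega_of_mem_diffLattice {U : X.Opens} (hU : genericPoint X ∈ U)
    {O : Subalgebra k X.functionField} (hO : O.IsLocalizationOf (regAlgK f hk U hU)) {v : Ω[X.functionField⁄k]}
    (hv : v ∈ diffLattice (KaehlerDifferential.D k X.functionField) O) :
    ∃ a : Γ(X, U), (gg U hU a)⁻¹ ∈ O ∧ ∃ ha : genericPoint X ∈ X.basicOpen a, ∃ t, (genOmega f hk).γ (X.basicOpen a) ha t = v := by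
  have res : ∀ (a b : Γ(X, U)) (ha : genericPoint X ∈ X.basicOpen a) (hab : genericPoint X ∈ X.basicOpen (a * b)) (t),
      ∃ t', (genOmega f hk).γ (X.basicOpen (a * b)) hab t' = (genOmega f hk).γ (X.basicOpen a) ha t := by
    intro a b ha hab t
    have hle : X.basicOpen (a * b) ≤ X.basicOpen a := by rw [X.basicOpen_mul]; exact inf_le_left
    exact ⟨_, (genOmega f hk).map_res _ _ hle hab t⟩
  have fn : ∀ y ∈ O, ∃ a : Γ(X, U), (gg U hU a)⁻¹ ∈ O ∧ ∃ ha : genericPoint X ∈ X.basicOpen a, IsReg (X.basicOpen a) ha y := by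
    intro y hy
    obtain ⟨_, ⟨a, rfl⟩, ha0, hinv, c, hc⟩ := hO.exists_mul_mem y hy
    have ha : genericPoint X ∈ X.basicOpen a := (mem_basicOpen_iff hU a).mpr fun h ↦ ha0 (by rw [h, map_zero])
    refine ⟨a, hinv, ha, ?_⟩
    have h1 := Subalgebra.mul_mem (regAlgK f hk _ ha) (isReg_inv_basicOpen (hU := hU) ha) (IsReg.mono (X.basicOpen_le a) ha ⟨c, hc⟩)
    rwa [inv_mul_cancel_left₀ ha0] at h1
  have hmul : ∀ a b : Γ(X, U), (gg U hU a)⁻¹ ∈ O → (gg U hU b)⁻¹ ∈ O → (gg U hU (a * b))⁻¹ ∈ O := fun a b ha hb ↦ by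
    rw [map_mul, mul_inv]; exact O.mul_mem ha hb
  have hη : ∀ a b : Γ(X, U), genericPoint X ∈ X.basicOpen a → genericPoint X ∈ X.basicOpen b → genericPoint X ∈ X.basicOpen (a * b) :=
    fun a b ha hb ↦ by rw [X.basicOpen_mul]; exact ⟨ha, hb⟩
  refine Submodule.span_induction (p := fun v _ ↦ ∃ a : Γ(X, U), (gg U hU a)⁻¹ ∈ O ∧
    ∃ ha : genericPoint X ∈ X.basicOpen a, ∃ t, (genOmega f hk).γ (X.basicOpen a) ha t = v) ?_ ?_ ?_ ?_ hv
  · rintro _ ⟨y, hy, rfl⟩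
    obtain ⟨a, hinv, ha, b, rfl⟩ := fn y hy
    exact ⟨a, hinv, ha, dX f b, omegaVal_dX f hk _ ha b⟩
  · have h1 : genericPoint X ∈ X.basicOpen (1 : Γ(X, U)) := by rwa [X.basicOpen_of_isUnit isUnit_one]
    exact ⟨1, by rw [map_one, inv_one]; exact O.one_mem, h1, 0, map_zero (omegaVal f hk _ h1)⟩
  · rintro v w _ _ ⟨a, hinv, ha, t, rfl⟩ ⟨b, hinvb, hb, t', rfl⟩
    have hab := hη a b ha hb
    obtain ⟨s, hs⟩ := res a b ha hab t
    obtain ⟨s', hs'⟩ := res b a hb (mul_comm a b ▸ hab) t'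
    have hle : X.basicOpen (a * b) ≤ X.basicOpen b := by rw [X.basicOpen_mul]; exact inf_le_right
    refine ⟨a * b, hmul a b hinv hinvb, hab, s + (Omega f).presheaf.map (homOfLE hle).op t', ?_⟩
    rw [(genOmega f hk).map_add, hs, (genOmega f hk).map_res]
  · rintro ⟨y, hy⟩ v _ ⟨a, hinv, ha, t, rfl⟩
    obtain ⟨b, hinvb, hb, c, hc⟩ := fn y hy
    have hab := hη a b ha hb
    obtain ⟨s, hs⟩ := res a b ha hab t
    have hle : X.basicOpen (a * b) ≤ X.basicOpen b := by rw [X.basicOpen_mul]; exact inf_le_right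
    refine ⟨a * b, hmul a b hinv hinvb, hab, X.presheaf.map (homOfLE hle).op c • s, ?_⟩
    rw [(genOmega f hk).map_smul, hs, gg_res, hc]
    rfl

variable {Z : Scheme.{u}} (p : X ⟶ Z) (g : Z ⟶ Spec (CommRingCat.of k)) (hp : p ≫ g = f)
  {Y : Z.Opens} (hYa : IsAffineOpen Y) (hY : p (genericPoint X) ∈ Y)

/-- The functional induced on forms on the saturation is regular. -/
lemma isReg_of_factor (hX : IsNormalScheme X) {m : ℕ}
    {σ : Module.Dual X.functionField (MultilinearMap X.functionField (fun _ : Fin m ↦ Ω[X.functionField⁄k]) X.functionField)}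
    (hσ : ∀ (U : X.Opens) (hU : genericPoint X ∈ U) (Λ), (genOmega f hk).RegT U Λ → IsReg U hU (σ Λ))
    {σ' : Module.Dual X.functionField (MultilinearMap X.functionField (fun _ : Fin m ↦ baseSpan p k Y hY) X.functionField)}
    (hσ' : ∀ (π : Ω[X.functionField⁄k] →ₗ[X.functionField] baseSpan p k Y hY), (∀ w : baseSpan p k Y hY, π w = w) →
      ∀ Λ, σ' Λ = σ (Λ.compLinearMap fun _ ↦ π))
    {U : X.Opens} (hU : genericPoint X ∈ U) {Λ} (hΛ : (genSat f hk p g hp hYa hY).RegT U Λ) : IsReg U hU (σ' Λ) := by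
  refine IsReg.of_locally hU fun y hy ↦ ?_
  obtain ⟨V, hVa, hVU, hyV⟩ := exists_affine_le hy
  have hV := genericPoint_mem hyV
  refine ⟨V, hVU, hV, hyV, ?_⟩
  by_contra hcon
  let A := regAlgK f hk V hV
  have : IsFractionRing A X.functionField := isFractionRing_regAlg hVa
  have : IsIntegrallyClosed A := isIntegrallyClosed_regAlg hX hVa
  have hA : A.FG := regAlgK_fg f hk hV hVa
  have : IsNoetherianRing A := by
    have := (Subalgebra.fg_iff_finiteType _).mp hA
    exact Algebra.FiniteType.isNoetherianRing k A
  -- As V is normal and affine, a failure of regularity on V shows at a discrete valuation ring O;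
  -- nothing is inverted, so S is trivial.
  obtain ⟨O, hO, hdvr, -, hx⟩ := Subalgebra.exists_isDiscreteValuationRing A ⊥ (fun s hs ↦ by
    rw [Submonoid.mem_bot.mp hs]; exact A.one_mem) (σ' Λ) (fun s hs ↦ by
    rw [Submonoid.mem_bot.mp hs, one_mul]; exact hcon)
  have : IsFractionRing O X.functionField := hO.isFractionRing
  -- Since π preserves the lattice of differentials of O, the extension Λ ∘ π will be regular on O,
  -- where σ preserves regularity.
  obtain ⟨π, hπW, hπ, hπM⟩ := exists_projection_of_lattice (K := X.functionField)
    (diffLattice (KaehlerDifferential.D k X.functionField) O) (diffLattice_fg _ hA hO)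
    (span_diffLattice _ (KaehlerDifferential.span_range_derivation k X.functionField)) (baseSpan p k Y hY)
  let π' := π.codRestrict (baseSpan p k Y hY) hπW
  apply hx
  rw [hσ' π' fun w ↦ Subtype.ext (hπ w w.2)]
  refine mem_of_isRegularOn_localization hA hO σ (fun Λ hΛ ↦ hσ V hV Λ ((regT_iff f hk hV hVa Λ).mpr hΛ)) fun a ha ↦ ?_
  rw [MultilinearMap.compLinearMap_apply]
  -- The projected differentials are values of sections of Ω over D(c), with c a unit of O. As they
  -- lie in W, they are sections of the saturation, on which Λ is regular.
  choose b hinv hb t ht using fun i ↦ exists_omega_of_mem_diffLattice f hk hV hO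
    (hπM _ (Submodule.subset_span ⟨a i, ha i, rfl⟩))
  let c := ∏ i, b i
  have hcb : ∀ i, X.basicOpen c ≤ X.basicOpen (b i) := fun i ↦ by
    change X.basicOpen (∏ i, b i) ≤ _
    rw [← Finset.mul_prod_erase Finset.univ b (Finset.mem_univ i), X.basicOpen_mul]
    exact inf_le_left
  have hc : genericPoint X ∈ X.basicOpen c := by
    rw [mem_basicOpen_iff hV]
    intro h
    have h1 : ∏ i, gg V hV (b i) = 0 := by rw [← map_prod]; exact (congrArg _ h).trans (map_zero _)
    obtain ⟨i, -, hi⟩ := Finset.prod_eq_zero_iff.mp h1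
    exact (mem_basicOpen_iff hV (b i)).mp (hb i) (gg_injective hV (hi.trans (map_zero _).symm))
  have hcO : (gg V hV c)⁻¹ ∈ O := by
    change (gg V hV (∏ i, b i))⁻¹ ∈ O
    rw [map_prod, ← Finset.prod_inv_distrib]
    exact O.prod_mem fun i _ ↦ hinv i
  choose s hs using fun i ↦ exists_genSat_eq f hk p g hp hYa hY hc ((Omega f).presheaf.map (homOfLE (hcb i)).op (t i))
    (π' (KaehlerDifferential.D k X.functionField (a i))) (((genOmega f hk).map_res _ _ (hcb i) hc (t i)).trans (ht i))
  have h1 := hΛ (X.basicOpen c) ((X.basicOpen_le c).trans hVU) hc s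
  simp only [hs] at h1
  obtain ⟨n, hn⟩ := exists_of_isReg_basicOpen (hU := hV) hVa hc h1
  have h2 := O.mul_mem (O.pow_mem hcO n) (hO.le hn)
  have hc0 : gg V hV c ≠ 0 := fun h ↦ (mem_basicOpen_iff hV c).mp hc (gg_injective hV (h.trans (map_zero _).symm))
  rwa [inv_pow, inv_mul_cancel_left₀ (pow_ne_zero _ hc0)] at h2

include hYa in
/-- The comparison isomorphism, given the vanishing of regular functionals on products with a vertical factor. -/
theorem exists_equiv_of_vanishing (hX : IsNormalScheme X) (m : ℕ)
    (hv : ∀ σ : Module.Dual X.functionField (MultilinearMap X.functionField (fun _ : Fin m ↦ Ω[X.functionField⁄k]) X.functionField),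
      (∀ (U : X.Opens) (hU : genericPoint X ∈ U) (Λ), (genOmega f hk).RegT U Λ → IsReg U hU (σ Λ)) →
      ∀ (ξ : Fin m → Module.Dual X.functionField Ω[X.functionField⁄k]) (i : Fin m), (∀ w ∈ baseSpan p k Y hY, ξ i w = 0) →
        σ (MultilinearMap.prodForm X.functionField _ _ ξ) = 0) :
    ∃ e : Γ(reflPow (Omega f) m, ⊤) ≃ₗ[Γ(X, ⊤)] Γ(reflPow (satPullback f p g hp) m, ⊤),
      ∀ s, (reflPowMap (satPullbackι f p g hp) m).app ⊤ (e s) = (reflPowMap (toReflOmega f) m).app ⊤ s := by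
  have := finiteDimensional_omega f hk
  refine exists_equiv_reflPow (baseSpan p k Y hY) (genOmega f hk) (genRefl f hk) (genSat f hk p g hp hYa hY) m
    (exists_regT f hk) (fun Λ ↦ ?_) (exists_regT_genSat f hk p g hp hYa hY) (toReflOmega f) (genRefl_toReflOmega f hk)
    (satPullbackι f p g hp) (fun U hU s ↦ rfl) (fun U Λ hΛ ↦ regT_genSat f hk p g hp hYa hY hΛ) fun σ hσ ↦ ?_
  · obtain ⟨U, hU, h⟩ := exists_regT f hk Λ
    exact ⟨U, hU, regT_genRefl f hk h⟩
  · obtain ⟨σ', h1, h2⟩ := MultilinearMap.exists_factor (baseSpan p k Y hY) σ (hv σ hσ)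
    exact ⟨σ', h1, fun U hU Λ hΛ ↦ isReg_of_factor f hk p g hp hYa hY hX hσ h2 hU hΛ⟩

end PluriForm

end

/-! ### Fibers over closed points as closed subschemes -/

noncomputable section

set_option linter.unusedSectionVars false
namespace PluriForm

/-- With C a quotient of B, the pushout A ⊗_B C is A modulo the ideal generated by the kernel of B →
C. -/
lemma isPushout_ker {B A C D : CommRingCat.{u}} {α : B ⟶ A} {β : B ⟶ C} {γ : A ⟶ D} {δ : C ⟶ D} (h : IsPushout α β γ δ)
    (hβ : Function.Surjective β) : RingHom.ker γ.hom = (RingHom.ker β.hom).map α.hom := by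
  apply le_antisymm
  · intro a ha
    let J := (RingHom.ker β.hom).map α.hom
    let q₀ : {q : B →+* A ⧸ J // RingHom.ker β.hom ≤ RingHom.ker q} := ⟨(Ideal.Quotient.mk J).comp α.hom, fun b hb ↦
      Ideal.Quotient.eq_zero_iff_mem.mpr (Ideal.mem_map_of_mem _ hb)⟩
    let q : C →+* A ⧸ J := β.hom.liftOfSurjective hβ q₀
    have hw : α ≫ CommRingCat.ofHom (Ideal.Quotient.mk J) = β ≫ CommRingCat.ofHom q := by
      ext b
      exact (RingHom.liftOfRightInverse_comp_apply β.hom _ (Function.rightInverse_surjInv hβ) q₀ b).symm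
    have h1 := ConcreteCategory.congr_hom (h.inl_desc _ _ hw) a
    have h2 : γ a = 0 := ha
    rw [ConcreteCategory.comp_apply, h2, map_zero] at h1
    exact Ideal.Quotient.eq_zero_iff_mem.mp h1.symm
  · rw [Ideal.map_le_iff_le_comap]
    intro b hb
    have h1 := ConcreteCategory.congr_hom h.w b
    have h2 : β b = 0 := hb
    rw [ConcreteCategory.comp_apply, ConcreteCategory.comp_apply, h2, map_zero] at h1
    exact h1

variable {X Z F : Scheme.{u}} (p : X ⟶ Z) (Y : Z.Opens)

/-- A morphism is locally the inclusion of the closed subscheme cut out by an ideal of functions on an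
affine open subset of the base. -/
structure IsFiberOver (ι : F ⟶ X) (I : Ideal Γ(Z, Y)) : Prop where
  mem : ∀ x, p (ι x) ∈ Y
  inducing : Topology.IsInducing ι
  surjective : ∀ U : X.Opens, IsAffineOpen U → Function.Surjective (ι.app U)
  ker : ∀ U : X.Opens, IsAffineOpen U → ∀ hU : U ≤ p ⁻¹ᵁ Y, RingHom.ker (ι.app U).hom = I.map (p.appLE Y U hU).hom

variable {Y}

lemma exists_isFiberOver (hYa : IsAffineOpen Y) [JacobsonSpace Z] {I : Ideal Γ(Z, Y)} (hI : I.IsMaximal) :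
    ∃ z ∈ Y, IsClosed ({z} : Set Z) ∧ IsFiberOver p Y (p.fiberι z) I := by
  let y : Spec Γ(Z, Y) := (⟨I, hI.isPrime⟩ : PrimeSpectrum Γ(Z, Y))
  let z := hYa.fromSpec y
  have hzY : z ∈ Y := by
    have : z ∈ Set.range hYa.fromSpec := ⟨y, rfl⟩
    rwa [hYa.range_fromSpec] at this
  -- Z is a Jacobson space, so a closed point of the open subset Y is closed in Z.
  have hz : IsClosed ({z} : Set Z) := by
    have h1 := hYa.isOpenImmersion_fromSpec
    have h2 := (hYa.fromSpec.isOpenEmbedding).preimage_closedPoints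
    have h3 : y ∈ closedPoints (Spec Γ(Z, Y)) := (PrimeSpectrum.isClosed_singleton_iff_isMaximal _).mpr hI
    rw [← h2] at h3
    exact h3
  have hzb : ∀ b : Γ(Z, Y), z ∈ Z.basicOpen b ↔ b ∉ I := fun b ↦ by
    have h1 : y ∈ hYa.fromSpec ⁻¹ᵁ Z.basicOpen b ↔ b ∉ I := by
      rw [hYa.fromSpec_preimage_basicOpen]
      rfl
    exact h1
  have hcl : IsClosedImmersion (Z.fromSpecResidueField z) := isClosed_singleton_iff_isClosedImmersion.mp hz
  have hcl' : IsClosedImmersion (p.fiberι z) := by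
    exact inferInstanceAs (IsClosedImmersion (Limits.pullback.fst p (Z.fromSpecResidueField z)))
  have hmem : ∀ x, p (p.fiberι z x) ∈ Y := fun x ↦ by
    have : p.fiberι z x ∈ Set.range (p.fiberι z) := ⟨x, rfl⟩
    rw [p.range_fiberι] at this
    have this : p (p.fiberι z x) = z := this
    rwa [this]
  refine ⟨z, hzY, hz, hmem, (p.fiberι z).isEmbedding.isInducing, fun U hU ↦ (p.fiberι z).app_surjective U hU, fun U hUa hU ↦ ?_⟩
  have hP : IsPullback (p.fiberι z) (p.fiberToSpecResidueField z) p (Z.fromSpecResidueField z) := IsPullback.of_hasPullback _ _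
  have hUY : p.fiberι z ⁻¹ᵁ U = p.fiberι z ⁻¹ᵁ U ⊓ p.fiberToSpecResidueField z ⁻¹ᵁ (Z.fromSpecResidueField z ⁻¹ᵁ Y) := by
    refine (inf_eq_left.mpr fun x _ ↦ ?_).symm
    have := ConcreteCategory.congr_hom (congrArg (fun φ ↦ φ.base) hP.w) x
    change (p.fiberToSpecResidueField z ≫ Z.fromSpecResidueField z) x ∈ Y
    rw [← hP.w]
    exact hmem x
  -- Functions on the fiber over U are the pushout of the functions on U and the residue field at z;
  -- functions on Y map onto the residue field because z is closed.
  have hpo := (isIso_pushoutSection_iff hP le_rfl hU hUY).mp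
    (isIso_pushoutSection_of_isAffineOpen hP le_rfl hU hUY hYa (hYa.preimage _) hUa)
  have hs := (Z.fromSpecResidueField z).app_surjective Y hYa
  rw [Scheme.Hom.app_eq_appLE] at hs
  have hk := isPushout_ker hpo hs
  rw [Scheme.Hom.app_eq_appLE, hk]
  -- It remains to identify I with the functions that vanish at z, i.e. those whose basic open set
  -- misses z.
  congr 1
  ext b
  rw [← Scheme.Hom.app_eq_appLE, RingHom.mem_ker, ← not_iff_not, ← hzb]
  change ¬ (Z.fromSpecResidueField z).app Y b = 0 ↔ _
  rw [← basicOpen_eq_bot_iff, ← Scheme.Hom.preimage_basicOpen]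
  constructor
  · intro h
    by_contra h'
    refine h (eq_bot_iff.mpr fun x hx ↦ h' ?_)
    have hx : Z.fromSpecResidueField z x ∈ Z.basicOpen b := hx
    rwa [Scheme.fromSpecResidueField_apply] at hx
  · intro h h'
    let x : Spec (Z.residueField z) := default
    have : x ∈ Z.fromSpecResidueField z ⁻¹ᵁ Z.basicOpen b := by
      change Z.fromSpecResidueField z x ∈ Z.basicOpen b
      rwa [Scheme.fromSpecResidueField_apply]
    rw [h'] at this
    exact this

/-- Nullstellensatz: B / I is a finite extension of the algebraically closed field k. Hence
functions of the base are constant on the fiber and have zero differential there. -/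
lemma exists_sub_algebraMap_mem {k B : Type*} [Field k] [IsAlgClosed k] [CommRing B] [Algebra k B] [Algebra.FiniteType k B]
    {I : Ideal B} (hI : I.IsMaximal) (b : B) : ∃ c : k, b - algebraMap k B c ∈ I := by
  let _ : Field (B ⧸ I) := Ideal.Quotient.field I
  have : Algebra.FiniteType k (B ⧸ I) := .of_surjective (Ideal.Quotient.mkₐ k I) Ideal.Quotient.mk_surjective
  have := finite_of_finite_type_of_isJacobsonRing k (B ⧸ I)
  obtain ⟨c, hc⟩ := (IsAlgClosed.algebraMap_bijective_of_isIntegral (k := k) (K := B ⧸ I)).2 (Ideal.Quotient.mk I b)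
  refine ⟨c, Ideal.Quotient.eq_zero_iff_mem.mp ?_⟩
  rw [map_sub, sub_eq_zero, ← hc]
  rfl

end PluriForm

end

/-! ### Gluing a pluri-form on a fiber from a regular functional -/

noncomputable section

set_option linter.unusedSectionVars false
namespace PluriForm

section
variable {F : Scheme.{u}}

lemma exists_glue {V : F.Opens} {α : Type u} (W : α → F.Opens) (hW : ∀ a, W a ≤ V) (s : ∀ a, Γ(F, W a))
    (hcov : ∀ x ∈ V, ∃ a, x ∈ W a)
    (hs : ∀ a b x, x ∈ W a → x ∈ W b → ∃ (W' : F.Opens) (h : W' ≤ W a) (h' : W' ≤ W b), x ∈ W' ∧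
      F.presheaf.map (homOfLE h).op (s a) = F.presheaf.map (homOfLE h').op (s b)) :
    ∃ t : Γ(F, V), ∀ a, F.presheaf.map (homOfLE (hW a)).op t = s a := by
  obtain ⟨t, ht, -⟩ := TopCat.Sheaf.existsUnique_gluing' F.sheaf W V (fun a ↦ homOfLE (hW a))
    (fun x hx ↦ Opens.mem_iSup.mpr (hcov x hx)) s fun a b ↦ by
      refine O_ext fun x hx ↦ ?_
      obtain ⟨W', h, h', hx', e⟩ := hs a b x hx.1 hx.2
      refine ⟨W', le_inf h h', hx', ?_⟩
      exact (O_res_res inf_le_left (le_inf h h') (s a)).trans (e.trans (O_res_res inf_le_right (le_inf h h') (s b)).symm)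
  exact ⟨t, ht⟩

lemma app_res {X : Scheme.{u}} (ι : F ⟶ X) {U V : X.Opens} (h : V ≤ U) (h' : ι ⁻¹ᵁ V ≤ ι ⁻¹ᵁ U) (a : Γ(X, U)) :
    ι.app V (X.presheaf.map (homOfLE h).op a) = F.presheaf.map (homOfLE h').op (ι.app U a) :=
  ConcreteCategory.congr_hom (ι.naturality (homOfLE h).op) a

variable {k : Type u} [Field k] (f : F ⟶ Spec (CommRingCat.of k))

lemma dX_add {U : F.Opens} (a b : Γ(F, U)) : dX f (a + b) = dX f a + dX f b := map_add ((univD f).d (X := op U)) a b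

lemma dX_mul {U : F.Opens} (a b : Γ(F, U)) : dX f (a * b) = a • dX f b + b • dX f a := (univD f).d_mul (X := op U) a b

lemma dX_kToO {U : F.Opens} (c : k) : dX f (kToO f U c) = 0 := (univD f).d_app (X := op U) c

/-- The universal derivation on an open subset. -/
def dDer (U : F.Opens) : Derivation ℤ Γ(F, U) Γ(Omega f, U) :=
  Derivation.mk' (AddMonoidHom.toIntLinearMap (AddMonoidHom.mk' (fun a : Γ(F, U) ↦ dX f a) (dX_add f))) (dX_mul f)

end

variable {X F : Scheme.{u}} [IsIntegral X] {k : Type u} [Field k] (f : X ⟶ Spec (CommRingCat.of k)) (ι : F ⟶ X)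
  {B : Type u} [CommRing B] [Algebra B X.functionField] {j : ℕ}

/-- A form at the generic point is regular on an open subset and restricts to a given form on a
closed subscheme. -/
def Compat (W : X.Opens) (hW : genericPoint X ∈ W)
    (Λ : MultilinearMap X.functionField (fun _ : Fin j ↦ Ω[X.functionField⁄B]) X.functionField)
    (μ : MultilinearMap Γ(F, ι ⁻¹ᵁ W) (fun _ : Fin j ↦ (Γ(Omega (ι ≫ f), ι ⁻¹ᵁ W) : Type u)) Γ(F, ι ⁻¹ᵁ W)) : Prop :=
  ∀ c : Fin j → Γ(X, W), ∃ r : Γ(X, W), gg W hW r = Λ (fun i ↦ KaehlerDifferential.D B X.functionField (gg W hW (c i))) ∧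
    ι.app W r = μ (fun i ↦ dX (ι ≫ f) (ι.app W (c i)))

section
variable {f ι}
variable {W : X.Opens} {hW : genericPoint X ∈ W}
    {Λ Λ' : MultilinearMap X.functionField (fun _ : Fin j ↦ Ω[X.functionField⁄B]) X.functionField}
    {μ μ' : MultilinearMap Γ(F, ι ⁻¹ᵁ W) (fun _ : Fin j ↦ (Γ(Omega (ι ≫ f), ι ⁻¹ᵁ W) : Type u)) Γ(F, ι ⁻¹ᵁ W)}

lemma Compat.sub (h : Compat f ι W hW Λ μ) (h' : Compat f ι W hW Λ' μ') : Compat f ι W hW (Λ - Λ') (μ - μ') := fun c ↦ by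
  obtain ⟨r, h1, h2⟩ := h c
  obtain ⟨r', h1', h2'⟩ := h' c
  exact ⟨r - r', by rw [map_sub, h1, h1']; rfl, by rw [map_sub, h2, h2']; rfl⟩

lemma Compat.smul (h : Compat f ι W hW Λ μ) (a : Γ(X, W)) : Compat f ι W hW (gg W hW a • Λ) (ι.app W a • μ) := fun c ↦ by
  obtain ⟨r, h1, h2⟩ := h c
  exact ⟨a * r, by rw [map_mul, h1]; rfl, by rw [map_mul, h2]; rfl⟩

/-- Differentials of functions on D(a) are spanned by those of functions on U, so compatibility need
only be tested on functions from U. -/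
lemma compat_basicOpen {U : X.Opens} (hU : genericPoint X ∈ U) (hUa : IsAffineOpen U) {a : Γ(X, U)}
    (ha : genericPoint X ∈ X.basicOpen a)
    {Λ : MultilinearMap X.functionField (fun _ : Fin j ↦ Ω[X.functionField⁄B]) X.functionField}
    {μ : MultilinearMap Γ(F, ι ⁻¹ᵁ X.basicOpen a) (fun _ : Fin j ↦ (Γ(Omega (ι ≫ f), ι ⁻¹ᵁ X.basicOpen a) : Type u))
      Γ(F, ι ⁻¹ᵁ X.basicOpen a)}
    (h : ∀ c : Fin j → Γ(X, U), ∃ r : Γ(X, X.basicOpen a),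
      gg _ ha r = Λ (fun i ↦ KaehlerDifferential.D B X.functionField (gg U hU (c i))) ∧
      ι.app _ r = μ (fun i ↦ dX (ι ≫ f) (ι.app _ (X.presheaf.map (homOfLE (X.basicOpen_le a)).op (c i))))) :
    Compat f ι (X.basicOpen a) ha Λ μ := by
  have := hUa.isLocalization_basicOpen a
  refine MultilinearMap.exists_of_isLocalization (Submonoid.powers a) (gg _ ha) (ι.app (X.basicOpen a)).hom
    ((KaehlerDifferential.D B X.functionField).restrictScalars ℤ) (dDer (ι ≫ f) _) Λ μ fun c ↦ ?_
  obtain ⟨r, h1, h2⟩ := h c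
  refine ⟨r, h1.trans (congrArg Λ (funext fun i ↦ ?_)), h2⟩
  exact congrArg (KaehlerDifferential.D B X.functionField) (gg_res (X.basicOpen_le a) ha (c i)).symm

lemma Compat.basicOpen (hWa : IsAffineOpen W) {V : F.Opens} {μ : dualSections (tensorPow (Omega (ι ≫ f)) j) V} (hV : ι ⁻¹ᵁ W ≤ V)
    (h : Compat f ι W hW Λ (evT μ ⟨ι ⁻¹ᵁ W, hV⟩)) {W' : X.Opens} {a : Γ(X, W)} (e : W' = X.basicOpen a) (ha : genericPoint X ∈ W')
    (hV' : ι ⁻¹ᵁ W' ≤ V) :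
    Compat f ι W' ha Λ (evT μ ⟨ι ⁻¹ᵁ W', hV'⟩) := by
  subst e
  refine compat_basicOpen hW hWa ha fun c ↦ ?_
  obtain ⟨r, h1, h2⟩ := h c
  have hle : ι ⁻¹ᵁ X.basicOpen a ≤ ι ⁻¹ᵁ W := fun x hx ↦ X.basicOpen_le a hx
  refine ⟨X.presheaf.map (homOfLE (X.basicOpen_le a)).op r, (gg_res _ ha r).trans h1, ?_⟩
  rw [app_res ι _ hle, h2, ← evT_res μ ⟨ι ⁻¹ᵁ W, hV⟩ ⟨_, hV'⟩ hle]
  congr 1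
  funext i
  rw [app_res ι _ hle, dX_res]

end

/-- A family of affine open subsets on which forms on a closed subscheme lift, compatibly with a
functional on forms. -/
structure IsLiftingFamily (σ : Module.Dual X.functionField
    (MultilinearMap X.functionField (fun _ : Fin j ↦ Ω[X.functionField⁄B]) X.functionField)) (G : Set X.Opens) : Prop where
  affine : ∀ W ∈ G, IsAffineOpen W
  mem : ∀ W ∈ G, genericPoint X ∈ W
  basicOpen : ∀ W ∈ G, ∀ a : Γ(X, W), genericPoint X ∈ X.basicOpen a → X.basicOpen a ∈ G
  cover : ∀ x, ∃ W ∈ G, ι x ∈ W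
  inducing : Topology.IsInducing ι
  surjective : ∀ W ∈ G, Function.Surjective (ι.app W)
  exists_form : ∀ W (h : W ∈ G) μ, ∃ Λ, Compat f ι (B := B) (j := j) W (mem W h) Λ μ
  regular : ∀ W (h : W ∈ G) Λ μ, Compat f ι (B := B) (j := j) W (mem W h) Λ μ → IsReg W (mem W h) (σ Λ)
  eq_zero : ∀ W (h : W ∈ G) Λ r, Compat f ι (B := B) (j := j) W (mem W h) Λ 0 → gg W (mem W h) r = σ Λ → ι.app W r = 0

namespace IsLiftingFamily
variable {f ι} {σ : Module.Dual X.functionField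
    (MultilinearMap X.functionField (fun _ : Fin j ↦ Ω[X.functionField⁄B]) X.functionField)} {G : Set X.Opens}
  (hG : IsLiftingFamily f ι σ G)
include hG

lemma exists_mem_le {V : F.Opens} {x : F} (hx : x ∈ V) : ∃ W ∈ G, ι x ∈ W ∧ ι ⁻¹ᵁ W ≤ V := by
  obtain ⟨W, hW, hxW⟩ := hG.cover x
  obtain ⟨O, hO, hOV⟩ := hG.inducing.isOpen_iff.mp V.isOpen
  have hxO : ι x ∈ (⟨O, hO⟩ : X.Opens) := by
    have : x ∈ ι ⁻¹' O := by rw [hOV]; exact hx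
    exact this
  obtain ⟨a, haO, hxa⟩ := (hG.affine W hW).exists_basicOpen_le ⟨ι x, hxO⟩ hxW
  refine ⟨X.basicOpen a, hG.basicOpen W hW a (genericPoint_mem hxa), hxa, fun y hy ↦ ?_⟩
  have h1 : y ∈ ι ⁻¹' O := haO hy
  rw [hOV] at h1
  exact h1

/-- Two lifts of one form on the fiber differ by a form that restricts to zero, and by `eq_zero` its
image under σ vanishes on the fiber. So the restriction of σ(Λ) depends on μ alone. -/
lemma app_eq_app {W : X.Opens} (hW : W ∈ G) {Λ Λ' μ} (h : Compat f ι (B := B) W (hG.mem W hW) Λ μ)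
    (h' : Compat f ι W (hG.mem W hW) Λ' μ) {r r' : Γ(X, W)} (hr : gg W (hG.mem W hW) r = σ Λ)
    (hr' : gg W (hG.mem W hW) r' = σ Λ') : ι.app W r = ι.app W r' := by
  have h1 := h.sub h'
  rw [sub_self] at h1
  have := hG.eq_zero W hW _ (r - r') h1 (by rw [map_sub, map_sub, hr, hr'])
  rwa [map_sub, sub_eq_zero] at this

/-- The value of the future pluri-form on μ: locally μ lifts to a form Λ on X, and the restrictions
of the functions σ(Λ) to the fiber are glued. -/
lemma exists_value {V : F.Opens} (μ : dualSections (tensorPow (Omega (ι ≫ f)) j) V) :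
    ∃ s : Γ(F, V), ∀ W (hW : W ∈ G) (h : ι ⁻¹ᵁ W ≤ V) Λ r, Compat f ι W (hG.mem W hW) Λ (evT μ ⟨ι ⁻¹ᵁ W, h⟩) →
      gg W (hG.mem W hW) r = σ Λ → F.presheaf.map (homOfLE h).op s = ι.app W r := by
  -- Gluing runs over all triples of an open set W, a lift Λ of μ on it, and r = σ(Λ), so that the
  -- value does not depend on choices.
  obtain ⟨s, hs⟩ := exists_glue (V := V) (α := {w : (W : X.Opens) × (MultilinearMap X.functionField
      (fun _ : Fin j ↦ Ω[X.functionField⁄B]) X.functionField) × Γ(X, W) // ∃ (hW : w.1 ∈ G) (h : ι ⁻¹ᵁ w.1 ≤ V),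
        Compat f ι w.1 (hG.mem w.1 hW) w.2.1 (evT μ ⟨ι ⁻¹ᵁ w.1, h⟩) ∧ gg w.1 (hG.mem w.1 hW) w.2.2 = σ w.2.1})
    (fun w ↦ ι ⁻¹ᵁ w.1.1) (fun w ↦ w.2.2.1) (fun w ↦ ι.app w.1.1 w.1.2.2) (fun x hx ↦ by
      obtain ⟨W, hW, hxW, hWV⟩ := hG.exists_mem_le hx
      obtain ⟨Λ, hΛ⟩ := hG.exists_form W hW (evT μ ⟨ι ⁻¹ᵁ W, hWV⟩)
      obtain ⟨r, hr⟩ := hG.regular W hW _ _ hΛ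
      exact ⟨⟨⟨W, Λ, r⟩, hW, hWV, hΛ, hr⟩, hxW⟩) (by
      rintro ⟨⟨W, Λ, r⟩, hW, hWV, hΛ, hr⟩ ⟨⟨W', Λ', r'⟩, hW', hWV', hΛ', hr'⟩ x hx hx'
      -- An open set that is basic in both W and W'; both lifts stay compatible with μ on it.
      obtain ⟨a, a', e, hxa⟩ := exists_basicOpen_le_affine_inter (hG.affine W hW) (hG.affine W' hW') (ι x) ⟨hx, hx'⟩
      have hη := genericPoint_mem hxa
      have hle : X.basicOpen a ≤ W := X.basicOpen_le a
      have hle' : X.basicOpen a ≤ W' := e.trans_le (X.basicOpen_le a')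
      have hpre : ι ⁻¹ᵁ X.basicOpen a ≤ ι ⁻¹ᵁ W := fun y hy ↦ hle hy
      have hpre' : ι ⁻¹ᵁ X.basicOpen a ≤ ι ⁻¹ᵁ W' := fun y hy ↦ hle' hy
      refine ⟨ι ⁻¹ᵁ X.basicOpen a, hpre, hpre', hxa, ?_⟩
      dsimp only at hΛ hΛ' hr hr' ⊢
      rw [← app_res ι hle, ← app_res ι hle']
      exact hG.app_eq_app (hG.basicOpen W hW a hη) (hΛ.basicOpen (hG.affine W hW) hWV rfl hη (hpre.trans hWV))
        (hΛ'.basicOpen (hG.affine W' hW') hWV' e hη (hpre.trans hWV)) ((gg_res hle hη r).trans hr)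
        ((gg_res hle' hη r').trans hr'))
  exact ⟨s, fun W hW h Λ r hΛ hr ↦ hs ⟨⟨W, Λ, r⟩, hW, h, hΛ, hr⟩⟩

lemma value_ext {V : F.Opens} {s s' : Γ(F, V)} (h : ∀ W ∈ G, ∀ h : ι ⁻¹ᵁ W ≤ V,
    F.presheaf.map (homOfLE h).op s = F.presheaf.map (homOfLE h).op s') : s = s' := by
  refine O_ext fun x hx ↦ ?_
  obtain ⟨W, hW, hxW, hWV⟩ := hG.exists_mem_le hx
  exact ⟨_, hWV, hxW, h W hW hWV⟩

/-- The glued values are linear in μ and commute with restriction, because sums, multiples and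
restrictions of lifts are lifts; so they form a section of the double dual. -/
lemma exists_pluriForm : ∃ Ψ : Γ(reflPow (Omega (ι ≫ f)) j, ⊤), ∀ W (hW : W ∈ G) (μ : dualSections (tensorPow (Omega (ι ≫ f)) j) (ι ⁻¹ᵁ W)) Λ r,
    Compat f ι W (hG.mem W hW) Λ (evT μ ⟨ι ⁻¹ᵁ W, le_rfl⟩) → gg W (hG.mem W hW) r = σ Λ →
      (Ψ : dualSections (dual (tensorPow (Omega (ι ≫ f)) j)) ⊤).1 ⟨ι ⁻¹ᵁ W, le_top⟩ μ = ι.app W r := by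
  choose s hs using fun (V : F.Opens) (μ : dualSections (tensorPow (Omega (ι ≫ f)) j) V) ↦ hG.exists_value μ
  let Ψ : dualSections (dual (tensorPow (Omega (ι ≫ f)) j)) ⊤ := ⟨fun V ↦
    { toFun := fun μ ↦ s V.1 μ
      map_add' := fun μ μ' ↦ by
        refine hG.value_ext fun W hW h ↦ ?_
        obtain ⟨Λ, hΛ⟩ := hG.exists_form W hW (evT (μ : dualSections (tensorPow (Omega (ι ≫ f)) j) V.1) ⟨ι ⁻¹ᵁ W, h⟩)
        obtain ⟨Λ', hΛ'⟩ := hG.exists_form W hW (evT (μ' : dualSections (tensorPow (Omega (ι ≫ f)) j) V.1) ⟨ι ⁻¹ᵁ W, h⟩)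
        obtain ⟨r, hr⟩ := hG.regular W hW _ _ hΛ
        obtain ⟨r', hr'⟩ := hG.regular W hW _ _ hΛ'
        rw [map_add, hs _ μ W hW h Λ r hΛ hr, hs _ μ' W hW h Λ' r' hΛ' hr',
          hs V.1 (μ + μ') W hW h (Λ + Λ') (r + r') (fun c ↦ by
            obtain ⟨t, h1, h2⟩ := hΛ c
            obtain ⟨t', h1', h2'⟩ := hΛ' c
            exact ⟨t + t', by rw [map_add, h1, h1']; rfl, by rw [map_add, h2, h2']; rfl⟩) (by rw [map_add, map_add, hr, hr']), map_add]
      map_smul' := fun a μ ↦ by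
        refine hG.value_ext fun W hW h ↦ ?_
        obtain ⟨Λ, hΛ⟩ := hG.exists_form W hW (evT (μ : dualSections (tensorPow (Omega (ι ≫ f)) j) V.1) ⟨ι ⁻¹ᵁ W, h⟩)
        obtain ⟨r, hr⟩ := hG.regular W hW _ _ hΛ
        obtain ⟨t, ht⟩ := hG.surjective W hW (F.presheaf.map (homOfLE h).op a)
        rw [RingHom.id_apply, smul_eq_mul, map_mul, hs _ μ W hW h Λ r hΛ hr, hs V.1 (a • μ) W hW h (gg W (hG.mem W hW) t • Λ) (t * r) (by
          have := hΛ.smul t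
          rw [ht] at this
          exact this) (by rw [map_mul, map_smul, hr]; rfl), map_mul, ht] }, fun V V' h μ ↦ by
    refine hG.value_ext fun W hW hWV ↦ ?_
    obtain ⟨Λ, hΛ⟩ := hG.exists_form W hW (evT (μ : dualSections (tensorPow (Omega (ι ≫ f)) j) V.1) ⟨ι ⁻¹ᵁ W, hWV.trans h⟩)
    obtain ⟨r, hr⟩ := hG.regular W hW _ _ hΛ
    rw [O_res_res]
    exact (hs V'.1 (dualRes _ h μ) W hW hWV Λ r hΛ hr).trans (hs V.1 μ W hW (hWV.trans h) Λ r hΛ hr).symm⟩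
  refine ⟨Ψ, fun W hW μ Λ r hΛ hr ↦ ?_⟩
  have := hs _ μ W hW le_rfl Λ r hΛ hr
  rwa [res_self] at this

/-- A regular functional vanishes on a fiber without pluri-forms. -/
theorem app_eq_zero (hF : NoPluriForms (ι ≫ f)) (hj : 0 < j) {W : X.Opens} (hW : W ∈ G)
    (μ : dualSections (tensorPow (Omega (ι ≫ f)) j) (ι ⁻¹ᵁ W)) {Λ r}
    (hΛ : Compat f ι W (hG.mem W hW) Λ (evT μ ⟨ι ⁻¹ᵁ W, le_rfl⟩)) (hr : gg W (hG.mem W hW) r = σ Λ) : ι.app W r = 0 := by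
  obtain ⟨Ψ, hΨ⟩ := hG.exists_pluriForm
  rw [← hΨ W hW μ Λ r hΛ hr, hF j hj Ψ]
  rfl

end IsLiftingFamily

end PluriForm

end

/-! ### Vector fields on a fiber -/

noncomputable section

set_option linter.unusedSectionVars false
namespace PluriForm

section
variable {F : Scheme.{u}} {k : Type u} [Field k] (f : F ⟶ Spec (CommRingCat.of k))

/-- A derivation of the structure sheaf gives a section of the dual of the sheaf of differentials. -/
lemma exists_dualSections_omega {U : F.Opens} (δ : ∀ V : {V : F.Opens // V ≤ U}, Γ(F, V.1) → Γ(F, V.1))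
    (hadd : ∀ V a b, δ V (a + b) = δ V a + δ V b) (hmul : ∀ V a b, δ V (a * b) = a * δ V b + b * δ V a)
    (hk : ∀ V c, δ V (kToO f V.1 c) = 0)
    (hres : ∀ (V W : {V : F.Opens // V ≤ U}) (h : W.1 ≤ V.1) (a : Γ(F, V.1)),
      δ W (F.presheaf.map (homOfLE h).op a) = F.presheaf.map (homOfLE h).op (δ V a)) :
    ∃ ω : dualSections (Omega f) U, ∀ V a, ω.1 V (dX f a) = δ V a := by
  let P : Pre F := preOmega f
  have der : ∀ V : {V : F.Opens // V ≤ U}, ∃ l : (P.obj (op V.1) : Type u) →ₗ[Γ(F, V.1)] Γ(F, V.1),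
      ∀ a, l ((PresheafOfModules.DifferentialsConstruction.derivation' (structureMap f)).d (X := op V.1) a) = δ V a := by
    intro V
    let _ := (kToO f V.1).toAlgebra
    let δ' : Derivation k Γ(F, V.1) Γ(F, V.1) := Derivation.mk'
      { toFun := δ V
        map_add' := hadd V
        map_smul' := fun c a ↦ by
          rw [Algebra.smul_def, hmul]
          have : δ V (algebraMap k Γ(F, V.1) c) = 0 := hk V c
          rw [this, mul_zero, add_zero, RingHom.id_apply, Algebra.smul_def] } (hmul V)
    exact ⟨δ'.liftKaehlerDifferential, fun a ↦ δ'.liftKaehlerDifferential_comp_D a⟩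
  choose l hl using der
  obtain ⟨ω, hω⟩ := exists_dualSections_sheafify P U l fun V W h s ↦ by
    let _ := (kToO f V.1).toAlgebra
    have : (s : Ω[Γ(F, V.1)⁄k]) ∈ Submodule.span Γ(F, V.1) (Set.range (KaehlerDifferential.D k Γ(F, V.1))) := by
      rw [KaehlerDifferential.span_range_derivation]; trivial
    refine Submodule.span_induction (p := fun (s : Ω[Γ(F, V.1)⁄k]) _ ↦ l W (P.presheaf.map (homOfLE h).op s) =
      F.presheaf.map (homOfLE h).op (l V s)) ?_ ?_ ?_ ?_ this
    · rintro _ ⟨a, rfl⟩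
      refine (congrArg (l W) ((PresheafOfModules.DifferentialsConstruction.derivation' (structureMap f)).d_map
        (homOfLE h).op a).symm).trans ?_
      refine (hl W _).trans ((hres V W h a).trans ?_)
      exact congrArg _ (hl V a).symm
    · refine (congrArg (l W) (map_zero (ConcreteCategory.hom (P.presheaf.map (homOfLE h).op)))).trans ?_
      exact (map_zero _).trans ((congrArg _ (map_zero (l V))).trans (map_zero _)).symm
    · intro s t _ _ hs ht
      refine (congrArg (l W) (map_add (ConcreteCategory.hom (P.presheaf.map (homOfLE h).op)) s t)).trans ?_
      refine (map_add (l W) _ _).trans ((congrArg₂ _ hs ht).trans ?_)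
      exact (map_add _ _ _).symm.trans (congrArg _ (map_add (l V) _ _).symm)
    · intro a s _ hs
      refine (congrArg (l W) (P.map_smul (homOfLE h).op a s)).trans ?_
      refine (map_smul (l W) _ _).trans ((congrArg _ hs).trans ?_)
      exact (map_mul _ _ _).symm.trans (congrArg _ (map_smul (l V) _ _).symm)
  exact ⟨ω, fun V a ↦ (hω V _).trans (hl V a)⟩

end

lemma kToO_res {F : Scheme.{u}} {k : Type u} [Field k] (f : F ⟶ Spec (CommRingCat.of k)) {V W : F.Opens} (h : W ≤ V) (c : k) :
    F.presheaf.map (homOfLE h).op (kToO f V c) = kToO f W c :=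
  (ConcreteCategory.congr_hom ((structureMap f).naturality (homOfLE h).op) c).symm

lemma app_kToO {X F : Scheme.{u}} {k : Type u} [Field k] (f : X ⟶ Spec (CommRingCat.of k)) (ι : F ⟶ X) (W : X.Opens) (c : k) :
    ι.app W (kToO f W c) = kToO (ι ≫ f) (ι ⁻¹ᵁ W) c := by
  have h : (structureMap f).app (op W) ≫ ι.app W = (structureMap (ι ≫ f)).app (op (ι ⁻¹ᵁ W)) := by
    have h := ι.naturality (homOfLE (le_top : W ≤ ⊤)).op
    simp only [structureMap, Scheme.Hom.comp_appTop, Category.assoc]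
    congr 2
  exact ConcreteCategory.congr_hom h c

variable {X F : Scheme.{u}} [IsIntegral X] {k : Type u} [Field k] (f : X ⟶ Spec (CommRingCat.of k)) (ι : F ⟶ X)

/-- A derivation of the function field that is regular on a family of affine open subsets and
preserves the ideal of a closed subscheme descends to the latter. -/
lemma exists_dualSections_of_derivation (θ : Derivation ℤ X.functionField X.functionField) (hθ : ∀ c, θ (kToK f c) = 0)
    {U : X.Opens} {G : Set X.Opens} (hη : ∀ W ∈ G, genericPoint X ∈ W) (hU : U ∈ G) (hinf : ∀ W ∈ G, ∀ W' ∈ G, W ⊓ W' ∈ G)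
    (hbasis : ∀ (V : F.Opens) (x : F), V ≤ ι ⁻¹ᵁ U → x ∈ V → ∃ W ∈ G, ι x ∈ W ∧ ι ⁻¹ᵁ W ≤ V)
    (hsurj : ∀ W ∈ G, Function.Surjective (ι.app W)) (hreg : ∀ W (h : W ∈ G) t, IsReg W (hη W h) (θ (gg W (hη W h) t)))
    (hker : ∀ W (h : W ∈ G) t r, ι.app W t = 0 → gg W (hη W h) r = θ (gg W (hη W h) t) → ι.app W r = 0) :
    ∃ ω : dualSections (Omega (ι ≫ f)) (ι ⁻¹ᵁ U), ∀ t r, gg U (hη U hU) r = θ (gg U (hη U hU) t) →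
      ω.1 ⟨ι ⁻¹ᵁ U, le_rfl⟩ (dX (ι ≫ f) (ι.app U t)) = ι.app U r := by
  have hex : ∀ (V : {V : F.Opens // V ≤ ι ⁻¹ᵁ U}) (s : Γ(F, V.1)), ∃ s' : Γ(F, V.1), ∀ W (hW : W ∈ G) (h : ι ⁻¹ᵁ W ≤ V.1) t r,
      ι.app W t = F.presheaf.map (homOfLE h).op s → gg W (hη W hW) r = θ (gg W (hη W hW) t) →
        F.presheaf.map (homOfLE h).op s' = ι.app W r := by
    rintro ⟨V, hV⟩ s
    -- Locally s lifts to a function t on X, and θ(t) is restricted to the fiber; by `hker` two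
    -- lifts give the same result.
    obtain ⟨s', hs'⟩ := exists_glue (V := V) (α := {w : (W : X.Opens) × Γ(X, W) × Γ(X, W) // ∃ (hW : w.1 ∈ G) (h : ι ⁻¹ᵁ w.1 ≤ V),
        ι.app w.1 w.2.1 = F.presheaf.map (homOfLE h).op s ∧ gg w.1 (hη w.1 hW) w.2.2 = θ (gg w.1 (hη w.1 hW) w.2.1)})
      (fun w ↦ ι ⁻¹ᵁ w.1.1) (fun w ↦ w.2.2.1) (fun w ↦ ι.app w.1.1 w.1.2.2) (fun x hx ↦ by
        obtain ⟨W, hW, hxW, hWV⟩ := hbasis V x hV hx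
        obtain ⟨t, ht⟩ := hsurj W hW (F.presheaf.map (homOfLE hWV).op s)
        obtain ⟨r, hr⟩ := hreg W hW t
        exact ⟨⟨⟨W, t, r⟩, hW, hWV, ht, hr⟩, hxW⟩) (by
        rintro ⟨⟨W, t, r⟩, hW, hWV, ht, hr⟩ ⟨⟨W', t', r'⟩, hW', hWV', ht', hr'⟩ x hx hx'
        dsimp only at ht ht' hr hr' ⊢
        have hWW := hinf W hW W' hW'
        have hl : W ⊓ W' ≤ W := inf_le_left
        have hr₀ : W ⊓ W' ≤ W' := inf_le_right
        have hpl : ι ⁻¹ᵁ (W ⊓ W') ≤ ι ⁻¹ᵁ W := fun y hy ↦ hl hy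
        have hpr : ι ⁻¹ᵁ (W ⊓ W') ≤ ι ⁻¹ᵁ W' := fun y hy ↦ hr₀ hy
        refine ⟨ι ⁻¹ᵁ (W ⊓ W'), hpl, hpr, ⟨hx, hx'⟩, ?_⟩
        rw [← app_res ι hl, ← app_res ι hr₀, ← sub_eq_zero, ← map_sub]
        refine hker _ hWW (X.presheaf.map (homOfLE hl).op t - X.presheaf.map (homOfLE hr₀).op t') _ ?_ ?_
        · rw [map_sub, app_res ι hl hpl, app_res ι hr₀ hpr, ht, ht', O_res_res, O_res_res, sub_self]
        · rw [map_sub, map_sub, map_sub, gg_res, gg_res, gg_res, gg_res, hr, hr'])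
    exact ⟨s', fun W hW h t r ht hr ↦ hs' ⟨⟨W, t, r⟩, hW, h, ht, hr⟩⟩
  choose δ hδ using hex
  have hext : ∀ (V : {V : F.Opens // V ≤ ι ⁻¹ᵁ U}) (s s' : Γ(F, V.1)), (∀ W ∈ G, ∀ h : ι ⁻¹ᵁ W ≤ V.1,
      F.presheaf.map (homOfLE h).op s = F.presheaf.map (homOfLE h).op s') → s = s' := by
    intro V s s' h
    refine O_ext fun x hx ↦ ?_
    obtain ⟨W, hW, hxW, hWV⟩ := hbasis V.1 x V.2 hx
    exact ⟨_, hWV, hxW, h W hW hWV⟩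
  obtain ⟨ω, hω⟩ := exists_dualSections_omega (ι ≫ f) δ (fun V a b ↦ by
      refine hext V _ _ fun W hW h ↦ ?_
      obtain ⟨t, ht⟩ := hsurj W hW (F.presheaf.map (homOfLE h).op a)
      obtain ⟨t', ht'⟩ := hsurj W hW (F.presheaf.map (homOfLE h).op b)
      obtain ⟨r, hr⟩ := hreg W hW t
      obtain ⟨r', hr'⟩ := hreg W hW t'
      rw [map_add, hδ V a W hW h t r ht hr, hδ V b W hW h t' r' ht' hr', hδ V (a + b) W hW h (t + t') (r + r') (by
        rw [map_add, map_add, ht, ht']) (by rw [map_add, map_add, map_add, hr, hr']), map_add]) (fun V a b ↦ by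
      refine hext V _ _ fun W hW h ↦ ?_
      obtain ⟨t, ht⟩ := hsurj W hW (F.presheaf.map (homOfLE h).op a)
      obtain ⟨t', ht'⟩ := hsurj W hW (F.presheaf.map (homOfLE h).op b)
      obtain ⟨r, hr⟩ := hreg W hW t
      obtain ⟨r', hr'⟩ := hreg W hW t'
      rw [map_add, map_mul, map_mul, hδ V a W hW h t r ht hr, hδ V b W hW h t' r' ht' hr',
        hδ V (a * b) W hW h (t * t') (t * r' + t' * r) (by rw [map_mul, map_mul, ht, ht']) (by
          rw [map_add, map_mul, map_mul, map_mul, θ.leibniz, hr, hr']; rfl), map_add, map_mul, map_mul, ht, ht'])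
    (fun V c ↦ by
      refine hext V _ _ fun W hW h ↦ ?_
      rw [hδ V _ W hW h (kToO f W c) 0 (by
        rw [app_kToO, kToO_res]) (by
        have : gg W (hη W hW) (kToO f W c) = kToK f c := gg_structureMap f W (hη W hW) c
        rw [this, hθ, map_zero]), map_zero, map_zero])
    (fun V V' h a ↦ by
      refine hext V' _ _ fun W hW hWV ↦ ?_
      obtain ⟨t, ht⟩ := hsurj W hW (F.presheaf.map (homOfLE (hWV.trans h)).op a)
      obtain ⟨r, hr⟩ := hreg W hW t
      rw [O_res_res, hδ V a W hW (hWV.trans h) t r ht hr, hδ V' _ W hW hWV t r (by rw [ht, O_res_res]) hr])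
  refine ⟨ω, fun t r hr ↦ (hω _ _).trans ?_⟩
  have := hδ ⟨ι ⁻¹ᵁ U, le_rfl⟩ (ι.app U t) U hU le_rfl t r (by rw [res_self]) hr
  rwa [res_self] at this

/-- The product of sections of the dual sheaf. -/
lemma exists_evT_eq_prod {M : F.Modules} {j : ℕ} {U : F.Opens} (ω : Fin j → dualSections M U) :
    ∃ μ : dualSections (tensorPow M j) U, ∀ V s, evT μ V s = ∏ i, (ω i).1 V (s i) := by
  obtain ⟨μ, hμ⟩ := exists_evT (M := M) (m := j) (U := U) (fun V ↦
    (MultilinearMap.mkPiAlgebra Γ(F, V.1) (Fin j) Γ(F, V.1)).compLinearMap fun i ↦ (ω i).1 V) fun V W h s ↦ by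
      simp only [MultilinearMap.compLinearMap_apply, MultilinearMap.mkPiAlgebra_apply, map_prod]
      exact Finset.prod_congr rfl fun i _ ↦ (ω i).2 V W h (s i)
  exact ⟨μ, fun V s ↦ hμ V s⟩

end PluriForm

end

/-! ### Lifting forms from general fibers to a chart -/

noncomputable section

set_option linter.unusedSectionVars false
namespace PluriForm

variable {X Z : Scheme.{u}} [IsIntegral X] {k : Type u} [Field k]

lemma appLE_kToO (g : Z ⟶ Spec (CommRingCat.of k)) (p : X ⟶ Z) {Y : Z.Opens} {U : X.Opens} (h : U ≤ p ⁻¹ᵁ Y) (c : k) :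
    p.appLE Y U h (kToO g Y c) = kToO (p ≫ g) U c := by
  refine Eq.trans ?_ (kToO_res (p ≫ g) h c)
  exact congrArg (X.presheaf.map (homOfLE h).op) (app_kToO g p Y c)

lemma gg_appLE (p : X ⟶ Z) {Y : Z.Opens} {U : X.Opens} (h : U ≤ p ⁻¹ᵁ Y) (hU : genericPoint X ∈ U) (b : Γ(Z, Y)) :
    gg U hU (p.appLE Y U h b) = pB p Y (h hU) b := gg_res h hU (p.app Y b)

lemma map_appLE {p : X ⟶ Z} {Y : Z.Opens} {U V : X.Opens} (h : U ≤ p ⁻¹ᵁ Y) (hV : V ≤ U) (b : Γ(Z, Y)) :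
    X.presheaf.map (homOfLE hV).op (p.appLE Y U h b) = p.appLE Y V (hV.trans h) b :=
  ConcreteCategory.congr_hom (p.appLE_map h (homOfLE hV).op) b

section
variable {p : X ⟶ Z} {Y : Z.Opens} {hY : p (genericPoint X) ∈ Y} [Algebra Γ(Z, Y) X.functionField]
  (hB : algebraMap Γ(Z, Y) X.functionField = pB p Y hY) {U : X.Opens} (hU : genericPoint X ∈ U) (h : U ≤ p ⁻¹ᵁ Y)

/-- The algebra over the functions on the base of rational functions that are regular on an open set. -/
abbrev chartAlg : Subalgebra Γ(Z, Y) X.functionField :=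
  regAlg Γ(Z, Y) U hU fun b ↦ ⟨p.appLE Y U h b, by rw [hB]; exact gg_appLE p h hU b⟩

variable (f : X ⟶ Spec (CommRingCat.of k)) [LocallyOfFiniteType f] [Algebra k X.functionField]
  (hk : algebraMap k X.functionField = kToK f) [Algebra k Γ(Z, Y)] [IsScalarTower k Γ(Z, Y) X.functionField]

lemma restrictScalars_chartAlg : (chartAlg hB hU h).restrictScalars k = regAlgK f hk U hU := rfl

include hk in
lemma isNormalChart_chartAlg (hX : IsNormalScheme X) (hUa : IsAffineOpen U) : IsNormalChart k (chartAlg hB hU h) where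
  fg := by
    rw [restrictScalars_chartAlg hB hU h f hk]
    exact regAlgK_fg f hk hU hUa
  integrallyClosed := isIntegrallyClosed_regAlg hX hUa
  isFractionRing := isFractionRing_regAlg hUa

include hk in
-- Preservation of regularity passes from the chart U to its basic open subsets, where regularity of
-- Λ is tested on functions from U.
lemma isReg_apply_of_regularForms (hUa : IsAffineOpen U) {j : ℕ} {σ : Module.Dual X.functionField
    (MultilinearMap X.functionField (fun _ : Fin j ↦ Ω[X.functionField⁄Γ(Z, Y)]) X.functionField)}
    (hσ : ∀ Λ ∈ regularForms k (chartAlg hB hU h) (Fin j), σ Λ ∈ chartAlg hB hU h) {a : Γ(X, U)}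
    (ha : genericPoint X ∈ X.basicOpen a) {Λ : MultilinearMap X.functionField (fun _ : Fin j ↦ Ω[X.functionField⁄Γ(Z, Y)]) X.functionField}
    (hΛ : ∀ c : Fin j → Γ(X, U), IsReg (X.basicOpen a) ha (Λ fun i ↦ KaehlerDifferential.D Γ(Z, Y) X.functionField (gg U hU (c i)))) :
    IsReg (X.basicOpen a) ha (σ Λ) := by
  have hloc := regAlgK_basicOpen f hk hU hUa ha
  have hreg : IsRegularOn (relD k Γ(Z, Y) X.functionField) (regAlgK f hk (X.basicOpen a) ha) Λ :=
    isRegularOn_of_generators (regAlgK f hk U hU : Set X.functionField) hloc (Algebra.adjoin_eq _) fun c hc ↦ by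
      choose c' hc' using hc
      obtain rfl := funext hc'
      exact hΛ c'
  exact mem_of_isRegularOn_localization (regAlgK_fg f hk hU hUa) hloc σ hσ hreg

end

variable (f : X ⟶ Spec (CommRingCat.of k)) {p : X ⟶ Z} (g : Z ⟶ Spec (CommRingCat.of k)) (hp : p ≫ g = f)
  [LocallyOfFiniteType f] [LocallyOfFiniteType g] [IsIntegral Z] [Algebra k X.functionField] (hk : algebraMap k X.functionField = kToK f)
  {Y : Z.Opens} (hYa : IsAffineOpen Y) {hY : p (genericPoint X) ∈ Y} [Algebra k Γ(Z, Y)]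
  (hkB : algebraMap k Γ(Z, Y) = kToO g Y) [Algebra Γ(Z, Y) X.functionField]
  (hB : algebraMap Γ(Z, Y) X.functionField = pB p Y hY) [IsScalarTower k Γ(Z, Y) X.functionField]

include hp in
-- Modulo I a function of the base is a constant, whose differential vanishes. So relative
-- differentials of the chart map to absolute differentials of the fiber.
lemma dX_app_appLE {F : Scheme.{u}} {ι : F ⟶ X} {I : Ideal Γ(Z, Y)} (hι : IsFiberOver p Y ι I)
    (hI : ∀ b, ∃ c, b - kToO g Y c ∈ I) {U : X.Opens} (hUa : IsAffineOpen U) (h : U ≤ p ⁻¹ᵁ Y) (b : Γ(Z, Y)) :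
    dX (ι ≫ f) (ι.app U (p.appLE Y U h b)) = 0 := by
  obtain ⟨c, hc⟩ := hI b
  have h1 : p.appLE Y U h (b - kToO g Y c) ∈ RingHom.ker (ι.app U).hom := by
    rw [hι.ker U hUa h]
    exact Ideal.mem_map_of_mem _ hc
  have h2 : ι.app U (p.appLE Y U h (b - kToO g Y c)) = 0 := h1
  rw [map_sub, map_sub, sub_eq_zero, appLE_kToO, hp, app_kToO] at h2
  rw [h2, dX_kToO]

include hp hk hYa hkB in
/-- Forms on general fibers lift to a chart. -/
lemma exists_forall_compat {U : X.Opens} (hUa : IsAffineOpen U) (hU : genericPoint X ∈ U) (h : U ≤ p ⁻¹ᵁ Y) (j : ℕ) :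
    ∃ b : Γ(Z, Y), b ≠ 0 ∧ ∀ I : Ideal Γ(Z, Y), I.IsMaximal → b ∉ I → (∀ b, ∃ c, b - kToO g Y c ∈ I) →
      ∀ (F : Scheme.{u}) (ι : F ⟶ X), IsFiberOver p Y ι I → ∀ (a : Γ(X, U)) (ha : genericPoint X ∈ X.basicOpen a),
      (∀ μ, ∃ Λ, Compat f ι (B := Γ(Z, Y)) (j := j) (X.basicOpen a) ha Λ μ) ∧
      ∀ σ : Module.Dual X.functionField
          (MultilinearMap X.functionField (fun _ : Fin j ↦ Ω[X.functionField⁄Γ(Z, Y)]) X.functionField),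
        (∀ Λ ∈ regularForms k (chartAlg hB hU h) (Fin j), σ Λ ∈ chartAlg hB hU h) →
        ∀ Λ r, Compat f ι (B := Γ(Z, Y)) (X.basicOpen a) ha Λ 0 → gg (X.basicOpen a) ha r = σ Λ → ι.app (X.basicOpen a) r = 0 := by
  have hne : Nonempty U := ⟨_, hU⟩
  let _ : Algebra Γ(Z, Y) Γ(X, U) := (p.appLE Y U h).hom.toAlgebra
  let _ : Algebra Γ(X, U) X.functionField := (gg U hU).toAlgebra
  let _ : Algebra k Γ(X, U) := (kToO f U).toAlgebra
  have tow1 : IsScalarTower Γ(Z, Y) Γ(X, U) X.functionField := IsScalarTower.of_algebraMap_eq fun b ↦ by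
    rw [hB]; exact (gg_appLE p h hU b).symm
  have tow2 : IsScalarTower k Γ(Z, Y) Γ(X, U) := IsScalarTower.of_algebraMap_eq fun c ↦ by
    rw [hkB]
    refine Eq.trans ?_ (appLE_kToO g p h c).symm
    rw [hp]; rfl
  have ftk : Algebra.FiniteType k Γ(X, U) := kToO_finiteType f hUa
  have ftB : Algebra.FiniteType Γ(Z, Y) Γ(X, U) := .of_restrictScalars_finiteType k _ _
  have ftkB : Algebra.FiniteType k Γ(Z, Y) := by
    have := kToO_finiteType g hYa
    rw [← hkB] at this
    exact RingHom.finiteType_algebraMap.mp this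
  have noeth : IsNoetherianRing Γ(X, U) := Algebra.FiniteType.isNoetherianRing k _
  have noethB : IsNoetherianRing Γ(Z, Y) := Algebra.FiniteType.isNoetherianRing k _
  have hfrac : IsFractionRing Γ(X, U) X.functionField := functionField_isFractionRing_of_isAffineOpen X U hUa
  have : Nonempty Y := ⟨_, hY⟩
  have : Algebra.EssFiniteType k X.functionField := essFiniteType_functionField f hk
  have : Algebra.EssFiniteType Γ(Z, Y) X.functionField := .of_comp k _ _
  have : FiniteDimensional X.functionField Ω[X.functionField⁄Γ(Z, Y)] := inferInstance
  -- The element b depends on the chart U and on j only: lifting holds uniformly for all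
  -- localizations, hence for all basic open subsets of U.
  obtain ⟨b, hb0, hb⟩ := exists_lift_multilinear (B := Γ(Z, Y)) (A := Γ(X, U)) Ω[Γ(X, U)⁄Γ(Z, Y)] j
  refine ⟨b, hb0, fun I hI hbI hIk F ι hι a ha ↦ ?_⟩
  have hle := X.basicOpen_le a
  have haa := hUa.basicOpen a
  let _ : Algebra Γ(Z, Y) Γ(X, X.basicOpen a) := (p.appLE Y (X.basicOpen a) (hle.trans h)).hom.toAlgebra
  let _ : Algebra Γ(X, X.basicOpen a) X.functionField := (gg (X.basicOpen a) ha).toAlgebra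
  have tow3 : IsScalarTower Γ(Z, Y) Γ(X, U) Γ(X, X.basicOpen a) := IsScalarTower.of_algebraMap_eq fun b ↦ (map_appLE h hle b).symm
  have tow4 : IsScalarTower Γ(X, U) Γ(X, X.basicOpen a) X.functionField := IsScalarTower.of_algebraMap_eq fun t ↦ (gg_res hle ha t).symm
  have hinj : Function.Injective (algebraMap Γ(X, U) Γ(X, X.basicOpen a)) := fun s t hst ↦ gg_injective hU (by
    rw [← gg_res hle ha s, ← gg_res hle ha t]
    exact congrArg (gg _ ha) hst)
  have := hUa.isLocalization_basicOpen a
  obtain ⟨h1, h2⟩ := hb I hI hbI (Submonoid.powers a) Γ(X, X.basicOpen a) hinj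
  have hker := hι.ker _ haa (hle.trans h)
  constructor
  · intro μ
    obtain ⟨Λ, hΛ⟩ := exists_compatible_form (K := X.functionField) h1 (ι.app (X.basicOpen a)).hom (hι.surjective _ haa) hker
      (dDer (ι ≫ f) _) (fun b ↦ dX_app_appLE f g hp hι hIk haa (hle.trans h) b) μ
    exact ⟨Λ, compat_basicOpen hU hUa ha hΛ⟩
  · intro σ hσ Λ r hΛ hr
    have : FaithfulSMul Γ(X, X.basicOpen a) X.functionField := (faithfulSMul_iff_algebraMap_injective _ _).mpr (gg_injective ha)
    obtain ⟨r', hr', e⟩ := exists_mem_map_of_forall_mem_map h2 σ (fun Λ hΛ ↦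
      isReg_apply_of_regularForms hB hU h f hk hUa hσ ha hΛ) Λ (fun c ↦ by
        obtain ⟨t, ht, ht'⟩ := hΛ fun i ↦ X.presheaf.map (homOfLE hle).op (c i)
        refine ⟨t, ?_, ht.trans ?_⟩
        · have : t ∈ RingHom.ker (ι.app (X.basicOpen a)).hom := ht'
          rwa [hker] at this
        · simp only [gg_res]
          rfl)
    have : r = r' := gg_injective ha (hr.trans e.symm)
    rw [this]
    have h3 : r' ∈ RingHom.ker (ι.app (X.basicOpen a)).hom := by rw [hker]; exact hr'
    exact h3

end PluriForm

end

/-! ### Absence of pluri-forms on general fibers implies vanishing -/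

noncomputable section

set_option linter.unusedSectionVars false
namespace PluriForm

variable {X Z : Scheme.{u}} [IsIntegral X] {k : Type u} [Field k]
  (f : X ⟶ Spec (CommRingCat.of k)) {p : X ⟶ Z} (g : Z ⟶ Spec (CommRingCat.of k)) (hp : p ≫ g = f)
  [LocallyOfFiniteType f] [LocallyOfFiniteType g] [IsIntegral Z] [Algebra k X.functionField] (hk : algebraMap k X.functionField = kToK f)
  {Y : Z.Opens} (hYa : IsAffineOpen Y) {hY : p (genericPoint X) ∈ Y} [Algebra k Γ(Z, Y)]
  (hkB : algebraMap k Γ(Z, Y) = kToO g Y) [Algebra Γ(Z, Y) X.functionField]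
  (hB : algebraMap Γ(Z, Y) X.functionField = pB p Y hY) [IsScalarTower k Γ(Z, Y) X.functionField]

/-- The basic open subsets of an open subset that contain the generic point. -/
def basicOpens (U : X.Opens) : Set X.Opens := {W | genericPoint X ∈ W ∧ ∃ a : Γ(X, U), W = X.basicOpen a}

lemma self_mem_basicOpens {U : X.Opens} (hU : genericPoint X ∈ U) : U ∈ basicOpens U :=
  ⟨hU, 1, (X.basicOpen_of_isUnit isUnit_one).symm⟩

lemma exists_mem_basicOpens {F : Scheme.{u}} {ι : F ⟶ X} (hι : Topology.IsInducing ι) {U : X.Opens} (hUa : IsAffineOpen U)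
    {V : F.Opens} {x : F} (hx : x ∈ V) (hxU : ι x ∈ U) : ∃ W ∈ basicOpens U, ι x ∈ W ∧ ι ⁻¹ᵁ W ≤ V := by
  obtain ⟨O, hO, hOV⟩ := hι.isOpen_iff.mp V.isOpen
  have hxO : ι x ∈ (⟨O, hO⟩ : X.Opens) := by
    have : x ∈ ι ⁻¹' O := by rw [hOV]; exact hx
    exact this
  obtain ⟨a, haO, hxa⟩ := hUa.exists_basicOpen_le ⟨ι x, hxO⟩ hxU
  refine ⟨X.basicOpen a, ⟨genericPoint_mem hxa, a, rfl⟩, hxa, fun y hy ↦ ?_⟩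
  have h1 : y ∈ ι ⁻¹' O := haO hy
  rw [hOV] at h1
  exact h1

include hk in
lemma isReg_dual_basicOpen {U : X.Opens} (hUa : IsAffineOpen U) (hU : genericPoint X ∈ U) (h : U ≤ p ⁻¹ᵁ Y)
    {ξ : Module.Dual X.functionField Ω[X.functionField⁄Γ(Z, Y)]}
    (hξ : ∀ a ∈ chartAlg hB hU h, ξ (relD k Γ(Z, Y) X.functionField a) ∈ chartAlg hB hU h) {W : X.Opens} (hW : W ∈ basicOpens U)
    (t : Γ(X, W)) : IsReg W hW.1 (ξ (KaehlerDifferential.D Γ(Z, Y) X.functionField (gg W hW.1 t))) := by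
  obtain ⟨hη, a, rfl⟩ := hW
  let Λ : MultilinearMap X.functionField (fun _ : Unit ↦ Ω[X.functionField⁄Γ(Z, Y)]) X.functionField :=
    LinearMap.compMultilinearMap ξ (MultilinearMap.ofSubsingleton _ _ _ () LinearMap.id)
  have hΛ : IsRegularOn (relD k Γ(Z, Y) X.functionField) (regAlgK f hk U hU) Λ := fun a ha ↦ hξ _ (ha ())
  exact (hΛ.of_isLocalizationOf (regAlgK_basicOpen f hk hU hUa hη)) (fun _ ↦ gg _ hη t) fun _ ↦ ⟨t, rfl⟩

include hk in
/-- A relative vector field on a chart descends to a fiber. -/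
lemma exists_dualSections_of_dual {U : X.Opens} (hUa : IsAffineOpen U) (hU : genericPoint X ∈ U) (h : U ≤ p ⁻¹ᵁ Y)
    {ξ : Module.Dual X.functionField Ω[X.functionField⁄Γ(Z, Y)]}
    (hξ : ∀ a ∈ chartAlg hB hU h, ξ (relD k Γ(Z, Y) X.functionField a) ∈ chartAlg hB hU h)
    {F : Scheme.{u}} {ι : F ⟶ X} {I : Ideal Γ(Z, Y)} (hι : IsFiberOver p Y ι I) :
    ∃ ω : dualSections (Omega (ι ≫ f)) (ι ⁻¹ᵁ U), ∀ t r, gg U hU r = ξ (KaehlerDifferential.D Γ(Z, Y) X.functionField (gg U hU t)) →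
      ω.1 ⟨ι ⁻¹ᵁ U, le_rfl⟩ (dX (ι ≫ f) (ι.app U t)) = ι.app U r := by
  have hle : ∀ W ∈ basicOpens U, W ≤ U := by
    rintro _ ⟨-, a, rfl⟩
    exact X.basicOpen_le a
  have haff : ∀ W ∈ basicOpens U, IsAffineOpen W := by
    rintro _ ⟨-, a, rfl⟩
    exact hUa.basicOpen a
  have hreg := fun W (hW : W ∈ basicOpens U) t ↦ isReg_dual_basicOpen f hk hB hUa hU h hξ hW t
  let θ : Derivation ℤ X.functionField X.functionField := (ξ.compDer (KaehlerDifferential.D Γ(Z, Y) X.functionField)).restrictScalars ℤ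
  have hθ : ∀ x, θ x = ξ (KaehlerDifferential.D Γ(Z, Y) X.functionField x) := fun _ ↦ rfl
  have hθB : ∀ b, θ (algebraMap Γ(Z, Y) X.functionField b) = 0 := fun b ↦ by rw [hθ, Derivation.map_algebraMap, map_zero]
  refine exists_dualSections_of_derivation f ι θ (fun c ↦ ?_) (G := basicOpens U) (fun W hW ↦ hW.1) (self_mem_basicOpens hU)
    ?_ (fun V x hV hx ↦ exists_mem_basicOpens hι.inducing hUa hx (hV hx)) (fun W hW ↦ hι.surjective W (haff W hW)) hreg ?_
  · rw [← hk, IsScalarTower.algebraMap_apply k Γ(Z, Y) X.functionField, hθB]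
  · rintro _ ⟨hη, a, rfl⟩ _ ⟨hη', a', rfl⟩
    exact ⟨⟨hη, hη'⟩, a * a', (X.basicOpen_mul a a').symm⟩
  · intro W hW t r ht hr
    -- θ kills the functions of the base, so by the Leibniz rule it maps the ideal of the fiber to
    -- itself.
    have key : ∀ t ∈ I.map (p.appLE Y W ((hle W hW).trans h)).hom, ∃ r ∈ I.map (p.appLE Y W ((hle W hW).trans h)).hom,
        gg W hW.1 r = θ (gg W hW.1 t) := by
      intro t ht
      refine Submodule.span_induction (p := fun t _ ↦ ∃ r ∈ I.map (p.appLE Y W ((hle W hW).trans h)).hom,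
        gg W hW.1 r = θ (gg W hW.1 t)) ?_ ?_ ?_ ?_ ht
      · rintro _ ⟨b, hb, rfl⟩
        refine ⟨0, zero_mem _, ?_⟩
        have : gg W hW.1 (p.appLE Y W ((hle W hW).trans h) b) = algebraMap Γ(Z, Y) X.functionField b := by
          rw [hB]; exact gg_appLE p _ hW.1 b
        exact (map_zero _).trans ((congrArg θ this).trans (hθB b)).symm
      · exact ⟨0, zero_mem _, by rw [map_zero, map_zero]⟩
      · rintro s t _ _ ⟨r, hr, e⟩ ⟨r', hr', e'⟩
        exact ⟨r + r', add_mem hr hr', by rw [map_add, map_add, map_add, e, e']⟩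
      · rintro c t ht ⟨r, hr, e⟩
        obtain ⟨s, hs⟩ := hreg W hW c
        refine ⟨c * r + t * s, add_mem (Ideal.mul_mem_left _ _ hr) (Ideal.mul_mem_right _ _ ht), ?_⟩
        rw [smul_eq_mul, map_add, map_mul, map_mul, map_mul, θ.leibniz, e, hs]
        rfl
    have hker := hι.ker W (haff W hW) ((hle W hW).trans h)
    have ht' : t ∈ RingHom.ker (ι.app W).hom := ht
    rw [hker] at ht'
    obtain ⟨r', hr', e⟩ := key t ht'
    have : r = r' := gg_injective hW.1 (hr.trans e.symm)
    rw [← hker] at hr'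
    rw [this]
    exact hr'

include hp hk hYa hkB in
/-- If the general fibers carry no pluri-forms, then regular functionals vanish on general fibers. -/
theorem fiberVanishing_of_noPluriForms [IsAlgClosed k] [JacobsonSpace Z] {κ : Type*} [Finite κ] {U : κ → X.Opens}
    (hUa : ∀ i, IsAffineOpen (U i)) (hU : ∀ i, genericPoint X ∈ U i) (h : ∀ i, U i ≤ p ⁻¹ᵁ Y) (hcov : ∀ x, p x ∈ Y → ∃ i, x ∈ U i)
    (hfib : ∀ z ∈ Y, IsClosed ({z} : Set Z) → NoPluriForms (p.fiberι z ≫ f)) :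
    FiberVanishing k fun i ↦ chartAlg hB (hU i) (h i) := by
  intro j hj σ hσ
  have := Fintype.ofFinite κ
  have : Nonempty Y := ⟨_, hY⟩
  have ftkB : Algebra.FiniteType k Γ(Z, Y) := by
    have := kToO_finiteType g hYa
    rw [← hkB] at this
    exact RingHom.finiteType_algebraMap.mp this
  choose b hb0 hb using fun i ↦ exists_forall_compat f g hp hk hYa hkB hB (hUa i) (hU i) (h i) j
  refine ⟨∏ i, b i, Finset.prod_ne_zero_iff.mpr fun i _ ↦ hb0 i, fun I hI hbI i ξ hξ ↦ ?_⟩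
  have hbI : ∀ i, b i ∉ I := fun i hi ↦ hbI (Ideal.mem_of_dvd I (Finset.dvd_prod_of_mem b (Finset.mem_univ i)) hi)
  have hIk : ∀ b, ∃ c, b - kToO g Y c ∈ I := fun b ↦ by
    obtain ⟨c, hc⟩ := exists_sub_algebraMap_mem (k := k) hI b
    rw [hkB] at hc
    exact ⟨c, hc⟩
  obtain ⟨z, hzY, hz, hι⟩ := exists_isFiberOver p hYa hI
  let ι := p.fiberι z
  -- The basic open subsets of all charts that contain the generic point; forms lift on them because
  -- I avoids every `b i`.
  have hG : IsLiftingFamily f ι σ (⋃ i, basicOpens (U i)) :=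
    { affine := fun W hW ↦ by
        obtain ⟨i, -, a, rfl⟩ := Set.mem_iUnion.mp hW
        exact (hUa i).basicOpen a
      mem := fun W hW ↦ by
        obtain ⟨i, hη, -⟩ := Set.mem_iUnion.mp hW
        exact hη
      basicOpen := fun W hW a hη ↦ by
        obtain ⟨i, -, c, rfl⟩ := Set.mem_iUnion.mp hW
        obtain ⟨c', e⟩ := (hUa i).basicOpen_basicOpen_is_basicOpen c a
        exact Set.mem_iUnion.mpr ⟨i, hη, c', e.symm⟩
      cover := fun x ↦ by
        obtain ⟨i, hi⟩ := hcov _ (hι.mem x)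
        exact ⟨U i, Set.mem_iUnion.mpr ⟨i, self_mem_basicOpens (hU i)⟩, hi⟩
      inducing := hι.inducing
      surjective := fun W hW ↦ by
        obtain ⟨i, -, a, rfl⟩ := Set.mem_iUnion.mp hW
        exact hι.surjective _ ((hUa i).basicOpen a)
      exists_form := fun W hW μ ↦ by
        obtain ⟨i, hη, a, rfl⟩ := Set.mem_iUnion.mp hW
        exact (hb i I hI (hbI i) hIk _ ι hι a hη).1 μ
      regular := fun W hW Λ μ hΛ ↦ by
        obtain ⟨i, hη, a, rfl⟩ := Set.mem_iUnion.mp hW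
        refine isReg_apply_of_regularForms hB (hU i) (h i) f hk (hUa i) (hσ i) hη fun c ↦ ?_
        obtain ⟨r, hr, -⟩ := hΛ fun l ↦ X.presheaf.map (homOfLE (X.basicOpen_le a)).op (c l)
        refine ⟨r, hr.trans ?_⟩
        simp only [gg_res]
      eq_zero := fun W hW Λ r hΛ hr ↦ by
        obtain ⟨i, hη, a, rfl⟩ := Set.mem_iUnion.mp hW
        exact (hb i I hI (hbI i) hIk _ ι hι a hη).2 σ (hσ i) Λ r hΛ hr }
  -- The vector fields ξ restrict to vector fields ω on the fiber, so their product lifts the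
  -- product μ of the ω. The restriction of σ(∏ ξ) is thus the value at μ of a pluri-form on the
  -- fiber, which is zero, and σ(∏ ξ) lies in the ideal of the fiber.
  choose ω hω using fun l ↦ exists_dualSections_of_dual f hk hB (hUa i) (hU i) (h i) (hξ l) hι
  obtain ⟨μ, hμ⟩ := exists_evT_eq_prod ω
  have hreg : ∀ (c : Fin j → Γ(X, U i)) l,
      ∃ r, gg (U i) (hU i) r = ξ l (KaehlerDifferential.D Γ(Z, Y) X.functionField (gg (U i) (hU i) (c l))) :=
    fun c l ↦ hξ l _ ⟨c l, rfl⟩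
  have hcompat : Compat f ι (U i) (hU i) (MultilinearMap.prodForm X.functionField _ _ ξ) (evT μ ⟨ι ⁻¹ᵁ U i, le_rfl⟩) := by
    intro c
    choose r hr using hreg c
    refine ⟨∏ l, r l, ?_, ?_⟩
    · rw [map_prod, MultilinearMap.prodForm_apply]
      exact Finset.prod_congr rfl fun l _ ↦ hr l
    · rw [map_prod, hμ]
      exact Finset.prod_congr rfl fun l _ ↦ (hω l _ _ (hr l)).symm
  have hmem : MultilinearMap.prodForm X.functionField _ _ ξ ∈ regularForms k (chartAlg hB (hU i) (h i)) (Fin j) := fun a ha ↦ by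
    rw [MultilinearMap.prodForm_apply]
    exact Subalgebra.prod_mem _ fun l _ ↦ hξ l _ (ha l)
  obtain ⟨r, hr⟩ := hσ i _ hmem
  have hr0 := hG.app_eq_zero (hfib z hzY hz) hj (Set.mem_iUnion.mpr ⟨i, self_mem_basicOpens (hU i)⟩) μ hcompat hr
  have hrI : r ∈ I.map (p.appLE Y (U i) (h i)).hom := by
    rw [← hι.ker _ (hUa i) (h i)]
    exact hr0
  refine ⟨regAlgEquiv r, ?_, hr⟩
  let q : Γ(X, U i) →+* chartAlg hB (hU i) (h i) := RingEquiv.toRingHom regAlgEquiv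
  have e : q.comp (p.appLE Y (U i) (h i)).hom = algebraMap Γ(Z, Y) (chartAlg hB (hU i) (h i)) := by
    ext b
    exact (gg_appLE p (h i) (hU i) b).trans (DFunLike.congr_fun hB b).symm
  have h1 := Ideal.mem_map_of_mem q hrI
  rw [Ideal.map_map, e] at h1
  exact h1

end PluriForm

end

/-! ### The comparison theorem -/

noncomputable section

set_option linter.unusedSectionVars false
namespace PluriForm

lemma map_genericPoint_mem {X Z : Scheme.{u}} [IsIntegral X] (p : X ⟶ Z) [IsDominant p] {V : Z.Opens}
    (hV : (V : Set Z).Nonempty) : p (genericPoint X) ∈ V := by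
  obtain ⟨_, hx, x, rfl⟩ := p.denseRange.inter_open_nonempty V V.isOpen hV
  exact genericPoint_mem (U := p ⁻¹ᵁ V) hx

lemma pB_injective {X Z : Scheme.{u}} [IsIntegral X] [IsIntegral Z] (p : X ⟶ Z) [IsDominant p] {Y : Z.Opens}
    (hY : p (genericPoint X) ∈ Y) : Function.Injective (pB p Y hY) := by
  rw [injective_iff_map_eq_zero]
  intro b hb
  by_contra h0
  have : (Z.basicOpen b : Set Z).Nonempty := by
    rw [Set.nonempty_iff_ne_empty]
    intro h
    exact h0 ((basicOpen_eq_bot_iff b).mp (Opens.ext h))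
  exact pB_ne_zero p hY (map_genericPoint_mem p this) hb

variable {X Z : Scheme.{u}} {k : Type u} [Field k]

lemma exists_finite_affine_cover [IsIntegral X] (f : X ⟶ Spec (CommRingCat.of k)) [LocallyOfFiniteType f] [QuasiCompact f] (V : X.Opens) :
    ∃ I : Set X.affineOpens, I.Finite ∧ (∀ i ∈ I, genericPoint X ∈ i.1 ∧ i.1 ≤ V) ∧ ∀ x ∈ V, ∃ i ∈ I, x ∈ i.1 := by
  have := LocallyOfFiniteType.isLocallyNoetherian f
  have : CompactSpace X := QuasiCompact.compactSpace_of_compactSpace f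
  have : IsNoetherian X := {}
  obtain ⟨I, hI, e⟩ := isCompact_iff_finite_and_eq_biUnion_affineOpens.mp (NoetherianSpace.isCompact (V : Set X))
  -- Members without the generic point are empty, so dropping them does not affect the covering.
  refine ⟨{i ∈ I | genericPoint X ∈ i.1}, hI.subset fun i hi ↦ hi.1, fun i hi ↦ ⟨hi.2, fun x hx ↦ ?_⟩, fun x hx ↦ ?_⟩
  · rw [e]
    exact Opens.mem_iSup.mpr ⟨i, Opens.mem_iSup.mpr ⟨hi.1, hx⟩⟩
  · rw [e] at hx
    obtain ⟨i, hx⟩ := Opens.mem_iSup.mp hx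
    obtain ⟨hi, hxi⟩ := Opens.mem_iSup.mp hx
    exact ⟨i, ⟨hi, genericPoint_mem hxi⟩, hxi⟩

/-- If the general fibers of a dominant morphism carry no pluri-forms, then the pluri-forms on the
source are those of the saturation of the pull-back of the differentials of the target. -/
theorem exists_equiv_reflPow_satPullback [CharZero k] [IsAlgClosed k] (f : X ⟶ Spec (CommRingCat.of k))
    (g : Z ⟶ Spec (CommRingCat.of k)) [IsIntegral X] [LocallyOfFiniteType f] [QuasiCompact f] [IsIntegral Z]
    [LocallyOfFiniteType g] (hX : IsNormalScheme X) (p : X ⟶ Z) (hp : p ≫ g = f) [IsDominant p]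
    (hfib : GeneralFiberNoPluriForms f p) (m : ℕ) :
    ∃ e : Γ(reflPow (Omega f) m, ⊤) ≃ₗ[Γ(X, ⊤)] Γ(reflPow (satPullback f p g hp) m, ⊤),
      ∀ s, (reflPowMap (satPullbackι f p g hp) m).app ⊤ (e s) = (reflPowMap (toReflOmega f) m).app ⊤ s := by
  obtain ⟨V, ⟨z, hz⟩, hV⟩ := hfib
  obtain ⟨Y, hYa, hYV, hzY⟩ := exists_affine_le (U := V) hz
  have hY : p (genericPoint X) ∈ Y := map_genericPoint_mem p ⟨z, hzY⟩
  let _ : Algebra k X.functionField := (kToK f).toAlgebra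
  have hk : algebraMap k X.functionField = kToK f := rfl
  let _ : Algebra k Γ(Z, Y) := (kToO g Y).toAlgebra
  let _ : Algebra Γ(Z, Y) X.functionField := (pB p Y hY).toAlgebra
  have hB : algebraMap Γ(Z, Y) X.functionField = pB p Y hY := rfl
  have : IsScalarTower k Γ(Z, Y) X.functionField := IsScalarTower.of_algebraMap_eq fun c ↦ by
    have h1 : p.app Y (kToO g Y c) = kToO f (p ⁻¹ᵁ Y) c := by rw [app_kToO, hp]
    exact ((congrArg (gg (p ⁻¹ᵁ Y) hY) h1).trans (gg_structureMap f (p ⁻¹ᵁ Y) hY c)).symm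
  have : Nonempty Y := ⟨_, hY⟩
  have : FaithfulSMul Γ(Z, Y) X.functionField := (faithfulSMul_iff_algebraMap_injective _ _).mpr (pB_injective p hY)
  have : Algebra.FiniteType k Γ(Z, Y) := kToO_finiteType g hYa
  have : JacobsonSpace Z := LocallyOfFiniteType.jacobsonSpace g
  -- The charts have to cover all of p⁻¹(Y), since the pluri-form is needed on whole fibers;
  -- finitely many allow a common denominator on the base.
  obtain ⟨I, hI, hIη, hIcov⟩ := exists_finite_affine_cover f (p ⁻¹ᵁ Y)
  have : Finite I := hI
  have : Nonempty I := by
    obtain ⟨i, hi, -⟩ := hIcov _ hY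
    exact ⟨⟨i, hi⟩⟩
  have hF := fiberVanishing_of_noPluriForms f g hp hk hYa rfl hB (κ := I) (U := fun i ↦ i.1.1) (fun i ↦ i.1.2)
    (fun i ↦ (hIη i.1 i.2).1) (fun i ↦ (hIη i.1 i.2).2) (fun x hx ↦ by
      obtain ⟨i, hi, hxi⟩ := hIcov x hx
      exact ⟨⟨i, hi⟩, hxi⟩) fun z hz hcl ↦ hV z (hYV hz) hcl
  refine exists_equiv_of_vanishing f hk p g hp hYa hY hX m fun σ hσ ξ i hξ ↦ ?_
  refine hF.eq_zero_of_mem_verticalForms (fun i ↦ isNormalChart_chartAlg hB _ _ f hk hX i.1.2) σ (fun l Λ hΛ ↦ ?_) ξ i fun b ↦ ?_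
  · exact hσ _ _ Λ ((regT_iff f hk (hIη l.1 l.2).1 l.1.2 Λ).mpr hΛ)
  · exact hξ _ (Submodule.subset_span ⟨b, rfl⟩)

end PluriForm

end

theorem mainTheorem11 (X Z : Scheme.{0})
    (f : X ⟶ Spec (CommRingCat.of ℂ)) (g : Z ⟶ Spec (CommRingCat.of ℂ))
    [IsIntegral X] [LocallyOfFiniteType f] [QuasiCompact f]
    [IsIntegral Z] [LocallyOfFiniteType g] [QuasiCompact g]
    (hX : PluriForm.IsNormalScheme X) (hZ : PluriForm.IsNormalScheme Z)
    (p : X ⟶ Z) (hp : p ≫ g = f) (heq : PluriForm.IsEquidimensional p)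
    (hfib : PluriForm.GeneralFiberNoPluriForms f p) (m : ℕ) (hm : 0 < m) :
    ∃ e : Γ(PluriForm.reflPow (PluriForm.Omega f) m, ⊤) ≃ₗ[Γ(X, ⊤)]
        Γ(PluriForm.reflPow (PluriForm.satPullback f p g hp) m, ⊤),
      ∀ s, (PluriForm.reflPowMap (PluriForm.satPullbackι f p g hp) m).app ⊤ (e s) =
        (PluriForm.reflPowMap (PluriForm.toReflOmega f) m).app ⊤ s := by
  have := heq.1
  exact PluriForm.exists_equiv_reflPow_satPullback f g hX p hp hfib m
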